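/- Let $M>0$, $a\in\mathbb R$ with $|a|<1$, $\nu>0$ (units with cosmological constant $\Lambda=-3$), and put $$\Delta_r=(r^2+a^2)(1+r^2)-2Mr,\quad \Delta_\theta=1-a^2\cos^2\theta,\quad \varrho^2=r^2+a^2\cos^2\theta,\quad \alpha=a^2 .$$ Assume that $\Delta_r$ has a largest positive root $r_+$ and that $\partial_r\Delta_r(r_+)>0$. Let $\delta>0$ be small, in the sense that $\Delta_r(r)<-\delta$ for some $r\in(0,r_+)$, let $I_\delta=\{r>0:\Delta_r(r')>-\delta \text{ for all } r'\ge r\}$ (the unbounded component of $\{r>0:\Delta_r>-\delta\}$), and set $$X=I_\delta\times\mathbb S^2,\qquad X_+=(r_+,\infty)\times\mathbb S^2\subset X,$$ with spherical coordinates $(\theta,\phi)$ on $\mathbb S^2$. Let $f_+\in C^\infty(I_\delta;\mathbb R)$, and let $g$ be the extended Kerr–AdS metric on $\mathbb R_t\times X$, i.e. the Lorentzian metric of signature $(1,3)$ whose dual metric is $$-\varrho^2 g^{-1}=\Delta_r(\partial_r+f_+\partial_t)^2+\Delta_\theta\,\partial_\theta^2+2(1-\alpha)(\partial_r+f_+\partial_t)\big((r^2+a^2)\partial_t+a\,\partial_\phi\big)+\frac{(1-\alpha)^2}{\Delta_\theta\sin^2\theta}\big(a\sin^2\theta\,\partial_t+\partial_\phi\big)^2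 ,$$ extended smoothly across the poles of $\mathbb S^2$; assume that $dt$ is timelike, $g^{-1}(dt,dt)>0$, on all of $\mathbb R_t\times X$ (for instance $f_+(r)=-(1-\alpha)/(1+r^2)$). For $\lambda\in\mathbb C$ define the stationary Klein–Gordon operator on $C^\infty(X)$ by $$P(\lambda)u=e^{i\lambda t}\,\varrho^2\big(\nabla^i\nabla_i+\nu^2-\tfrac94\big)\big(e^{-i\lambda t}u\big),$$ where $\nabla^i\nabla_i=|g|^{-1/2}\partial_i(|g|^{1/2}g^{ij}\partial_j)$ is the wave operator of $g$. Let $\lambda\in\mathbb C$ and $m\in\mathbb Z$, and let $f\in C^\infty(X)$ be complex valued with $-i\partial_\phi f=mf$ and $\operatorname{supp} f\subseteq X\setminus X_+$. Then there exists a unique $u\in C^\infty(X)$ such that $$P(\lambda)u=f,\qquad -i\partial_\phi u=mu,\qquad \operatorname{supp}u\subseteq X\setminus X_+ .$$ -/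

import Mathlib

open scoped ContDiff

noncomputable section

namespace KerrAdS

/-! Cosmological constant normalised so that `l = 1`; then `α = a ^ 2`.
The spatial slice is described in Cartesian coordinates `x = r ω`, `ω` in the unit sphere of `ℝ³`,
which identifies `(0, ∞) × S²` with `ℝ³ \ {0}`.  Spacetime coordinates are `(t, x₁, x₂, x₃)`. -/

/-- `Δ_r = (r² + a²)(1 + r²) - 2 M r`. -/
def DeltaR (M a r : ℝ) : ℝ := (r ^ 2 + a ^ 2) * (1 + r ^ 2) - 2 * M * r

/-- The range of the radial coordinate: the unbounded component of `{Δ_r > -δ}` in `r > 0`. -/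
def radii (M a δ : ℝ) : Set ℝ := {r | 0 < r ∧ ∀ r', r ≤ r' → -δ < DeltaR M a r'}

/-- The radial coordinate. -/
def rad (x : Fin 3 → ℝ) : ℝ := √(x 0 ^ 2 + x 1 ^ 2 + x 2 ^ 2)

/-- `cos² θ`. -/
def cosSq (x : Fin 3 → ℝ) : ℝ := x 2 ^ 2 / rad x ^ 2

/-- `sin² θ`. -/
def sinSq (x : Fin 3 → ℝ) : ℝ := (x 0 ^ 2 + x 1 ^ 2) / rad x ^ 2

/-- `Δ_θ = 1 - a² cos² θ`. -/
def DeltaTheta (a : ℝ) (x : Fin 3 → ℝ) : ℝ := 1 - a ^ 2 * cosSq x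

/-- `ϱ² = r² + a² cos² θ`. -/
def rhoSq (a : ℝ) (x : Fin 3 → ℝ) : ℝ := rad x ^ 2 + a ^ 2 * cosSq x

/-- The time slice `X`, extended a little across the event horizon. -/
def slice (M a δ : ℝ) : Set (Fin 3 → ℝ) := {x | rad x ∈ radii M a δ}

/-- The part `X₊` of the slice in the black hole exterior. -/
def exterior (rp : ℝ) : Set (Fin 3 → ℝ) := {x | rp < rad x}

/-- The spatial part of a spacetime point `(t, x₁, x₂, x₃)`. -/
def space (p : Fin 4 → ℝ) : Fin 3 → ℝ := Fin.tail p

/-- The vector field `∂_t`. -/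
def vecT : Fin 4 → ℝ := ![1, 0, 0, 0]

/-- The vector field `∂_r` in Cartesian components. -/
def vecR (x : Fin 3 → ℝ) : Fin 4 → ℝ := ![0, x 0 / rad x, x 1 / rad x, x 2 / rad x]

/-- The vector field `∂_φ` in Cartesian components. -/
def vecPhi (x : Fin 3 → ℝ) : Fin 4 → ℝ := ![0, -x 1, x 0, 0]

/-- The symmetrised tensor product `2 V W = V ⊗ W + W ⊗ V`. -/
def symm2 (V W : Fin 4 → ℝ) : Matrix (Fin 4) (Fin 4) ℝ :=
  Matrix.vecMulVec V W + Matrix.vecMulVec W V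

/-- `∂_θ² + (sin θ)⁻² ∂_φ²`, the dual metric of the unit round sphere, in Cartesian components. -/
def roundDual (x : Fin 3 → ℝ) : Matrix (Fin 4) (Fin 4) ℝ :=
  rad x ^ 2 • (1 - Matrix.vecMulVec vecT vecT - Matrix.vecMulVec (vecR x) (vecR x))

/-- Components, in the coordinates `(t, x₁, x₂, x₃)`, of the dual metric `g⁻¹` of signature
`(1, 3)`, given by
`-ϱ² g⁻¹ = Δ_r (∂_r + f ∂_t)² + Δ_θ ∂_θ² + 2 (1 - α) (∂_r + f ∂_t) ((r² + a²) ∂_t + a ∂_φ)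
  + (1 - α)² / (Δ_θ sin² θ) (a sin² θ ∂_t + ∂_φ)²`.
The terms in `∂_θ²` and `∂_φ²` are regrouped so that the expression makes sense (and is smooth)
at the poles; see `dualMetric_spherical` for the formula above off the poles. -/
def dualMetric (M a : ℝ) (fp : ℝ → ℝ) (x : Fin 3 → ℝ) : Matrix (Fin 4) (Fin 4) ℝ :=
  -(rhoSq a x)⁻¹ •
    (DeltaR M a (rad x) • Matrix.vecMulVec (vecR x + fp (rad x) • vecT)
        (vecR x + fp (rad x) • vecT)
      + (1 - a ^ 2) • symm2 (vecR x + fp (rad x) • vecT)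
          ((rad x ^ 2 + a ^ 2) • vecT + a • vecPhi x)
      + DeltaTheta a x • roundDual x
      - (a ^ 2 * (1 - a ^ 2 + DeltaTheta a x) / DeltaTheta a x) •
          Matrix.vecMulVec (vecPhi x) (vecPhi x)
      + ((1 - a ^ 2) ^ 2 * a / DeltaTheta a x) • symm2 vecT (vecPhi x)
      + ((1 - a ^ 2) ^ 2 * a ^ 2 * sinSq x / DeltaTheta a x) • Matrix.vecMulVec vecT vecT)

/-- The partial derivative in the `i`-th coordinate of spacetime. -/
def pd (i : Fin 4) (ψ : (Fin 4 → ℝ) → ℂ) (p : Fin 4 → ℝ) : ℂ :=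
  fderiv ℝ ψ p (Pi.single i 1)

/-- The wave operator `∇^i ∇_i ψ = |g|^{-1/2} ∂_i (|g|^{1/2} g^{ij} ∂_j ψ)` of a metric whose dual
metric has components `G = (g^{ij})`, so that `|g| = |det G|⁻¹`. -/
def box (G : (Fin 4 → ℝ) → Matrix (Fin 4) (Fin 4) ℝ) (ψ : (Fin 4 → ℝ) → ℂ)
    (p : Fin 4 → ℝ) : ℂ :=
  (√|(G p).det| : ℂ) *
    ∑ i, pd i (fun q => ((√|(G q).det|)⁻¹ : ℂ) * ∑ j, (G q i j : ℂ) * pd j ψ q) p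

/-- The stationary Klein-Gordon operator
`P(λ) u = e^{iλt} ϱ² (∇^i ∇_i + ν² - 9/4) (e^{-iλt} u)`.  The right side does not depend on `t`
and is evaluated at `t = 0`, where `e^{iλt} = 1`. -/
def statOp (M a ν : ℝ) (fp : ℝ → ℝ) (lam : ℂ) (u : (Fin 3 → ℝ) → ℂ) (x : Fin 3 → ℝ) : ℂ :=
  (rhoSq a x : ℂ) *
    (box (fun p => dualMetric M a fp (space p))
        (fun p => Complex.exp (-Complex.I * lam * (p 0 : ℂ)) * u (space p)) (Fin.cons 0 x)
      + ((ν : ℂ) ^ 2 - 9 / 4) * u x)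

/-- `(D_φ - m) u = 0` on `S`, where `D_φ = -i ∂_φ` and `∂_φ = x₁ ∂_{x₂} - x₂ ∂_{x₁}`. -/
def HasMode (m : ℤ) (S : Set (Fin 3 → ℝ)) (u : (Fin 3 → ℝ) → ℂ) : Prop :=
  ∀ x ∈ S, -Complex.I * fderiv ℝ u x ![-x 1, x 0, 0] - (m : ℂ) * u x = 0

/-- The (relatively closed) support in `S` of a function on `S`. -/
def suppOn (S : Set (Fin 3 → ℝ)) (u : (Fin 3 → ℝ) → ℂ) : Set (Fin 3 → ℝ) :=
  S ∩ closure {x | x ∈ S ∧ u x ≠ 0}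

/-- Off the poles, in spherical coordinates, `dualMetric` is given by the usual formula. -/
theorem dualMetric_spherical (M a : ℝ) (fp : ℝ → ℝ) (r θ φ : ℝ) (ha : |a| < 1) (hr : 0 < r)
    (hθ : Real.sin θ ≠ 0) :
    let x : Fin 3 → ℝ := ![r * Real.sin θ * Real.cos φ, r * Real.sin θ * Real.sin φ,
      r * Real.cos θ]
    let dt : Fin 4 → ℝ := ![1, 0, 0, 0]
    let dr : Fin 4 → ℝ := ![0, Real.sin θ * Real.cos φ, Real.sin θ * Real.sin φ, Real.cos θ]
    let dθ : Fin 4 → ℝ := ![0, r * Real.cos θ * Real.cos φ, r * Real.cos θ * Real.sin φ,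
      -(r * Real.sin θ)]
    let dφ : Fin 4 → ℝ := ![0, -(r * Real.sin θ * Real.sin φ), r * Real.sin θ * Real.cos φ, 0]
    let Δθ : ℝ := 1 - a ^ 2 * Real.cos θ ^ 2;
    (-(r ^ 2 + a ^ 2 * Real.cos θ ^ 2)) • dualMetric M a fp x =
      DeltaR M a r • Matrix.vecMulVec (dr + fp r • dt) (dr + fp r • dt)
      + Δθ • Matrix.vecMulVec dθ dθ
      + (1 - a ^ 2) • symm2 (dr + fp r • dt) ((r ^ 2 + a ^ 2) • dt + a • dφ)
      + ((1 - a ^ 2) ^ 2 / (Δθ * Real.sin θ ^ 2)) •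
          Matrix.vecMulVec ((a * Real.sin θ ^ 2) • dt + dφ) ((a * Real.sin θ ^ 2) • dt + dφ) := by
  intro x dt dr dθ dφ Δθ
  have hc : Real.cos θ ^ 2 = 1 - Real.sin θ ^ 2 := by
    have := Real.sin_sq_add_cos_sq θ; linarith
  have hcφ : Real.cos φ ^ 2 = 1 - Real.sin φ ^ 2 := by
    have := Real.sin_sq_add_cos_sq φ; linarith
  have ha2 : a ^ 2 < 1 := by rw [← sq_abs]; nlinarith [abs_nonneg a]
  have hrad : rad x = r := by
    have : x 0 ^ 2 + x 1 ^ 2 + x 2 ^ 2 = r ^ 2 := by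
      simp only [x, Matrix.cons_val_zero, Matrix.cons_val_one, Matrix.cons_val]
      linear_combination r ^ 2 * Real.sin θ ^ 2 * hcφ + r ^ 2 * hc
    rw [rad, this, Real.sqrt_sq hr.le]
  have hcos : cosSq x = Real.cos θ ^ 2 := by
    rw [cosSq, hrad]; simp only [x, Matrix.cons_val]; field_simp
  have hsin : sinSq x = Real.sin θ ^ 2 := by
    rw [sinSq, hrad]; simp only [x, Matrix.cons_val_zero, Matrix.cons_val_one]
    field_simp; linear_combination hcφ
  have hΔ : DeltaTheta a x = Δθ := by rw [DeltaTheta, hcos]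
  have hρ : rhoSq a x = r ^ 2 + a ^ 2 * Real.cos θ ^ 2 := by rw [rhoSq, hcos, hrad]
  have hρ0 : r ^ 2 + a ^ 2 * Real.cos θ ^ 2 ≠ 0 := by positivity
  have hΔ0 : Δθ ≠ 0 := by
    have h1 : 0 ≤ Real.sin θ ^ 2 := sq_nonneg _
    have : 0 < Δθ := by simp only [Δθ]; rw [hc]; nlinarith [mul_nonneg (sq_nonneg a) h1]
    exact this.ne'
  have hvR : vecR x = dr := by
    rw [vecR, hrad]
    ext i; fin_cases i <;> simp [x, dr] <;> field_simp
  have hvΦ : vecPhi x = dφ := by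
    ext i; fin_cases i <;> simp [x, dφ, vecPhi]
  have key : Δθ • roundDual x
      - (a ^ 2 * (1 - a ^ 2 + Δθ) / Δθ) • Matrix.vecMulVec dφ dφ
      = Δθ • Matrix.vecMulVec dθ dθ
        + ((1 - a ^ 2) ^ 2 / (Δθ * Real.sin θ ^ 2)) • Matrix.vecMulVec dφ dφ := by
    have hround : roundDual x = Matrix.vecMulVec dθ dθ
        + (Real.sin θ ^ 2)⁻¹ • Matrix.vecMulVec dφ dφ := by
      rw [roundDual, hrad, hvR]
      ext i j
      fin_cases i <;> fin_cases j <;>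
        simp [dr, dθ, dφ, vecT] <;> field_simp <;>
        grind
    have hΔs : Δθ / Real.sin θ ^ 2 - a ^ 2 * (1 - a ^ 2 + Δθ) / Δθ
        = (1 - a ^ 2) ^ 2 / (Δθ * Real.sin θ ^ 2) := by
      have hD : Δθ = 1 - a ^ 2 + a ^ 2 * Real.sin θ ^ 2 := by simp only [Δθ]; rw [hc]; ring
      rw [div_sub_div _ _ (pow_ne_zero 2 hθ) hΔ0, mul_comm (Real.sin θ ^ 2) Δθ]
      congr 1
      rw [hD]; ring
    rw [hround, ← hΔs]
    module
  have hb : ((1 - a ^ 2) ^ 2 * a / Δθ) • symm2 dt dφ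
      + ((1 - a ^ 2) ^ 2 * a ^ 2 * Real.sin θ ^ 2 / Δθ) • Matrix.vecMulVec dt dt
      + ((1 - a ^ 2) ^ 2 / (Δθ * Real.sin θ ^ 2)) • Matrix.vecMulVec dφ dφ
      = ((1 - a ^ 2) ^ 2 / (Δθ * Real.sin θ ^ 2)) •
          Matrix.vecMulVec ((a * Real.sin θ ^ 2) • dt + dφ) ((a * Real.sin θ ^ 2) • dt + dφ) := by
    ext i j
    simp only [symm2, Matrix.add_apply, Matrix.smul_apply, Matrix.vecMulVec_apply, Pi.add_apply,
      Pi.smul_apply, smul_eq_mul]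
    field_simp
    ring
  have hT : vecT = dt := rfl
  rw [dualMetric, hρ, hΔ, hsin, hrad, hvR, hvΦ, hT, smul_smul,
    show -(r ^ 2 + a ^ 2 * Real.cos θ ^ 2) * -(r ^ 2 + a ^ 2 * Real.cos θ ^ 2)⁻¹ = 1 by
      field_simp, one_smul, ← hb]
  rw [sub_eq_iff_eq_add] at key
  rw [key]
  abel

end KerrAdS

end

/-!
Write `n = |m|` and `σ = ± 1` for the sign of `m`.  A smooth function of azimuthal mode `m` is
`ζ ^ n * w (s, z)` with `ζ = (x₁ + i σ x₂) / r`, `s = r₊ - r`, `z = cos θ`, and the profile `w` is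
smooth up to the poles `z = ± 1` (`exists_reduction`).  The stationary Klein–Gordon operator acts on
profiles by the reduced operator

  `s κ(s) w_ss + b(s) w_s + q(s) w + φ(z) w - ρ⁻¹ (ρ p w_z)_z`,
  `ρ = (1 - z²) ^ n`, `p = (1 - z²) (1 - a² z²)`

(`statOp_eq_redOp`).  Here `-Δ_r = s κ(s)` is the principal coefficient in `s`.  The factor `κ`
decreases in `s` and is positive at the inner end of the radial range, where `Δ_r < 0`; hence it is
positive throughout (`kap_anti`, `exists_radii_eq`).  So beyond the horizon, where `s > 0`, this is a wave
equation with time `s`, whose principal part degenerates at the initial time `s = 0`.  A function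
supported in the complement of the exterior region vanishes for `s ≤ 0`; being smooth, it vanishes to
infinite order at `s = 0`.  The theorem is thus the well-posedness of the degenerate Cauchy problem
with data and source that are flat at `s = 0`.

The operator `-ρ⁻¹ ∂_z ρ p ∂_z` plus the projection to the mean is inverted by an integral operator
`K` of Hardy type, symmetric and nonnegative in `L²(ρ dz)` (`kC`, `hardyC`, `inner_kC`).  With
`u = K g` the equation becomes the abstract wave equation `s κ u'' + b u' + q u + Q u + g = f` with
bounded operators only.  The energy `s κ ‖u'‖² + ⟪u, g⟫ + ‖u‖²` satisfies
`E' ≤ (n₀ / s) E + ‖f‖²`, where `n₀` depends on bounds for `κ`, `b`, `q`, `Q` but not on `K`.  The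
singular factor costs a fixed power of `s`, which is harmless for flat curves
(`energy_estimate`, `uflat_of_solves`).  Uniqueness follows at once (`wave_unique`).  For existence,
`K` is replaced by the invertible operator `K + ε`; the equation is then an ordinary differential
equation with a regular singular point in Hilbert space (`exists_fuchsian_solution`).  The estimates
are uniform in `ε`, and a weak limit along an ultrafilter solves the original equation
(`exists_wave_solution`).

The solution so obtained is flat in `s` with values in a weighted `L²` space.  Since `u = K g`, and
since `g` is recovered from `u` by differentiation in `s` alone, each use of the equation improves the
regularity in `z`: from weighted `L²` to continuous functions
(`exists_wave_solution_continuous`), and then to any number of derivatives, up to the poles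
(`reg_of_waveRHS`, `contDiffOn_of_reg`).  This solves the reduced equation
(`exists_reduced_solution`), and `eq_zero_of_reduced` gives uniqueness.
-/

open scoped ContDiff Topology ComplexOrder InnerProductSpace
open Set Filter

noncomputable section

namespace KerrAdS

/-! ### Families of curves that are flat at the origin -/

section Flat

variable {ι κ E F : Type*} [NormedAddCommGroup E] [NormedSpace ℂ E]
  [NormedAddCommGroup F] [NormedSpace ℂ F]

/-- The curves `u i` are `O(s ^ N)` on `(0, S)` for every `N`, uniformly in `i`. -/
def FlatBound (S : ℝ) (u : ι → ℝ → E) : Prop :=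
  ∀ N : ℕ, ∃ C : ℝ, ∀ i, ∀ s ∈ Ioo 0 S, ‖u i s‖ ≤ C * s ^ N

/-- The curves `u i` are `k` times differentiable on `(0, S)`, and their derivatives up to order
`k` vanish to infinite order at `0`, uniformly in `i`. -/
def UFlat (S : ℝ) : ℕ → (ι → ℝ → E) → Prop
  | 0, u => FlatBound S u
  | k + 1, u => FlatBound S u ∧ (∀ i, ∀ s ∈ Ioo 0 S, DifferentiableAt ℝ (u i) s) ∧
      UFlat S k (fun i => deriv (u i))

theorem UFlat.flatBound {S : ℝ} {k : ℕ} {u : ι → ℝ → E} (h : UFlat S k u) : FlatBound S u := by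
  cases k with
  | zero => exact h
  | succ k => exact h.1

theorem UFlat.of_succ {S : ℝ} {k : ℕ} {u : ι → ℝ → E} (h : UFlat S (k + 1) u) : UFlat S k u := by
  induction k generalizing u with
  | zero => exact h.1
  | succ k ih => exact ⟨h.1, h.2.1, ih h.2.2⟩

theorem deriv_eqOn_Ioo {u v : ℝ → E} {S T : ℝ} (h : EqOn u v (Ioo T S)) :
    EqOn (deriv u) (deriv v) (Ioo T S) := fun _ hs =>
  (h.eventuallyEq_of_mem (Ioo_mem_nhds hs.1 hs.2)).deriv_eq

theorem UFlat.congr {S : ℝ} {k : ℕ} {u v : ι → ℝ → E} (h : UFlat S k u)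
    (huv : ∀ i, EqOn (u i) (v i) (Ioo 0 S)) : UFlat S k v := by
  have h0 : ∀ {u v : ι → ℝ → E}, FlatBound S u → (∀ i, EqOn (u i) (v i) (Ioo 0 S)) →
      FlatBound S v := fun h huv N => by
    obtain ⟨C, hC⟩ := h N
    exact ⟨C, fun i s hs => by rw [← huv i hs]; exact hC i s hs⟩
  induction k generalizing u v with
  | zero => exact h0 h huv
  | succ k ih =>
    refine ⟨h0 h.1 huv, fun i s hs => ?_, ih h.2.2 fun i => deriv_eqOn_Ioo (huv i)⟩
    exact (h.2.1 i s hs).congr_of_eventuallyEq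
      ((huv i).symm.eventuallyEq_of_mem (Ioo_mem_nhds hs.1 hs.2))

theorem UFlat.reindex {S : ℝ} {k : ℕ} {u : ι → ℝ → E} (h : UFlat S k u) (φ : κ → ι) :
    UFlat S k (fun j => u (φ j)) := by
  have h0 : ∀ {u : ι → ℝ → E}, FlatBound S u → FlatBound S (fun j => u (φ j)) := fun h N => by
    obtain ⟨C, hC⟩ := h N
    exact ⟨C, fun j => hC (φ j)⟩
  induction k generalizing u with
  | zero => exact h0 h
  | succ k ih => exact ⟨h0 h.1, fun j => h.2.1 (φ j), ih h.2.2⟩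

theorem UFlat.mono {S T : ℝ} (hST : T ≤ S) {k : ℕ} {u : ι → ℝ → E} (h : UFlat S k u) :
    UFlat T k u := by
  have h1 : ∀ {s}, s ∈ Ioo 0 T → s ∈ Ioo 0 S := fun hs => ⟨hs.1, hs.2.trans_le hST⟩
  have h0 : ∀ {u : ι → ℝ → E}, FlatBound S u → FlatBound T u := fun h N => by
    obtain ⟨C, hC⟩ := h N
    exact ⟨C, fun j s hs => hC j s (h1 hs)⟩
  induction k generalizing u with
  | zero => exact h0 h
  | succ k ih => exact ⟨h0 h.1, fun j s hs => h.2.1 j s (h1 hs), ih h.2.2⟩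

theorem UFlat.add {S : ℝ} {k : ℕ} {u v : ι → ℝ → E} (hu : UFlat S k u) (hv : UFlat S k v) :
    UFlat S k (fun i s => u i s + v i s) := by
  have h0 : ∀ {u v : ι → ℝ → E}, FlatBound S u → FlatBound S v →
      FlatBound S (fun i s => u i s + v i s) := fun hu hv N => by
    obtain ⟨C, hC⟩ := hu N
    obtain ⟨D, hD⟩ := hv N
    refine ⟨C + D, fun i s hs => (norm_add_le _ _).trans ?_⟩
    rw [add_mul]
    exact add_le_add (hC i s hs) (hD i s hs)
  induction k generalizing u v with
  | zero => exact h0 hu hv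
  | succ k ih =>
    refine ⟨h0 hu.1 hv.1, fun i s hs => (hu.2.1 i s hs).add (hv.2.1 i s hs), ?_⟩
    refine (ih hu.2.2 hv.2.2).congr fun i s hs => ?_
    exact (deriv_fun_add (hu.2.1 i s hs) (hv.2.1 i s hs)).symm

theorem FlatBound.smul_of_bound {S : ℝ} {u : ι → ℝ → E} (hu : FlatBound S u) {c : ι → ℝ → ℂ}
    {B : ℝ} {j : ℕ} (hc : ∀ i, ∀ s ∈ Ioo 0 S, ‖c i s‖ * s ^ j ≤ B) :
    FlatBound S (fun i s => c i s • u i s) := fun N => by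
  obtain ⟨C, hC⟩ := hu (N + j)
  refine ⟨B * |C|, fun i s hs => ?_⟩
  have hs0 : 0 < s := hs.1
  rw [norm_smul]
  calc ‖c i s‖ * ‖u i s‖ ≤ ‖c i s‖ * (|C| * s ^ (N + j)) := by
        gcongr
        exact (hC i s hs).trans (by gcongr; exact le_abs_self C)
    _ = ‖c i s‖ * s ^ j * (|C| * s ^ N) := by ring
    _ ≤ B * (|C| * s ^ N) := by
        gcongr
        exact hc i s hs
    _ = _ := by ring

theorem UFlat.const_smul {S : ℝ} {k : ℕ} {u : ι → ℝ → E} (hu : UFlat S k u) (c : ℂ) :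
    UFlat S k (fun i s => c • u i s) := by
  have h0 : ∀ {u : ι → ℝ → E}, FlatBound S u → FlatBound S (fun i s => c • u i s) := fun h =>
    h.smul_of_bound (c := fun _ _ => c) (B := ‖c‖) (j := 0) (by simp)
  induction k generalizing u with
  | zero => exact h0 hu
  | succ k ih =>
    refine ⟨h0 hu.1, fun i s hs => (hu.2.1 i s hs).const_smul c, ?_⟩
    refine (ih hu.2.2).congr fun i s hs => ?_
    exact (deriv_fun_const_smul c (hu.2.1 i s hs)).symm

theorem UFlat.sub {S : ℝ} {k : ℕ} {u v : ι → ℝ → E} (hu : UFlat S k u) (hv : UFlat S k v) :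
    UFlat S k (fun i s => u i s - v i s) := by
  refine (hu.add (hv.const_smul (-1))).congr fun i s _ => ?_
  simp [sub_eq_add_neg]

theorem UFlat.clm {S : ℝ} {k : ℕ} {u : ι → ℝ → E} (hu : UFlat S k u) (L : E →L[ℂ] F) :
    UFlat S k (fun i s => L (u i s)) := by
  have h0 : ∀ {u : ι → ℝ → E}, FlatBound S u → FlatBound S (fun i s => L (u i s)) := fun h N => by
    obtain ⟨C, hC⟩ := h N
    refine ⟨‖L‖ * C, fun i s hs => (L.le_opNorm _).trans ?_⟩
    rw [mul_assoc]
    gcongr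
    exact hC i s hs
  induction k generalizing u with
  | zero => exact h0 hu
  | succ k ih =>
    have hd : ∀ i, ∀ s ∈ Ioo 0 S, HasDerivAt (fun s => L (u i s)) (L (deriv (u i) s)) s :=
      fun i s hs => (L.restrictScalars ℝ).hasFDerivAt.comp_hasDerivAt s (hu.2.1 i s hs).hasDerivAt
    refine ⟨h0 hu.1, fun i s hs => (hd i s hs).differentiableAt, ?_⟩
    exact (ih hu.2.2).congr fun i s hs => (hd i s hs).deriv.symm

theorem exists_bound_of_contDiffOn {c : ℝ → ℂ} {S S₀ : ℝ} (hS : S < S₀)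
    (hc : ContDiffOn ℝ ∞ c (Iio S₀)) : ∃ B : ℝ, 0 ≤ B ∧ ∀ s ∈ Ioo 0 S, ‖c s‖ ≤ B := by
  obtain ⟨B, hB⟩ := isCompact_Icc.exists_bound_of_continuousOn
    (hc.continuousOn.mono (fun s (hs : s ∈ Icc 0 S) => hs.2.trans_lt hS))
  exact ⟨|B|, abs_nonneg B, fun s hs => (hB s ⟨hs.1.le, hs.2.le⟩).trans (le_abs_self B)⟩

theorem contDiffOn_deriv_Iio {G : Type*} [NormedAddCommGroup G] [NormedSpace ℝ G] {c : ℝ → G} {S : ℝ} (hc : ContDiffOn ℝ ∞ c (Iio S)) :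
    ContDiffOn ℝ ∞ (deriv c) (Iio S) :=
  hc.deriv_of_isOpen isOpen_Iio (by simp)

theorem differentiableAt_of_Iio {G : Type*} [NormedAddCommGroup G] [NormedSpace ℝ G] {c : ℝ → G} {S : ℝ} (hc : ContDiffOn ℝ ∞ c (Iio S))
    {s : ℝ} (hs : s < S) : DifferentiableAt ℝ c s :=
  (hc.contDiffAt (Iio_mem_nhds hs)).differentiableAt (by simp)

theorem UFlat.smul {S S₀ : ℝ} (hS : S < S₀) {k : ℕ} {u : ι → ℝ → E} (hu : UFlat S k u)
    {c : ℝ → ℂ} (hc : ContDiffOn ℝ ∞ c (Iio S₀)) : UFlat S k (fun i s => c s • u i s) := by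
  have h0 : ∀ {u : ι → ℝ → E}, FlatBound S u → FlatBound S (fun i s => c s • u i s) := fun h => by
    obtain ⟨B, -, hB⟩ := exists_bound_of_contDiffOn hS hc
    exact h.smul_of_bound (c := fun _ => c) (B := B) (j := 0) (by simpa using fun _ => hB)
  induction k generalizing u c with
  | zero => exact h0 hu
  | succ k ih =>
    have hd : ∀ i, ∀ s ∈ Ioo 0 S, HasDerivAt (fun s => c s • u i s)
        (c s • deriv (u i) s + deriv c s • u i s) s := fun i s hs =>
      (differentiableAt_of_Iio hc (hs.2.trans hS)).hasDerivAt.smul (hu.2.1 i s hs).hasDerivAt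
    refine ⟨h0 hu.1, fun i s hs => (hd i s hs).differentiableAt, ?_⟩
    refine UFlat.congr (UFlat.add (ih hu.2.2 hc fun h => ?_)
      (ih hu.of_succ (contDiffOn_deriv_Iio hc) fun h => ?_)) fun i s hs => (hd i s hs).deriv.symm
    · obtain ⟨B, -, hB⟩ := exists_bound_of_contDiffOn hS hc
      exact h.smul_of_bound (c := fun _ => c) (B := B) (j := 0) (by simpa using fun _ => hB)
    · obtain ⟨B, -, hB⟩ := exists_bound_of_contDiffOn hS (contDiffOn_deriv_Iio hc)
      exact h.smul_of_bound (c := fun _ => deriv c) (B := B) (j := 0) (by simpa using fun _ => hB)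

theorem UFlat.inv_pow_smul {S : ℝ} {k : ℕ} {u : ι → ℝ → E} (hu : UFlat S k u) (j : ℕ) :
    UFlat S k (fun i s => ((s : ℂ) ^ j)⁻¹ • u i s) := by
  have h0 : ∀ {u : ι → ℝ → E} (j : ℕ), FlatBound S u →
      FlatBound S (fun i s => ((s : ℂ) ^ j)⁻¹ • u i s) := fun j h =>
    h.smul_of_bound (c := fun _ s => ((s : ℂ) ^ j)⁻¹) (B := 1) (j := j) (fun i s hs => by
      have : (0 : ℝ) < s ^ j := pow_pos hs.1 j
      simp only [norm_inv, norm_pow, Complex.norm_real, Real.norm_eq_abs, abs_of_pos hs.1]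
      rw [inv_mul_cancel₀ this.ne'])
  induction k generalizing u j with
  | zero => exact h0 j hu
  | succ k ih =>
    have hd : ∀ i, ∀ s ∈ Ioo 0 S, HasDerivAt (fun s : ℝ => ((s : ℂ) ^ j)⁻¹ • u i s)
        (((s : ℂ) ^ j)⁻¹ • deriv (u i) s + (-(j : ℂ)) • (((s : ℂ) ^ (j + 1))⁻¹ • u i s)) s :=
      fun i s hs => by
        have hs0 : (s : ℂ) ≠ 0 := by exact_mod_cast hs.1.ne'
        have h1 : HasDerivAt (fun s : ℝ => ((s : ℂ) ^ j)⁻¹) (-(j : ℂ) * ((s : ℂ) ^ (j + 1))⁻¹) s := by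
          have h2 := ((hasDerivAt_id (s : ℂ)).pow j).inv (pow_ne_zero j hs0)
          have h3 := h2.comp_ofReal
          refine h3.congr_deriv ?_
          rcases j with _ | j
          · simp
          · simp only [id, mul_one, Nat.add_sub_cancel, Pi.pow_apply]
            field_simp
            ring
        have := h1.smul (hu.2.1 i s hs).hasDerivAt
        rwa [mul_smul] at this
    refine ⟨h0 j hu.1, fun i s hs => (hd i s hs).differentiableAt, ?_⟩
    exact ((ih hu.2.2 j).add ((ih hu.of_succ (j + 1)).const_smul _)).congr
      fun i s hs => (hd i s hs).deriv.symm

/-- Differentiable flat curves whose derivatives are flat. -/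
theorem UFlat.succ_of_hasDerivAt {S : ℝ} {k : ℕ} {u u' : ι → ℝ → E} (hu : FlatBound S u)
    (hd : ∀ i, ∀ s ∈ Ioo 0 S, HasDerivAt (u i) (u' i s) s) (hu' : UFlat S k u') :
    UFlat S (k + 1) u :=
  ⟨hu, fun i s hs => (hd i s hs).differentiableAt, hu'.congr fun i s hs => (hd i s hs).deriv.symm⟩

/-- The curves on `(-∞, S)` that are smooth and vanish on `(-∞, 0]`. -/
def IsFlatCurve (S : ℝ) (u : ℝ → E) : Prop :=
  ContDiffOn ℝ ∞ u (Iio S) ∧ ∀ s ≤ 0, u s = 0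

theorem IsFlatCurve.deriv {S : ℝ} (hS : 0 < S) {u : ℝ → E} (h : IsFlatCurve S u) :
    IsFlatCurve S (deriv u) := by
  refine ⟨(contDiffOn_deriv_Iio h.1), fun s hs => ?_⟩
  -- the one-sided derivative from the left determines the derivative, also at `0`
  have h1 : HasDerivWithinAt u (_root_.deriv u s) (Iic s) s :=
    (differentiableAt_of_Iio h.1 (hs.trans_lt hS)).hasDerivAt.hasDerivWithinAt
  have h2 : HasDerivWithinAt u 0 (Iic s) s :=
    (hasDerivWithinAt_const s (Iic s) (0 : E)).congr (fun t ht => h.2 t (le_trans ht hs))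
      (h.2 s hs)
  exact (uniqueDiffWithinAt_Iic s).eq_deriv _ h1 h2

theorem IsFlatCurve.add {S : ℝ} {u v : ℝ → E} (hu : IsFlatCurve S u) (hv : IsFlatCurve S v) :
    IsFlatCurve S (fun s => u s + v s) :=
  ⟨hu.1.add hv.1, fun s hs => by simp [hu.2 s hs, hv.2 s hs]⟩

theorem IsFlatCurve.sub {S : ℝ} {u v : ℝ → E} (hu : IsFlatCurve S u) (hv : IsFlatCurve S v) :
    IsFlatCurve S (fun s => u s - v s) :=
  ⟨hu.1.sub hv.1, fun s hs => by simp [hu.2 s hs, hv.2 s hs]⟩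

theorem IsFlatCurve.smul {S : ℝ} {u : ℝ → E} (hu : IsFlatCurve S u) {c : ℝ → ℂ}
    (hc : ContDiffOn ℝ ∞ c (Iio S)) : IsFlatCurve S (fun s => c s • u s) :=
  ⟨hc.smul hu.1, fun s hs => by simp [hu.2 s hs]⟩

theorem IsFlatCurve.clm {S : ℝ} {u : ℝ → E} (hu : IsFlatCurve S u) (L : E →L[ℂ] F) :
    IsFlatCurve S (fun s => L (u s)) :=
  ⟨(L.restrictScalars ℝ).contDiff.comp_contDiffOn hu.1, fun s hs => by simp [hu.2 s hs]⟩

theorem deriv_clm {S : ℝ} {u : ℝ → E} (hu : ContDiffOn ℝ ∞ u (Iio S)) (L : E →L[ℂ] F) {s : ℝ}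
    (hs : s < S) : deriv (fun s => L (u s)) s = L (deriv u s) :=
  ((L.restrictScalars ℝ).hasFDerivAt.comp_hasDerivAt s
    (differentiableAt_of_Iio hu hs).hasDerivAt).deriv

theorem IsFlatCurve.uflat {S T : ℝ} (hT : T < S) (hS : 0 < S) {u : ℝ → E} (hu : IsFlatCurve S u)
    (k : ℕ) : UFlat T k (fun _ : Unit => u) := by
  have key : ∀ N : ℕ, ∀ u : ℝ → E, IsFlatCurve S u → ∃ C : ℝ, 0 ≤ C ∧ ∀ s ∈ Icc 0 T,
      ‖u s‖ ≤ C * s ^ N := by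
    intro N
    induction N with
    | zero =>
      intro u hu
      obtain ⟨B, hB⟩ := isCompact_Icc.exists_bound_of_continuousOn
        (hu.1.continuousOn.mono (fun s (hs : s ∈ Icc 0 T) => hs.2.trans_lt hT))
      exact ⟨|B|, abs_nonneg B, fun s hs => by simpa using (hB s hs).trans (le_abs_self B)⟩
    | succ N ih =>
      intro u hu
      obtain ⟨C, hC0, hC⟩ := ih _ (hu.deriv hS)
      refine ⟨C, hC0, fun s hs => ?_⟩
      have := Convex.norm_image_sub_le_of_norm_deriv_le (𝕜 := ℝ) (f := u) (C := C * s ^ N)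
        (s := Icc 0 s) (x := 0) (y := s)
        (fun x hx => differentiableAt_of_Iio hu.1 ((hx.2.trans hs.2).trans_lt hT))
        (fun x hx => (hC x ⟨hx.1, hx.2.trans hs.2⟩).trans (by
          have := hx.1
          gcongr
          exact hx.2)) (convex_Icc 0 s) ⟨le_rfl, hs.1⟩ ⟨hs.1, le_rfl⟩
      rw [hu.2 0 le_rfl, sub_zero, sub_zero, Real.norm_eq_abs, abs_of_nonneg hs.1] at this
      rwa [pow_succ, ← mul_assoc]
  induction k generalizing u with
  | zero =>
    intro N
    obtain ⟨C, -, hC⟩ := key N u hu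
    exact ⟨C, fun _ s hs => hC s ⟨hs.1.le, hs.2.le⟩⟩
  | succ k ih =>
    refine ⟨fun N => ?_, fun _ s hs => differentiableAt_of_Iio hu.1 (hs.2.trans hT),
      ih (hu.deriv hS)⟩
    obtain ⟨C, -, hC⟩ := key N u hu
    exact ⟨C, fun _ s hs => hC s ⟨hs.1.le, hs.2.le⟩⟩

/-- Extension by zero of a curve that is flat at the origin. -/
theorem isFlatCurve_extend {S : ℝ} {u : ℝ → E}
    (hu : ∀ T < S, ∀ k, UFlat T k (fun _ : Unit => u)) :
    IsFlatCurve S (fun s => if 0 < s then u s else 0) := by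
  have hd : ∀ u : ℝ → E, (∀ T < S, ∀ k, UFlat T k (fun _ : Unit => u)) → ∀ s ∈ Iio S,
      HasDerivAt (fun s => if 0 < s then u s else 0) (if 0 < s then deriv u s else 0) s := by
    intro u hu s hs
    rcases lt_trichotomy s 0 with h | rfl | h
    · rw [if_neg h.not_gt]
      refine (hasDerivAt_const s (0 : E)).congr_of_eventuallyEq ?_
      filter_upwards [Iio_mem_nhds h] with t ht
      exact if_neg (not_lt.2 (le_of_lt ht))
    · rw [if_neg (lt_irrefl _)]
      have hS : 0 < S := hs
      obtain ⟨C, hC⟩ := (hu (S / 2) (by linarith) 0) 2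
      rw [hasDerivAt_iff_isLittleO]
      simp only [lt_irrefl, if_false, smul_zero, sub_zero]
      refine Asymptotics.IsBigO.trans_isLittleO (g := fun t : ℝ => t ^ 2) ?_
        (Asymptotics.isLittleO_pow_id one_lt_two)
      refine Asymptotics.IsBigO.of_bound |C| ?_
      filter_upwards [Iio_mem_nhds (show (0 : ℝ) < S / 2 by linarith)] with t ht
      split_ifs with h0
      · refine (hC () t ⟨h0, ht⟩).trans ?_
        rw [Real.norm_eq_abs, abs_of_nonneg (sq_nonneg t)]
        gcongr
        exact le_abs_self C
      · simp only [norm_zero]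
        positivity
    · rw [if_pos h]
      have h1 : DifferentiableAt ℝ u s :=
        (hu ((s + S) / 2) (by have : s < S := hs; linarith) 1).2.1 () s
          ⟨h, by have : s < S := hs; linarith⟩
      refine h1.hasDerivAt.congr_of_eventuallyEq ?_
      filter_upwards [Ioi_mem_nhds h] with t ht
      exact if_pos ht
  refine ⟨?_, fun s hs => if_neg hs.not_gt⟩
  rw [contDiffOn_infty]
  intro n
  induction n generalizing u with
  | zero =>
    rw [Nat.cast_zero, contDiffOn_zero]
    exact fun s hs => (hd u hu s hs).continuousAt.continuousWithinAt
  | succ n ih =>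
    rw [Nat.cast_succ, contDiffOn_succ_iff_deriv_of_isOpen isOpen_Iio]
    refine ⟨fun s hs => (hd u hu s hs).differentiableAt.differentiableWithinAt, by simp, ?_⟩
    exact (ih (u := deriv u) (fun T hT k => (hu T hT (k + 1)).2.2)).congr
      fun s hs => (hd u hu s hs).deriv

end Flat

/-! ### The energy estimate -/

section Energy

variable {H : Type*} [NormedAddCommGroup H] [InnerProductSpace ℂ H]

/-- Energy estimate at a degenerate initial time for the abstract wave equation
`a u'' + b u' + q u + Q u + g = f`, `u = P g`, with `P ≥ 0` symmetric and `a ∼ s` at `s = 0`.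
The energy is `a ‖u'‖² + ⟪u, g⟫ + ‖u‖²`.  A solution that vanishes to sufficiently high order
obeys a bound that does not depend on `P`. -/
theorem energy_estimate {S κ₀ B : ℝ} {a a₁ : ℝ → ℝ} {b q : ℝ → ℂ} {Q P : H →L[ℂ] H}
    {u u₁ u₂ g g₁ f : ℝ → H} {n j N : ℕ} {A D : ℝ} (hκ₀ : 0 < κ₀)
    (hPsymm : ∀ x y, inner ℂ (P x) y = inner ℂ x (P y)) (hPpos : ∀ x, 0 ≤ (inner ℂ (P x) x).re)
    (ha : ∀ s ∈ Ioo 0 S, HasDerivAt a (a₁ s) s) (haκ : ∀ s ∈ Ioo 0 S, κ₀ * s ≤ a s)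
    (haB : ∀ s ∈ Ioo 0 S, a s ≤ B)
    (ha₁ : ∀ s ∈ Ioo 0 S, |a₁ s| ≤ B) (hb : ∀ s ∈ Ioo 0 S, ‖b s‖ ≤ B)
    (hq : ∀ s ∈ Ioo 0 S, ‖q s‖ ≤ B) (hQ : ‖Q‖ ≤ B) (hn : (5 * B + 2) * (κ₀⁻¹ + S) ≤ n)
    (hu : ∀ s ∈ Ioo 0 S, HasDerivAt u (u₁ s) s) (hu₁ : ∀ s ∈ Ioo 0 S, HasDerivAt u₁ (u₂ s) s)
    (hg : ∀ s ∈ Ioo 0 S, HasDerivAt g (g₁ s) s)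
    (hPu : ∀ s ∈ Ioo 0 S, u s = P (g s)) (hPu₁ : ∀ s ∈ Ioo 0 S, u₁ s = P (g₁ s))
    (heq : ∀ s ∈ Ioo 0 S, (a s : ℂ) • u₂ s + b s • u₁ s + q s • u s + Q (u s) + g s = f s)
    (hN : n < N) (hD : ∀ s ∈ Ioo 0 S, ‖u s‖ ≤ D * s ^ N ∧ ‖u₁ s‖ ≤ D * s ^ N ∧ ‖g s‖ ≤ D * s ^ N)
    (hf : ∀ s ∈ Ioo 0 S, ‖f s‖ ≤ A * s ^ (n + j)) :
    ∀ s ∈ Ioo 0 S, ‖u s‖ ^ 2 ≤ A ^ 2 * s ^ (2 * (n + j) + 1) ∧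
      κ₀ * ‖u₁ s‖ ^ 2 ≤ A ^ 2 * s ^ (2 * (n + j)) := by
  have hB : 0 ≤ B := (norm_nonneg _).trans hQ
  obtain ⟨l, rfl⟩ := Nat.exists_eq_add_of_lt hN
  set E : ℝ → ℝ := fun s => a s * ‖u₁ s‖ ^ 2 + (inner ℂ (u s) (g s)).re + ‖u s‖ ^ 2 with hE
  set E₁ : ℝ → ℝ := fun s => a₁ s * ‖u₁ s‖ ^ 2
    + 2 * (inner ℂ (u₁ s) ((a s : ℂ) • u₂ s + g s)).re + 2 * (inner ℂ (u s) (u₁ s)).re with hE₁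
  have hpos : ∀ s ∈ Ioo 0 S, 0 ≤ (inner ℂ (u s) (g s)).re := fun s hs => by
    rw [hPu s hs]; exact hPpos _
  have hEd : ∀ s ∈ Ioo 0 S, HasDerivAt E (E₁ s) s := by
    intro s hs
    have hre : ∀ {v w : ℝ → H} {v' w' : H}, HasDerivAt v v' s → HasDerivAt w w' s →
        HasDerivAt (fun s => (inner ℂ (v s) (w s)).re)
          ((inner ℂ (v s) w').re + (inner ℂ v' (w s)).re) s := fun hv hw => by
      have h := HasDerivAt.inner ℂ hv hw
      exact (Complex.reCLM.hasFDerivAt.comp_hasDerivAt s h).congr_deriv (by simp)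
    have h1 := (ha s hs).mul (hre (hu₁ s hs) (hu₁ s hs))
    have h2 := hre (hu s hs) (hg s hs)
    have h3 := hre (hu s hs) (hu s hs)
    have h := (h1.add h2).add h3
    have hsq : ∀ x : H, ‖x‖ ^ 2 = (inner ℂ x x).re := fun x => by
      rw [inner_self_eq_norm_sq_to_K]; norm_cast
    have hc : ∀ x y : H, (inner ℂ x y).re = (inner ℂ y x).re := fun x y => by
      rw [← inner_conj_symm, Complex.conj_re]
    refine HasDerivAt.congr_deriv (h.congr_of_eventuallyEq ?_) ?_
    · refine Eventually.of_forall fun t => ?_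
      simp only [hE, hsq, Pi.add_apply, Pi.mul_apply]
    -- symmetry of `P` moves the derivative of `⟪u, g⟫` from `g` to `u`
    · have e1 : (inner ℂ (u s) (g₁ s)).re = (inner ℂ (u₁ s) (g s)).re := by
        rw [hPu s hs, hPsymm, ← hPu₁ s hs, hc]
      simp only [hE₁, hsq, inner_add_right, inner_smul_right, Complex.add_re, Complex.mul_re,
        Complex.ofReal_re, Complex.ofReal_im, zero_mul, sub_zero]
      rw [e1, hc (u₂ s), hc (u₁ s) (u s)]
      ring
  -- the equation replaces `a u'' + g` by terms of lower order; since `‖u'‖² ≤ E / (κ₀ s)`,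
  -- the price is a factor `1 / s`
  have hEbd : ∀ s ∈ Ioo 0 S, E₁ s ≤ n / s * E s + ‖f s‖ ^ 2 := by
    intro s hs
    have hs0 : 0 < s := hs.1
    have hc1 : (inner ℂ (u₁ s) ((a s : ℂ) • u₂ s + g s)).re
        ≤ ‖u₁ s‖ * (‖f s‖ + B * ‖u₁ s‖ + B * ‖u s‖ + B * ‖u s‖) := by
      have h1 : (a s : ℂ) • u₂ s + g s = f s - b s • u₁ s - q s • u s - Q (u s) := by
        rw [← heq s hs]; abel
      rw [h1]
      refine (Complex.re_le_norm _).trans ((norm_inner_le_norm _ _).trans ?_)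
      gcongr
      refine (norm_sub_le _ _).trans ?_
      gcongr
      · refine (norm_sub_le _ _).trans ?_
        gcongr
        · refine (norm_sub_le _ _).trans ?_
          gcongr
          rw [norm_smul]
          gcongr
          exact hb s hs
        · rw [norm_smul]
          gcongr
          exact hq s hs
      · exact (Q.le_opNorm _).trans (by gcongr)
    have hc2 : (inner ℂ (u s) (u₁ s)).re ≤ ‖u s‖ * ‖u₁ s‖ :=
      (Complex.re_le_norm _).trans (norm_inner_le_norm _ _)
    have hc3 : a₁ s * ‖u₁ s‖ ^ 2 ≤ B * ‖u₁ s‖ ^ 2 := by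
      gcongr
      exact (le_abs_self _).trans (ha₁ s hs)
    have h4 : E₁ s ≤ (5 * B + 2) * (‖u₁ s‖ ^ 2 + ‖u s‖ ^ 2) + ‖f s‖ ^ 2 := by
      simp only [hE₁]
      nlinarith [sq_nonneg (‖u₁ s‖ - ‖f s‖), sq_nonneg (‖u s‖ - ‖u₁ s‖),
        mul_nonneg hB (sq_nonneg (‖u s‖ - ‖u₁ s‖)), mul_nonneg hB (sq_nonneg (‖u s‖))]
    have h5 : ‖u₁ s‖ ^ 2 + ‖u s‖ ^ 2 ≤ (κ₀⁻¹ + S) * (E s / s) := by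
      have h6 : κ₀ * s * ‖u₁ s‖ ^ 2 ≤ a s * ‖u₁ s‖ ^ 2 := by
        gcongr
        exact haκ s hs
      have h7 : κ₀ * s * ‖u₁ s‖ ^ 2 ≤ E s := by
        simp only [hE]
        nlinarith [hpos s hs, sq_nonneg ‖u s‖]
      have h8 : ‖u s‖ ^ 2 ≤ E s := by
        have : 0 ≤ κ₀ * s * ‖u₁ s‖ ^ 2 := by positivity
        simp only [hE]
        linarith [hpos s hs]
      have h9 : ‖u₁ s‖ ^ 2 ≤ κ₀⁻¹ * (E s / s) := by
        rw [← div_eq_inv_mul, div_div, le_div_iff₀ (by positivity)]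
        linarith
      have h10 : ‖u s‖ ^ 2 ≤ S * (E s / s) := by
        have hE0 : 0 ≤ E s := (sq_nonneg _).trans h8
        refine h8.trans ?_
        rw [← mul_div_assoc, le_div_iff₀ hs0, mul_comm]
        gcongr
        exact hs.2.le
      rw [add_mul]
      exact add_le_add h9 h10
    have hE0 : 0 ≤ E s / s := by
      have h8 : 0 ≤ κ₀ * s * ‖u₁ s‖ ^ 2 := by positivity
      have h6 : κ₀ * s * ‖u₁ s‖ ^ 2 ≤ a s * ‖u₁ s‖ ^ 2 := by
        gcongr
        exact haκ s hs
      refine div_nonneg ?_ hs0.le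
      simp only [hE]
      linarith [hpos s hs, sq_nonneg ‖u s‖]
    calc E₁ s ≤ (5 * B + 2) * ((κ₀⁻¹ + S) * (E s / s)) + ‖f s‖ ^ 2 :=
          h4.trans (by gcongr)
      _ = (5 * B + 2) * (κ₀⁻¹ + S) * (E s / s) + ‖f s‖ ^ 2 := by ring
      _ ≤ n * (E s / s) + ‖f s‖ ^ 2 := by gcongr
      _ = _ := by ring
  -- the integrating factor `s ^ (-n)` absorbs the singular term, so `φ` is decreasing
  set φ : ℝ → ℝ := fun s => E s * (s ^ n)⁻¹ - A ^ 2 * s ^ (n + 2 * j + 1) with hφ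
  have hφd : ∀ s ∈ Ioo 0 S, HasDerivAt φ (E₁ s * (s ^ n)⁻¹ + E s * (-(n / s) * (s ^ n)⁻¹)
      - A ^ 2 * ((n + 2 * j + 1) * s ^ (n + 2 * j))) s := by
    intro s hs
    have hs0 : s ≠ 0 := hs.1.ne'
    have h1 : HasDerivAt (fun s : ℝ => (s ^ n)⁻¹) (-(n / s) * (s ^ n)⁻¹) s := by
      refine ((hasDerivAt_pow n s).fun_inv (pow_ne_zero n hs0)).congr_deriv ?_
      rcases n with _ | n
      · simp
      · simp only [Nat.add_sub_cancel]
        field_simp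
        ring
    have h2 := (hasDerivAt_pow (n + 2 * j + 1) s).const_mul (A ^ 2)
    refine (((hEd s hs).mul h1).sub h2).congr_deriv ?_
    push_cast
    simp
  have hφneg : ∀ s ∈ Ioo 0 S, E₁ s * (s ^ n)⁻¹ + E s * (-(n / s) * (s ^ n)⁻¹)
      - A ^ 2 * ((n + 2 * j + 1) * s ^ (n + 2 * j)) ≤ 0 := by
    intro s hs
    have hs0 : 0 < s := hs.1
    have h1 : ‖f s‖ ^ 2 * (s ^ n)⁻¹ ≤ A ^ 2 * s ^ (n + 2 * j) := by
      rw [← div_eq_mul_inv, div_le_iff₀ (by positivity)]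
      calc ‖f s‖ ^ 2 ≤ (A * s ^ (n + j)) ^ 2 := by
            gcongr
            exact hf s hs
        _ = _ := by ring
    have h2 : E₁ s * (s ^ n)⁻¹ ≤ (n / s * E s + ‖f s‖ ^ 2) * (s ^ n)⁻¹ := by
      gcongr
      exact hEbd s hs
    have h3 : 0 ≤ A ^ 2 * ((n + 2 * j) * s ^ (n + 2 * j)) := by positivity
    nlinarith
  have hanti : AntitoneOn φ (Ioo 0 S) := by
    refine antitoneOn_of_deriv_nonpos (convex_Ioo 0 S)
      (fun s hs => (hφd s hs).continuousAt.continuousWithinAt) ?_ ?_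
    · rw [interior_Ioo]
      exact fun s hs => (hφd s hs).differentiableAt.differentiableWithinAt
    · rw [interior_Ioo]
      exact fun s hs => by rw [(hφd s hs).deriv]; exact hφneg s hs
  -- the assumed order of vanishing `N > n` forces `φ` to have limit at most `0` at `s = 0`
  have hEup : ∀ s ∈ Ioo 0 S, E s * (s ^ n)⁻¹ ≤ ((B + 2) * D ^ 2 * S ^ (n + 2 * l + 1)) * s := by
    intro s hs
    have hs0 : 0 < s := hs.1
    obtain ⟨h1, h2, h3⟩ := hD s hs
    have hsq : ∀ {x : ℝ}, 0 ≤ x → x ≤ D * s ^ (n + l + 1) → x ^ 2 ≤ (D * s ^ (n + l + 1)) ^ 2 := fun h0 h => by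
      gcongr
    have h4 : (inner ℂ (u s) (g s)).re ≤ (D * s ^ (n + l + 1)) ^ 2 := by
      refine (Complex.re_le_norm _).trans ((norm_inner_le_norm _ _).trans ?_)
      rw [sq]
      gcongr
      exact (norm_nonneg _).trans h1
    have h5 : a s * ‖u₁ s‖ ^ 2 ≤ B * (D * s ^ (n + l + 1)) ^ 2 := by
      have := hsq (norm_nonneg _) h2
      have := haB s hs
      gcongr
    have h6 : E s ≤ (B + 2) * (D * s ^ (n + l + 1)) ^ 2 := by
      simp only [hE]
      linarith [hsq (norm_nonneg _) h1]
    rw [← div_eq_mul_inv, div_le_iff₀ (by positivity)]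
    refine h6.trans ?_
    calc (B + 2) * (D * s ^ (n + l + 1)) ^ 2
        = (B + 2) * D ^ 2 * s ^ (n + 2 * l + 1) * s * s ^ n := by ring
      _ ≤ (B + 2) * D ^ 2 * S ^ (n + 2 * l + 1) * s * s ^ n := by
        gcongr
        exact hs.2.le
  have hlim : ∀ s ∈ Ioo 0 S, φ s ≤ 0 := by
    intro s hs
    have ht : Tendsto (fun t : ℝ => ((B + 2) * D ^ 2 * S ^ (n + 2 * l + 1)) * t) (𝓝[>] 0) (𝓝 0) := by
      have : Tendsto (fun t : ℝ => ((B + 2) * D ^ 2 * S ^ (n + 2 * l + 1)) * t) (𝓝 0)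
          (𝓝 (((B + 2) * D ^ 2 * S ^ (n + 2 * l + 1)) * 0)) := (continuous_const.mul continuous_id).tendsto 0
      rw [mul_zero] at this
      exact this.mono_left nhdsWithin_le_nhds
    refine ge_of_tendsto ht ?_
    filter_upwards [Ioo_mem_nhdsGT hs.1] with t ht
    have htS : t ∈ Ioo 0 S := ⟨ht.1, ht.2.trans hs.2⟩
    refine (hanti htS hs ht.2.le).trans ((sub_le_self _ ?_).trans (hEup t htS))
    have := ht.1
    positivity
  intro s hs
  have hs0 : 0 < s := hs.1
  have h1 : E s ≤ A ^ 2 * s ^ (2 * (n + j) + 1) := by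
    have h := hlim s hs
    simp only [hφ, sub_nonpos] at h
    rw [← div_eq_mul_inv, div_le_iff₀ (by positivity)] at h
    refine h.trans_eq (by ring)
  have h6 : κ₀ * s * ‖u₁ s‖ ^ 2 ≤ a s * ‖u₁ s‖ ^ 2 := by
    gcongr
    exact haκ s hs
  have h7 : 0 ≤ κ₀ * s * ‖u₁ s‖ ^ 2 := by positivity
  simp only [hE] at h1
  refine ⟨by linarith [hpos s hs], ?_⟩
  have h8 : (κ₀ * ‖u₁ s‖ ^ 2) * s ≤ A ^ 2 * s ^ (2 * (n + j)) * s := by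
    calc (κ₀ * ‖u₁ s‖ ^ 2) * s = κ₀ * s * ‖u₁ s‖ ^ 2 := by ring
      _ ≤ A ^ 2 * s ^ (2 * (n + j) + 1) := by linarith [hpos s hs, sq_nonneg ‖u s‖]
      _ = _ := by ring
  exact le_of_mul_le_mul_right h8 hs0

end Energy

section Solves

variable {ι H : Type*} [NormedAddCommGroup H] [InnerProductSpace ℂ H]

/-- The abstract wave equation `a u'' + b u' + q u + Q u + g = f`, `u = P g`, on `(0, S)`. -/
def Solves (S : ℝ) (a : ℝ → ℝ) (b q : ℝ → ℂ) (Q P : H →L[ℂ] H) (u g f : ℝ → H) : Prop :=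
  ∀ s ∈ Ioo 0 S, u s = P (g s) ∧
    (a s : ℂ) • deriv (deriv u) s + b s • deriv u s + q s • u s + Q (u s) + g s = f s

theorem contDiffOn_ofReal {a : ℝ → ℝ} {s : Set ℝ} (ha : ContDiffOn ℝ ∞ a s) :
    ContDiffOn ℝ ∞ (fun x => (a x : ℂ)) s :=
  Complex.ofRealCLM.contDiff.comp_contDiffOn ha

theorem deriv_eq_clm {S : ℝ} {u g : ℝ → H} {P : H →L[ℂ] H} (h : ∀ s ∈ Ioo 0 S, u s = P (g s))
    {s : ℝ} (hs : s ∈ Ioo 0 S) (hg : DifferentiableAt ℝ g s) : deriv u s = P (deriv g s) := by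
  have h1 : EqOn u (fun s => P (g s)) (Ioo 0 S) := h
  rw [deriv_eqOn_Ioo h1 hs]
  exact ((P.restrictScalars ℝ).hasFDerivAt.comp_hasDerivAt s hg.hasDerivAt).deriv

/-- The differentiated abstract wave equation. -/
theorem Solves.deriv {S S₀ : ℝ} (hS : S < S₀) {a : ℝ → ℝ} {b q : ℝ → ℂ} {Q P : H →L[ℂ] H}
    {u g f : ℝ → H} (h : Solves S a b q Q P u g f) (ha : ContDiffOn ℝ ∞ a (Iio S₀))
    (hb : ContDiffOn ℝ ∞ b (Iio S₀)) (hq : ContDiffOn ℝ ∞ q (Iio S₀))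
    (hu : UFlat S 3 (fun _ : Unit => u)) (hg : UFlat S 1 (fun _ : Unit => g)) :
    Solves S a (fun s => b s + ((_root_.deriv a s : ℝ) : ℂ)) (fun s => q s + _root_.deriv b s) Q P
      (_root_.deriv u) (_root_.deriv g) (fun s => _root_.deriv f s - _root_.deriv q s • u s) := by
  intro s hs
  have hs0 : s < S₀ := hs.2.trans hS
  refine ⟨deriv_eq_clm (fun s hs => (h s hs).1) hs (hg.2.1 () s hs), ?_⟩
  have hu1 := (hu.2.1 () s hs).hasDerivAt
  have hu2 := (hu.2.2.2.1 () s hs).hasDerivAt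
  have hu3 := (hu.2.2.2.2.2.1 () s hs).hasDerivAt
  have ha1 := (differentiableAt_of_Iio (contDiffOn_ofReal ha) hs0).hasDerivAt
  have ha2 : _root_.deriv (fun x => (a x : ℂ)) s = ((_root_.deriv a s : ℝ) : ℂ) :=
    ((differentiableAt_of_Iio ha hs0).hasDerivAt.ofReal_comp).deriv
  have hb1 := (differentiableAt_of_Iio hb hs0).hasDerivAt
  have hq1 := (differentiableAt_of_Iio hq hs0).hasDerivAt
  have h1 := ((((ha1.smul hu3).add (hb1.smul hu2)).add (hq1.smul hu1)).add
    ((Q.restrictScalars ℝ).hasFDerivAt.comp_hasDerivAt s hu1)).add (hg.2.1 () s hs).hasDerivAt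
  have h2 := h1.congr_of_eventuallyEq (f₁ := f) (by
    filter_upwards [Ioo_mem_nhds hs.1 hs.2] with t ht
    exact (h t ht).2.symm)
  beta_reduce
  rw [h2.deriv, ha2]
  beta_reduce
  simp only [ContinuousLinearMap.coe_restrictScalars', add_smul]
  abel

theorem exists_common_bound {S S₀ : ℝ} (hS : S < S₀) {a : ℝ → ℝ} {b q : ℝ → ℂ} (Q : H →L[ℂ] H)
    (ha : ContDiffOn ℝ ∞ a (Iio S₀)) (hb : ContDiffOn ℝ ∞ b (Iio S₀))
    (hq : ContDiffOn ℝ ∞ q (Iio S₀)) : ∃ B : ℝ, (∀ s ∈ Ioo 0 S, a s ≤ B) ∧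
      (∀ s ∈ Ioo 0 S, |deriv a s| ≤ B) ∧ (∀ s ∈ Ioo 0 S, ‖b s‖ ≤ B) ∧
      (∀ s ∈ Ioo 0 S, ‖q s‖ ≤ B) ∧ ‖Q‖ ≤ B := by
  obtain ⟨B₁, h1, h1'⟩ := exists_bound_of_contDiffOn hS (contDiffOn_ofReal ha)
  obtain ⟨B₂, h2, h2'⟩ := exists_bound_of_contDiffOn hS
    (contDiffOn_ofReal (contDiffOn_deriv_Iio ha))
  obtain ⟨B₃, h3, h3'⟩ := exists_bound_of_contDiffOn hS hb
  obtain ⟨B₄, h4, h4'⟩ := exists_bound_of_contDiffOn hS hq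
  have h5 := norm_nonneg Q
  refine ⟨B₁ + B₂ + B₃ + B₄ + ‖Q‖, fun s hs => ?_, fun s hs => ?_, fun s hs => ?_,
    fun s hs => ?_, by linarith⟩
  · have := h1' s hs
    rw [Complex.norm_real, Real.norm_eq_abs] at this
    linarith [le_abs_self (a s)]
  · have := h2' s hs
    rw [Complex.norm_real, Real.norm_eq_abs] at this
    linarith
  · linarith [h3' s hs]
  · linarith [h4' s hs]

theorem le_of_sq_le_flat {x A s S : ℝ} {m N : ℕ} (hs : s ∈ Ioo 0 S)
    (h : x ^ 2 ≤ A ^ 2 * s ^ (2 * N + m)) : x ≤ |A| * (1 + S ^ m) * s ^ N := by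
  have hs0 : 0 < s := hs.1
  have hS : 0 < S := hs0.trans hs.2
  refine abs_le_of_sq_le_sq' ?_ (by positivity) |>.2
  calc x ^ 2 ≤ |A| ^ 2 * s ^ m * (s ^ N) ^ 2 := by rw [sq_abs]; exact h.trans_eq (by ring)
    _ ≤ |A| ^ 2 * (1 + S ^ m) ^ 2 * (s ^ N) ^ 2 := by
      have h1 : s ^ m ≤ S ^ m := by gcongr; exact hs.2.le
      have h2 : 0 ≤ S ^ m := by positivity
      gcongr
      nlinarith
    _ = _ := by ring

/-- Solutions of the abstract wave equation are as flat as the source, uniformly in the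
operators `P i`: the energy estimate is applied to the differentiated equations. -/
theorem uflat_of_solves {S S₀ κ₀ : ℝ} (hS : S < S₀) (hκ₀ : 0 < κ₀) {a : ℝ → ℝ} {b q : ℝ → ℂ}
    {Q : H →L[ℂ] H} {P : ι → H →L[ℂ] H} {u g f : ι → ℝ → H}
    (hPsymm : ∀ i x y, inner ℂ (P i x) y = inner ℂ x (P i y))
    (hPpos : ∀ i x, 0 ≤ (inner ℂ (P i x) x).re)
    (ha : ContDiffOn ℝ ∞ a (Iio S₀)) (hb : ContDiffOn ℝ ∞ b (Iio S₀))
    (hq : ContDiffOn ℝ ∞ q (Iio S₀)) (haκ : ∀ s ∈ Ioo 0 S, κ₀ * s ≤ a s)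
    (h : ∀ i, Solves S a b q Q (P i) (u i) (g i) (f i))
    (hu : ∀ i k, UFlat S k (fun _ : Unit => u i)) (hg : ∀ i k, UFlat S k (fun _ : Unit => g i))
    {k : ℕ} (hf : UFlat S k f) : UFlat S k u := by
  induction k generalizing b q u g f with
  | zero =>
    intro N
    obtain ⟨B, hB1, hB2, hB3, hB4, hB5⟩ := exists_common_bound hS Q ha hb hq
    -- this power depends only on the coefficients, so the estimate is uniform in the family
    obtain ⟨n, hn⟩ := exists_nat_ge ((5 * B + 2) * (κ₀⁻¹ + S))
    obtain ⟨A, hA⟩ := hf (n + N)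
    refine ⟨|A| * (1 + S ^ (2 * n + 1)), fun i s hs => ?_⟩
    obtain ⟨D₁, hD₁⟩ := (hu i 0) (n + 1)
    obtain ⟨D₂, hD₂⟩ := (hu i 1).2.2 (n + 1)
    obtain ⟨D₃, hD₃⟩ := (hg i 0) (n + 1)
    have hle : ∀ t ∈ Ioo 0 S, ∀ D, D ≤ |D₁| + |D₂| + |D₃| →
        D * t ^ (n + 1) ≤ (|D₁| + |D₂| + |D₃|) * t ^ (n + 1) := fun t ht D hD => by
      have := ht.1
      gcongr
    have hE := energy_estimate (A := A) (j := N) (n := n) (N := n + 1) (P := P i) (u := u i)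
      (g := g i) (f := f i) (D := |D₁| + |D₂| + |D₃|)
      hκ₀ (hPsymm i) (hPpos i) (fun s hs => (differentiableAt_of_Iio ha (hs.2.trans hS)).hasDerivAt)
      haκ hB1 hB2 hB3 hB4 hB5 hn (fun s hs => ((hu i 1).2.1 () s hs).hasDerivAt)
      (fun s hs => ((hu i 2).2.2.2.1 () s hs).hasDerivAt)
      (fun s hs => ((hg i 1).2.1 () s hs).hasDerivAt) (fun s hs => (h i s hs).1)
      (fun s hs => deriv_eq_clm (fun s hs => (h i s hs).1) hs ((hg i 1).2.1 () s hs))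
      (fun s hs => (h i s hs).2) (Nat.lt_succ_self n)
      (fun t ht => ⟨(hD₁ () t ht).trans (hle t ht _ (by
          linarith [le_abs_self D₁, abs_nonneg D₂, abs_nonneg D₃])),
        (hD₂ () t ht).trans (hle t ht _ (by
          linarith [le_abs_self D₂, abs_nonneg D₁, abs_nonneg D₃])),
        (hD₃ () t ht).trans (hle t ht _ (by
          linarith [le_abs_self D₃, abs_nonneg D₂, abs_nonneg D₁]))⟩)
      (hA i) s hs
    exact le_of_sq_le_flat hs (hE.1.trans_eq (by ring))
  | succ k ih =>
    have h1 := ih hb hq h hu hg hf.of_succ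
    refine ⟨h1.flatBound, fun i s hs => (hu i 1).2.1 () s hs, ?_⟩
    -- `u'` solves the equation with coefficients `b + a'`, `q + b'` and source `f' - q' u`
    refine ih (hb.add (contDiffOn_ofReal (contDiffOn_deriv_Iio ha)))
      (hq.add (contDiffOn_deriv_Iio hb))
      (fun i => Solves.deriv hS (h i) ha hb hq (hu i 3) (hg i 1))
      (fun i k => (hu i (k + 1)).2.2) (fun i k => (hg i (k + 1)).2.2) ?_
    exact hf.2.2.sub (h1.smul hS (contDiffOn_deriv_Iio hq))

end Solves

/-! ### Ordinary differential equations with a regular singular point -/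

section Fuchs

/-- The equation `s U' = A U + s ^ N Φ` has a solution of size `s ^ N`, for `N` larger than the
norm of `A`: the operator `Y ↦ ∫₀¹ t ^ (N - 1) (A Y + Φ)(t s) dt` is a contraction and
`U = s ^ N Y` for its fixed point `Y`. -/
theorem exists_fuchsian_solution {G : Type*} [NormedAddCommGroup G] [NormedSpace ℝ G]
    [CompleteSpace G] {S α : ℝ} (hS : 0 ≤ S) {A : ℝ → G →L[ℝ] G} {Φ : ℝ → G} {N : ℕ}
    (hA : ContinuousOn A (Icc 0 S)) (hα : ∀ s ∈ Icc 0 S, ‖A s‖ ≤ α)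
    (hΦ : ContinuousOn Φ (Icc 0 S)) (hN : α < N) :
    ∃ U : ℝ → G, (∃ C, ∀ s ∈ Ioo 0 S, ‖U s‖ ≤ C * s ^ N) ∧
      ∀ s ∈ Ioo 0 S, HasDerivAt U (s⁻¹ • (A s (U s) + s ^ N • Φ s)) s := by
  have hα0 : 0 ≤ α := (norm_nonneg _).trans (hα 0 ⟨le_rfl, hS⟩)
  have hN0 : (0 : ℝ) < N := hα0.trans_lt hN
  obtain ⟨n, rfl⟩ : ∃ n, N = n + 1 :=
    Nat.exists_eq_succ_of_ne_zero (by rintro rfl; simp at hN0)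
  -- extend the coefficients to `ℝ`
  set c : ℝ → ℝ := fun s => max 0 (min s S) with hc
  have hcc : Continuous c := continuous_const.max (continuous_id.min continuous_const)
  have hcI : ∀ s, c s ∈ Icc 0 S := fun s => ⟨le_max_left _ _, max_le hS (min_le_right _ _)⟩
  have hcs : ∀ s ∈ Icc 0 S, c s = s := fun s hs => by simp [hc, hs.1, hs.2]
  set A' : ℝ → G →L[ℝ] G := fun s => A (c s) with hA'
  set Φ' : ℝ → G := fun s => Φ (c s) with hΦ'
  have hA'c : Continuous A' := hA.comp_continuous hcc hcI
  have hΦ'c : Continuous Φ' := hΦ.comp_continuous hcc hcI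
  obtain ⟨β, hβ⟩ := isCompact_Icc.exists_bound_of_continuousOn hΦ
  have hint : ∀ (Y : BoundedContinuousFunction ℝ G),
      Continuous (fun p : ℝ × ℝ => p.2 ^ n • (A' (p.2 * p.1) (Y (p.2 * p.1)) + Φ' (p.2 * p.1))) := by
    intro Y
    have h1 : Continuous fun p : ℝ × ℝ => p.2 * p.1 := continuous_snd.mul continuous_fst
    exact (continuous_snd.pow n).smul
      (((hA'c.comp h1).clm_apply (Y.continuous.comp h1)).add (hΦ'c.comp h1))
  have hI : ∫ t in (0 : ℝ)..1, t ^ n = ((n + 1 : ℕ) : ℝ)⁻¹ := by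
    rw [integral_pow]; simp
  have hbd : ∀ (g : ℝ → G) (D : ℝ), (∀ t ∈ Ioc (0 : ℝ) 1, ‖g t‖ ≤ t ^ n * D) →
      ‖∫ t in (0 : ℝ)..1, g t‖ ≤ ((n + 1 : ℕ) : ℝ)⁻¹ * D := by
    intro g D h
    rw [← hI, ← intervalIntegral.integral_mul_const]
    exact intervalIntegral.norm_integral_le_of_norm_le zero_le_one
      (Eventually.of_forall fun t ht => h t ht)
      (((continuous_id.pow n).mul continuous_const).intervalIntegrable _ _)
  let T : BoundedContinuousFunction ℝ G → BoundedContinuousFunction ℝ G := fun Y =>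
    BoundedContinuousFunction.ofNormedAddCommGroup
      (fun s => ∫ t in (0 : ℝ)..1, t ^ n • (A' (t * s) (Y (t * s)) + Φ' (t * s)))
      (intervalIntegral.continuous_parametric_intervalIntegral_of_continuous' (hint Y) 0 1)
      (((n + 1 : ℕ) : ℝ)⁻¹ * (α * ‖Y‖ + β)) (fun s => hbd _ _ fun t ht => by
        rw [norm_smul, norm_pow, Real.norm_eq_abs, abs_of_pos ht.1]
        have h0 := ht.1
        gcongr
        refine (norm_add_le _ _).trans (add_le_add ?_ (hβ _ (hcI _)))
        exact ((A' (t * s)).le_opNorm _).trans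
          (mul_le_mul (hα _ (hcI _)) (Y.norm_coe_le_norm _) (norm_nonneg _) hα0))
  set K : NNReal := Real.toNNReal (α * ((n + 1 : ℕ) : ℝ)⁻¹) with hKdef
  have hK : (K : ℝ) = α * ((n + 1 : ℕ) : ℝ)⁻¹ := Real.coe_toNNReal _ (by positivity)
  have hints : ∀ (Y : BoundedContinuousFunction ℝ G) (s : ℝ), IntervalIntegrable
      (fun t => t ^ n • (A' (t * s) (Y (t * s)) + Φ' (t * s))) MeasureTheory.volume 0 1 :=
    fun Y s => ((hint Y).comp (Continuous.prodMk_right s)).intervalIntegrable _ _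
  have hT : ContractingWith K T := by
    refine ⟨?_, LipschitzWith.of_dist_le_mul fun Y Z => ?_⟩
    · rw [← NNReal.coe_lt_coe, hK, NNReal.coe_one]
      rwa [← div_eq_mul_inv, div_lt_one hN0]
    · rw [BoundedContinuousFunction.dist_le (by positivity), hK]
      intro s
      simp only [T, BoundedContinuousFunction.coe_ofNormedAddCommGroup, dist_eq_norm]
      rw [← intervalIntegral.integral_sub (hints Y s) (hints Z s)]
      refine (hbd _ (α * ‖Y - Z‖) fun t ht => ?_).trans_eq (by ring)
      rw [← smul_sub, add_sub_add_right_eq_sub, ← map_sub, norm_smul, norm_pow, Real.norm_eq_abs,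
        abs_of_pos ht.1]
      have h0 := ht.1
      gcongr
      refine ((A' (t * s)).le_opNorm _).trans
          (mul_le_mul (hα _ (hcI _)) ?_ (norm_nonneg _) hα0)
      exact (Y - Z).norm_coe_le_norm (t * s)
  set Y := hT.fixedPoint with hY
  have hYfix : ∀ s, Y s = ∫ t in (0 : ℝ)..1, t ^ n • (A' (t * s) (Y (t * s)) + Φ' (t * s)) := by
    intro s
    have h : T Y = Y := hT.fixedPoint_isFixedPt
    conv_lhs => rw [← h]
    rfl
  set ψ : ℝ → G := fun x => x ^ n • (A' x (Y x) + Φ' x) with hψ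
  have hψc : Continuous ψ :=
    (continuous_id.pow n).smul ((hA'c.clm_apply Y.continuous).add hΦ'c)
  have hU : ∀ s, s ^ (n + 1) • Y s = ∫ x in (0 : ℝ)..s, ψ x := by
    intro s
    have h := intervalIntegral.smul_integral_comp_mul_right (a := 0) (b := 1) ψ s
    rw [zero_mul, one_mul] at h
    rw [← h, hYfix s, pow_succ', mul_smul, ← intervalIntegral.integral_smul]
    congr 2
    ext t
    simp only [hψ, mul_pow, smul_smul, mul_comm]
  refine ⟨fun s => s ^ (n + 1) • Y s, ⟨‖Y‖, fun s hs => ?_⟩, fun s hs => ?_⟩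
  · rw [norm_smul, norm_pow, Real.norm_eq_abs, abs_of_pos hs.1, mul_comm]
    have := hs.1
    gcongr
    exact Y.norm_coe_le_norm s
  · have h1 : HasDerivAt (fun s => s ^ (n + 1) • Y s) (ψ s) s := by
      simp only [hU]
      exact intervalIntegral.integral_hasDerivAt_right
        (hψc.intervalIntegrable _ _) (hψc.stronglyMeasurableAtFilter _ _) hψc.continuousAt
    refine h1.congr_deriv ?_
    have hs0 : s ≠ 0 := hs.1.ne'
    have hsI : s ∈ Icc 0 S := ⟨hs.1.le, hs.2.le⟩
    simp only [hψ, hA', hΦ', hcs s hsI, map_smul, ← smul_add, smul_smul]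
    rw [pow_succ', inv_mul_cancel_left₀ hs0]

end Fuchs

section Exist

variable {H : Type*} [NormedAddCommGroup H] [InnerProductSpace ℂ H] [CompleteSpace H]

/-- Existence for the abstract wave equation when `P` has a bounded inverse `L`. -/
theorem exists_solves_of_inverse {S S₀ : ℝ} (hS0 : 0 < S) (hS : S < S₀) {κ : ℝ → ℝ} {b q : ℝ → ℂ}
    {Q P L : H →L[ℂ] H} {f : ℝ → H} (hPL : ∀ x, P (L x) = x)
    (hPsymm : ∀ x y, inner ℂ (P x) y = inner ℂ x (P y)) (hPpos : ∀ x, 0 ≤ (inner ℂ (P x) x).re)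
    (hκ : ContDiffOn ℝ ∞ κ (Iio S₀)) (hκ0 : ∀ s < S₀, 0 < κ s) (hb : ContDiffOn ℝ ∞ b (Iio S₀))
    (hq : ContDiffOn ℝ ∞ q (Iio S₀)) (hf : IsFlatCurve S₀ f) :
    ∃ u : ℝ → H, (∀ k, UFlat S k (fun _ : Unit => u)) ∧
      Solves S (fun s => s * κ s) b q Q P u (fun s => L (u s)) f := by
  have hκc : ContDiffOn ℝ ∞ (fun s => (κ s : ℂ)) (Iio S₀) := contDiffOn_ofReal hκ
  have hκi : ContDiffOn ℝ ∞ (fun s => (κ s : ℂ)⁻¹) (Iio S₀) :=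
    hκc.inv fun s hs => by exact_mod_cast (hκ0 s hs).ne'
  have hid : ContDiffOn ℝ ∞ (fun s : ℝ => (s : ℂ)) (Iio S₀) := contDiffOn_ofReal contDiffOn_id
  have ha : ContDiffOn ℝ ∞ (fun s => s * κ s) (Iio S₀) := contDiffOn_id.mul hκ
  have hI : Icc 0 S ⊆ Iio S₀ := fun s hs => hs.2.trans_lt hS
  obtain ⟨κ₀, hκ₀, hκb⟩ : ∃ κ₀ : ℝ, 0 < κ₀ ∧ ∀ s ∈ Icc 0 S, κ₀ ≤ κ s := by
    obtain ⟨x, hx, hmin⟩ := isCompact_Icc.exists_isMinOn ⟨0, le_rfl, hS0.le⟩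
      (hκ.continuousOn.mono hI)
    exact ⟨κ x, hκ0 x (hI hx), fun s hs => hmin hs⟩
  obtain ⟨B, hB1, hB2, hB3, hB4, hB5⟩ := exists_common_bound hS Q ha hb hq
  obtain ⟨n, hn⟩ := exists_nat_ge ((5 * B + 2) * (κ₀⁻¹ + S))
  -- the first order system for `U = (u, s u')`
  let fst := ContinuousLinearMap.fst ℂ H H
  let snd := ContinuousLinearMap.snd ℂ H H
  let inl := ContinuousLinearMap.inl ℂ H H
  let inr := ContinuousLinearMap.inr ℂ H H
  let A₁ : ℝ → (H × H) →L[ℂ] (H × H) := fun s =>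
    (inl ∘L snd + inr ∘L snd) + (-(b s * (κ s : ℂ)⁻¹)) • (inr ∘L snd)
      + (-((s : ℂ) * (κ s : ℂ)⁻¹ * q s)) • (inr ∘L fst)
      + (-((s : ℂ) * (κ s : ℂ)⁻¹)) • (inr ∘L (Q + L) ∘L fst)
  have hA₁ : ContinuousOn A₁ (Icc 0 S) := by
    have h1 := (hb.mul hκi).continuousOn.mono hI
    have h2 := ((hid.mul hκi).mul hq).continuousOn.mono hI
    have h3 := (hid.mul hκi).continuousOn.mono hI
    exact ((continuousOn_const.add (h1.neg.smul continuousOn_const)).add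
      (h2.neg.smul continuousOn_const)).add (h3.neg.smul continuousOn_const)
  let A : ℝ → (H × H) →L[ℝ] (H × H) := fun s => (A₁ s).restrictScalars ℝ
  have hA : ContinuousOn A (Icc 0 S) :=
    (ContinuousLinearMap.restrictScalarsL ℂ (H × H) (H × H) ℝ ℝ).continuous.comp_continuousOn hA₁
  obtain ⟨α, hα⟩ :=
    IsCompact.exists_bound_of_continuousOn (E := (H × H) →L[ℝ] (H × H)) isCompact_Icc hA
  obtain ⟨N₁, hN₁⟩ := exists_nat_gt α
  -- beyond the norm of the system, `n + 1` orders are needed for the energy estimate and one more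
  -- because `u' = v / s`
  set N := N₁ + n + 2 with hN
  have hφ : IsFlatCurve S₀ (fun s => if 0 < s then ((s : ℂ) ^ N)⁻¹ • f s else 0) :=
    isFlatCurve_extend fun T hT k => (hf.uflat hT (hS0.trans hS) k).inv_pow_smul N
  set φ : ℝ → H := fun s => if 0 < s then ((s : ℂ) ^ N)⁻¹ • f s else 0 with hφdef
  let Φ : ℝ → H × H := fun s => inr (((s : ℂ) * (κ s : ℂ)⁻¹) • φ s)
  have hΦ : ContinuousOn Φ (Icc 0 S) :=
    inr.continuous.comp_continuousOn
      (((hid.mul hκi).continuousOn.mono hI).smul (hφ.1.continuousOn.mono hI))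
  obtain ⟨U, ⟨C, hC⟩, hU⟩ := exists_fuchsian_solution (N := N) hS0.le hA hα hΦ
    (hN₁.trans_le (by rw [hN]; push_cast; linarith))
  set u : ℝ → H := fun s => (U s).1 with hu
  set v : ℝ → H := fun s => (U s).2 with hv
  have hud : ∀ s ∈ Ioo 0 S, HasDerivAt u ((s : ℂ)⁻¹ • v s) s := by
    intro s hs
    have h := (ContinuousLinearMap.fst ℝ H H).hasFDerivAt.comp_hasDerivAt s (hU s hs)
    refine h.congr_deriv ?_
    simp only [A, A₁, Φ, inl, inr, fst, snd, hv, ← Complex.coe_smul]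
    simp
  have hvd : ∀ s ∈ Ioo 0 S, HasDerivAt v ((s : ℂ)⁻¹ • v s + (κ s : ℂ)⁻¹ • (f s
      - b s • ((s : ℂ)⁻¹ • v s) - q s • u s - Q (u s) - L (u s))) s := by
    intro s hs
    have h := (ContinuousLinearMap.snd ℝ H H).hasFDerivAt.comp_hasDerivAt s (hU s hs)
    refine h.congr_deriv ?_
    have hs0 : (s : ℂ) ≠ 0 := by exact_mod_cast hs.1.ne'
    have hk0 : (κ s : ℂ) ≠ 0 := by exact_mod_cast (hκ0 s (hs.2.trans hS)).ne'
    have hφs : φ s = ((s : ℂ) ^ N)⁻¹ • f s := by simp only [hφdef, if_pos hs.1]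
    simp only [A, A₁, Φ, inl, inr, fst, snd, hv, hu, hφs, ← Complex.coe_smul]
    simp only [ContinuousLinearMap.coe_restrictScalars', FunLike.coe_add,
      ContinuousLinearMap.coe_comp, FunLike.coe_smul, Pi.add_apply, Pi.smul_apply,
      Function.comp_apply, ContinuousLinearMap.inl_apply, ContinuousLinearMap.inr_apply,
      ContinuousLinearMap.coe_fst', ContinuousLinearMap.coe_snd', Prod.snd_add, Prod.smul_snd,
      zero_add]
    push_cast
    match_scalars <;> field_simp
  have hu1d : ∀ s ∈ Ioo 0 S, HasDerivAt (fun s : ℝ => ((s : ℂ) ^ 1)⁻¹ • v s)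
      (((s : ℂ) ^ 1)⁻¹ • (κ s : ℂ)⁻¹ • (f s - b s • (((s : ℂ) ^ 1)⁻¹ • v s) - q s • u s - Q (u s)
        - L (u s))) s := by
    intro s hs
    have hs0 : (s : ℂ) ≠ 0 := by exact_mod_cast hs.1.ne'
    have h1 : HasDerivAt (fun s : ℝ => ((s : ℂ) ^ 1)⁻¹) (-((s : ℂ) ^ 2)⁻¹) s := by
      simp only [pow_one]
      have h3 := (hasDerivAt_inv hs0).comp_ofReal
      exact h3
    refine (h1.smul (hvd s hs)).congr_deriv ?_
    simp only [pow_one]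
    match_scalars <;> field_simp <;> ring
  set u₁ : ℝ → H := fun s : ℝ => ((s : ℂ) ^ 1)⁻¹ • v s with hu₁
  have hud' : ∀ s ∈ Ioo 0 S, HasDerivAt u (u₁ s) s := fun s hs => by
    simpa only [hu₁, pow_one] using hud s hs
  have heq : ∀ s ∈ Ioo 0 S, ((s * κ s : ℝ) : ℂ) • (((s : ℂ) ^ 1)⁻¹ • (κ s : ℂ)⁻¹ • (f s
      - b s • u₁ s - q s • u s - Q (u s) - L (u s))) + b s • u₁ s + q s • u s + Q (u s) + L (u s)
      = f s := by
    intro s hs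
    have hs0 : (s : ℂ) ≠ 0 := by exact_mod_cast hs.1.ne'
    have hk0 : (κ s : ℂ) ≠ 0 := by exact_mod_cast (hκ0 s (hs.2.trans hS)).ne'
    push_cast
    rw [pow_one]
    match_scalars <;> field_simp <;> ring
  have hLd : ∀ s ∈ Ioo 0 S, HasDerivAt (fun s => L (u s)) (L (u₁ s)) s := fun s hs =>
    (L.restrictScalars ℝ).hasFDerivAt.comp_hasDerivAt s (hud' s hs)
  have hC0 : ∀ s ∈ Ioo 0 S, ‖u s‖ ≤ C * s ^ N ∧ ‖v s‖ ≤ C * s ^ N := fun s hs =>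
    ⟨(norm_fst_le (U s)).trans (hC s hs), (norm_snd_le (U s)).trans (hC s hs)⟩
  have hpriori : ∀ s ∈ Ioo 0 S, ‖u s‖ ≤ (C * S ^ N₁ * (1 + S + ‖L‖ * S)) * s ^ (n + 1)
      ∧ ‖u₁ s‖ ≤ (C * S ^ N₁ * (1 + S + ‖L‖ * S)) * s ^ (n + 1)
      ∧ ‖L (u s)‖ ≤ (C * S ^ N₁ * (1 + S + ‖L‖ * S)) * s ^ (n + 1) := by
    intro s hs
    have hs0 : 0 < s := hs.1
    have hC' : 0 ≤ C := nonneg_of_mul_nonneg_left ((norm_nonneg _).trans (hC s hs))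
      (by positivity)
    have hu' : ‖u s‖ ≤ C * S ^ N₁ * S * s ^ (n + 1) := by
      refine (hC0 s hs).1.trans ?_
      calc C * s ^ N = C * s ^ N₁ * s * s ^ (n + 1) := by rw [hN]; ring
        _ ≤ _ := by gcongr <;> exact hs.2.le
    have hv' : ‖u₁ s‖ ≤ C * S ^ N₁ * s ^ (n + 1) := by
      have h1 : ‖u₁ s‖ = s⁻¹ * ‖v s‖ := by
        simp [hu₁, norm_smul, abs_of_pos hs0]
      rw [h1]
      calc s⁻¹ * ‖v s‖ ≤ s⁻¹ * (C * s ^ N) := by gcongr; exact (hC0 s hs).2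
        _ = C * s ^ N₁ * s ^ (n + 1) := by rw [hN]; field_simp; ring
        _ ≤ _ := by gcongr; exact hs.2.le
    have hL' : ‖L (u s)‖ ≤ ‖L‖ * (C * S ^ N₁ * S * s ^ (n + 1)) :=
      (L.le_opNorm _).trans (by gcongr)
    have hnn : 0 ≤ C * S ^ N₁ * s ^ (n + 1) := by positivity
    have hnS : 0 ≤ C * S ^ N₁ * S * s ^ (n + 1) := by positivity
    have hnL : 0 ≤ ‖L‖ * (C * S ^ N₁ * S * s ^ (n + 1)) := by positivity
    refine ⟨?_, ?_, ?_⟩ <;> linarith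
  -- the energy estimate improves the finite order of vanishing to every order
  have hflat : FlatBound S (fun _ : Unit => u) ∧ FlatBound S (fun _ : Unit => u₁) := by
    have key : ∀ j : ℕ, ∃ A : ℝ, ∀ s ∈ Ioo 0 S, ‖u s‖ ^ 2 ≤ A ^ 2 * s ^ (2 * (n + j) + 1) ∧
        κ₀ * ‖u₁ s‖ ^ 2 ≤ A ^ 2 * s ^ (2 * (n + j)) := by
      intro j
      obtain ⟨A, hA⟩ := (hf.uflat hS (hS0.trans hS) 0) (n + j)
      refine ⟨A, energy_estimate (A := A) (j := j) (n := n) (N := n + 1) (P := P) (Q := Q) (u := u)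
        (u₁ := u₁) (g := fun s => L (u s)) (f := f) hκ₀ hPsymm hPpos
        (fun s hs => (differentiableAt_of_Iio ha (hs.2.trans hS)).hasDerivAt)
        (fun s hs => ?_) hB1 hB2 hB3 hB4 hB5 hn hud' hu1d hLd (fun s _ => (hPL _).symm)
        (fun s _ => (hPL _).symm) heq (Nat.lt_succ_self n) hpriori (hA ())⟩
      rw [mul_comm]
      have := hs.1
      gcongr
      exact hκb s ⟨hs.1.le, hs.2.le⟩
    constructor
    · intro j
      obtain ⟨A, hA⟩ := key j
      exact ⟨_, fun _ s hs => le_of_sq_le_flat (m := 2 * n + 1) hs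
        ((hA s hs).1.trans_eq (by ring))⟩
    · intro j
      obtain ⟨A, hA⟩ := key j
      refine ⟨_, fun _ s hs => le_of_sq_le_flat (m := 2 * n) (A := A * (√κ₀)⁻¹) hs ?_⟩
      have h1 := (hA s hs).2
      rw [mul_pow, inv_pow, Real.sq_sqrt hκ₀.le, mul_assoc, mul_comm κ₀⁻¹, ← mul_assoc,
        ← div_eq_mul_inv, le_div_iff₀ hκ₀, mul_comm]
      exact h1.trans_eq (by ring)
  -- solving the equation for `u''` bounds the higher derivatives; dividing by `s` loses nothing
  have hsmooth : ∀ k, UFlat S k (fun _ : Unit => u) ∧ UFlat S k (fun _ : Unit => u₁) := by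
    intro k
    induction k with
    | zero => exact hflat
    | succ k ih =>
      refine ⟨UFlat.succ_of_hasDerivAt hflat.1 (fun _ => hud') ih.2,
        UFlat.succ_of_hasDerivAt hflat.2 (fun _ => hu1d) ?_⟩
      refine UFlat.inv_pow_smul (u := fun (_ : Unit) s => (κ s : ℂ)⁻¹ • (f s - b s • u₁ s
        - q s • u s - Q (u s) - L (u s))) ?_ 1
      refine UFlat.smul hS ?_ hκi
      exact ((((hf.uflat hS (hS0.trans hS) k).sub (ih.2.smul hS hb)).sub (ih.1.smul hS hq)).sub
        (ih.1.clm Q)).sub (ih.1.clm L)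
  refine ⟨u, fun k => (hsmooth k).1, fun s hs => ⟨(hPL _).symm, ?_⟩⟩
  have h1 : EqOn (deriv u) u₁ (Ioo 0 S) := fun s hs => (hud' s hs).deriv
  rw [deriv_eqOn_Ioo h1 hs, (hu1d s hs).deriv, h1 hs]
  exact heq s hs

end Exist

/-! ### Weak limits along an ultrafilter -/

section Weak

variable {H : Type*} [NormedAddCommGroup H] [InnerProductSpace ℂ H]

/-- Weak convergence of a sequence along the fixed free ultrafilter on `ℕ`. -/
def WeakLim (x : ℕ → H) (y : H) : Prop :=
  ∀ z, Tendsto (fun n => inner ℂ (x n) z) (hyperfilter ℕ : Filter ℕ) (𝓝 (inner ℂ y z))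

theorem WeakLim.unique {x : ℕ → H} {y y' : H} (h : WeakLim x y) (h' : WeakLim x y') : y = y' :=
  ext_inner_right ℂ fun z => tendsto_nhds_unique (h z) (h' z)

theorem WeakLim.add {x x' : ℕ → H} {y y' : H} (h : WeakLim x y) (h' : WeakLim x' y') :
    WeakLim (fun n => x n + x' n) (y + y') := fun z => by
  simp only [inner_add_left]
  exact (h z).add (h' z)

theorem WeakLim.smul {x : ℕ → H} {y : H} (h : WeakLim x y) (c : ℂ) :
    WeakLim (fun n => c • x n) (c • y) := fun z => by
  simp only [inner_smul_left]
  exact (h z).const_mul _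

theorem weakLim_of_tendsto {x : ℕ → H} {y : H} (h : Tendsto x (hyperfilter ℕ : Filter ℕ) (𝓝 y)) :
    WeakLim x y := fun _ => h.inner tendsto_const_nhds

theorem WeakLim.norm_le {x : ℕ → H} {y : H} (h : WeakLim x y) {C : ℝ} (hx : ∀ n, ‖x n‖ ≤ C) :
    ‖y‖ ≤ C := by
  have h1 := le_of_tendsto (h y).norm (Eventually.of_forall fun n =>
      (norm_inner_le_norm _ _).trans (mul_le_mul_of_nonneg_right (hx n) (norm_nonneg y)))
  rw [inner_self_eq_norm_sq_to_K] at h1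
  have h2 : ‖y‖ * ‖y‖ ≤ C * ‖y‖ := by
    simpa [sq] using h1
  rcases (norm_nonneg y).eq_or_lt with h0 | h0
  · rw [← h0]; exact (norm_nonneg _).trans (hx 0)
  · exact le_of_mul_le_mul_right h2 h0

/-- A bound for the second derivatives makes the Taylor remainders uniformly quadratic, and norms are
lower semicontinuous under weak limits. -/
theorem hasDerivAt_of_weakLim {S : ℝ} {u : ℕ → ℝ → H} (hu : UFlat S 2 u) {U V : ℝ → H}
    (hU : ∀ s ∈ Ioo 0 S, WeakLim (fun n => u n s) (U s))
    (hV : ∀ s ∈ Ioo 0 S, WeakLim (fun n => deriv (u n) s) (V s)) {s : ℝ} (hs : s ∈ Ioo 0 S) :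
    HasDerivAt U (V s) s := by
  obtain ⟨C, hC⟩ := hu.2.2.2.2 0
  simp only [pow_zero, mul_one] at hC
  have hrem : ∀ n, ∀ t ∈ Ioo 0 S, ‖u n t - u n s - ((t - s : ℝ) : ℂ) • deriv (u n) s‖
      ≤ C * |t - s| * |t - s| := by
    intro n t ht
    have h1 : ∀ x ∈ Ioo 0 S, ∀ y ∈ Ioo 0 S, ‖deriv (u n) x - deriv (u n) y‖ ≤ C * |x - y| :=
      fun x hx y hy => Convex.norm_image_sub_le_of_norm_deriv_le
        (fun z hz => hu.2.2.2.1 n z hz) (fun z hz => hC n z hz) (convex_Ioo 0 S) hy hx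
    have h2 := Convex.norm_image_sub_le_of_norm_hasDerivWithin_le (s := uIcc s t) (x := s) (y := t)
      (f := fun x : ℝ => u n x - ((x - s : ℝ) : ℂ) • deriv (u n) s)
      (f' := fun x => deriv (u n) x - deriv (u n) s) (C := C * |t - s|)
      (fun x hx => by
        have hxS : x ∈ Ioo 0 S := (ordConnected_Ioo.uIcc_subset hs ht) hx
        have h3 : HasDerivAt (fun x : ℝ => ((x - s : ℝ) : ℂ)) 1 x := by
          simpa using ((hasDerivAt_id x).sub_const s).ofReal_comp
        simpa using ((hu.2.1 n x hxS).hasDerivAt.fun_sub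
          (h3.smul_const (deriv (u n) s))).hasDerivWithinAt)
      (fun x hx => by
        have hxS : x ∈ Ioo 0 S := (ordConnected_Ioo.uIcc_subset hs ht) hx
        refine (h1 x hxS s hs).trans ?_
        have hC0 : 0 ≤ C := (norm_nonneg _).trans (hC n s hs)
        exact mul_le_mul_of_nonneg_left (abs_sub_left_of_mem_uIcc hx) hC0)
      (convex_uIcc s t) left_mem_uIcc right_mem_uIcc
    simp only [sub_self, Complex.ofReal_zero, zero_smul, sub_zero] at h2
    rw [sub_right_comm]
    exact h2
  rw [hasDerivAt_iff_isLittleO]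
  refine Asymptotics.IsBigO.trans_isLittleO (g := fun t : ℝ => (t - s) ^ 2) ?_ ?_
  · refine Asymptotics.IsBigO.of_bound C ?_
    filter_upwards [Ioo_mem_nhds hs.1 hs.2] with t ht
    have h1 : WeakLim (fun n => u n t - u n s - ((t - s : ℝ) : ℂ) • deriv (u n) s)
        (U t - U s - ((t - s : ℝ) : ℂ) • V s) := by
      have := ((hU t ht).add ((hU s hs).smul (-1))).add
        (((hV s hs).smul ((t - s : ℝ) : ℂ)).smul (-1))
      simpa only [neg_smul, one_smul, ← sub_eq_add_neg] using this
    refine (h1.norm_le fun n => hrem n t ht).trans_eq ?_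
    rw [Real.norm_eq_abs, abs_pow, sq, mul_assoc]
  · simpa only [Real.norm_eq_abs, sq_abs] using
      Asymptotics.isLittleO_pow_sub_sub s one_lt_two

variable [CompleteSpace H]

theorem WeakLim.clm {x : ℕ → H} {y : H} (h : WeakLim x y) (L : H →L[ℂ] H) :
    WeakLim (fun n => L (x n)) (L y) := fun z => by
  simp only [← ContinuousLinearMap.adjoint_inner_right]
  exact h _

theorem exists_weakLim {x : ℕ → H} {C : ℝ} (hx : ∀ n, ‖x n‖ ≤ C) : ∃ y, WeakLim x y := by
  have h1 : ∀ z, ∃ c : ℂ, Tendsto (fun n => inner ℂ (x n) z) (hyperfilter ℕ : Filter ℕ) (𝓝 c) := by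
    intro z
    have := (isCompact_closedBall (0 : ℂ) (C * ‖z‖)).ultrafilter_le_nhds
      ((hyperfilter ℕ).map fun n => inner ℂ (x n) z) (by
        rw [le_principal_iff]
        refine Filter.mem_map.2 (univ_mem' fun n => ?_)
        simp only [mem_preimage, mem_closedBall_zero_iff]
        exact (norm_inner_le_norm _ _).trans (by gcongr; exact hx n))
    obtain ⟨c, -, hc⟩ := this
    exact ⟨c, hc⟩
  choose φ hφ using h1
  let ℓ : H →ₗ[ℂ] ℂ :=
    { toFun := φ
      map_add' := fun z w => tendsto_nhds_unique (hφ (z + w)) (by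
        simp only [inner_add_right]; exact (hφ z).add (hφ w))
      map_smul' := fun c z => tendsto_nhds_unique (hφ (c • z)) (by
        simp only [inner_smul_right]; exact (hφ z).const_mul c) }
  let ℓ' : H →L[ℂ] ℂ := ℓ.mkContinuous C fun z =>
    le_of_tendsto (hφ z).norm (Eventually.of_forall fun n =>
      (norm_inner_le_norm _ _).trans (by gcongr; exact hx n))
  refine ⟨(InnerProductSpace.toDual ℂ H).symm ℓ', fun z => ?_⟩
  rw [InnerProductSpace.toDual_symm_apply]
  exact hφ z

theorem exists_weakLim_curve {S : ℝ} {u : ℕ → ℝ → H} (hu : FlatBound S u) :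
    ∃ U : ℝ → H, ∀ s ∈ Ioo 0 S, WeakLim (fun n => u n s) (U s) := by
  have h1 : ∀ s, ∃ y, s ∈ Ioo 0 S → WeakLim (fun n => u n s) y := fun s => by
    by_cases hs : s ∈ Ioo 0 S
    · obtain ⟨C, hC⟩ := hu 0
      obtain ⟨y, hy⟩ := exists_weakLim (fun n => hC n s hs)
      exact ⟨y, fun _ => hy⟩
    · exact ⟨0, fun h => absurd h hs⟩
  choose U hU using h1
  exact ⟨U, hU⟩

theorem UFlat.of_weakLim {S : ℝ} {k : ℕ} {u : ℕ → ℝ → H} (hu : ∀ k, UFlat S k u) {U : ℝ → H}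
    (hU : ∀ s ∈ Ioo 0 S, WeakLim (fun n => u n s) (U s)) : UFlat S k (fun _ : Unit => U) := by
  have h0 : ∀ (u : ℕ → ℝ → H) (U : ℝ → H), FlatBound S u →
      (∀ s ∈ Ioo 0 S, WeakLim (fun n => u n s) (U s)) → FlatBound S (fun _ : Unit => U) := by
    intro u U hu hU N
    obtain ⟨C, hC⟩ := hu N
    exact ⟨C, fun _ s hs => (hU s hs).norm_le fun n => hC n s hs⟩
  induction k generalizing u U with
  | zero => exact h0 u U (hu 0) hU
  | succ k ih =>
    obtain ⟨V, hV⟩ := exists_weakLim_curve (hu 1).2.2.flatBound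
    exact UFlat.succ_of_hasDerivAt (u' := fun _ => V) (h0 u U (hu 0) hU)
      (fun _ s hs => hasDerivAt_of_weakLim (hu 2) hU hV hs) (ih (fun k => (hu (k + 1)).2.2) hV)

theorem weakLim_deriv {S : ℝ} {u : ℕ → ℝ → H} (hu : UFlat S 2 u) {U : ℝ → H}
    (hU : ∀ s ∈ Ioo 0 S, WeakLim (fun n => u n s) (U s)) :
    ∀ s ∈ Ioo 0 S, WeakLim (fun n => deriv (u n) s) (deriv U s) := by
  obtain ⟨V, hV⟩ := exists_weakLim_curve hu.2.2.flatBound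
  intro s hs
  rw [(hasDerivAt_of_weakLim hu hU hV hs).deriv]
  exact hV s hs

end Weak
/-! ### The abstract wave equation -/

section Wave

variable {H : Type*} [NormedAddCommGroup H] [InnerProductSpace ℂ H]

theorem eq_of_solves {S S₀ : ℝ} (hS : S < S₀) {κ : ℝ → ℝ} {b q : ℝ → ℂ}
    {Q K : H →L[ℂ] H} {u g u' g' f : ℝ → H}
    (hsymm : ∀ x y, inner ℂ (K x) y = inner ℂ x (K y)) (hpos : ∀ x, 0 ≤ (inner ℂ (K x) x).re)
    (hκ : ContDiffOn ℝ ∞ κ (Iio S₀)) (hκ0 : ∀ s < S₀, 0 < κ s) (hb : ContDiffOn ℝ ∞ b (Iio S₀))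
    (hq : ContDiffOn ℝ ∞ q (Iio S₀)) (hu : ∀ k, UFlat S k (fun _ : Unit => u))
    (hg : ∀ k, UFlat S k (fun _ : Unit => g)) (hu' : ∀ k, UFlat S k (fun _ : Unit => u'))
    (hg' : ∀ k, UFlat S k (fun _ : Unit => g'))
    (h : Solves S (fun s => s * κ s) b q Q K u g f)
    (h' : Solves S (fun s => s * κ s) b q Q K u' g' f) :
    EqOn u u' (Ioo 0 S) ∧ EqOn g g' (Ioo 0 S) := by
  have hu0 : EqOn u u' (Ioo 0 S) := by
    intro s hs
    have hS0 : 0 < S := hs.1.trans hs.2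
    obtain ⟨κ₀, hκ₀, hκb⟩ : ∃ κ₀ : ℝ, 0 < κ₀ ∧ ∀ s ∈ Icc 0 S, κ₀ ≤ κ s := by
      obtain ⟨x, hx, hmin⟩ := isCompact_Icc.exists_isMinOn ⟨0, le_rfl, hS0.le⟩
        (hκ.continuousOn.mono (fun s (hs : s ∈ Icc 0 S) => hs.2.trans_lt hS))
      exact ⟨κ x, hκ0 x (hx.2.trans_lt hS), fun s hs => hmin hs⟩
    -- all multiples of the difference are solutions with source `0`, hence uniformly bounded
    have hfam : UFlat S 0 (fun (n : ℕ) s => (n : ℂ) • (u s - u' s)) := by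
      refine uflat_of_solves (P := fun _ => K) (g := fun (n : ℕ) s => (n : ℂ) • (g s - g' s))
        (f := fun (n : ℕ) s => (n : ℂ) • (0 : H)) (a := fun s => s * κ s) (Q := Q)
        hS hκ₀ (fun _ => hsymm) (fun _ => hpos) (contDiffOn_id.mul hκ) hb hq
        (fun s hs => ?_) (fun n s hs => ?_)
        (fun n k => ((hu k).sub (hu' k)).const_smul _)
        (fun n k => ((hg k).sub (hg' k)).const_smul _)
        (fun N => ⟨0, by simp⟩)
      · rw [mul_comm]
        have := hs.1
        exact mul_le_mul_of_nonneg_left (hκb s ⟨hs.1.le, hs.2.le⟩) hs.1.le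
      · have h1 : ∀ s ∈ Ioo 0 S, deriv (fun s => (n : ℂ) • (u s - u' s)) s
            = (n : ℂ) • (deriv u s - deriv u' s) := fun s hs =>
          ((((hu 1).2.1 () s hs).hasDerivAt.fun_sub ((hu' 1).2.1 () s hs).hasDerivAt).const_smul
            (n : ℂ)).deriv
        have h2 : deriv (deriv (fun s => (n : ℂ) • (u s - u' s))) s
            = (n : ℂ) • (deriv (deriv u) s - deriv (deriv u') s) := by
          rw [deriv_eqOn_Ioo (show EqOn _ _ (Ioo 0 S) from h1) hs]
          exact ((((hu 2).2.2.2.1 () s hs).hasDerivAt.fun_sub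
            ((hu' 2).2.2.2.1 () s hs).hasDerivAt).const_smul (n : ℂ)).deriv
        obtain ⟨e1, e2⟩ := h s hs
        obtain ⟨e1', e2'⟩ := h' s hs
        refine ⟨by simp [e1, e1'], ?_⟩
        rw [h1 s hs, h2, map_smul, map_sub, ← sub_self (f s)]
        nth_rw 1 [← e2]
        rw [← e2']
        simp only [smul_sub, smul_add, smul_smul, mul_comm]
        abel
    obtain ⟨C, hC⟩ := hfam 0
    by_contra hne
    have hpos' : 0 < ‖u s - u' s‖ := norm_pos_iff.2 (sub_ne_zero.2 hne)
    obtain ⟨n, hn⟩ := exists_nat_gt (C / ‖u s - u' s‖)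
    have := hC n s hs
    rw [norm_smul, pow_zero, mul_one, Complex.norm_natCast] at this
    rw [div_lt_iff₀ hpos'] at hn
    linarith
  refine ⟨hu0, fun s hs => ?_⟩
  obtain ⟨-, e2⟩ := h s hs
  obtain ⟨-, e2'⟩ := h' s hs
  rw [deriv_eqOn_Ioo (deriv_eqOn_Ioo hu0) hs, deriv_eqOn_Ioo hu0 hs, hu0 hs, ← e2'] at e2
  exact add_left_cancel e2

/-- Uniqueness for the abstract wave equation. -/
theorem wave_unique {S : ℝ} (hS : 0 < S) {κ : ℝ → ℝ} {b q : ℝ → ℂ}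
    {Q K : H →L[ℂ] H} {u g : ℝ → H}
    (hsymm : ∀ x y, inner ℂ (K x) y = inner ℂ x (K y)) (hpos : ∀ x, 0 ≤ (inner ℂ (K x) x).re)
    (hκ : ContDiffOn ℝ ∞ κ (Iio S)) (hκ0 : ∀ s < S, 0 < κ s) (hb : ContDiffOn ℝ ∞ b (Iio S))
    (hq : ContDiffOn ℝ ∞ q (Iio S)) (hu : IsFlatCurve S u) (hg : IsFlatCurve S g)
    (h : ∀ s < S, u s = K (g s) ∧
      ((s * κ s : ℝ) : ℂ) • deriv (deriv u) s + b s • deriv u s + q s • u s + Q (u s) + g s = 0) :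
    ∀ s < S, u s = 0 := by
  intro s hs
  rcases le_or_gt s 0 with h0 | h0
  · exact hu.2 s h0
  · have hm : s < (s + S) / 2 ∧ (s + S) / 2 < S := ⟨by linarith, by linarith⟩
    have hzero : ∀ k, UFlat ((s + S) / 2) k (fun _ : Unit => (fun _ => 0 : ℝ → H)) := fun k =>
      IsFlatCurve.uflat hm.2 hS ⟨contDiffOn_const, fun _ _ => rfl⟩ k
    exact (eq_of_solves (Q := Q) (K := K) (f := fun _ => 0) hm.2 hsymm hpos hκ hκ0 hb hq
      (fun k => hu.uflat hm.2 hS k) (fun k => hg.uflat hm.2 hS k) hzero hzero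
      (fun t ht => h t (ht.2.trans hm.2)) (fun t _ => by simp)).1 ⟨h0, hm.1⟩

variable [CompleteSpace H]

theorem exists_inverse_of_nonneg {K : H →L[ℂ] H} (hsymm : ∀ x y, inner ℂ (K x) y = inner ℂ x (K y))
    (hpos : ∀ x, 0 ≤ (inner ℂ (K x) x).re) {ε : ℝ} (hε : 0 < ε) :
    ∃ L : H →L[ℂ] H, ∀ x, K (L x) + (ε : ℂ) • L x = x := by
  have hK : 0 ≤ K := by
    rw [ContinuousLinearMap.nonneg_iff_isPositive]
    exact ⟨hsymm, hpos⟩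
  have h1 : (-(ε : ℂ)) ∉ spectrum ℂ K := fun h => by
    have := spectrum_nonneg_of_nonneg hK h
    rw [Complex.le_def] at this
    simp at this
    linarith
  rw [spectrum.notMem_iff] at h1
  obtain ⟨L, hL⟩ := h1.exists_right_inv
  refine ⟨-L, fun x => ?_⟩
  have h2 := congrArg (fun T : H →L[ℂ] H => T x) hL
  simp [Algebra.algebraMap_eq_smul_one] at h2
  refine Eq.trans ?_ h2
  simp
  abel

/-- Existence on a bounded interval, as the limit of the solutions for `K + ε`, `ε → 0`. -/
theorem exists_solves {S S₀ : ℝ} (hS0 : 0 < S) (hS : S < S₀) {κ : ℝ → ℝ} {b q : ℝ → ℂ}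
    {Q K : H →L[ℂ] H} {f : ℝ → H}
    (hsymm : ∀ x y, inner ℂ (K x) y = inner ℂ x (K y)) (hpos : ∀ x, 0 ≤ (inner ℂ (K x) x).re)
    (hκ : ContDiffOn ℝ ∞ κ (Iio S₀)) (hκ0 : ∀ s < S₀, 0 < κ s) (hb : ContDiffOn ℝ ∞ b (Iio S₀))
    (hq : ContDiffOn ℝ ∞ q (Iio S₀)) (hf : IsFlatCurve S₀ f) :
    ∃ u g : ℝ → H, (∀ k, UFlat S k (fun _ : Unit => u)) ∧ (∀ k, UFlat S k (fun _ : Unit => g)) ∧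
      Solves S (fun s => s * κ s) b q Q K u g f := by
  have hε : ∀ n : ℕ, (0 : ℝ) < 1 / ((n : ℝ) + 1) := fun n => Nat.one_div_pos_of_nat
  choose L hL using fun n : ℕ => exists_inverse_of_nonneg hsymm hpos (hε n)
  set P : ℕ → H →L[ℂ] H := fun n => K + ((1 / ((n : ℝ) + 1) : ℝ) : ℂ) • ContinuousLinearMap.id ℂ H
    with hP
  have hPsymm : ∀ n x y, inner ℂ (P n x) y = inner ℂ x (P n y) := fun n x y => by
    simp only [hP, FunLike.coe_add, FunLike.coe_smul, Pi.add_apply, Pi.smul_apply,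
      ContinuousLinearMap.coe_id', id, inner_add_left, inner_add_right, inner_smul_left,
      inner_smul_right, hsymm, Complex.conj_ofReal]
  have hPpos : ∀ n x, 0 ≤ (inner ℂ (P n x) x).re := fun n x => by
    simp only [hP, FunLike.coe_add, FunLike.coe_smul, Pi.add_apply, Pi.smul_apply,
      ContinuousLinearMap.coe_id', id, inner_add_left, inner_smul_left, Complex.conj_ofReal,
      Complex.add_re, Complex.re_ofReal_mul]
    have h1 : 0 ≤ (inner ℂ x x).re := inner_self_nonneg (𝕜 := ℂ)
    exact add_nonneg (hpos x) (mul_nonneg (hε n).le h1)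
  have hPL : ∀ n x, P n (L n x) = x := fun n x => by simpa [hP] using hL n x
  choose u huf hu using fun n => exists_solves_of_inverse (Q := Q) hS0 hS (hPL n) (hPsymm n)
    (hPpos n) hκ hκ0 hb hq hf
  set g : ℕ → ℝ → H := fun n s => L n (u n s) with hg
  have ha : ContDiffOn ℝ ∞ (fun s => s * κ s) (Iio S₀) := contDiffOn_id.mul hκ
  obtain ⟨κ₀, hκ₀, hκb⟩ : ∃ κ₀ : ℝ, 0 < κ₀ ∧ ∀ s ∈ Icc 0 S, κ₀ ≤ κ s := by
    obtain ⟨x, hx, hmin⟩ := isCompact_Icc.exists_isMinOn ⟨0, le_rfl, hS0.le⟩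
      (hκ.continuousOn.mono (fun s (hs : s ∈ Icc 0 S) => hs.2.trans_lt hS))
    exact ⟨κ x, hκ0 x (hx.2.trans_lt hS), fun s hs => hmin hs⟩
  have huU : ∀ k, UFlat S k u := fun k => by
    refine uflat_of_solves (P := P) (g := g) (f := fun _ => f) hS hκ₀ hPsymm hPpos ha hb hq
      (fun s hs => ?_) hu huf (fun n k => (huf n k).clm (L n))
      ((hf.uflat hS (hS0.trans hS) k).reindex fun _ => ())
    rw [mul_comm]
    exact mul_le_mul_of_nonneg_left (hκb s ⟨hs.1.le, hs.2.le⟩) hs.1.le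
  -- the equation bounds `g = L u` although the norm of `L` grows with `n`
  have hgU : ∀ k, UFlat S k g := fun k => by
    have h1 := (((((hf.uflat hS (hS0.trans hS) k).reindex fun _ : ℕ => ()).sub
      ((huU (k + 2)).2.2.2.2.smul hS (contDiffOn_ofReal ha))).sub
      ((huU (k + 1)).2.2.smul hS hb)).sub ((huU k).smul hS hq)).sub ((huU k).clm Q)
    refine h1.congr fun n s hs => ?_
    have := (hu n s hs).2
    simp only [hg]
    rw [← this]
    abel
  obtain ⟨U, hU⟩ := exists_weakLim_curve (huU 0)
  obtain ⟨G, hG⟩ := exists_weakLim_curve (hgU 0)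
  have hU1 := weakLim_deriv (huU 2) hU
  have hU2 := weakLim_deriv (huU 3).2.2 hU1
  refine ⟨U, G, fun k => UFlat.of_weakLim huU hU, fun k => UFlat.of_weakLim hgU hG,
    fun s hs => ⟨?_, ?_⟩⟩
  · have h1 : WeakLim (fun n => u n s) (K (G s) + 0) := by
      have h2 : WeakLim (fun n => K (g n s) + ((1 / ((n : ℝ) + 1) : ℝ) : ℂ) • g n s)
          (K (G s) + 0) := by
        refine ((hG s hs).clm K).add (weakLim_of_tendsto ?_)
        obtain ⟨C, hC⟩ := (hgU 0) 0
        have h3 : Tendsto (fun n : ℕ => 1 / ((n : ℝ) + 1) * C) atTop (𝓝 0) := by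
          simpa using (tendsto_one_div_add_atTop_nhds_zero_nat (𝕜 := ℝ)).mul_const C
        refine (squeeze_zero_norm (fun n => ?_) h3).mono_left Nat.hyperfilter_le_atTop
        rw [norm_smul, Complex.norm_real, Real.norm_eq_abs, abs_of_pos (hε n)]
        have h4 := hC n s hs
        rw [pow_zero, mul_one] at h4
        exact mul_le_mul_of_nonneg_left h4 (hε n).le
      have h5 : (fun n => u n s) = fun n => K (g n s) + ((1 / ((n : ℝ) + 1) : ℝ) : ℂ) • g n s :=
        funext fun n => (hu n s hs).1
      rw [h5]
      exact h2
    rw [add_zero] at h1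
    exact (hU s hs).unique h1
  · have h1 := (((((hU2 s hs).smul ((s * κ s : ℝ) : ℂ)).add ((hU1 s hs).smul (b s))).add
      ((hU s hs).smul (q s))).add ((hU s hs).clm Q)).add (hG s hs)
    refine h1.unique ?_
    have h2 : ∀ n, ((s * κ s : ℝ) : ℂ) • deriv (deriv (u n)) s + b s • deriv (u n) s + q s • u n s
      + Q (u n s) + g n s = f s := fun n => (hu n s hs).2
    simp only [h2]
    exact weakLim_of_tendsto tendsto_const_nhds

/-- Existence for the abstract wave equation `s κ u'' + b u' + q u + Q u + g = f`, `u = K g`, with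
a nonnegative symmetric bounded operator `K` and a source that is flat at `s = 0`. -/
theorem exists_wave_solution {S : ℝ} (hS : 0 < S) {κ : ℝ → ℝ} {b q : ℝ → ℂ}
    {Q K : H →L[ℂ] H} {f : ℝ → H}
    (hsymm : ∀ x y, inner ℂ (K x) y = inner ℂ x (K y)) (hpos : ∀ x, 0 ≤ (inner ℂ (K x) x).re)
    (hκ : ContDiffOn ℝ ∞ κ (Iio S)) (hκ0 : ∀ s < S, 0 < κ s) (hb : ContDiffOn ℝ ∞ b (Iio S))
    (hq : ContDiffOn ℝ ∞ q (Iio S)) (hf : IsFlatCurve S f) :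
    ∃ u g : ℝ → H, IsFlatCurve S u ∧ IsFlatCurve S g ∧ ∀ s < S, u s = K (g s) ∧
      ((s * κ s : ℝ) : ℂ) • deriv (deriv u) s + b s • deriv u s + q s • u s + Q (u s) + g s
        = f s := by
  have hmid : ∀ s ∈ Ioo 0 S, s < (s + S) / 2 ∧ (s + S) / 2 < S := fun s hs =>
    ⟨by linarith [hs.2], by linarith [hs.2]⟩
  have hex : ∀ T : ℝ, ∃ u g : ℝ → H, T ∈ Ioo 0 S → (∀ k, UFlat T k (fun _ : Unit => u)) ∧
      (∀ k, UFlat T k (fun _ : Unit => g)) ∧ Solves T (fun s => s * κ s) b q Q K u g f := by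
    intro T
    by_cases hT : T ∈ Ioo 0 S
    · obtain ⟨u, g, h⟩ := exists_solves (Q := Q) hT.1 hT.2 hsymm hpos hκ hκ0 hb hq hf
      exact ⟨u, g, fun _ => h⟩
    · exact ⟨0, 0, fun h => absurd h hT⟩
  choose u g h using hex
  -- solutions on different intervals agree on the smaller one
  have hcomp : ∀ T T', T ∈ Ioo 0 S → T' ∈ Ioo 0 S → T ≤ T' →
      EqOn (u T) (u T') (Ioo 0 T) ∧ EqOn (g T) (g T') (Ioo 0 T) := by
    intro T T' hT hT' hle
    obtain ⟨h1, h2, h3⟩ := h T hT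
    obtain ⟨h1', h2', h3'⟩ := h T' hT'
    exact eq_of_solves hT.2 hsymm hpos hκ hκ0 hb hq h1 h2 (fun k => (h1' k).mono hle)
      (fun k => (h2' k).mono hle) h3 fun s hs => h3' s ⟨hs.1, hs.2.trans_le hle⟩
  set U : ℝ → H := fun s => u ((s + S) / 2) s with hU
  set G : ℝ → H := fun s => g ((s + S) / 2) s with hG
  have hUT : ∀ T ∈ Ioo 0 S, EqOn (u T) U (Ioo 0 T) ∧ EqOn (g T) G (Ioo 0 T) := by
    intro T hT
    have key : ∀ s ∈ Ioo 0 T, u T s = U s ∧ g T s = G s := by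
      intro s hs
      have hsS : s ∈ Ioo 0 S := ⟨hs.1, hs.2.trans hT.2⟩
      have hm := hmid s hsS
      have hmS : (s + S) / 2 ∈ Ioo 0 S := ⟨hs.1.trans hm.1, hm.2⟩
      rcases le_total T ((s + S) / 2) with hle | hle
      · exact ⟨(hcomp _ _ hT hmS hle).1 hs, (hcomp _ _ hT hmS hle).2 hs⟩
      · exact ⟨((hcomp _ _ hmS hT hle).1 ⟨hs.1, hm.1⟩).symm,
          ((hcomp _ _ hmS hT hle).2 ⟨hs.1, hm.1⟩).symm⟩
    exact ⟨fun s hs => (key s hs).1, fun s hs => (key s hs).2⟩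
  have hUflat : ∀ T < S, ∀ k, UFlat T k (fun _ : Unit => U) ∧ UFlat T k (fun _ : Unit => G) := by
    intro T hT k
    have hT' : max T (S / 2) ∈ Ioo 0 S := ⟨lt_max_of_lt_right (by linarith), max_lt hT (by linarith)⟩
    obtain ⟨h1, h2, -⟩ := h _ hT'
    exact ⟨((h1 k).congr fun _ => (hUT _ hT').1).mono (le_max_left _ _),
      ((h2 k).congr fun _ => (hUT _ hT').2).mono (le_max_left _ _)⟩
  set U₀ : ℝ → H := fun s => if 0 < s then U s else 0 with hU₀
  set G₀ : ℝ → H := fun s => if 0 < s then G s else 0 with hG₀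
  have hUf : IsFlatCurve S U₀ := isFlatCurve_extend fun T hT k => (hUflat T hT k).1
  have hGf : IsFlatCurve S G₀ := isFlatCurve_extend fun T hT k => (hUflat T hT k).2
  refine ⟨U₀, G₀, hUf, hGf, fun s hs => ?_⟩
  rcases le_or_gt s 0 with h0 | h0
  · rw [hUf.2 s h0, hGf.2 s h0, (hUf.deriv hS).2 s h0, ((hUf.deriv hS).deriv hS).2 s h0, hf.2 s h0]
    simp
  · have hsS : s ∈ Ioo 0 S := ⟨h0, hs⟩
    have hm := hmid s hsS
    have hmS : (s + S) / 2 ∈ Ioo 0 S := ⟨h0.trans hm.1, hm.2⟩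
    have hsI : s ∈ Ioo 0 ((s + S) / 2) := ⟨h0, hm.1⟩
    have e1 : EqOn U₀ (u ((s + S) / 2)) (Ioo 0 ((s + S) / 2)) := fun t ht =>
      (if_pos ht.1).trans ((hUT _ hmS).1 ht).symm
    have e2 : G₀ s = g ((s + S) / 2) s := (if_pos h0).trans ((hUT _ hmS).2 hsI).symm
    rw [deriv_eqOn_Ioo (deriv_eqOn_Ioo e1) hsI, deriv_eqOn_Ioo e1 hsI, e2, e1 hsI]
    exact (h _ hmS).2.2 s hsI

end Wave

/-! ### Continuous functions on `[-1, 1]` and a Hardy operator -/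

section Hardy

/-- The interval `[-1, 1]`, the range of `cos θ`. -/
abbrev J : Set ℝ := Icc (-1) 1

theorem neg_one_le_one' : (-1 : ℝ) ≤ 1 := by norm_num

theorem zero_mem_J : (0 : ℝ) ∈ J := ⟨by norm_num, by norm_num⟩

/-- The extension of a continuous function on `[-1, 1]` to `ℝ`, constant on both sides. -/
def ex (g : C(J, ℂ)) : ℝ → ℂ := IccExtend neg_one_le_one' g

theorem continuous_ex (g : C(J, ℂ)) : Continuous (ex g) := g.continuous.Icc_extend'

theorem ex_of_mem (g : C(J, ℂ)) {z : ℝ} (hz : z ∈ J) : ex g z = g ⟨z, hz⟩ :=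
  IccExtend_of_mem _ _ hz

@[simp] theorem ex_coe (g : C(J, ℂ)) (z : J) : ex g z = g z := IccExtend_val _ _ z

theorem ex_add (g h : C(J, ℂ)) (z : ℝ) : ex (g + h) z = ex g z + ex h z := rfl

theorem ex_sub (g h : C(J, ℂ)) (z : ℝ) : ex (g - h) z = ex g z - ex h z := rfl

theorem ex_mul (g h : C(J, ℂ)) (z : ℝ) : ex (g * h) z = ex g z * ex h z := rfl

theorem ex_smul (c : ℂ) (g : C(J, ℂ)) (z : ℝ) : ex (c • g) z = c * ex g z := rfl

theorem norm_ex_le (g : C(J, ℂ)) (z : ℝ) : ‖ex g z‖ ≤ ‖g‖ := g.norm_coe_le_norm _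

theorem ext_ex {g h : C(J, ℂ)} (H : ∀ z ∈ J, ex g z = ex h z) : g = h :=
  ContinuousMap.ext fun z => by simpa using H z z.2

theorem ext_ex_Ioo {g h : C(J, ℂ)} (H : ∀ z ∈ Ioo (-1 : ℝ) 1, ex g z = ex h z) : g = h := by
  refine ext_ex fun z hz => ?_
  have h1 : EqOn (ex g) (ex h) (closure (Ioo (-1 : ℝ) 1)) :=
    EqOn.closure H (continuous_ex g) (continuous_ex h)
  rw [closure_Ioo (by norm_num)] at h1
  exact h1 hz

/-- The restriction to `[-1, 1]` of a function that is continuous there. -/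
def mkC (f : ℝ → ℂ) (hf : ContinuousOn f J) : C(J, ℂ) := ⟨J.domRestrict f, hf.domRestrict⟩

theorem ex_mkC {f : ℝ → ℂ} (hf : ContinuousOn f J) {z : ℝ} (hz : z ∈ J) : ex (mkC f hf) z = f z :=
  ex_of_mem _ hz

/-- Constant functions. -/
def constC : ℂ →L[ℂ] C(J, ℂ) := ContinuousLinearMap.toSpanSingleton ℂ (1 : C(J, ℂ))

theorem ex_constC (c : ℂ) (z : ℝ) : ex (constC c) z = c := by
  simp [constC, ex, IccExtend]

/-- The primitive `z ↦ ∫₀ᶻ g`. -/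
def primC : C(J, ℂ) →L[ℂ] C(J, ℂ) :=
  LinearMap.mkContinuous
    { toFun := fun g => mkC (fun z => ∫ y in (0 : ℝ)..z, ex g y)
        (intervalIntegral.continuous_primitive
          (fun _ _ => (continuous_ex g).intervalIntegrable _ _) 0).continuousOn
      map_add' := fun g h => ContinuousMap.ext fun z =>
        intervalIntegral.integral_add ((continuous_ex g).intervalIntegrable _ _)
          ((continuous_ex h).intervalIntegrable _ _)
      map_smul' := fun c g => ContinuousMap.ext fun z =>
        intervalIntegral.integral_const_mul c _ } 1 (fun g => by
      rw [one_mul, ContinuousMap.norm_le _ (norm_nonneg _)]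
      intro z
      refine (intervalIntegral.norm_integral_le_of_norm_le_const
        fun y _ => norm_ex_le g y).trans ?_
      have : |(z : ℝ) - 0| ≤ 1 := by rw [sub_zero]; exact abs_le.2 z.2
      exact mul_le_of_le_one_right (norm_nonneg _) this)

theorem ex_primC (g : C(J, ℂ)) {z : ℝ} (hz : z ∈ J) : ex (primC g) z = ∫ y in (0 : ℝ)..z, ex g y :=
  ex_of_mem _ hz

theorem hasDerivAt_primC (g : C(J, ℂ)) {z : ℝ} (hz : z ∈ Ioo (-1 : ℝ) 1) :
    HasDerivAt (ex (primC g)) (ex g z) z := by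
  have h1 : HasDerivAt (fun z => ∫ y in (0 : ℝ)..z, ex g y) (ex g z) z :=
    intervalIntegral.integral_hasDerivAt_right ((continuous_ex g).intervalIntegrable _ _)
      ((continuous_ex g).stronglyMeasurableAtFilter _ _) (continuous_ex g).continuousAt
  refine h1.congr_of_eventuallyEq ?_
  filter_upwards [Ioo_mem_nhds hz.1 hz.2] with y hy
  exact ex_primC g ⟨hy.1.le, hy.2.le⟩

/-- A continuous function on `[-1, 1]` that is differentiable inside is the primitive of its
derivative. -/
theorem eq_const_add_primC {v y : C(J, ℂ)}
    (h : ∀ z ∈ Ioo (-1 : ℝ) 1, HasDerivAt (ex v) (ex y z) z) :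
    v = constC (ex v 0) + primC y := by
  refine ext_ex_Ioo fun z hz => ?_
  have hsub : uIcc 0 z ⊆ Ioo (-1 : ℝ) 1 := by
    refine ordConnected_Ioo.uIcc_subset ⟨by norm_num, by norm_num⟩ hz
  rw [ex_add, ex_constC, ex_primC _ ⟨hz.1.le, hz.2.le⟩,
    intervalIntegral.integral_eq_sub_of_hasDerivAt (fun x hx => h x (hsub hx))
      ((continuous_ex y).intervalIntegrable _ _)]
  ring

variable (a : ℝ)

/-- The weights `(1 - z²) ^ k (1 - a² z²) ^ j`. -/
def wt (k j : ℕ) (z : ℝ) : ℝ := (1 - z ^ 2) ^ k * (1 - a ^ 2 * z ^ 2) ^ j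

/-- The logarithmic derivative factor: `wt (k + 1) (j + 1)` has derivative `wtc k j * wt k j`. -/
def wtc (k j : ℕ) (z : ℝ) : ℝ :=
  -2 * z * ((k + 1) * (1 - a ^ 2 * z ^ 2) + (j + 1) * a ^ 2 * (1 - z ^ 2))

theorem continuous_wt (k j : ℕ) : Continuous (wt a k j) := by unfold wt; fun_prop

theorem continuous_wtc (k j : ℕ) : Continuous (wtc a k j) := by unfold wtc; fun_prop

theorem hasDerivAt_wt (k j : ℕ) (z : ℝ) :
    HasDerivAt (wt a (k + 1) (j + 1)) (wtc a k j z * wt a k j z) z := by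
  have h1 : HasDerivAt (fun z : ℝ => 1 - z ^ 2) (-(2 * z)) z := by
    simpa using (hasDerivAt_pow 2 z).const_sub 1
  have h2 : HasDerivAt (fun z : ℝ => 1 - a ^ 2 * z ^ 2) (-(a ^ 2 * (2 * z))) z := by
    simpa using ((hasDerivAt_pow 2 z).const_mul (a ^ 2)).const_sub 1
  refine ((h1.pow (k + 1)).mul (h2.pow (j + 1))).congr_deriv ?_
  simp only [wtc, wt, Pi.pow_apply, Nat.add_sub_cancel]
  push_cast
  ring

theorem wt_neg (k j : ℕ) (z : ℝ) : wt a k j (-z) = wt a k j z := by simp [wt]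

variable {a}

theorem one_sub_sq_pos {z : ℝ} (hz : z ∈ Ioo (-1 : ℝ) 1) : 0 < 1 - z ^ 2 := by
  nlinarith [hz.1, hz.2]

theorem one_sub_sq_nonneg {z : ℝ} (hz : z ∈ J) : 0 ≤ 1 - z ^ 2 := by
  nlinarith [hz.1, hz.2]

theorem sq_lt_one_of_abs (ha : |a| < 1) : a ^ 2 < 1 := (sq_lt_one_iff_abs_lt_one a).2 ha

theorem hfac_ge (z : ℝ) (hz : z ∈ J) : 1 - a ^ 2 ≤ 1 - a ^ 2 * z ^ 2 := by
  nlinarith [one_sub_sq_nonneg hz, sq_nonneg a]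

theorem hfac_pos (ha : |a| < 1) {z : ℝ} (hz : z ∈ J) : 0 < 1 - a ^ 2 * z ^ 2 :=
  lt_of_lt_of_le (by linarith [sq_lt_one_of_abs ha]) (hfac_ge z hz)

theorem wt_pos (ha : |a| < 1) (k j : ℕ) {z : ℝ} (hz : z ∈ Ioo (-1 : ℝ) 1) : 0 < wt a k j z :=
  mul_pos (pow_pos (one_sub_sq_pos hz) k) (pow_pos (hfac_pos ha ⟨hz.1.le, hz.2.le⟩) j)

theorem wt_nonneg (ha : |a| < 1) (k j : ℕ) {z : ℝ} (hz : z ∈ J) : 0 ≤ wt a k j z :=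
  mul_nonneg (pow_nonneg (one_sub_sq_nonneg hz) k) (pow_nonneg (hfac_pos ha hz).le j)

theorem wt_neg_one (k j : ℕ) : wt a (k + 1) j (-1) = 0 := by simp [wt]

theorem wt_one (k j : ℕ) : wt a (k + 1) j 1 = 0 := by simp [wt]

/-- The weights grow on the left half of the interval, so a weight has a small integral near the
end point. -/
theorem integral_wt_le (ha : |a| < 1) (k j : ℕ) {z : ℝ} (h1 : -1 ≤ z) (h0 : z ≤ 0) :
    ∫ y in (-1 : ℝ)..z, wt a k j y ≤ ((1 - a ^ 2) ^ (j + 1))⁻¹ * wt a (k + 1) (j + 1) z := by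
  have ha2 := sq_lt_one_of_abs ha
  have ha3 : 0 < 1 - a ^ 2 := by linarith
  have hzJ : z ∈ J := ⟨h1, by linarith⟩
  have hle : ∀ y ∈ Icc (-1) z, wt a k j y ≤ (1 - z ^ 2) ^ k := fun y hy => by
    have hyJ : y ∈ J := ⟨hy.1, hy.2.trans hzJ.2⟩
    calc wt a k j y ≤ (1 - y ^ 2) ^ k * 1 := by
          refine mul_le_mul_of_nonneg_left ?_ (pow_nonneg (one_sub_sq_nonneg hyJ) k)
          refine pow_le_one₀ (hfac_pos ha hyJ).le ?_
          nlinarith [mul_nonneg (sq_nonneg a) (sq_nonneg y)]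
      _ ≤ (1 - z ^ 2) ^ k := by
          rw [mul_one]
          refine pow_le_pow_left₀ (one_sub_sq_nonneg hyJ) ?_ k
          nlinarith [hy.1, hy.2]
  calc ∫ y in (-1 : ℝ)..z, wt a k j y ≤ ∫ y in (-1 : ℝ)..z, (1 - z ^ 2) ^ k :=
        intervalIntegral.integral_mono_on h1 ((continuous_wt a k j).intervalIntegrable _ _)
          (continuous_const.intervalIntegrable _ _) hle
    _ = (1 + z) * (1 - z ^ 2) ^ k := by
        rw [intervalIntegral.integral_const, smul_eq_mul]; ring
    _ ≤ (1 - z ^ 2) * (1 - z ^ 2) ^ k := by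
        refine mul_le_mul_of_nonneg_right ?_ (pow_nonneg (one_sub_sq_nonneg hzJ) k)
        nlinarith
    _ = ((1 - a ^ 2) ^ (j + 1))⁻¹ * ((1 - z ^ 2) ^ (k + 1) * (1 - a ^ 2) ^ (j + 1)) := by
        field_simp
        ring
    _ ≤ _ := by
        unfold wt
        refine mul_le_mul_of_nonneg_left ?_ (by positivity)
        exact mul_le_mul_of_nonneg_left (pow_le_pow_left₀ ha3.le (hfac_ge z hzJ) _)
          (pow_nonneg (one_sub_sq_nonneg hzJ) _)

theorem integral_wt_eq (k j : ℕ) (z : ℝ) :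
    ∫ y in (-1 : ℝ)..z, wtc a k j y * wt a k j y = wt a (k + 1) (j + 1) z := by
  rw [intervalIntegral.integral_eq_sub_of_hasDerivAt (fun y _ => hasDerivAt_wt a k j y)
    (((continuous_wtc a k j).mul (continuous_wt a k j)).intervalIntegrable _ _), wt_neg_one,
    sub_zero]

theorem norm_integral_wt_le (ha : |a| < 1) (k j : ℕ) {z : ℝ} (h1 : -1 ≤ z) (h0 : z ≤ 0)
    {φ : ℝ → ℂ} {B : ℝ} (hB : 0 ≤ B) (hφ : ∀ y ∈ Icc (-1) z, ‖φ y‖ ≤ B) :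
    ‖∫ y in (-1 : ℝ)..z, (wt a k j y : ℂ) * φ y‖
      ≤ B * ((1 - a ^ 2) ^ (j + 1))⁻¹ * wt a (k + 1) (j + 1) z := by
  rw [mul_assoc]
  refine le_trans ?_ (mul_le_mul_of_nonneg_left (integral_wt_le ha k j h1 h0) hB)
  rw [← intervalIntegral.integral_const_mul]
  refine intervalIntegral.norm_integral_le_of_norm_le h1 (Eventually.of_forall fun y hy => ?_)
    ((continuous_const.mul (continuous_wt a k j)).intervalIntegrable _ _)
  have hyJ : y ∈ J := ⟨hy.1.le, by linarith [hy.2]⟩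
  rw [norm_mul, Complex.norm_real, Real.norm_eq_abs, abs_of_nonneg (wt_nonneg ha k j hyJ), mul_comm]
  exact mul_le_mul_of_nonneg_right (hφ y ⟨hy.1.le, hy.2⟩) (wt_nonneg ha k j hyJ)

theorem wtc_neg_one (k j : ℕ) : wtc a k j (-1) = 2 * (k + 1) * (1 - a ^ 2) := by
  simp [wtc]; ring

/-- The boundary value at `-1` of `(∫_{-1}^z wt k j g) / wt (k + 1) (j + 1)`. -/
theorem tendsto_hardy_left (ha : |a| < 1) (k j : ℕ) {g : ℝ → ℂ} (hg : Continuous g) :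
    Tendsto (fun z => (∫ y in (-1 : ℝ)..z, (wt a k j y : ℂ) * g y) / (wt a (k + 1) (j + 1) z : ℂ))
      (𝓝[>] (-1)) (𝓝 (g (-1) / (wtc a k j (-1) : ℂ))) := by
  have ha2 := sq_lt_one_of_abs ha
  have hc0 : (wtc a k j (-1) : ℂ) ≠ 0 := by
    rw [wtc_neg_one]
    have : 0 < 1 - a ^ 2 := by linarith
    exact_mod_cast (by positivity : 2 * ((k : ℝ) + 1) * (1 - a ^ 2) ≠ 0)
  set l : ℂ := g (-1) / (wtc a k j (-1) : ℂ) with hl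
  set D : ℝ := ((1 - a ^ 2) ^ (j + 1))⁻¹ with hD
  have hDpos : 0 < D := by
    have : 0 < 1 - a ^ 2 := by linarith
    positivity
  rw [Metric.tendsto_nhds]
  intro ε hε
  have hcont : Continuous fun y => g y - l * (wtc a k j y : ℂ) :=
    hg.sub (continuous_const.mul (Complex.continuous_ofReal.comp (continuous_wtc a k j)))
  have hzero : g (-1) - l * (wtc a k j (-1) : ℂ) = 0 := by rw [hl, div_mul_cancel₀ _ hc0, sub_self]
  obtain ⟨δ, hδ, hδ'⟩ := Metric.continuousAt_iff.1 (hcont.continuousAt (x := -1)) (ε / (2 * D))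
    (by positivity)
  rw [hzero] at hδ'
  filter_upwards [Ioo_mem_nhdsGT (show (-1 : ℝ) < min 0 (-1 + δ) from
    lt_min (by norm_num) (by linarith))] with z hz
  have hz0 : z ≤ 0 := (hz.2.trans_le (min_le_left _ _)).le
  have hzδ : z < -1 + δ := hz.2.trans_le (min_le_right _ _)
  have hzI : z ∈ Ioo (-1 : ℝ) 1 := ⟨hz.1, by linarith⟩
  have hW := wt_pos ha (k + 1) (j + 1) hzI
  have hWc : (wt a (k + 1) (j + 1) z : ℂ) ≠ 0 := by exact_mod_cast hW.ne'
  have e1 : (∫ y in (-1 : ℝ)..z, (wt a k j y : ℂ) * g y) - l * (wt a (k + 1) (j + 1) z : ℂ)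
      = ∫ y in (-1 : ℝ)..z, (wt a k j y : ℂ) * (g y - l * (wtc a k j y : ℂ)) := by
    rw [← integral_wt_eq, ← intervalIntegral.integral_ofReal, ← intervalIntegral.integral_const_mul,
      ← intervalIntegral.integral_sub]
    · congr 1; ext y; push_cast; ring
    · exact ((Complex.continuous_ofReal.comp (continuous_wt a k j)).mul hg).intervalIntegrable _ _
    · exact (continuous_const.mul (Complex.continuous_ofReal.comp
        ((continuous_wtc a k j).mul (continuous_wt a k j)))).intervalIntegrable _ _
  have e2 := norm_integral_wt_le (a := a) ha k j hz.1.le hz0 (B := ε / (2 * D)) (by positivity)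
    (φ := fun y => g y - l * (wtc a k j y : ℂ)) (fun y hy => by
      have := hδ' (x := y) (by
        rw [Real.dist_eq, abs_of_nonneg (by linarith [hy.1])]; linarith [hy.2])
      rw [dist_zero_right] at this
      exact this.le)
  rw [dist_eq_norm, div_sub' hWc, mul_comm _ l, e1, norm_div, Complex.norm_real, Real.norm_eq_abs,
    abs_of_pos hW, div_lt_iff₀ hW]
  refine e2.trans_lt ?_
  rw [show ε / (2 * D) * D = ε / 2 by field_simp]
  nlinarith

end Hardy

section HardyOperator

variable {a : ℝ}

theorem continuous_wt_mul (k j : ℕ) {φ : ℝ → ℂ} (hφ : Continuous φ) :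
    Continuous fun y => (wt a k j y : ℂ) * φ y :=
  (Complex.continuous_ofReal.comp (continuous_wt a k j)).mul hφ

/-- The total mass of the weight `wt a k j`. -/
def wmass (a : ℝ) (k j : ℕ) : ℝ := ∫ y in (-1 : ℝ)..1, wt a k j y

theorem wmass_pos (ha : |a| < 1) (k j : ℕ) : 0 < wmass a k j :=
  intervalIntegral.intervalIntegral_pos_of_pos_on ((continuous_wt a k j).intervalIntegrable _ _)
    (fun _ hz => wt_pos ha k j hz) (by norm_num)

/-- The mean value with respect to the weight `wt a k j`. -/
def meanC (ha : |a| < 1) (k j : ℕ) : C(J, ℂ) →L[ℂ] ℂ :=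
  LinearMap.mkContinuous
    { toFun := fun g => (∫ y in (-1 : ℝ)..1, (wt a k j y : ℂ) * ex g y) / (wmass a k j : ℂ)
      map_add' := fun g h => by
        simp only [ex_add, mul_add]
        rw [intervalIntegral.integral_add
          ((continuous_wt_mul k j (continuous_ex g)).intervalIntegrable _ _)
          ((continuous_wt_mul k j (continuous_ex h)).intervalIntegrable _ _), add_div]
      map_smul' := fun c g => by
        simp only [ex_smul, mul_left_comm _ c]
        rw [intervalIntegral.integral_const_mul, mul_div_assoc, RingHom.id_apply, smul_eq_mul] }
    1 (fun g => by
      have hm := wmass_pos ha k j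
      simp only [LinearMap.coe_mk, AddHom.coe_mk]
      rw [norm_div, Complex.norm_real, Real.norm_eq_abs, abs_of_pos hm, div_le_iff₀ hm, one_mul,
        wmass, ← intervalIntegral.integral_const_mul]
      refine intervalIntegral.norm_integral_le_of_norm_le (by norm_num)
        (Eventually.of_forall fun y hy => ?_)
        ((continuous_const.mul (continuous_wt a k j)).intervalIntegrable _ _)
      have := wt_nonneg ha k j (z := y) ⟨hy.1.le, hy.2⟩
      rw [norm_mul, Complex.norm_real, Real.norm_eq_abs, abs_of_nonneg this, mul_comm]
      exact mul_le_mul_of_nonneg_right (norm_ex_le g y) this)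

theorem meanC_apply (ha : |a| < 1) (k j : ℕ) (g : C(J, ℂ)) :
    meanC ha k j g = (∫ y in (-1 : ℝ)..1, (wt a k j y : ℂ) * ex g y) / (wmass a k j : ℂ) := rfl

theorem norm_meanC_le (ha : |a| < 1) (k j : ℕ) (g : C(J, ℂ)) : ‖meanC ha k j g‖ ≤ ‖g‖ := by
  simpa using (meanC ha k j).le_of_opNorm_le (LinearMap.mkContinuous_norm_le _ zero_le_one _) g

/-- `∫_{-1}^z wt k j (g - mean g)`. -/
def flux (ha : |a| < 1) (k j : ℕ) (g : C(J, ℂ)) (z : ℝ) : ℂ :=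
  ∫ y in (-1 : ℝ)..z, (wt a k j y : ℂ) * (ex g y - meanC ha k j g)

theorem continuous_sub_mean (ha : |a| < 1) (k j : ℕ) (g : C(J, ℂ)) :
    Continuous fun y => ex g y - meanC ha k j g := (continuous_ex g).sub continuous_const

theorem flux_one (ha : |a| < 1) (k j : ℕ) (g : C(J, ℂ)) : flux ha k j g 1 = 0 := by
  have hm : (wmass a k j : ℂ) ≠ 0 := by exact_mod_cast (wmass_pos ha k j).ne'
  simp only [flux, mul_sub]
  rw [intervalIntegral.integral_sub
    ((continuous_wt_mul k j (continuous_ex g)).intervalIntegrable _ _)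
    ((continuous_wt_mul k j continuous_const).intervalIntegrable _ _),
    intervalIntegral.integral_mul_const, intervalIntegral.integral_ofReal]
  change _ - (wmass a k j : ℂ) * _ = 0
  rw [meanC_apply, mul_div_cancel₀ _ hm, sub_self]

theorem hasDerivAt_flux (ha : |a| < 1) (k j : ℕ) (g : C(J, ℂ)) (z : ℝ) :
    HasDerivAt (flux ha k j g) ((wt a k j z : ℂ) * (ex g z - meanC ha k j g)) z := by
  have hc := continuous_wt_mul (a := a) k j (continuous_sub_mean ha k j g)
  exact intervalIntegral.integral_hasDerivAt_right (hc.intervalIntegrable _ _)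
    (hc.stronglyMeasurableAtFilter _ _) hc.continuousAt

theorem flux_eq_reflect (ha : |a| < 1) (k j : ℕ) (g : C(J, ℂ)) (z : ℝ) :
    flux ha k j g z
      = -∫ y in (-1 : ℝ)..(-z), (wt a k j y : ℂ) * (ex g (-y) - meanC ha k j g) := by
  have hc := continuous_wt_mul (a := a) k j (continuous_sub_mean ha k j g)
  have e := intervalIntegral.integral_comp_neg (a := -1) (b := -z)
    fun y => (wt a k j y : ℂ) * (ex g y - meanC ha k j g)
  simp only [wt_neg, neg_neg] at e
  rw [e, eq_neg_iff_add_eq_zero, flux,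
    intervalIntegral.integral_add_adjacent_intervals (hc.intervalIntegrable _ _)
      (hc.intervalIntegrable _ _)]
  exact flux_one ha k j g

theorem flux_add (ha : |a| < 1) (k j : ℕ) (g h : C(J, ℂ)) (z : ℝ) :
    flux ha k j (g + h) z = flux ha k j g z + flux ha k j h z := by
  rw [flux, flux, flux, ← intervalIntegral.integral_add
    ((continuous_wt_mul k j (continuous_sub_mean ha k j g)).intervalIntegrable _ _)
    ((continuous_wt_mul k j (continuous_sub_mean ha k j h)).intervalIntegrable _ _)]
  congr 1
  ext y
  rw [ex_add, map_add]; ring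

theorem flux_smul (ha : |a| < 1) (k j : ℕ) (c : ℂ) (g : C(J, ℂ)) (z : ℝ) :
    flux ha k j (c • g) z = c * flux ha k j g z := by
  rw [flux, flux, ← intervalIntegral.integral_const_mul]
  congr 1
  ext y
  rw [ex_smul, map_smul, smul_eq_mul]; ring

/-- The quotient `-(wt (k + 1) (j + 1))⁻¹ ∫_{-1}^z wt k j (g - mean g)` inside the interval. -/
def hardyFun (ha : |a| < 1) (k j : ℕ) (g : C(J, ℂ)) (z : ℝ) : ℂ :=
  -(flux ha k j g z / (wt a (k + 1) (j + 1) z : ℂ))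

theorem wtC_ne_zero (ha : |a| < 1) (k j : ℕ) {z : ℝ} (hz : z ∈ Ioo (-1 : ℝ) 1) :
    (wt a k j z : ℂ) ≠ 0 := by exact_mod_cast (wt_pos ha k j hz).ne'

theorem hasDerivAt_wtC (k j : ℕ) (z : ℝ) :
    HasDerivAt (fun z => (wt a (k + 1) (j + 1) z : ℂ)) ((wtc a k j z * wt a k j z : ℝ) : ℂ) z :=
  (hasDerivAt_wt a k j z).ofReal_comp

theorem continuousOn_hardyFun (ha : |a| < 1) (k j : ℕ) (g : C(J, ℂ)) :
    ContinuousOn (hardyFun ha k j g) (Ioo (-1) 1) := fun z hz =>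
  (((hasDerivAt_flux ha k j g z).div (hasDerivAt_wtC k j z)
    (wtC_ne_zero ha _ _ hz)).neg).continuousAt.continuousWithinAt

theorem continuousOn_extend_hardyFun (ha : |a| < 1) (k j : ℕ) (g : C(J, ℂ)) :
    ContinuousOn (extendFrom (Ioo (-1) 1) (hardyFun ha k j g)) J := by
  have h1 := tendsto_hardy_left ha k j ((continuous_sub_mean ha k j g).comp continuous_neg)
  have h2 : Tendsto (fun z : ℝ => -z) (𝓝[<] 1) (𝓝[>] (-1)) := tendsto_neg_nhdsLT
  have h3 := (h1.comp h2).congr (f₂ := hardyFun ha k j g) fun z => by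
    rw [hardyFun, flux_eq_reflect]
    simp only [Function.comp, wt_neg]
    ring
  exact continuousOn_Icc_extendFrom_Ioo (continuousOn_hardyFun ha k j g)
    (tendsto_hardy_left ha k j (continuous_sub_mean ha k j g)).neg h3

theorem norm_hardyFun_le (ha : |a| < 1) (k j : ℕ) (g : C(J, ℂ)) {z : ℝ} (hz : z ∈ Ioo (-1 : ℝ) 1) :
    ‖hardyFun ha k j g z‖ ≤ 2 * ((1 - a ^ 2) ^ (j + 1))⁻¹ * ‖g‖ := by
  have hW := wt_pos ha (k + 1) (j + 1) hz
  have hB : ∀ y, ‖ex g y - meanC ha k j g‖ ≤ 2 * ‖g‖ := fun y =>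
    (norm_sub_le _ _).trans (by linarith [norm_ex_le g y, norm_meanC_le ha k j g])
  rw [hardyFun, norm_neg, norm_div, Complex.norm_real, Real.norm_eq_abs, abs_of_pos hW,
    div_le_iff₀ hW]
  rcases le_total z 0 with h0 | h0
  · refine (norm_integral_wt_le ha k j hz.1.le h0 (B := 2 * ‖g‖) (by positivity)
      fun y _ => hB y).trans (le_of_eq (by ring))
  · rw [flux_eq_reflect, norm_neg]
    refine (norm_integral_wt_le ha k j (by linarith [hz.2]) (by linarith) (B := 2 * ‖g‖)
      (by positivity) fun y _ => hB (-y)).trans (le_of_eq (by rw [wt_neg]; ring))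

theorem norm_le_of_ex_le {g : C(J, ℂ)} {B : ℝ} (hB : ∀ z ∈ Ioo (-1 : ℝ) 1, ‖ex g z‖ ≤ B) :
    ‖g‖ ≤ B := by
  have hcl : ∀ z ∈ J, ‖ex g z‖ ≤ B := by
    rw [show J = closure (Ioo (-1 : ℝ) 1) from (closure_Ioo (by norm_num)).symm]
    exact fun z hz => closure_minimal hB
      (isClosed_le (continuous_ex g).norm continuous_const) hz
  refine (ContinuousMap.norm_le _ ((norm_nonneg _).trans (hcl 0 zero_mem_J))).2 fun z => ?_
  rw [← ex_coe]
  exact hcl z z.2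

/-- The Hardy type operator `g ↦ -(wt (k + 1) (j + 1))⁻¹ ∫_{-1}^z wt k j (g - mean g)`. -/
def hardyC (ha : |a| < 1) (k j : ℕ) : C(J, ℂ) →L[ℂ] C(J, ℂ) :=
  have hex : ∀ g : C(J, ℂ), ∀ z ∈ Ioo (-1 : ℝ) 1,
      ex (mkC _ (continuousOn_extend_hardyFun ha k j g)) z = hardyFun ha k j g z := fun g z hz => by
    rw [ex_mkC _ ⟨hz.1.le, hz.2.le⟩, extendFrom_extends (continuousOn_hardyFun ha k j g) z hz]
  LinearMap.mkContinuous
    { toFun := fun g => mkC _ (continuousOn_extend_hardyFun ha k j g)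
      map_add' := fun g h => ext_ex_Ioo fun z hz => by
        rw [ex_add, hex _ z hz, hex _ z hz, hex _ z hz, hardyFun, hardyFun, hardyFun, flux_add]
        ring
      map_smul' := fun c g => ext_ex_Ioo fun z hz => by
        rw [RingHom.id_apply, ex_smul, hex _ z hz, hex _ z hz, hardyFun, hardyFun, flux_smul]
        ring } (2 * ((1 - a ^ 2) ^ (j + 1))⁻¹) (fun g => norm_le_of_ex_le fun z hz => by
      rw [LinearMap.coe_mk, AddHom.coe_mk, hex _ z hz]
      exact norm_hardyFun_le ha k j g hz)

theorem ex_hardyC (ha : |a| < 1) (k j : ℕ) (g : C(J, ℂ)) {z : ℝ} (hz : z ∈ Ioo (-1 : ℝ) 1) :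
    ex (hardyC ha k j g) z = hardyFun ha k j g z := by
  rw [← extendFrom_extends (continuousOn_hardyFun ha k j g) z hz]
  exact ex_mkC (continuousOn_extend_hardyFun ha k j g) ⟨hz.1.le, hz.2.le⟩

theorem wt_mul_ex_hardyC (ha : |a| < 1) (k j : ℕ) (g : C(J, ℂ)) {z : ℝ} (hz : z ∈ J) :
    (wt a (k + 1) (j + 1) z : ℂ) * ex (hardyC ha k j g) z = -flux ha k j g z := by
  rcases eq_or_lt_of_le hz.1 with h1 | h1
  · rw [← h1, wt_neg_one, flux]; simp
  rcases eq_or_lt_of_le hz.2 with h2 | h2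
  · rw [h2, wt_one, flux_one]; simp
  rw [ex_hardyC ha k j g ⟨h1, h2⟩, hardyFun, mul_neg, mul_div_cancel₀ _ (wtC_ne_zero ha _ _ ⟨h1, h2⟩)]

theorem hasDerivAt_wt_mul_hardyC (ha : |a| < 1) (k j : ℕ) (g : C(J, ℂ)) {z : ℝ}
    (hz : z ∈ Ioo (-1 : ℝ) 1) :
    HasDerivAt (fun z => (wt a (k + 1) (j + 1) z : ℂ) * ex (hardyC ha k j g) z)
      (-((wt a k j z : ℂ) * (ex g z - meanC ha k j g))) z := by
  refine (hasDerivAt_flux ha k j g z).neg.congr_of_eventuallyEq ?_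
  filter_upwards [Ioo_mem_nhds hz.1 hz.2] with y hy
  exact wt_mul_ex_hardyC ha k j g ⟨hy.1.le, hy.2.le⟩

/-- `hardyC g` is the only continuous function whose product with the weight has derivative
`-wt (g - γ)` for some constant `γ`; and then `γ` is the mean. -/
theorem hardyC_unique (ha : |a| < 1) (k j : ℕ) {g v : C(J, ℂ)} {γ : ℂ}
    (h : ∀ z ∈ Ioo (-1 : ℝ) 1, HasDerivAt (fun z => (wt a (k + 1) (j + 1) z : ℂ) * ex v z)
      (-((wt a k j z : ℂ) * (ex g z - γ))) z) :
    meanC ha k j g = γ ∧ hardyC ha k j g = v := by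
  have hcv : Continuous fun z => (wt a (k + 1) (j + 1) z : ℂ) * ex v z :=
    continuous_wt_mul _ _ (continuous_ex v)
  have hc : Continuous fun z => -((wt a k j z : ℂ) * (ex g z - γ)) :=
    (continuous_wt_mul _ _ ((continuous_ex g).sub continuous_const)).neg
  have hint : ∀ z ∈ J, (wt a (k + 1) (j + 1) z : ℂ) * ex v z
      = ∫ y in (-1 : ℝ)..z, -((wt a k j y : ℂ) * (ex g y - γ)) := fun z hz => by
    rw [intervalIntegral.integral_eq_sub_of_hasDerivAt_of_le hz.1 hcv.continuousOn
      (fun y hy => h y ⟨hy.1, hy.2.trans_le hz.2⟩) (hc.intervalIntegrable _ _), wt_neg_one]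
    simp
  have hm : (wmass a k j : ℂ) ≠ 0 := by exact_mod_cast (wmass_pos ha k j).ne'
  have hγ : meanC ha k j g = γ := by
    have h1 := hint 1 ⟨by norm_num, le_rfl⟩
    rw [wt_one, Complex.ofReal_zero, zero_mul, intervalIntegral.integral_neg] at h1
    simp only [mul_sub] at h1
    rw [intervalIntegral.integral_sub
      ((continuous_wt_mul k j (continuous_ex g)).intervalIntegrable _ _)
      ((continuous_wt_mul k j continuous_const).intervalIntegrable _ _),
      intervalIntegral.integral_mul_const, intervalIntegral.integral_ofReal] at h1
    change _ = -(_ - (wmass a k j : ℂ) * γ) at h1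
    rw [meanC_apply, div_eq_iff hm]
    linear_combination h1
  refine ⟨hγ, ext_ex_Ioo fun z hz => ?_⟩
  have hzJ : z ∈ J := ⟨hz.1.le, hz.2.le⟩
  refine mul_left_cancel₀ (wtC_ne_zero ha (k + 1) (j + 1) hz) ?_
  rw [wt_mul_ex_hardyC ha k j g hzJ, hint z hzJ, intervalIntegral.integral_neg, flux, hγ]

/-- The derivative of `wtc`. -/
def wtcD (a : ℝ) (k j : ℕ) (z : ℝ) : ℝ :=
  -2 * ((k + 1) + (j + 1) * a ^ 2) + 6 * a ^ 2 * (k + j + 2) * z ^ 2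

theorem hasDerivAt_wtc (k j : ℕ) (z : ℝ) : HasDerivAt (wtc a k j) (wtcD a k j z) z := by
  have h : wtc a k j = fun z : ℝ =>
      -2 * ((k + 1) + (j + 1) * a ^ 2) * z + 2 * a ^ 2 * (k + j + 2) * z ^ 3 := by
    funext z; simp only [wtc]; ring
  rw [h]
  refine (((hasDerivAt_id z).const_mul _).add ((hasDerivAt_pow 3 z).const_mul _)).congr_deriv ?_
  simp only [wtcD]; push_cast; ring

theorem contDiff_wtcD (k j : ℕ) : ContDiff ℝ ∞ (wtcD a k j) := by
  unfold wtcD; fun_prop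

/-- A real function on the line, as a continuous complex function on `[-1, 1]`. -/
def mulC (φ : ℝ → ℝ) (hφ : Continuous φ) : C(J, ℂ) :=
  mkC (fun z => (φ z : ℂ)) (Complex.continuous_ofReal.comp hφ).continuousOn

theorem ex_mulC {φ : ℝ → ℝ} (hφ : Continuous φ) {z : ℝ} (hz : z ∈ J) :
    ex (mulC φ hφ) z = (φ z : ℂ) := ex_mkC _ hz

/-- The derivative of `hardyC g` is again given by a Hardy operator, with larger weights.  This is
what makes the operator preserve regularity up to the end points. -/
theorem hardyC_const_add_primC (ha : |a| < 1) (k j : ℕ) (c : ℂ) (g : C(J, ℂ)) :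
    hardyC ha k j (constC c + primC g)
      = constC (ex (hardyC ha k j (constC c + primC g)) 0)
        + primC (hardyC ha (k + 1) (j + 1) (g + mulC (wtcD a k j) (contDiff_wtcD k j).continuous
            * hardyC ha k j (constC c + primC g))) := by
  set G := constC c + primC g with hG
  set v := hardyC ha k j G with hv
  set γ := meanC ha k j G
  set y : C(J, ℂ) := g + mulC (wtcD a k j) (contDiff_wtcD k j).continuous * v
  have hGd : ∀ z ∈ Ioo (-1 : ℝ) 1, HasDerivAt (ex G) (ex g z) z := fun z hz =>
    ((hasDerivAt_primC g hz).const_add c).congr_of_eventuallyEq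
      (Eventually.of_forall fun x => by rw [hG, ex_add, ex_constC])
  -- the derivative of `v` inside the interval
  have hvd : ∀ z ∈ Ioo (-1 : ℝ) 1, HasDerivAt (ex v)
      (-(ex G z - γ + (wtc a k j z : ℂ) * ex v z) / (wt a 1 1 z : ℂ)) z := fun z hz => by
    have hW := wtC_ne_zero ha (k + 1) (j + 1) hz
    have h1 := (hasDerivAt_wt_mul_hardyC ha k j G hz).div (hasDerivAt_wtC k j z) hW
    refine (h1.congr_of_eventuallyEq ?_).congr_deriv ?_
    · filter_upwards [Ioo_mem_nhds hz.1 hz.2] with x hx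
      have := wtC_ne_zero ha (k + 1) (j + 1) hx
      simp only [Pi.div_apply]
      rw [mul_div_cancel_left₀ _ this]
    · have hw := wtC_ne_zero ha k j hz
      have hw1 := wtC_ne_zero ha 1 1 hz
      have e : (wt a (k + 1) (j + 1) z : ℂ) = wt a k j z * wt a 1 1 z := by
        simp only [wt]; push_cast; ring
      rw [← hv, e]
      push_cast
      field_simp
      ring
  -- `-wt v'` extends to a flux of its own
  have hZ : ∀ z ∈ Ioo (-1 : ℝ) 1, HasDerivAt (fun z => (wt a (k + 1) (j + 1) z : ℂ) *
      (ex G z - γ) + (wtc a k j z : ℂ) * ((wt a (k + 1) (j + 1) z : ℂ) * ex v z))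
      ((wt a (k + 1) (j + 1) z : ℂ) * ex y z) z := fun z hz => by
    have h1 := (hasDerivAt_wtC (a := a) k j z).mul ((hGd z hz).sub_const γ)
    have h2 := (hasDerivAt_wtc (a := a) k j z).ofReal_comp.mul (hasDerivAt_wt_mul_hardyC ha k j G hz)
    refine (h1.add h2).congr_deriv ?_
    have : ex y z = ex g z + (wtcD a k j z : ℂ) * ex v z := by
      rw [show ex y z = ex g z + ex (mulC (wtcD a k j) _) z * ex v z from rfl,
        ex_mulC _ ⟨hz.1.le, hz.2.le⟩]
    rw [this, ← hv]
    push_cast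
    ring
  have hcZ : Continuous (fun z => (wt a (k + 1) (j + 1) z : ℂ) *
      (ex G z - γ) + (wtc a k j z : ℂ) * ((wt a (k + 1) (j + 1) z : ℂ) * ex v z)) :=
    (continuous_wt_mul _ _ ((continuous_ex G).sub continuous_const)).add
      ((Complex.continuous_ofReal.comp (continuous_wtc a k j)).mul
        (continuous_wt_mul _ _ (continuous_ex v)))
  have hcy := continuous_wt_mul (a := a) (k + 1) (j + 1) (continuous_ex y)
  have hZint : ∀ z ∈ J, (wt a (k + 1) (j + 1) z : ℂ) * (ex G z - γ)
      + (wtc a k j z : ℂ) * ((wt a (k + 1) (j + 1) z : ℂ) * ex v z)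
      = ∫ x in (-1 : ℝ)..z, (wt a (k + 1) (j + 1) x : ℂ) * ex y x := fun z hz => by
    rw [intervalIntegral.integral_eq_sub_of_hasDerivAt_of_le hz.1 hcZ.continuousOn
      (fun x hx => hZ x ⟨hx.1, hx.2.trans_le hz.2⟩) (hcy.intervalIntegrable _ _), wt_neg_one]
    simp
  have hmean : meanC ha (k + 1) (j + 1) y = 0 := by
    rw [meanC_apply, ← hZint 1 ⟨by norm_num, le_rfl⟩, wt_one]
    simp
  refine eq_const_add_primC fun z hz => (hvd z hz).congr_deriv ?_
  have hzJ : z ∈ J := ⟨hz.1.le, hz.2.le⟩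
  rw [ex_hardyC ha (k + 1) (j + 1) y hz, hardyFun, flux, hmean]
  simp only [sub_zero]
  rw [← hZint z hzJ]
  have hw := wtC_ne_zero ha (k + 1) (j + 1) hz
  have hw1 := wtC_ne_zero ha 1 1 hz
  have e : (wt a (k + 1 + 1) (j + 1 + 1) z : ℂ) = wt a (k + 1) (j + 1) z * wt a 1 1 z := by
    simp only [wt]; push_cast; ring
  rw [e]
  field_simp

end HardyOperator

/-! ### The inverse of the angular operator and weighted `L²` spaces -/

section WeightedSpaces

open MeasureTheory

/-- The fourth root of `1 - z²`. -/
def sig (z : ℝ) : ℝ := √√(1 - z ^ 2)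

theorem continuous_sig : Continuous sig := by unfold sig; fun_prop

theorem sig_nonneg (z : ℝ) : 0 ≤ sig z := Real.sqrt_nonneg _

theorem sig_pos {z : ℝ} (hz : z ∈ Ioo (-1 : ℝ) 1) : 0 < sig z :=
  Real.sqrt_pos.2 (Real.sqrt_pos.2 (one_sub_sq_pos hz))

theorem sig_sq (z : ℝ) : sig z ^ 2 = √(1 - z ^ 2) := Real.sq_sqrt (Real.sqrt_nonneg _)

theorem sig_pow_four {z : ℝ} (hz : z ∈ J) : sig z ^ 4 = 1 - z ^ 2 := by
  rw [show sig z ^ 4 = (sig z ^ 2) ^ 2 by ring, sig_sq, Real.sq_sqrt (one_sub_sq_nonneg hz)]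

theorem sig_le_one (z : ℝ) : sig z ≤ 1 := by
  unfold sig
  rw [Real.sqrt_le_one, Real.sqrt_le_one]
  linarith [sq_nonneg z]

theorem sig_anti {y z : ℝ} (h : y ^ 2 ≤ z ^ 2) : sig z ≤ sig y :=
  Real.sqrt_le_sqrt (Real.sqrt_le_sqrt (by linarith))

/-- Lebesgue measure on `[-1, 1]` with density `(1 - z²) ^ (k / 2)`. -/
def muW (k : ℕ) : Measure J :=
  (Measure.comap Subtype.val (volume : Measure ℝ) : Measure J).withDensity fun z => ENNReal.ofReal (sig z ^ (2 * k))

instance isFiniteMeasure_muW (k : ℕ) : IsFiniteMeasure (muW k) := by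
  set μ : Measure J := Measure.comap Subtype.val (volume : Measure ℝ) with hμ
  refine isFiniteMeasure_withDensity (ne_top_of_le_ne_top (b := μ univ) ?_ ?_)
  · rw [hμ, comap_subtype_coe_apply measurableSet_Icc, image_univ, Subtype.range_coe,
      Real.volume_Icc]
    exact ENNReal.ofReal_ne_top
  · calc ∫⁻ z : J, ENNReal.ofReal (sig z ^ (2 * k)) ∂μ ≤ ∫⁻ _ : J, 1 ∂μ :=
          lintegral_mono fun z => by
            rw [← ENNReal.ofReal_one]
            exact ENNReal.ofReal_le_ofReal (pow_le_one₀ (sig_nonneg z) (sig_le_one z))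
      _ = μ univ := by simp

/-- The weighted space `L²([-1, 1], (1 - z²) ^ (k / 2) dz)`. -/
abbrev HS (k : ℕ) : Type := Lp ℂ 2 (muW k)

/-- The inclusion of continuous functions in the weighted space. -/
def emb (k : ℕ) : C(J, ℂ) →L[ℂ] HS k := ContinuousMap.toLp 2 (muW k) ℂ

theorem denseRange_emb (k : ℕ) : DenseRange (emb k) :=
  ContinuousMap.toLp_denseRange ℂ (muW k) ℂ (by norm_num)

theorem inner_emb (k : ℕ) (g h : C(J, ℂ)) :
    ⟪emb k g, emb k h⟫_ℂ
      = ∫ z in (-1 : ℝ)..1, ((sig z ^ (2 * k) : ℝ) : ℂ) * (star (ex g z) * ex h z) := by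
  have hm : Measurable fun z : J => ENNReal.ofReal (sig z ^ (2 * k)) :=
    ENNReal.measurable_ofReal.comp ((continuous_sig.comp continuous_subtype_val).pow _).measurable
  rw [emb, ContinuousMap.inner_toLp, muW, integral_withDensity_eq_integral_toReal_smul hm
    (Eventually.of_forall fun _ => ENNReal.ofReal_lt_top), intervalIntegral.integral_of_le
    (by norm_num), ← integral_Icc_eq_integral_Ioc, ← integral_subtype_comap measurableSet_Icc]
  refine integral_congr_ae (Eventually.of_forall fun z => ?_)
  have : 0 ≤ sig z ^ (2 * k) := pow_nonneg (sig_nonneg _) _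
  simp only [ENNReal.toReal_ofReal this, ex_coe, Complex.real_smul, starRingEnd_apply]
  ring

theorem norm_emb_sq (k : ℕ) (g : C(J, ℂ)) :
    ‖emb k g‖ ^ 2 = ∫ z in (-1 : ℝ)..1, (sig z ^ k * ‖ex g z‖) ^ 2 := by
  have h := inner_self_eq_norm_sq_to_K (𝕜 := ℂ) (emb k g)
  rw [inner_emb] at h
  have h2 : ∀ z : ℝ, ((sig z ^ (2 * k) : ℝ) : ℂ) * (star (ex g z) * ex g z)
      = (((sig z ^ k * ‖ex g z‖) ^ 2 : ℝ) : ℂ) := fun z => by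
    rw [Complex.star_def, Complex.conj_mul']; push_cast; ring
  simp only [h2] at h
  rw [intervalIntegral.integral_ofReal] at h
  refine Complex.ofReal_injective ?_
  rw [h]
  push_cast
  rfl

theorem continuous_sig_mul_norm (k : ℕ) (g : C(J, ℂ)) :
    Continuous fun z => sig z ^ k * ‖ex g z‖ := (continuous_sig.pow k).mul (continuous_ex g).norm

theorem norm_emb_le_of_le {k : ℕ} {g : C(J, ℂ)} {G : ℝ → ℝ} {A : ℝ} (hA : 0 ≤ A)
    (hG : IntervalIntegrable G volume (-1) 1) (hGA : ∫ z in (-1 : ℝ)..1, G z ≤ A ^ 2)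
    (h : ∀ z ∈ Ioo (-1 : ℝ) 1, (sig z ^ k * ‖ex g z‖) ^ 2 ≤ G z) : ‖emb k g‖ ≤ A := by
  refine abs_le_of_sq_le_sq' ?_ hA |>.2
  rw [norm_emb_sq]
  exact (intervalIntegral.integral_mono_on_of_le_Ioo (by norm_num)
    (((continuous_sig_mul_norm k g).pow 2).intervalIntegrable _ _) hG h).trans hGA

theorem norm_emb_le_emb {k l : ℕ} {g h : C(J, ℂ)} {c : ℝ} (hc : 0 ≤ c)
    (H : ∀ z ∈ Ioo (-1 : ℝ) 1, sig z ^ k * ‖ex g z‖ ≤ c * (sig z ^ l * ‖ex h z‖)) :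
    ‖emb k g‖ ≤ c * ‖emb l h‖ := by
  refine norm_emb_le_of_le (mul_nonneg hc (norm_nonneg _))
    ((continuous_const.mul ((continuous_sig_mul_norm l h).pow 2)).intervalIntegrable _ _)
    (G := fun z => c ^ 2 * (sig z ^ l * ‖ex h z‖) ^ 2) ?_ fun z hz => ?_
  · rw [intervalIntegral.integral_const_mul, ← norm_emb_sq, mul_pow]
  · rw [← mul_pow]
    exact pow_le_pow_left₀ (mul_nonneg (pow_nonneg (sig_nonneg _) _) (norm_nonneg _)) (H z hz) 2

theorem norm_emb_mono {k l : ℕ} (h : k ≤ l) (g : C(J, ℂ)) : ‖emb l g‖ ≤ ‖emb k g‖ := by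
  rw [← one_mul ‖emb k g‖]
  refine norm_emb_le_emb zero_le_one fun z _ => ?_
  rw [one_mul]
  exact mul_le_mul_of_nonneg_right (pow_le_pow_of_le_one (sig_nonneg z) (sig_le_one z) h)
    (norm_nonneg _)

theorem norm_emb_mul_le (k : ℕ) (φ g : C(J, ℂ)) : ‖emb k (φ * g)‖ ≤ ‖φ‖ * ‖emb k g‖ := by
  refine norm_emb_le_emb (norm_nonneg _) fun z _ => ?_
  rw [ex_mul, norm_mul, mul_left_comm]
  exact mul_le_mul_of_nonneg_right (norm_ex_le φ z)
    (mul_nonneg (pow_nonneg (sig_nonneg _) _) (norm_nonneg _))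

theorem norm_emb_constC_le (k : ℕ) (c : ℂ) : ‖emb k (constC c)‖ ≤ 2 * ‖c‖ := by
  refine norm_emb_le_of_le (G := fun _ => ‖c‖ ^ 2) (by positivity)
    (continuous_const.intervalIntegrable _ _) ?_ fun z _ => ?_
  · rw [intervalIntegral.integral_const, smul_eq_mul]; nlinarith [sq_nonneg ‖c‖]
  · rw [ex_constC]
    exact pow_le_pow_left₀ (mul_nonneg (pow_nonneg (sig_nonneg _) _) (norm_nonneg _))
      (mul_le_of_le_one_left (norm_nonneg _) (pow_le_one₀ (sig_nonneg z) (sig_le_one z))) 2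

theorem injective_emb (k : ℕ) : Function.Injective (emb k) := by
  refine (injective_iff_map_eq_zero _).2 fun g hg => ext_ex_Ioo fun z hz => ?_
  have h0 := norm_emb_sq k g
  rw [hg, norm_zero] at h0
  by_contra hne
  have hpos : 0 < ∫ z in (-1 : ℝ)..1, (sig z ^ k * ‖ex g z‖) ^ 2 := by
    refine intervalIntegral.integral_pos (by norm_num)
      ((continuous_sig_mul_norm k g).pow 2).continuousOn (fun _ _ => sq_nonneg _)
      ⟨z, ⟨hz.1.le, hz.2.le⟩, ?_⟩
    have h1 : 0 < sig z ^ k := pow_pos (sig_pos hz) k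
    have h2 : 0 < ‖ex g z‖ := norm_pos_iff.2 hne
    positivity
  rw [← h0] at hpos
  norm_num at hpos

/-- The Cauchy-Schwarz inequality on an interval. -/
theorem integral_mul_le_sqrt {x y : ℝ} (hxy : x ≤ y) {A B : ℝ → ℝ} (hA : Continuous A)
    (hB : Continuous B) {α β : ℝ} (hα : 0 ≤ α) (hβ : 0 ≤ β)
    (h1 : ∫ t in x..y, A t ^ 2 ≤ α ^ 2) (h2 : ∫ t in x..y, B t ^ 2 ≤ β ^ 2) :
    ∫ t in x..y, A t * B t ≤ α * β := by
  set a := ∫ t in x..y, A t ^ 2 with ha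
  set b := ∫ t in x..y, B t ^ 2 with hb
  set c := ∫ t in x..y, A t * B t with hc
  have ha0 : 0 ≤ a := intervalIntegral.integral_nonneg hxy fun _ _ => sq_nonneg _
  have hb0 : 0 ≤ b := intervalIntegral.integral_nonneg hxy fun _ _ => sq_nonneg _
  have hq : ∀ s : ℝ, 0 ≤ a * (s * s) + 2 * c * s + b := fun s => by
    have h : 0 ≤ ∫ t in x..y, (s * A t + B t) ^ 2 :=
      intervalIntegral.integral_nonneg hxy fun _ _ => sq_nonneg _
    have e : (∫ t in x..y, (s * A t + B t) ^ 2) = a * (s * s) + 2 * c * s + b := by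
      have e1 : ∀ t, (s * A t + B t) ^ 2 = (s * s) * A t ^ 2 + (2 * s) * (A t * B t) + B t ^ 2 :=
        fun t => by ring
      simp only [e1]
      have i1 : Continuous fun t => (s * s) * A t ^ 2 := by fun_prop
      have i2 : Continuous fun t => (2 * s) * (A t * B t) := by fun_prop
      have i3 : Continuous fun t => (s * s) * A t ^ 2 + (2 * s) * (A t * B t) := i1.add i2
      have i4 : Continuous fun t => B t ^ 2 := hB.pow 2
      rw [intervalIntegral.integral_add (i3.intervalIntegrable _ _)
        (i4.intervalIntegrable _ _), intervalIntegral.integral_add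
        (i1.intervalIntegrable _ _) (i2.intervalIntegrable _ _),
        intervalIntegral.integral_const_mul, intervalIntegral.integral_const_mul]
      ring
    rwa [e] at h
  have hd := discrim_le_zero hq
  have h3 : c ^ 2 ≤ (α * β) ^ 2 := by
    rw [discrim] at hd
    have : a * b ≤ α ^ 2 * β ^ 2 := mul_le_mul h1 h2 hb0 (sq_nonneg _)
    rw [mul_pow]
    nlinarith
  exact (abs_le_of_sq_le_sq' h3 (mul_nonneg hα hβ)).2

end WeightedSpaces

section AngularInverse

open MeasureTheory

variable {a : ℝ}

theorem wt_zero_eq_sig (n : ℕ) {z : ℝ} (hz : z ∈ J) : wt a n 0 z = sig z ^ (4 * n) := by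
  rw [wt, pow_zero, mul_one, pow_mul, sig_pow_four hz]

theorem wt_succ_one_ge (n : ℕ) {z : ℝ} (hz : z ∈ J) :
    (1 - a ^ 2) * sig z ^ (4 * n + 4) ≤ wt a (n + 1) 1 z := by
  rw [wt, pow_one, show 4 * n + 4 = 4 * (n + 1) by ring, pow_mul, sig_pow_four hz, mul_comm]
  exact mul_le_mul_of_nonneg_left (hfac_ge z hz) (pow_nonneg (one_sub_sq_nonneg hz) _)

/-- A weighted Cauchy-Schwarz bound for integrals from the left end point. -/
theorem norm_integral_wt_emb_le (n : ℕ) {k : ℕ} (hk : k ≤ 2 * n) (φ : C(J, ℂ))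
    {z : ℝ} (hz : z ∈ Ioo (-1 : ℝ) 1) (h0 : z ≤ 0) :
    ‖∫ y in (-1 : ℝ)..z, (wt a n 0 y : ℂ) * ex φ y‖ ≤ ‖emb k φ‖ * sig z ^ (4 * n - k + 2) := by
  have hle : ‖∫ y in (-1 : ℝ)..z, (wt a n 0 y : ℂ) * ex φ y‖
      ≤ ∫ y in (-1 : ℝ)..z, (sig y ^ k * ‖ex φ y‖) * sig y ^ (4 * n - k) := by
    refine intervalIntegral.norm_integral_le_of_norm_le hz.1.le (Eventually.of_forall fun y hy => ?_)
      (((continuous_sig_mul_norm k φ).mul (continuous_sig.pow _)).intervalIntegrable _ _)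
    have hyJ : y ∈ J := ⟨hy.1.le, hy.2.trans hz.2.le⟩
    rw [norm_mul, Complex.norm_real, Real.norm_eq_abs, wt_zero_eq_sig n hyJ,
      abs_of_nonneg (pow_nonneg (sig_nonneg y) _), mul_right_comm, ← pow_add,
      show k + (4 * n - k) = 4 * n by omega]
  refine hle.trans (integral_mul_le_sqrt hz.1.le (continuous_sig_mul_norm k φ)
    (continuous_sig.pow _) (norm_nonneg _) (pow_nonneg (sig_nonneg _) _) ?_ ?_)
  · rw [norm_emb_sq]
    have hc := (continuous_sig_mul_norm k φ).pow 2
    exact intervalIntegral.integral_mono_interval le_rfl hz.1.le hz.2.le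
      (Eventually.of_forall fun _ => sq_nonneg _) (hc.intervalIntegrable _ _)
  · calc ∫ y in (-1 : ℝ)..z, (sig y ^ (4 * n - k)) ^ 2
        ≤ ∫ y in (-1 : ℝ)..z, (sig z ^ (4 * n - k)) ^ 2 := by
          refine intervalIntegral.integral_mono_on hz.1.le
            (((continuous_sig.pow _).pow 2).intervalIntegrable _ _)
            (continuous_const.intervalIntegrable _ _) fun y hy => ?_
          refine pow_le_pow_left₀ (pow_nonneg (sig_nonneg _) _)
            (pow_le_pow_left₀ (sig_nonneg _) (sig_anti ?_) _) 2
          nlinarith [hy.1, hy.2]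
      _ = (1 + z) * (sig z ^ (4 * n - k)) ^ 2 := by
          rw [intervalIntegral.integral_const, smul_eq_mul]; ring
      _ ≤ sig z ^ 4 * (sig z ^ (4 * n - k)) ^ 2 := by
          refine mul_le_mul_of_nonneg_right ?_ (sq_nonneg _)
          rw [sig_pow_four ⟨hz.1.le, hz.2.le⟩]
          nlinarith [hz.1]
      _ = (sig z ^ (4 * n - k + 2)) ^ 2 := by ring

/-- Reflection `z ↦ -z`. -/
def reflC (g : C(J, ℂ)) : C(J, ℂ) := mkC (fun z => ex g (-z)) ((continuous_ex g).comp
  continuous_neg).continuousOn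

theorem ex_reflC (g : C(J, ℂ)) {z : ℝ} (hz : z ∈ J) : ex (reflC g) z = ex g (-z) := ex_mkC _ hz

theorem sig_neg (z : ℝ) : sig (-z) = sig z := by simp [sig]

theorem norm_emb_reflC (k : ℕ) (g : C(J, ℂ)) : ‖emb k (reflC g)‖ = ‖emb k g‖ := by
  rw [← sq_eq_sq₀ (norm_nonneg _) (norm_nonneg _), norm_emb_sq, norm_emb_sq]
  have := intervalIntegral.integral_comp_neg (a := -1) (b := 1)
    fun z => (sig z ^ k * ‖ex g z‖) ^ 2
  rw [neg_neg] at this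
  rw [← this]
  refine intervalIntegral.integral_congr fun z hz => ?_
  rw [uIcc_of_le (by norm_num)] at hz
  simp only [ex_reflC g hz, sig_neg]

theorem norm_meanC_le_emb (ha : |a| < 1) (n : ℕ) {k : ℕ} (hk : k ≤ 2 * n) (g : C(J, ℂ)) :
    ‖meanC ha n 0 g‖ ≤ 2 / wmass a n 0 * ‖emb k g‖ := by
  have hm := wmass_pos ha n 0
  have hc := continuous_wt_mul (a := a) n 0 (continuous_ex g)
  have h0 : (0 : ℝ) ∈ Ioo (-1 : ℝ) 1 := ⟨by norm_num, by norm_num⟩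
  have hs0 : sig 0 = 1 := by simp [sig]
  have e1 := norm_integral_wt_emb_le (a := a) n hk g h0 le_rfl
  have e2 := norm_integral_wt_emb_le (a := a) n hk (reflC g) h0 le_rfl
  have e3 : ∫ y in (-1 : ℝ)..0, (wt a n 0 y : ℂ) * ex (reflC g) y
      = ∫ y in (0 : ℝ)..1, (wt a n 0 y : ℂ) * ex g y := by
    have := intervalIntegral.integral_comp_neg (a := -1) (b := 0)
      fun y => (wt a n 0 y : ℂ) * ex g y
    rw [neg_neg, neg_zero] at this
    rw [← this]
    refine intervalIntegral.integral_congr fun z hz => ?_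
    rw [uIcc_of_le (by norm_num)] at hz
    simp only [ex_reflC g ⟨hz.1, hz.2.trans zero_le_one⟩, wt_neg]
  rw [hs0, one_pow, mul_one] at e1 e2
  rw [e3, norm_emb_reflC] at e2
  rw [meanC_apply, norm_div, Complex.norm_real, Real.norm_eq_abs, abs_of_pos hm, div_le_iff₀ hm,
    ← intervalIntegral.integral_add_adjacent_intervals (b := 0) (hc.intervalIntegrable _ _)
      (hc.intervalIntegrable _ _)]
  refine (norm_add_le _ _).trans ?_
  rw [mul_right_comm, div_mul_cancel₀ _ hm.ne']
  linarith

/-- The centred function `g - mean g`. -/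
theorem norm_emb_sub_mean_le (ha : |a| < 1) (n : ℕ) {k : ℕ} (hk : k ≤ 2 * n) (g : C(J, ℂ)) :
    ‖emb k (g - constC (meanC ha n 0 g))‖ ≤ (1 + 4 / wmass a n 0) * ‖emb k g‖ := by
  rw [map_sub]
  refine (norm_sub_le _ _).trans ?_
  have h1 := norm_emb_constC_le k (meanC ha n 0 g)
  have h2 := norm_meanC_le_emb ha n hk g
  have : 2 * (2 / wmass a n 0 * ‖emb k g‖) = 4 / wmass a n 0 * ‖emb k g‖ := by ring
  linarith

/-- The constant in the pointwise bound for `hardyC`. -/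
def hardyK (a : ℝ) (n : ℕ) : ℝ := (1 - a ^ 2)⁻¹ * (1 + 4 / wmass a n 0)

theorem hardyK_nonneg (ha : |a| < 1) (n : ℕ) : 0 ≤ hardyK a n := by
  have h1 := wmass_pos ha n 0
  have h2 : 0 < 1 - a ^ 2 := by linarith [sq_lt_one_of_abs ha]
  unfold hardyK; positivity

theorem norm_hardyC_le (ha : |a| < 1) (n : ℕ) {k : ℕ} (hk : k ≤ 2 * n) (g : C(J, ℂ))
    {z : ℝ} (hz : z ∈ Ioo (-1 : ℝ) 1) :
    ‖ex (hardyC ha n 0 g) z‖ * sig z ^ (k + 2) ≤ hardyK a n * ‖emb k g‖ := by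
  have hzJ : z ∈ J := ⟨hz.1.le, hz.2.le⟩
  have hs := sig_pos hz
  have h2 : 0 < 1 - a ^ 2 := by linarith [sq_lt_one_of_abs ha]
  have hW := wt_pos ha (n + 1) 1 hz
  set φ := g - constC (meanC ha n 0 g) with hφ
  have hφe : ∀ y, ex φ y = ex g y - meanC ha n 0 g := fun y => by rw [hφ, ex_sub, ex_constC]
  have hflux : ‖flux ha n 0 g z‖ ≤ ‖emb k φ‖ * sig z ^ (4 * n - k + 2) := by
    rcases le_total z 0 with h0 | h0
    · have := norm_integral_wt_emb_le (a := a) n hk φ hz h0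
      rw [flux]
      simpa only [hφe] using this
    · have hz' : -z ∈ Ioo (-1 : ℝ) 1 := ⟨by linarith [hz.2], by linarith [hz.1]⟩
      have := norm_integral_wt_emb_le (a := a) n hk (reflC φ) hz' (by linarith)
      rw [norm_emb_reflC, sig_neg] at this
      rw [flux_eq_reflect, norm_neg]
      refine le_trans (le_of_eq ?_) this
      congr 1
      refine intervalIntegral.integral_congr fun y hy => ?_
      rw [uIcc_of_le hz'.1.le] at hy
      simp only [ex_reflC φ ⟨hy.1, hy.2.trans hz'.2.le⟩, hφe]
  have hmul : ‖ex (hardyC ha n 0 g) z‖ * wt a (n + 1) 1 z = ‖flux ha n 0 g z‖ := by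
    have := congrArg norm (wt_mul_ex_hardyC ha n 0 g hzJ)
    rw [norm_mul, norm_neg, Complex.norm_real, Real.norm_eq_abs, abs_of_pos hW] at this
    rw [← this, mul_comm]
  have h3 : ‖ex (hardyC ha n 0 g) z‖ * sig z ^ (k + 2) * ((1 - a ^ 2) * sig z ^ (4 * n - k + 2))
      ≤ ‖emb k φ‖ * sig z ^ (4 * n - k + 2) := by
    refine le_trans (le_trans (le_of_eq ?_) (mul_le_mul_of_nonneg_left
      (wt_succ_one_ge (a := a) n hzJ) (norm_nonneg (ex (hardyC ha n 0 g) z)))) (hmul.le.trans hflux)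
    rw [show 4 * n + 4 = (k + 2) + (4 * n - k + 2) by omega, pow_add]
    ring
  rw [← mul_assoc] at h3
  have h4 := le_of_mul_le_mul_right h3 (pow_pos hs _)
  rw [hardyK, mul_assoc, ← div_eq_inv_mul, le_div_iff₀ h2]
  exact h4.trans (norm_emb_sub_mean_le ha n hk g)

theorem hasDerivAt_arcsin_sig {z : ℝ} (hz : z ∈ Ioo (-1 : ℝ) 1) :
    HasDerivAt Real.arcsin ((sig z ^ 2)⁻¹) z := by
  rw [sig_sq, ← one_div]
  exact Real.hasDerivAt_arcsin (by linarith [hz.1]) (by linarith [hz.2])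

theorem intervalIntegrable_sig_inv : IntervalIntegrable (fun z => (sig z ^ 2)⁻¹) volume (-1) 1 := by
  refine intervalIntegral.intervalIntegrable_deriv_of_nonneg (g := Real.arcsin)
    Real.continuous_arcsin.continuousOn ?_ ?_
  · intro z hz
    rw [min_eq_left (by norm_num), max_eq_right (by norm_num)] at hz
    exact hasDerivAt_arcsin_sig hz
  · intro z _
    have := sq_nonneg (sig z)
    positivity

theorem integral_sig_inv_le {x y : ℝ} (hx : -1 ≤ x) (hxy : x ≤ y) (hy : y ≤ 1) :
    ∫ z in x..y, (sig z ^ 2)⁻¹ ≤ Real.pi := by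
  rw [intervalIntegral.integral_eq_sub_of_hasDerivAt_of_le hxy Real.continuous_arcsin.continuousOn
    (fun z hz => hasDerivAt_arcsin_sig ⟨hx.trans_lt hz.1, hz.2.trans_le hy⟩)
    (intervalIntegrable_sig_inv.mono_set (by
      rw [uIcc_of_le hxy, uIcc_of_le (by norm_num)]; exact Icc_subset_Icc hx hy))]
  linarith [Real.arcsin_le_pi_div_two y, Real.neg_pi_div_two_le_arcsin x]

/-- Integration of `hardyC g` gains two powers of `sig`. -/
theorem norm_primC_hardyC_le (ha : |a| < 1) (n : ℕ) {k : ℕ} (hk : k ≤ 2 * n) (g : C(J, ℂ))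
    {z : ℝ} (hz : z ∈ Ioo (-1 : ℝ) 1) :
    sig z ^ k * ‖ex (primC (hardyC ha n 0 g)) z‖ ≤ hardyK a n * Real.pi * ‖emb k g‖ := by
  have hs := sig_pos hz
  have hK := mul_nonneg (hardyK_nonneg ha n) (norm_nonneg (emb k g))
  have hbound : ∀ x y : ℝ, -1 < x → x ≤ y → y < 1 → (∀ t ∈ Icc x y, t ^ 2 ≤ z ^ 2) →
      ‖∫ t in x..y, ex (hardyC ha n 0 g) t‖
        ≤ hardyK a n * ‖emb k g‖ * (sig z ^ k)⁻¹ * Real.pi := by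
    intro x y hx hxy hy hsq
    have hI : IntervalIntegrable (fun t => (sig t ^ 2)⁻¹) volume x y :=
      intervalIntegrable_sig_inv.mono_set (by
        rw [uIcc_of_le hxy, uIcc_of_le (by norm_num)]; exact Icc_subset_Icc hx.le hy.le)
    refine (intervalIntegral.norm_integral_le_of_norm_le hxy
      (g := fun t => hardyK a n * ‖emb k g‖ * (sig z ^ k)⁻¹ * (sig t ^ 2)⁻¹)
      (Eventually.of_forall fun t ht => ?_) (hI.const_mul _)).trans ?_
    · have htI : t ∈ Ioo (-1 : ℝ) 1 := ⟨hx.trans ht.1, ht.2.trans_lt hy⟩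
      have hst := sig_pos htI
      have h1 := norm_hardyC_le ha n hk g htI
      have h2 : sig z ^ k ≤ sig t ^ k :=
        pow_le_pow_left₀ hs.le (sig_anti (hsq t ⟨ht.1.le, ht.2⟩)) k
      rw [mul_assoc, ← mul_inv, ← div_eq_mul_inv, le_div_iff₀ (by positivity)]
      refine le_trans (mul_le_mul_of_nonneg_left ?_ (norm_nonneg _)) h1
      rw [pow_add]
      exact mul_le_mul_of_nonneg_right h2 (by positivity)
    · rw [intervalIntegral.integral_const_mul]
      exact mul_le_mul_of_nonneg_left (integral_sig_inv_le hx.le hxy hy.le) (by positivity)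
  have key : ‖ex (primC (hardyC ha n 0 g)) z‖
      ≤ hardyK a n * ‖emb k g‖ * (sig z ^ k)⁻¹ * Real.pi := by
    rw [ex_primC _ ⟨hz.1.le, hz.2.le⟩]
    rcases le_total 0 z with h0 | h0
    · exact hbound 0 z (by norm_num) h0 hz.2 fun t ht => by nlinarith [ht.1, ht.2]
    · rw [intervalIntegral.integral_symm, norm_neg]
      exact hbound z 0 hz.1 h0 (by norm_num) fun t ht => by nlinarith [ht.1, ht.2]
  calc _ ≤ sig z ^ k * (hardyK a n * ‖emb k g‖ * (sig z ^ k)⁻¹ * Real.pi) :=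
        mul_le_mul_of_nonneg_left key (pow_nonneg hs.le _)
    _ = _ := by field_simp

theorem norm_emb_primC_hardyC_le (ha : |a| < 1) (n : ℕ) {k : ℕ} (hk : k + 1 ≤ 2 * n)
    (g : C(J, ℂ)) :
    ‖emb k (primC (hardyC ha n 0 g))‖ ≤ hardyK a n * Real.pi * 2 * ‖emb (k + 1) g‖ := by
  set B := hardyK a n * Real.pi * ‖emb (k + 1) g‖ with hB
  have hB0 : 0 ≤ B := mul_nonneg (mul_nonneg (hardyK_nonneg ha n) Real.pi_pos.le) (norm_nonneg _)
  refine (norm_emb_le_of_le (A := 2 * B) (by positivity)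
    (intervalIntegrable_sig_inv.const_mul (B ^ 2)) ?_ fun z hz => ?_).trans (le_of_eq (by
      rw [hB]; ring))
  · rw [intervalIntegral.integral_const_mul]
    have h1 := integral_sig_inv_le (x := -1) (y := 1) le_rfl (by norm_num) le_rfl
    have h2 := Real.pi_le_four
    nlinarith [sq_nonneg B]
  · have hs := sig_pos hz
    have := norm_primC_hardyC_le ha n hk g hz
    rw [pow_succ, mul_right_comm, ← hB, ← le_div_iff₀ hs] at this
    refine (pow_le_pow_left₀ (by positivity) this 2).trans (le_of_eq ?_)
    rw [div_pow, div_eq_mul_inv]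

/-- The inverse of the angular operator plus the mean: `kC g` solves
`-wt⁻¹ (wt (n + 1) 1 u')' + mean u = g`. -/
def kC (ha : |a| < 1) (n : ℕ) : C(J, ℂ) →L[ℂ] C(J, ℂ) :=
  constC ∘L meanC ha n 0 + primC ∘L hardyC ha n 0
    - constC ∘L meanC ha n 0 ∘L primC ∘L hardyC ha n 0

theorem kC_apply (ha : |a| < 1) (n : ℕ) (g : C(J, ℂ)) :
    kC ha n g = constC (meanC ha n 0 g - meanC ha n 0 (primC (hardyC ha n 0 g)))
      + primC (hardyC ha n 0 g) := by
  simp only [kC, sub_apply, add_apply, ContinuousLinearMap.comp_apply, map_sub]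
  abel

theorem meanC_constC (ha : |a| < 1) (n : ℕ) (c : ℂ) : meanC ha n 0 (constC c) = c := by
  have hm : (wmass a n 0 : ℂ) ≠ 0 := by exact_mod_cast (wmass_pos ha n 0).ne'
  rw [meanC_apply]
  simp only [ex_constC]
  rw [intervalIntegral.integral_mul_const, intervalIntegral.integral_ofReal]
  exact mul_div_cancel_left₀ c hm

theorem meanC_kC (ha : |a| < 1) (n : ℕ) (g : C(J, ℂ)) : meanC ha n 0 (kC ha n g) = meanC ha n 0 g := by
  rw [kC_apply, map_add, meanC_constC]; ring

theorem hasDerivAt_kC (ha : |a| < 1) (n : ℕ) (g : C(J, ℂ)) {z : ℝ} (hz : z ∈ Ioo (-1 : ℝ) 1) :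
    HasDerivAt (ex (kC ha n g)) (ex (hardyC ha n 0 g) z) z := by
  refine ((hasDerivAt_primC _ hz).const_add
    (meanC ha n 0 g - meanC ha n 0 (primC (hardyC ha n 0 g)))).congr_of_eventuallyEq
    (Eventually.of_forall fun x => ?_)
  rw [kC_apply, ex_add, ex_constC]

/-- If `d` has derivative `v` and `wt (n + 1) 1 v` has derivative `-wt n 0 * y`, then `kC` inverts
the operator. -/
theorem kC_of_hasDerivAt (ha : |a| < 1) (n : ℕ) {d v y : C(J, ℂ)}
    (hd : ∀ z ∈ Ioo (-1 : ℝ) 1, HasDerivAt (ex d) (ex v z) z)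
    (hv : ∀ z ∈ Ioo (-1 : ℝ) 1, HasDerivAt (fun z => (wt a (n + 1) 1 z : ℂ) * ex v z)
      (-((wt a n 0 z : ℂ) * ex y z)) z) :
    kC ha n (y + constC (meanC ha n 0 d)) = d := by
  obtain ⟨h1, h2⟩ := hardyC_unique ha n 0 (g := y + constC (meanC ha n 0 d)) (v := v)
    (γ := meanC ha n 0 d) fun z hz => (hv z hz).congr_deriv (by rw [ex_add, ex_constC]; ring)
  have h3 := eq_const_add_primC hd
  rw [kC_apply, h1, h2]
  have h4 := congrArg (meanC ha n 0) h3
  rw [map_add, meanC_constC] at h4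
  conv_rhs => rw [h3]
  rw [h4]
  congr 2
  ring

/-- Integration by parts turns the form of the inverse angular operator into an energy of its
derivative plus the contribution of the means.  Symmetry and nonnegativity are read off from it. -/
theorem inner_kC (ha : |a| < 1) (n : ℕ) (g h : C(J, ℂ)) :
    ⟪emb (2 * n) (kC ha n g), emb (2 * n) h⟫_ℂ
      = (∫ z in (-1 : ℝ)..1, (wt a (n + 1) 1 z : ℂ) *
          (star (ex (hardyC ha n 0 g) z) * ex (hardyC ha n 0 h) z))
        + wmass a n 0 * (star (meanC ha n 0 g) * meanC ha n 0 h) := by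
  have hm : (wmass a n 0 : ℂ) ≠ 0 := by exact_mod_cast (wmass_pos ha n 0).ne'
  have hcK : Continuous fun z => star (ex (kC ha n g) z) := continuous_star.comp (continuous_ex _)
  have hcV : Continuous fun z => star (ex (hardyC ha n 0 g) z) :=
    continuous_star.comp (continuous_ex _)
  have hcF : Continuous (flux ha n 0 h) := continuous_iff_continuousAt.2 fun z =>
    (hasDerivAt_flux ha n 0 h z).continuousAt
  have hcw : Continuous fun z => (wt a n 0 z : ℂ) :=
    Complex.continuous_ofReal.comp (continuous_wt a n 0)
  have hch := continuous_ex h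
  -- integration by parts
  have hibp : ∫ z in (-1 : ℝ)..1, (star (ex (hardyC ha n 0 g) z) * flux ha n 0 h z
      + star (ex (kC ha n g) z) * ((wt a n 0 z : ℂ) * (ex h z - meanC ha n 0 h))) = 0 := by
    rw [intervalIntegral.integral_eq_sub_of_hasDerivAt_of_le (by norm_num)
      (f := fun z => star (ex (kC ha n g) z) * flux ha n 0 h z)
      (hcK.mul hcF).continuousOn
      (fun z hz => (hasDerivAt_kC ha n g hz).star.mul (hasDerivAt_flux ha n 0 h z))
      ((hcV.mul hcF).add (hcK.mul (hcw.mul (hch.sub continuous_const))) |>.intervalIntegrable _ _),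
      flux_one]
    simp [flux]
  have hmeanK : ∫ z in (-1 : ℝ)..1, star (ex (kC ha n g) z) * (wt a n 0 z : ℂ)
      = wmass a n 0 * star (meanC ha n 0 g) := by
    have e : ∀ z, star (ex (kC ha n g) z) * (wt a n 0 z : ℂ)
        = star ((wt a n 0 z : ℂ) * ex (kC ha n g) z) := fun z => by
      rw [star_mul', mul_comm, Complex.star_def, Complex.conj_ofReal]
    simp only [e]
    rw [← meanC_kC ha n g, meanC_apply, Complex.star_def, map_div₀, Complex.conj_ofReal,
      mul_div_cancel₀ _ hm, ← intervalIntegral.intervalIntegral_conj]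
  have e1 : ∀ z ∈ uIcc (-1 : ℝ) 1, ((sig z ^ (2 * (2 * n)) : ℝ) : ℂ)
        * (star (ex (kC ha n g) z) * ex h z)
      = (wt a (n + 1) 1 z : ℂ) * (star (ex (hardyC ha n 0 g) z) * ex (hardyC ha n 0 h) z)
        + ((star (ex (hardyC ha n 0 g) z) * flux ha n 0 h z
          + star (ex (kC ha n g) z) * ((wt a n 0 z : ℂ) * (ex h z - meanC ha n 0 h)))
        + (star (ex (kC ha n g) z) * (wt a n 0 z : ℂ)) * meanC ha n 0 h) := fun z hz => by
    rw [uIcc_of_le (by norm_num)] at hz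
    have hV := wt_mul_ex_hardyC ha n 0 h hz
    rw [show 2 * (2 * n) = 4 * n by ring, ← wt_zero_eq_sig (a := a) n hz]
    linear_combination (-star (ex (hardyC ha n 0 g) z)) * hV
  rw [inner_emb, intervalIntegral.integral_congr e1]
  have c1 : Continuous fun z => (wt a (n + 1) 1 z : ℂ) *
      (star (ex (hardyC ha n 0 g) z) * ex (hardyC ha n 0 h) z) :=
    continuous_wt_mul _ _ (hcV.mul (continuous_ex _))
  have c2 : Continuous fun z => star (ex (hardyC ha n 0 g) z) * flux ha n 0 h z
      + star (ex (kC ha n g) z) * ((wt a n 0 z : ℂ) * (ex h z - meanC ha n 0 h)) :=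
    (hcV.mul hcF).add (hcK.mul (hcw.mul (hch.sub continuous_const)))
  have c3 : Continuous fun z => (star (ex (kC ha n g) z) * (wt a n 0 z : ℂ)) * meanC ha n 0 h :=
    (hcK.mul hcw).mul continuous_const
  have c4 : Continuous fun z => (star (ex (hardyC ha n 0 g) z) * flux ha n 0 h z
          + star (ex (kC ha n g) z) * ((wt a n 0 z : ℂ) * (ex h z - meanC ha n 0 h)))
        + (star (ex (kC ha n g) z) * (wt a n 0 z : ℂ)) * meanC ha n 0 h := c2.add c3
  rw [intervalIntegral.integral_add (c1.intervalIntegrable _ _) (c4.intervalIntegrable _ _),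
    intervalIntegral.integral_add (c2.intervalIntegrable _ _) (c3.intervalIntegrable _ _),
    hibp, intervalIntegral.integral_mul_const, hmeanK]
  ring

end AngularInverse

/-! ### Solving the wave equation in spaces of continuous functions -/

section WaveRHS

variable {E F : Type*} [NormedAddCommGroup E] [NormedSpace ℂ E] [NormedAddCommGroup F]
  [NormedSpace ℂ F]

/-- The difference of the source `f` and the lower order part of the wave operator applied
to `u`. -/
def waveRHS (κ : ℝ → ℝ) (b q : ℝ → ℂ) (Q : E →L[ℂ] E) (f u : ℝ → E) (s : ℝ) : E :=
  f s - (((s * κ s : ℝ) : ℂ) • deriv (deriv u) s + b s • deriv u s + q s • u s + Q (u s))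

theorem isFlatCurve_waveRHS {S : ℝ} (hS : 0 < S) {κ : ℝ → ℝ} {b q : ℝ → ℂ} {Q : E →L[ℂ] E}
    {f u : ℝ → E} (hκ : ContDiffOn ℝ ∞ κ (Iio S)) (hb : ContDiffOn ℝ ∞ b (Iio S))
    (hq : ContDiffOn ℝ ∞ q (Iio S)) (hf : IsFlatCurve S f) (hu : IsFlatCurve S u) :
    IsFlatCurve S (waveRHS κ b q Q f u) := by
  have h1 := hu.deriv hS
  exact hf.sub (((((h1.deriv hS).smul (contDiffOn_ofReal (contDiffOn_id.mul hκ))).add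
    (h1.smul hb)).add (hu.smul hq)).add (hu.clm Q))

theorem clm_waveRHS {S : ℝ} {κ : ℝ → ℝ} {b q : ℝ → ℂ} {Q : E →L[ℂ] E} {Q' : F →L[ℂ] F}
    {f u : ℝ → E} {f' u' : ℝ → F} (L : E →L[ℂ] F) (hL : ∀ x, L (Q x) = Q' (L x))
    (hu : ContDiffOn ℝ ∞ u (Iio S)) (hf' : ∀ s < S, L (f s) = f' s)
    (hu' : ∀ s < S, L (u s) = u' s) {s : ℝ} (hs : s < S) :
    L (waveRHS κ b q Q f u s) = waveRHS κ b q Q' f' u' s := by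
  have h1 : ∀ t < S, deriv u' t = L (deriv u t) := fun t ht => by
    rw [← deriv_clm hu L ht]
    exact (Filter.eventuallyEq_of_mem (Iio_mem_nhds ht) fun x hx => (hu' x hx).symm).deriv_eq
  have h2 : deriv (deriv u') s = L (deriv (deriv u) s) := by
    rw [← deriv_clm (contDiffOn_deriv_Iio hu) L hs]
    exact (Filter.eventuallyEq_of_mem (Iio_mem_nhds hs) fun x hx => h1 x hx).deriv_eq
  simp only [waveRHS, map_sub, map_add, map_smul, hL, hf' s hs, hu' s hs, h1 s hs, h2]

end WaveRHS

section Extension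

variable {a : ℝ} {F : Type*} [NormedAddCommGroup F] [NormedSpace ℂ F] [CompleteSpace F]

/-- The extension to the weighted space of an operator defined on continuous functions. -/
def extOp (k : ℕ) (T : C(J, ℂ) →L[ℂ] F) : HS k →L[ℂ] F :=
  T.toLinearMap.extendOfNorm (emb k).toLinearMap

theorem extOp_emb {k : ℕ} {T : C(J, ℂ) →L[ℂ] F} {C : ℝ} (h : ∀ g, ‖T g‖ ≤ C * ‖emb k g‖)
    (g : C(J, ℂ)) : extOp k T (emb k g) = T g :=
  LinearMap.extendOfNorm_eq (denseRange_emb k) ⟨C, h⟩ g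

theorem clm_ext_emb {G : Type*} [NormedAddCommGroup G] [NormedSpace ℂ G] {k : ℕ}
    {A B : HS k →L[ℂ] G} (h : ∀ g, A (emb k g) = B (emb k g)) : A = B :=
  ContinuousLinearMap.ext fun x =>
    congrFun ((denseRange_emb k).equalizer A.continuous B.continuous (funext h)) x

theorem norm_emb_kC_le (ha : |a| < 1) (n : ℕ) {k l : ℕ} (hk : k ≤ 2 * n) (hl : l ≤ 2 * n) {B : ℝ}
    (hB : ∀ g, ‖emb l (primC (hardyC ha n 0 g))‖ ≤ B * ‖emb k g‖) (g : C(J, ℂ)) :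
    ‖emb l (kC ha n g)‖ ≤ (4 / wmass a n 0 + (4 / wmass a n 0 + 1) * B) * ‖emb k g‖ := by
  set W := primC (hardyC ha n 0 g)
  have hm := wmass_pos ha n 0
  have h1 := norm_meanC_le_emb ha n hk g
  have h2 := norm_meanC_le_emb ha n hl W
  have h3 := norm_emb_constC_le l (meanC ha n 0 g - meanC ha n 0 W)
  have h4 := norm_sub_le (meanC ha n 0 g) (meanC ha n 0 W)
  have h5 : (4 / wmass a n 0 + 1) * ‖emb l W‖ ≤ (4 / wmass a n 0 + 1) * (B * ‖emb k g‖) :=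
    mul_le_mul_of_nonneg_left (hB g) (by positivity)
  rw [kC_apply, map_add]
  refine (norm_add_le _ _).trans ?_
  have e1 : 2 * (2 / wmass a n 0 * ‖emb k g‖) = 4 / wmass a n 0 * ‖emb k g‖ := by ring
  have e2 : 2 * (2 / wmass a n 0 * ‖emb l W‖) = 4 / wmass a n 0 * ‖emb l W‖ := by ring
  linarith

theorem norm_emb_kC_le_self (ha : |a| < 1) (n : ℕ) :
    ∃ B, ∀ g, ‖emb (2 * n) (kC ha n g)‖ ≤ B * ‖emb (2 * n) g‖ := by
  refine ⟨_, norm_emb_kC_le ha n le_rfl le_rfl (B := 2 * (hardyK a n * Real.pi)) fun g => ?_⟩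
  have hB := mul_nonneg (mul_nonneg (hardyK_nonneg ha n) Real.pi_pos.le)
    (norm_nonneg (emb (2 * n) g))
  refine norm_emb_le_of_le (G := fun _ => (hardyK a n * Real.pi * ‖emb (2 * n) g‖) ^ 2)
    (by linarith) (continuous_const.intervalIntegrable _ _) ?_ fun z hz =>
      pow_le_pow_left₀ (mul_nonneg (pow_nonneg (sig_nonneg _) _) (norm_nonneg _))
        (norm_primC_hardyC_le ha n le_rfl g hz) 2
  rw [intervalIntegral.integral_const, smul_eq_mul]
  nlinarith [sq_nonneg (hardyK a n * Real.pi * ‖emb (2 * n) g‖)]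

theorem norm_emb_kC_le_succ (ha : |a| < 1) (n : ℕ) {k : ℕ} (hk : k + 1 ≤ 2 * n) :
    ∃ B, ∀ g, ‖emb k (kC ha n g)‖ ≤ B * ‖emb (k + 1) g‖ :=
  ⟨_, norm_emb_kC_le ha n hk (by omega) (norm_emb_primC_hardyC_le ha n hk)⟩

theorem norm_kC_le_emb_zero (ha : |a| < 1) (n : ℕ) : ∃ B, ∀ g, ‖kC ha n g‖ ≤ B * ‖emb 0 g‖ := by
  refine ⟨2 / wmass a n 0 + 2 * (hardyK a n * Real.pi), fun g => ?_⟩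
  set W := primC (hardyC ha n 0 g)
  have h1 := norm_meanC_le_emb ha n (Nat.zero_le _) g
  have h2 := norm_meanC_le ha n 0 W
  have h3 : ‖W‖ ≤ hardyK a n * Real.pi * ‖emb 0 g‖ := norm_le_of_ex_le fun z hz => by
    simpa using norm_primC_hardyC_le ha n (Nat.zero_le _) g hz
  have h4 := norm_sub_le (meanC ha n 0 g) (meanC ha n 0 W)
  have h5 : ∀ c : ℂ, ‖constC c‖ ≤ ‖c‖ := fun c => norm_le_of_ex_le fun z _ => by rw [ex_constC]
  rw [kC_apply]
  refine (norm_add_le _ _).trans ?_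
  linarith [h5 (meanC ha n 0 g - meanC ha n 0 W)]

/-- The zeroth order angular term: multiplication by `φ`, minus the mean. -/
def potC (ha : |a| < 1) (n : ℕ) (φ : C(J, ℂ)) : C(J, ℂ) →L[ℂ] C(J, ℂ) :=
  ContinuousLinearMap.mul ℂ C(J, ℂ) φ - constC ∘L meanC ha n 0

theorem potC_apply (ha : |a| < 1) (n : ℕ) (φ g : C(J, ℂ)) :
    potC ha n φ g = φ * g - constC (meanC ha n 0 g) := rfl

theorem norm_emb_potC_le (ha : |a| < 1) (n : ℕ) (φ : C(J, ℂ)) {k : ℕ} (hk : k ≤ 2 * n)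
    (g : C(J, ℂ)) : ‖emb k (potC ha n φ g)‖ ≤ (‖φ‖ + 4 / wmass a n 0) * ‖emb k g‖ := by
  rw [potC_apply, map_sub]
  refine (norm_sub_le _ _).trans ?_
  have h1 := norm_emb_mul_le k φ g
  have h2 := norm_emb_constC_le k (meanC ha n 0 g)
  have h3 := norm_meanC_le_emb ha n hk g
  have e1 : 2 * (2 / wmass a n 0 * ‖emb k g‖) = 4 / wmass a n 0 * ‖emb k g‖ := by ring
  linarith

/-- `kC` as an operator on the weighted space in which it is symmetric. -/
def kH (ha : |a| < 1) (n : ℕ) : HS (2 * n) →L[ℂ] HS (2 * n) :=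
  extOp (2 * n) (emb (2 * n) ∘L kC ha n)

theorem kH_emb (ha : |a| < 1) (n : ℕ) (g : C(J, ℂ)) :
    kH ha n (emb (2 * n) g) = emb (2 * n) (kC ha n g) :=
  extOp_emb (norm_emb_kC_le_self ha n).choose_spec g

/-- `potC` as an operator on weighted spaces. -/
def potH (ha : |a| < 1) (n : ℕ) (φ : C(J, ℂ)) (k : ℕ) : HS k →L[ℂ] HS k :=
  extOp k (emb k ∘L potC ha n φ)

theorem potH_emb (ha : |a| < 1) (n : ℕ) (φ : C(J, ℂ)) {k : ℕ} (hk : k ≤ 2 * n) (g : C(J, ℂ)) :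
    potH ha n φ k (emb k g) = emb k (potC ha n φ g) :=
  extOp_emb (norm_emb_potC_le ha n φ hk) g

/-- The inclusion of a weighted space in one with a smaller weight. -/
def inclH (k l : ℕ) : HS k →L[ℂ] HS l := extOp k (emb l)

theorem inclH_emb {k l : ℕ} (h : k ≤ l) (g : C(J, ℂ)) : inclH k l (emb k g) = emb l g :=
  extOp_emb (C := 1) (fun g => by rw [one_mul]; exact norm_emb_mono h g) g

theorem kH_symm (ha : |a| < 1) (n : ℕ) (x y : HS (2 * n)) :
    inner ℂ (kH ha n x) y = inner ℂ x (kH ha n y) := by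
  refine (denseRange_emb (2 * n)).induction_on₂ (p := fun x y =>
    inner ℂ (kH ha n x) y = inner ℂ x (kH ha n y)) ?_ (fun g h => ?_) x y
  · exact isClosed_eq (((kH ha n).continuous.comp continuous_fst).inner continuous_snd)
      (continuous_fst.inner ((kH ha n).continuous.comp continuous_snd))
  · rw [kH_emb, kH_emb, inner_kC, ← inner_conj_symm, inner_kC]
    simp only [map_add, map_mul, Complex.conj_ofReal, Complex.star_def, Complex.conj_conj]
    rw [← intervalIntegral.intervalIntegral_conj]
    simp only [map_mul, Complex.conj_ofReal, Complex.conj_conj]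
    congr 1
    · refine intervalIntegral.integral_congr fun z _ => ?_
      ring
    · ring

theorem kH_nonneg (ha : |a| < 1) (n : ℕ) (x : HS (2 * n)) : 0 ≤ (inner ℂ (kH ha n x) x).re := by
  refine (denseRange_emb (2 * n)).induction_on (p := fun x => 0 ≤ (inner ℂ (kH ha n x) x).re) x
    ?_ fun g => ?_
  · exact isClosed_le continuous_const
      (Complex.continuous_re.comp ((kH ha n).continuous.inner continuous_id))
  · have e : ∀ z, (wt a (n + 1) 1 z : ℂ) * (star (ex (hardyC ha n 0 g) z) * ex (hardyC ha n 0 g) z)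
        = ((wt a (n + 1) 1 z * ‖ex (hardyC ha n 0 g) z‖ ^ 2 : ℝ) : ℂ) := fun z => by
      rw [Complex.star_def, Complex.conj_mul']; push_cast; ring
    rw [kH_emb, inner_kC]
    simp only [e]
    rw [intervalIntegral.integral_ofReal, Complex.star_def, Complex.conj_mul', ← Complex.ofReal_pow,
      ← Complex.ofReal_mul, ← Complex.ofReal_add, Complex.ofReal_re]
    refine add_nonneg (intervalIntegral.integral_nonneg (by norm_num) fun z hz =>
      mul_nonneg (wt_nonneg ha _ _ hz) (sq_nonneg _))
      (mul_nonneg (wmass_pos ha n 0).le (sq_nonneg _))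

end Extension

section Solve

variable {a : ℝ}

/-- Existence for the wave equation with the angular operator, in the space of continuous
functions. -/
theorem exists_wave_solution_continuous (ha : |a| < 1) (n : ℕ) (φ : C(J, ℂ)) {S : ℝ} (hS : 0 < S)
    {κ : ℝ → ℝ} {b q : ℝ → ℂ} {f : ℝ → C(J, ℂ)} (hκ : ContDiffOn ℝ ∞ κ (Iio S))
    (hκ0 : ∀ s < S, 0 < κ s) (hb : ContDiffOn ℝ ∞ b (Iio S)) (hq : ContDiffOn ℝ ∞ q (Iio S))
    (hf : IsFlatCurve S f) :
    ∃ u g : ℝ → C(J, ℂ), IsFlatCurve S u ∧ IsFlatCurve S g ∧ ∀ s < S, u s = kC ha n (g s) ∧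
      g s = waveRHS κ b q (potC ha n φ) f u s := by
  obtain ⟨U, G, hU, hG, hUG⟩ := exists_wave_solution (Q := potH ha n φ (2 * n)) hS (kH_symm ha n)
    (kH_nonneg ha n) hκ hκ0 hb hq (hf.clm (emb (2 * n)))
  have hG' : ∀ s < S, G s
      = waveRHS κ b q (potH ha n φ (2 * n)) (fun s => emb (2 * n) (f s)) U s := fun s hs => by
    rw [waveRHS, ← (hUG s hs).2]; abel
  -- each application of the inverse operator lowers the weight
  have lift : ∀ j k : ℕ, k + j = 2 * n → ∃ γ : ℝ → HS k, IsFlatCurve S γ ∧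
      ∀ s < S, inclH k (2 * n) (γ s) = G s := by
    intro j
    induction j with
    | zero =>
      intro k hk
      obtain rfl : k = 2 * n := by omega
      refine ⟨G, hG, fun s _ => ?_⟩
      have : inclH (2 * n) (2 * n) = ContinuousLinearMap.id ℂ _ :=
        clm_ext_emb fun g => inclH_emb le_rfl g
      rw [this]; rfl
    | succ j ih =>
      intro k hk
      obtain ⟨γ, hγ, hγG⟩ := ih (k + 1) (by omega)
      obtain ⟨B, hB⟩ := norm_emb_kC_le_succ ha n (k := k) (by omega)
      set T : HS (k + 1) →L[ℂ] HS k := extOp (k + 1) (emb k ∘L kC ha n)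
      have hT : ∀ g, T (emb (k + 1) g) = emb k (kC ha n g) := fun g => extOp_emb hB g
      have hTK : inclH k (2 * n) ∘L T = kH ha n ∘L inclH (k + 1) (2 * n) := clm_ext_emb fun g => by
        simp only [ContinuousLinearMap.comp_apply]
        rw [hT, inclH_emb (by omega), inclH_emb (by omega), kH_emb]
      have hPot : inclH k (2 * n) ∘L potH ha n φ k
          = potH ha n φ (2 * n) ∘L inclH k (2 * n) := clm_ext_emb fun g => by
        simp only [ContinuousLinearMap.comp_apply]
        rw [potH_emb ha n φ (by omega), inclH_emb (by omega), inclH_emb (by omega),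
          potH_emb ha n φ le_rfl]
      have hu := hγ.clm T
      refine ⟨waveRHS κ b q (potH ha n φ k) (fun s => emb k (f s)) (fun s => T (γ s)),
        isFlatCurve_waveRHS hS hκ hb hq (hf.clm _) hu, fun s hs => ?_⟩
      rw [hG' s hs]
      refine clm_waveRHS (S := S) _ (fun x => DFunLike.congr_fun hPot x) hu.1
        (fun s _ => inclH_emb (by omega) _) (fun s hs => ?_) hs
      rw [(hUG s hs).1, ← hγG s hs]
      exact DFunLike.congr_fun hTK (γ s)
  -- from weight zero, one more application of the inverse operator reaches continuous functions
  obtain ⟨γ, hγ, hγG⟩ := lift (2 * n) 0 (by omega)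
  obtain ⟨B, hB⟩ := norm_kC_le_emb_zero ha n
  set T : HS 0 →L[ℂ] C(J, ℂ) := extOp 0 (kC ha n)
  have hTK : emb (2 * n) ∘L T = kH ha n ∘L inclH 0 (2 * n) := clm_ext_emb fun g => by
    simp only [ContinuousLinearMap.comp_apply]
    rw [extOp_emb hB, inclH_emb (by omega), kH_emb]
  have hu := hγ.clm T
  have huU : ∀ s < S, emb (2 * n) (T (γ s)) = U s := fun s hs => by
    rw [(hUG s hs).1, ← hγG s hs]
    exact DFunLike.congr_fun hTK (γ s)
  refine ⟨fun s => T (γ s), waveRHS κ b q (potC ha n φ) f (fun s => T (γ s)), hu,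
    isFlatCurve_waveRHS hS hκ hb hq hf hu, fun s hs => ⟨injective_emb (2 * n) ?_, rfl⟩⟩
  have hgG : emb (2 * n) (waveRHS κ b q (potC ha n φ) f (fun s => T (γ s)) s) = G s := by
    rw [hG' s hs]
    exact clm_waveRHS (S := S) _ (fun x => (potH_emb ha n φ le_rfl x).symm) hu.1
      (fun s _ => rfl) huU hs
  rw [huU s hs, ← kH_emb, hgG, (hUG s hs).1]

/-- Uniqueness for the wave equation with the angular operator: the embedding into weighted `L²`
reduces it to the abstract statement. -/
theorem wave_unique_continuous (ha : |a| < 1) (n : ℕ) (φ : C(J, ℂ)) {S : ℝ} (hS : 0 < S)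
    {κ : ℝ → ℝ} {b q : ℝ → ℂ} {u g : ℝ → C(J, ℂ)} (hκ : ContDiffOn ℝ ∞ κ (Iio S))
    (hκ0 : ∀ s < S, 0 < κ s) (hb : ContDiffOn ℝ ∞ b (Iio S)) (hq : ContDiffOn ℝ ∞ q (Iio S))
    (hu : IsFlatCurve S u) (hg : IsFlatCurve S g)
    (h : ∀ s < S, u s = kC ha n (g s) ∧ g s = waveRHS κ b q (potC ha n φ) 0 u s) :
    ∀ s < S, u s = 0 := by
  have key := wave_unique (Q := potH ha n φ (2 * n)) hS (kH_symm ha n)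
    (kH_nonneg ha n) hκ hκ0 hb hq (hu.clm (emb (2 * n))) (hg.clm (emb (2 * n))) fun s hs => by
      refine ⟨by rw [(h s hs).1, kH_emb], ?_⟩
      have e := clm_waveRHS (S := S) (κ := κ) (b := b) (q := q) (f := 0) (f' := 0) (emb (2 * n))
        (fun x => (potH_emb ha n φ le_rfl x).symm) hu.1 (fun s _ => map_zero _)
        (fun s _ => rfl) hs
      rw [(h s hs).2, e, waveRHS, Pi.zero_apply]
      abel
  exact fun s hs => injective_emb (2 * n) (by rw [key s hs, map_zero])

end Solve

/-! ### Regularity up to the poles -/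

section Reg

variable {a : ℝ} {S : ℝ}

theorem hasDerivAt_of_const_add_primC {u w : C(J, ℂ)} {c : ℂ} (h : u = constC c + primC w) {z : ℝ}
    (hz : z ∈ Ioo (-1 : ℝ) 1) : HasDerivAt (ex u) (ex w z) z :=
  ((hasDerivAt_primC w hz).const_add c).congr_of_eventuallyEq
    (Eventually.of_forall fun x => by rw [h, ex_add, ex_constC])

/-- Flat curves of functions with `j` derivatives in the angular variable, each of which is again
a flat curve of continuous functions. -/
def Reg (S : ℝ) : ℕ → (ℝ → C(J, ℂ)) → Prop
  | 0, u => IsFlatCurve S u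
  | j + 1, u => ∃ (c : ℝ → ℂ) (w : ℝ → C(J, ℂ)), IsFlatCurve S c ∧ Reg S j w ∧
      ∀ s < S, u s = constC (c s) + primC (w s)

theorem IsFlatCurve.congr {E : Type*} [NormedAddCommGroup E] [NormedSpace ℂ E] (hS : 0 < S)
    {u v : ℝ → E} (hu : IsFlatCurve S u) (h : ∀ s < S, v s = u s) : IsFlatCurve S v :=
  ⟨hu.1.congr h, fun s hs => by rw [h s (hs.trans_lt hS), hu.2 s hs]⟩

theorem Reg.congr (hS : 0 < S) {j : ℕ} {u v : ℝ → C(J, ℂ)} (hu : Reg S j u)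
    (h : ∀ s < S, v s = u s) : Reg S j v := by
  cases j with
  | zero => exact IsFlatCurve.congr hS hu h
  | succ j =>
    obtain ⟨c, w, hc, hw, e⟩ := hu
    exact ⟨c, w, hc, hw, fun s hs => by rw [h s hs, e s hs]⟩

theorem Reg.flat (hS : 0 < S) {j : ℕ} {u : ℝ → C(J, ℂ)} (hu : Reg S j u) : IsFlatCurve S u := by
  induction j generalizing u with
  | zero => exact hu
  | succ j ih =>
    obtain ⟨c, w, hc, hw, e⟩ := hu
    exact ((hc.clm constC).add ((ih hw).clm primC)).congr hS e

theorem Reg.of_succ (hS : 0 < S) {j : ℕ} {u : ℝ → C(J, ℂ)} (hu : Reg S (j + 1) u) :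
    Reg S j u := by
  induction j generalizing u with
  | zero => exact hu.flat hS
  | succ j ih =>
    obtain ⟨c, w, hc, hw, e⟩ := hu
    exact ⟨c, w, hc, ih hw, e⟩

theorem Reg.add {j : ℕ} {u v : ℝ → C(J, ℂ)} (hu : Reg S j u) (hv : Reg S j v) :
    Reg S j (fun s => u s + v s) := by
  induction j generalizing u v with
  | zero => exact IsFlatCurve.add hu hv
  | succ j ih =>
    obtain ⟨c, w, hc, hw, e⟩ := hu
    obtain ⟨c', w', hc', hw', e'⟩ := hv
    refine ⟨_, _, hc.add hc', ih hw hw', fun s hs => ?_⟩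
    change u s + v s = _
    rw [e s hs, e' s hs, map_add, map_add]; abel

theorem Reg.smul {j : ℕ} {u : ℝ → C(J, ℂ)} (hu : Reg S j u) {p : ℝ → ℂ}
    (hp : ContDiffOn ℝ ∞ p (Iio S)) : Reg S j (fun s => p s • u s) := by
  induction j generalizing u with
  | zero => exact IsFlatCurve.smul hu hp
  | succ j ih =>
    obtain ⟨c, w, hc, hw, e⟩ := hu
    refine ⟨_, _, hc.smul hp, ih hw, fun s hs => ?_⟩
    change p s • u s = _
    rw [e s hs, map_smul, map_smul]
    exact smul_add (p s) (KerrAdS.constC (c s)) (primC (w s))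

theorem Reg.sub {j : ℕ} {u v : ℝ → C(J, ℂ)} (hu : Reg S j u) (hv : Reg S j v) :
    Reg S j (fun s => u s - v s) := by
  induction j generalizing u v with
  | zero => exact IsFlatCurve.sub hu hv
  | succ j ih =>
    obtain ⟨c, w, hc, hw, e⟩ := hu
    obtain ⟨c', w', hc', hw', e'⟩ := hv
    refine ⟨_, _, hc.sub hc', ih hw hw', fun s hs => ?_⟩
    change u s - v s = _
    rw [e s hs, e' s hs, map_sub, map_sub]; abel

theorem Reg.deriv (hS : 0 < S) {j : ℕ} {u : ℝ → C(J, ℂ)} (hu : Reg S j u) :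
    Reg S j (deriv u) := by
  induction j generalizing u with
  | zero => exact IsFlatCurve.deriv hS hu
  | succ j ih =>
    obtain ⟨c, w, hc, hw, e⟩ := hu
    refine ⟨_, _, hc.deriv hS, ih hw, fun s hs => ?_⟩
    have h1 := (differentiableAt_of_Iio (hc.clm constC).1 hs).hasDerivAt.add
      (differentiableAt_of_Iio ((hw.flat hS).clm primC).1 hs).hasDerivAt
    rw [← deriv_clm hc.1 constC hs, ← deriv_clm (hw.flat hS).1 primC hs]
    exact (h1.congr_of_eventuallyEq
      (Filter.eventuallyEq_of_mem (Iio_mem_nhds hs) fun t ht => e t ht)).deriv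

theorem Reg.constC (j : ℕ) {c : ℝ → ℂ} (hc : IsFlatCurve S c) :
    Reg S j (fun s => constC (c s)) := by
  cases j with
  | zero => exact hc.clm _
  | succ j =>
    have h0 : ∀ i, Reg S i (fun _ => (0 : C(J, ℂ))) := fun i => by
      induction i with
      | zero => exact ⟨contDiffOn_const, fun _ _ => rfl⟩
      | succ i ih => exact ⟨0, _, ⟨contDiffOn_const, fun _ _ => rfl⟩, ih, fun s _ => by simp⟩
    exact ⟨c, _, hc, h0 j, fun s _ => by simp⟩

/-- Evaluation at a point of `[-1, 1]`. -/
def evC (z : J) : C(J, ℂ) →L[ℂ] ℂ := ContinuousMap.evalCLM ℂ z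

theorem evC_apply (z : J) (g : C(J, ℂ)) : evC z g = ex g z := (ex_coe g z).symm

theorem uniqueDiffOn_J : UniqueDiffOn ℝ J := uniqueDiffOn_Icc (by norm_num)

theorem Reg.mul (hS : 0 < S) {j : ℕ} {u : ℝ → C(J, ℂ)} (hu : Reg S j u) {φ : ℝ → ℂ}
    (hφ : ContDiffOn ℝ ∞ φ J) : Reg S j (fun s => mkC φ hφ.continuousOn * u s) := by
  induction j generalizing u φ with
  | zero =>
    exact IsFlatCurve.clm hu (ContinuousLinearMap.mul ℂ C(J, ℂ) (mkC φ hφ.continuousOn))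
  | succ j ih =>
    have hu' := hu.of_succ hS
    have huf := hu.flat hS
    obtain ⟨c, w, hc, hw, e⟩ := hu
    have hφ' : ContDiffOn ℝ ∞ (derivWithin φ J) J := hφ.derivWithin uniqueDiffOn_J (by simp)
    refine ⟨_, _, (huf.clm (ContinuousLinearMap.mul ℂ C(J, ℂ) (mkC φ hφ.continuousOn))).clm
      (evC ⟨0, zero_mem_J⟩), (ih hu' hφ').add (ih hw hφ), fun s hs => ?_⟩
    rw [evC_apply]
    refine eq_const_add_primC fun z hz => ?_
    have hzJ : z ∈ J := ⟨hz.1.le, hz.2.le⟩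
    have hJ : J ∈ 𝓝 z := Icc_mem_nhds hz.1 hz.2
    have h1 : HasDerivAt φ (derivWithin φ J z) z :=
      ((hφ.differentiableOn (by simp)) z hzJ).hasDerivWithinAt.hasDerivAt hJ
    have h2 := hasDerivAt_of_const_add_primC (e s hs) hz
    have h3 := h1.mul h2
    simp only [ex_add, ex_mul, ex_mkC _ hzJ]
    refine h3.congr_of_eventuallyEq ?_
    filter_upwards [hJ] with y hy
    change ex (mkC φ hφ.continuousOn * u s) y = φ y * ex (u s) y
    rw [ex_mul, ex_mkC _ hy]

theorem Reg.hardyC (ha : |a| < 1) (hS : 0 < S) {j : ℕ} {u : ℝ → C(J, ℂ)} (hu : Reg S j u)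
    (k l : ℕ) : Reg S j (fun s => hardyC ha k l (u s)) := by
  induction j generalizing u k l with
  | zero => exact IsFlatCurve.clm hu _
  | succ j ih =>
    have hu' := hu.of_succ hS
    have huf := hu.flat hS
    obtain ⟨c, w, hc, hw, e⟩ := hu
    have hφ : ContDiffOn ℝ ∞ (fun z => (wtcD a k l z : ℂ)) J :=
      (Complex.ofRealCLM.contDiff.comp (contDiff_wtcD k l)).contDiffOn
    refine ⟨_, _, (huf.clm (KerrAdS.hardyC ha k l)).clm (evC ⟨0, zero_mem_J⟩),
      ih (hw.add ((ih hu' k l).mul hS hφ)) (k + 1) (l + 1), fun s hs => ?_⟩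
    rw [evC_apply]
    have := hardyC_const_add_primC ha k l (c s) (w s)
    rw [← e s hs] at this
    exact this

theorem Reg.kC (ha : |a| < 1) (hS : 0 < S) (n : ℕ) {j : ℕ} {u : ℝ → C(J, ℂ)} (hu : Reg S j u) :
    Reg S (j + 1) (fun s => kC ha n (u s)) := by
  have huf := hu.flat hS
  refine ⟨fun s => meanC ha n 0 (u s)
    - meanC ha n 0 (primC (KerrAdS.hardyC ha n 0 (u s))), _,
    (huf.clm (meanC ha n 0)).sub (((huf.clm (KerrAdS.hardyC ha n 0)).clm primC).clm (meanC ha n 0)),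
    hu.hardyC ha hS n 0, fun s _ => kC_apply ha n _⟩

/-- A solution of the wave equation is as regular as its source. -/
theorem reg_of_waveRHS (ha : |a| < 1) (hS : 0 < S) (n : ℕ) {φ : ℝ → ℂ} (hφ : ContDiffOn ℝ ∞ φ J)
    {κ : ℝ → ℝ} {b q : ℝ → ℂ} {f u g : ℝ → C(J, ℂ)} (hκ : ContDiffOn ℝ ∞ κ (Iio S))
    (hb : ContDiffOn ℝ ∞ b (Iio S)) (hq : ContDiffOn ℝ ∞ q (Iio S)) (hf : ∀ j, Reg S j f)
    (hu : IsFlatCurve S u)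
    (h : ∀ s < S, u s = KerrAdS.kC ha n (g s) ∧
      g s = waveRHS κ b q (potC ha n (mkC φ hφ.continuousOn)) f u s) (j : ℕ) : Reg S j u := by
  induction j with
  | zero => exact hu
  | succ j ih =>
    have h1 := ih.deriv hS
    have h2 := (hf j).sub (((((h1.deriv hS).smul (contDiffOn_ofReal (contDiffOn_id.mul hκ))).add
      (h1.smul hb)).add (ih.smul hq)).add
        ((ih.mul hS hφ).sub (Reg.constC j (hu.clm (meanC ha n 0)))))
    -- `g` involves only derivatives in `s`, which cost no regularity in `z`
    have hg : Reg S j g := h2.congr hS fun s hs => (h s hs).2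
    exact (hg.kC ha hS n).congr hS fun s hs => (h s hs).1

/-- The region in the `(s, z)` plane. -/
abbrev dom (S : ℝ) : Set (ℝ × ℝ) := Iio S ×ˢ J

theorem uniqueDiffOn_dom : UniqueDiffOn ℝ (dom S) := isOpen_Iio.uniqueDiffOn.prod uniqueDiffOn_J

/-- The derivative of a curve of functions, as a function of two variables. -/
theorem hasFDerivWithinAt_curve {u w : ℝ → C(J, ℂ)} {c : ℝ → ℂ} (hu : ContDiffOn ℝ ∞ u (Iio S))
    (h : ∀ s < S, u s = constC (c s) + primC (w s)) {p : ℝ × ℝ} (hp : p ∈ dom S) :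
    HasFDerivWithinAt (fun p : ℝ × ℝ => ex (u p.1) p.2)
      ((ContinuousLinearMap.fst ℝ ℝ ℝ).smulRight (ex (deriv u p.1) p.2)
        + (ContinuousLinearMap.snd ℝ ℝ ℝ).smulRight (ex (w p.1) p.2)) (dom S) p := by
  obtain ⟨s, z⟩ := p
  have hs : s < S := hp.1
  have hz : z ∈ J := hp.2
  have hfst : (fun p : ℝ × ℝ => p.1 - s) =O[𝓝[dom S] (s, z)] fun p => p - (s, z) :=
    Asymptotics.IsBigO.of_bound 1 (Eventually.of_forall fun p => by
      rw [one_mul]; exact norm_fst_le (p - (s, z)))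
  have hsnd : (fun p : ℝ × ℝ => p.2 - z) =O[𝓝[dom S] (s, z)] fun p => p - (s, z) :=
    Asymptotics.IsBigO.of_bound 1 (Eventually.of_forall fun p => by
      rw [one_mul]; exact norm_snd_le (p - (s, z)))
  have tfst : Tendsto (fun p : ℝ × ℝ => p.1) (𝓝[dom S] (s, z)) (𝓝 s) :=
    continuous_fst.continuousAt.mono_left nhdsWithin_le_nhds
  have tsnd : Tendsto (fun p : ℝ × ℝ => p.2) (𝓝[dom S] (s, z)) (𝓝[J] z) :=
    tendsto_nhdsWithin_iff.2 ⟨continuous_snd.continuousAt.mono_left nhdsWithin_le_nhds,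
      eventually_nhdsWithin_of_forall fun p hp => hp.2⟩
  have hA : (fun p : ℝ × ℝ => ex (u p.1 - u s - (p.1 - s) • deriv u s) p.2)
      =o[𝓝[dom S] (s, z)] fun p => p - (s, z) := by
    have h1 := (hasDerivAt_iff_isLittleO.1 (differentiableAt_of_Iio hu hs).hasDerivAt)
    refine (Asymptotics.IsBigO.of_bound 1 (Eventually.of_forall fun p => ?_)).trans_isLittleO
      ((h1.comp_tendsto tfst).trans_isBigO hfst)
    rw [one_mul]
    exact norm_ex_le _ _
  have hB : (fun p : ℝ × ℝ => (p.1 - s) • (ex (deriv u s) p.2 - ex (deriv u s) z))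
      =o[𝓝[dom S] (s, z)] fun p => p - (s, z) := by
    have h1 : (fun p : ℝ × ℝ => ex (deriv u s) p.2 - ex (deriv u s) z)
        =o[𝓝[dom S] (s, z)] fun _ => (1 : ℝ) := by
      rw [Asymptotics.isLittleO_one_iff]
      have := ((continuous_ex (deriv u s)).tendsto z).comp
        (continuous_snd.continuousAt.mono_left nhdsWithin_le_nhds :
          Tendsto (fun p : ℝ × ℝ => p.2) (𝓝[dom S] (s, z)) (𝓝 z))
      simpa using this.sub_const (ex (deriv u s) z)
    have h2 := (Asymptotics.isBigO_refl (fun p : ℝ × ℝ => p.1 - s)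
      (𝓝[dom S] (s, z))).smul_isLittleO h1
    simp only [smul_eq_mul, mul_one] at h2
    exact h2.trans_isBigO hfst
  have hC : (fun p : ℝ × ℝ => ex (u s) p.2 - ex (u s) z - (p.2 - z) • ex (w s) z)
      =o[𝓝[dom S] (s, z)] fun p => p - (s, z) := by
    have h1 : HasDerivWithinAt (ex (u s)) (ex (w s) z) J z := by
      have h2 : HasDerivAt (fun z => c s + ∫ y in (0 : ℝ)..z, ex (w s) y) (ex (w s) z) z :=
        (intervalIntegral.integral_hasDerivAt_right ((continuous_ex _).intervalIntegrable _ _)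
          ((continuous_ex _).stronglyMeasurableAtFilter _ _)
          (continuous_ex _).continuousAt).const_add _
      refine h2.hasDerivWithinAt.congr (fun y hy => ?_) ?_
      · rw [h s hs, ex_add, ex_constC, ex_primC _ hy]
      · rw [h s hs, ex_add, ex_constC, ex_primC _ hz]
    exact ((hasDerivWithinAt_iff_isLittleO.1 h1).comp_tendsto tsnd).trans_isBigO hsnd
  rw [hasFDerivWithinAt_iff_isLittleO]
  refine ((hA.add hB).add hC).congr_left fun p => ?_
  have e : ex (u p.1 - u s - (p.1 - s) • deriv u s) p.2
      = ex (u p.1) p.2 - ex (u s) p.2 - (p.1 - s) • ex (deriv u s) p.2 := rfl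
  simp only [e, add_apply, ContinuousLinearMap.smulRight_apply, ContinuousLinearMap.coe_fst',
    ContinuousLinearMap.coe_snd', Prod.fst_sub, Prod.snd_sub, smul_sub]
  abel

theorem exists_reg_angular_deriv {u : ℝ → C(J, ℂ)} (hS : 0 < S) (hu : ∀ j, Reg S j u) :
    ∃ (c : ℝ → ℂ) (w : ℝ → C(J, ℂ)), (∀ j, Reg S j w) ∧
      ∀ s < S, u s = constC (c s) + primC (w s) := by
  obtain ⟨c, w, -, -, e⟩ := hu 1
  refine ⟨c, w, fun j => ?_, e⟩
  obtain ⟨c', w', -, hw', e'⟩ := hu (j + 1)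
  refine hw'.congr hS fun s hs => ext_ex_Ioo fun z hz => ?_
  exact (hasDerivAt_of_const_add_primC (e s hs) hz).unique
    (hasDerivAt_of_const_add_primC (e' s hs) hz)

/-- A curve of functions that is regular to every order is a smooth function of both variables: its
partial derivatives are of the same kind. -/
theorem contDiffOn_of_reg {u : ℝ → C(J, ℂ)} (hS : 0 < S) (hu : ∀ j, Reg S j u) :
    ContDiffOn ℝ ∞ (fun p : ℝ × ℝ => ex (u p.1) p.2) (dom S) := by
  rw [contDiffOn_infty]
  intro k
  induction k generalizing u with
  | zero =>
    obtain ⟨c, w, -, e⟩ := exists_reg_angular_deriv hS hu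
    rw [Nat.cast_zero, contDiffOn_zero]
    exact fun p hp => (hasFDerivWithinAt_curve (hu 0).1 e hp).continuousWithinAt
  | succ k ih =>
    obtain ⟨c, w, hw, e⟩ := exists_reg_angular_deriv hS hu
    rw [Nat.cast_succ, contDiffOn_succ_iff_hasFDerivWithinAt_of_uniqueDiffOn uniqueDiffOn_dom]
    refine ⟨by simp, _, ?_, fun p hp => hasFDerivWithinAt_curve (hu 0).1 e hp⟩
    exact (contDiffOn_const.smulRight (ih fun j => (hu j).deriv hS)).add
      (contDiffOn_const.smulRight (ih hw))

end Reg

/-! ### The reduced equation in two variables -/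

section Reduced

variable {a : ℝ} {S : ℝ}

/-- The partial derivative in the first variable. -/
def dS (S : ℝ) (F : ℝ × ℝ → ℂ) (p : ℝ × ℝ) : ℂ := fderivWithin ℝ F (dom S) p (1, 0)

/-- The partial derivative in the second variable. -/
def dZ (S : ℝ) (F : ℝ × ℝ → ℂ) (p : ℝ × ℝ) : ℂ := fderivWithin ℝ F (dom S) p (0, 1)

theorem contDiffOn_dS {F : ℝ × ℝ → ℂ} (hF : ContDiffOn ℝ ∞ F (dom S)) :
    ContDiffOn ℝ ∞ (dS S F) (dom S) :=
  (hF.fderivWithin uniqueDiffOn_dom (by simp)).clm_apply contDiffOn_const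

theorem contDiffOn_dZ {F : ℝ × ℝ → ℂ} (hF : ContDiffOn ℝ ∞ F (dom S)) :
    ContDiffOn ℝ ∞ (dZ S F) (dom S) :=
  (hF.fderivWithin uniqueDiffOn_dom (by simp)).clm_apply contDiffOn_const

theorem hasFDerivWithinAt_dom {F : ℝ × ℝ → ℂ} (hF : ContDiffOn ℝ ∞ F (dom S)) {p : ℝ × ℝ}
    (hp : p ∈ dom S) : HasFDerivWithinAt F (fderivWithin ℝ F (dom S) p) (dom S) p :=
  (hF.differentiableOn (by simp) p hp).hasFDerivWithinAt

theorem hasDerivAt_dS {F : ℝ × ℝ → ℂ} (hF : ContDiffOn ℝ ∞ F (dom S)) {s z : ℝ} (hs : s < S)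
    (hz : z ∈ J) : HasDerivAt (fun t => F (t, z)) (dS S F (s, z)) s := by
  have h1 : HasDerivWithinAt (fun t : ℝ => (t, z)) ((1, 0) : ℝ × ℝ) (Iio S) s :=
    ((hasDerivAt_id s).prodMk (hasDerivAt_const s z)).hasDerivWithinAt
  have h2 : MapsTo (fun t : ℝ => (t, z)) (Iio S) (dom S) := fun t ht => ⟨ht, hz⟩
  exact ((hasFDerivWithinAt_dom hF (p := (s, z)) ⟨hs, hz⟩).comp_hasDerivWithinAt s h1
    h2).hasDerivAt (Iio_mem_nhds hs)

theorem hasDerivWithinAt_dZ {F : ℝ × ℝ → ℂ} (hF : ContDiffOn ℝ ∞ F (dom S)) {s z : ℝ} (hs : s < S)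
    (hz : z ∈ J) : HasDerivWithinAt (fun y => F (s, y)) (dZ S F (s, z)) J z := by
  have h1 : HasDerivWithinAt (fun y : ℝ => (s, y)) ((0, 1) : ℝ × ℝ) J z :=
    ((hasDerivAt_const z s).prodMk (hasDerivAt_id z)).hasDerivWithinAt
  have h2 : MapsTo (fun y : ℝ => (s, y)) J (dom S) := fun t ht => ⟨hs, ht⟩
  exact (hasFDerivWithinAt_dom hF (p := (s, z)) ⟨hs, hz⟩).comp_hasDerivWithinAt z h1 h2

theorem hasDerivAt_dZ {F : ℝ × ℝ → ℂ} (hF : ContDiffOn ℝ ∞ F (dom S)) {s z : ℝ} (hs : s < S)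
    (hz : z ∈ Ioo (-1 : ℝ) 1) : HasDerivAt (fun y => F (s, y)) (dZ S F (s, z)) z :=
  (hasDerivWithinAt_dZ hF hs ⟨hz.1.le, hz.2.le⟩).hasDerivAt (Icc_mem_nhds hz.1 hz.2)

theorem dS_congr {F G : ℝ × ℝ → ℂ} (h : EqOn F G (dom S)) : EqOn (dS S F) (dS S G) (dom S) :=
  fun p hp => by rw [dS, dS, fderivWithin_congr h (h hp)]

theorem dZ_congr {F G : ℝ × ℝ → ℂ} (h : EqOn F G (dom S)) : EqOn (dZ S F) (dZ S G) (dom S) :=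
  fun p hp => by rw [dZ, dZ, fderivWithin_congr h (h hp)]

open Classical in
/-- A function of two variables as a curve of continuous functions. -/
def crv (F : ℝ × ℝ → ℂ) (s : ℝ) : C(J, ℂ) :=
  if h : ContinuousOn (fun z => F (s, z)) J then mkC _ h else 0

theorem ex_crv {F : ℝ × ℝ → ℂ} (hF : ContinuousOn F (dom S)) {s z : ℝ} (hs : s < S) (hz : z ∈ J) :
    ex (crv F s) z = F (s, z) := by
  have h : ContinuousOn (fun z => F (s, z)) J :=
    hF.comp (by fun_prop) fun y hy => ⟨hs, hy⟩
  rw [crv, dif_pos h, ex_mkC _ hz]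

theorem continuousOn_crv {F : ℝ × ℝ → ℂ} (hF : ContinuousOn F (dom S)) :
    ContinuousOn (crv F) (Iio S) := by
  rw [continuousOn_iff_continuous_domRestrict]
  let G : C(Iio S × J, ℂ) := ⟨fun p => F (p.1, p.2), hF.comp_continuous (by fun_prop)
    fun p => ⟨p.1.2, p.2.2⟩⟩
  refine G.curry.continuous.congr fun s => ext_ex fun z hz => ?_
  rw [ex_of_mem _ hz]
  exact (ex_crv hF s.2 hz).symm

theorem hasDerivAt_crv {F : ℝ × ℝ → ℂ} (hF : ContDiffOn ℝ ∞ F (dom S)) {s : ℝ} (hs : s < S) :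
    HasDerivAt (crv F) (crv (dS S F) s) s := by
  have hd := continuousOn_crv (contDiffOn_dS hF).continuousOn
  have hsub : ∀ t < S, uIcc s t ⊆ Iio S := fun t ht => ordConnected_Iio.uIcc_subset hs ht
  have hint : ∀ t < S, IntervalIntegrable (crv (dS S F)) MeasureTheory.volume s t := fun t ht =>
    (hd.mono (hsub t ht)).intervalIntegrable
  have h1 : HasDerivAt (fun t => crv F s + ∫ x in s..t, crv (dS S F) x) (crv (dS S F) s) s :=
    (intervalIntegral.integral_hasDerivAt_right (hint s hs)
      (hd.stronglyMeasurableAtFilter isOpen_Iio s hs)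
      (hd.continuousAt (Iio_mem_nhds hs))).const_add _
  refine h1.congr_of_eventuallyEq ?_
  filter_upwards [Iio_mem_nhds hs] with t ht
  refine ext_ex fun z hz => ?_
  have h2 := (evC ⟨z, hz⟩).intervalIntegral_comp_comm (hint t ht)
  simp only [evC_apply] at h2
  rw [ex_add, ← h2, ex_crv hF.continuousOn ht hz, ex_crv hF.continuousOn hs hz,
    intervalIntegral.integral_congr (g := fun x => dS S F (x, z)) fun x hx =>
      ex_crv (contDiffOn_dS hF).continuousOn (hsub t ht hx) hz,
    intervalIntegral.integral_eq_sub_of_hasDerivAt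
      (fun x hx => hasDerivAt_dS hF (hsub t ht hx) hz)]
  · ring
  · refine ContinuousOn.intervalIntegrable ?_
    exact (contDiffOn_dS hF).continuousOn.comp (by fun_prop) fun x hx => ⟨hsub t ht hx, hz⟩

theorem deriv_crv {F : ℝ × ℝ → ℂ} (hF : ContDiffOn ℝ ∞ F (dom S)) {s : ℝ} (hs : s < S) :
    deriv (crv F) s = crv (dS S F) s := (hasDerivAt_crv hF hs).deriv

theorem contDiffOn_crv {F : ℝ × ℝ → ℂ} (hF : ContDiffOn ℝ ∞ F (dom S)) :
    ContDiffOn ℝ ∞ (crv F) (Iio S) := by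
  rw [contDiffOn_infty]
  intro k
  induction k generalizing F with
  | zero => rw [Nat.cast_zero, contDiffOn_zero]; exact continuousOn_crv hF.continuousOn
  | succ k ih =>
    rw [Nat.cast_succ, contDiffOn_succ_iff_deriv_of_isOpen isOpen_Iio]
    exact ⟨fun s hs => (hasDerivAt_crv hF hs).differentiableAt.differentiableWithinAt, by simp,
      (ih (contDiffOn_dS hF)).congr fun s hs => deriv_crv hF hs⟩

theorem crv_eq_const_add_primC {F : ℝ × ℝ → ℂ} (hF : ContDiffOn ℝ ∞ F (dom S)) {s : ℝ}
    (hs : s < S) : crv F s = constC (F (s, 0)) + primC (crv (dZ S F) s) := by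
  rw [← ex_crv hF.continuousOn hs zero_mem_J]
  refine eq_const_add_primC fun z hz => ?_
  rw [ex_crv (contDiffOn_dZ hF).continuousOn hs ⟨hz.1.le, hz.2.le⟩]
  refine (hasDerivAt_dZ hF hs hz).congr_of_eventuallyEq ?_
  filter_upwards [Icc_mem_nhds hz.1 hz.2] with y hy
  exact ex_crv hF.continuousOn hs hy

theorem isFlatCurve_crv (hS : 0 < S) {F : ℝ × ℝ → ℂ} (hF : ContDiffOn ℝ ∞ F (dom S))
    (h0 : ∀ s ≤ 0, ∀ z ∈ J, F (s, z) = 0) : IsFlatCurve S (crv F) :=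
  ⟨contDiffOn_crv hF, fun s hs => ext_ex fun z hz => by
    rw [ex_crv hF.continuousOn (hs.trans_lt hS) hz, h0 s hs z hz]; rfl⟩

theorem dZ_eq_zero (hS : 0 < S) {F : ℝ × ℝ → ℂ} (hF : ContDiffOn ℝ ∞ F (dom S))
    (h0 : ∀ s ≤ 0, ∀ z ∈ J, F (s, z) = 0) : ∀ s ≤ 0, ∀ z ∈ J, dZ S F (s, z) = 0 := fun s hs z hz =>
  (uniqueDiffOn_J z hz).eq_deriv _ (hasDerivWithinAt_dZ hF (hs.trans_lt hS) hz)
    ((hasDerivWithinAt_const z J (0 : ℂ)).congr (fun y hy => h0 s hs y hy) (h0 s hs z hz))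

theorem reg_crv (hS : 0 < S) {F : ℝ × ℝ → ℂ} (hF : ContDiffOn ℝ ∞ F (dom S))
    (h0 : ∀ s ≤ 0, ∀ z ∈ J, F (s, z) = 0) (j : ℕ) : Reg S j (crv F) := by
  induction j generalizing F with
  | zero => exact isFlatCurve_crv hS hF h0
  | succ j ih =>
    refine ⟨fun s => F (s, 0), crv (dZ S F), ?_, ih (contDiffOn_dZ hF) (dZ_eq_zero hS hF h0),
      fun s hs => crv_eq_const_add_primC hF hs⟩
    exact ((isFlatCurve_crv hS hF h0).clm (evC ⟨0, zero_mem_J⟩)).congr hS fun s hs => by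
      rw [evC_apply, ex_crv hF.continuousOn hs zero_mem_J]

/-- The reduced wave operator in the variables `s` and `z`. -/
def redOp (a : ℝ) (n : ℕ) (S : ℝ) (κ : ℝ → ℝ) (b q φ : ℝ → ℂ) (W : ℝ × ℝ → ℂ) (p : ℝ × ℝ) : ℂ :=
  ((p.1 * κ p.1 : ℝ) : ℂ) * dS S (dS S W) p + b p.1 * dS S W p + q p.1 * W p + φ p.2 * W p
    - ((wtc a n 0 p.2 : ℂ) * dZ S W p + (wt a 1 1 p.2 : ℂ) * dZ S (dZ S W) p)

theorem wt_succ_succ (n : ℕ) (z : ℝ) : wt a (n + 1) 1 z = wt a n 0 z * wt a 1 1 z := by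
  simp only [wt]; ring

/-- Existence for the reduced equation with a source that vanishes for `s ≤ 0`. -/
theorem exists_reduced_solution (ha : |a| < 1) (n : ℕ) (hS : 0 < S) {κ : ℝ → ℝ} {b q φ : ℝ → ℂ}
    {F : ℝ × ℝ → ℂ} (hκ : ContDiffOn ℝ ∞ κ (Iio S)) (hκ0 : ∀ s < S, 0 < κ s)
    (hb : ContDiffOn ℝ ∞ b (Iio S)) (hq : ContDiffOn ℝ ∞ q (Iio S)) (hφ : ContDiffOn ℝ ∞ φ J)
    (hF : ContDiffOn ℝ ∞ F (dom S)) (hF0 : ∀ s ≤ 0, ∀ z ∈ J, F (s, z) = 0) :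
    ∃ W : ℝ × ℝ → ℂ, ContDiffOn ℝ ∞ W (dom S) ∧ (∀ s ≤ 0, ∀ z ∈ J, W (s, z) = 0) ∧
      ∀ p ∈ Iio S ×ˢ Ioo (-1 : ℝ) 1, redOp a n S κ b q φ W p = F p := by
  obtain ⟨u, g, hu, -, hug⟩ := exists_wave_solution_continuous ha n (mkC φ hφ.continuousOn) hS hκ
    hκ0 hb hq (isFlatCurve_crv hS hF hF0)
  have hreg := reg_of_waveRHS ha hS n hφ hκ hb hq (reg_crv hS hF hF0) hu hug
  set W : ℝ × ℝ → ℂ := fun p => ex (u p.1) p.2 with hWdef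
  have hW : ContDiffOn ℝ ∞ W (dom S) := contDiffOn_of_reg hS hreg
  refine ⟨W, hW, fun s hs z _ => by simp only [hWdef, hu.2 s hs]; rfl, ?_⟩
  have hdS : ∀ {v : ℝ → C(J, ℂ)}, (∀ j, Reg S j v) →
      EqOn (dS S fun p => ex (v p.1) p.2) (fun p => ex (deriv v p.1) p.2) (dom S) := by
    intro v hv p hp
    obtain ⟨c, w, -, e⟩ := exists_reg_angular_deriv hS hv
    rw [dS, (hasFDerivWithinAt_curve (hv 0).1 e hp).fderivWithin (uniqueDiffOn_dom p hp)]
    simp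
  rintro ⟨s, z⟩ ⟨hs, hz⟩
  have hzJ : z ∈ J := ⟨hz.1.le, hz.2.le⟩
  have hp : (s, z) ∈ dom S := ⟨hs, hzJ⟩
  have e1 : dS S W (s, z) = ex (deriv u s) z := hdS hreg hp
  have e2 : dS S (dS S W) (s, z) = ex (deriv (deriv u) s) z :=
    (dS_congr (hdS hreg) hp).trans (hdS (fun j => (hreg j).deriv hS) hp)
  -- the angular derivative is given by the Hardy operator
  have e3 : ∀ y ∈ Ioo (-1 : ℝ) 1, dZ S W (s, y) = ex (hardyC ha n 0 (g s)) y := fun y hy => by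
    have h1 := hasDerivAt_kC ha n (g s) hy
    rw [← (hug s hs).1] at h1
    exact (hasDerivAt_dZ hW hs hy).unique h1
  -- the flux identity of the Hardy operator, divided by the weight, recovers the angular operator
  have e4 : (wtc a n 0 z : ℂ) * dZ S W (s, z) + (wt a 1 1 z : ℂ) * dZ S (dZ S W) (s, z)
      = -(ex (g s) z - meanC ha n 0 (g s)) := by
    have h1 := (hasDerivAt_wtC (a := a) n 0 z).mul (hasDerivAt_dZ (contDiffOn_dZ hW) hs hz)
    have h2 := hasDerivAt_wt_mul_hardyC ha n 0 (g s) hz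
    have h3 := h1.unique (h2.congr_of_eventuallyEq (by
      filter_upwards [Ioo_mem_nhds hz.1 hz.2] with y hy
      simp only [Pi.mul_apply, e3 y hy]))
    rw [wt_succ_succ] at h3
    push_cast at h3
    refine mul_left_cancel₀ (wtC_ne_zero ha n 0 hz) ?_
    linear_combination h3
  -- `K` preserves means, so the mean added to the angular operator cancels the one in the potential
  have e5 : meanC ha n 0 (g s) = meanC ha n 0 (u s) := by rw [(hug s hs).1, meanC_kC]
  have e6 := congrArg (fun v => ex v z) (hug s hs).2
  simp only [waveRHS, ex_sub, ex_add, ex_smul, potC_apply, ex_mul, ex_mkC _ hzJ, ex_constC,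
    ex_crv hF.continuousOn hs hzJ] at e6
  rw [redOp]
  simp only
  rw [e4, e1, e2, e5, e6]
  simp only [hWdef]
  ring

/-- Uniqueness for the reduced equation among smooth functions that vanish for `s ≤ 0`. -/
theorem eq_zero_of_reduced (ha : |a| < 1) (n : ℕ) (hS : 0 < S) {κ : ℝ → ℝ} {b q φ : ℝ → ℂ}
    {W : ℝ × ℝ → ℂ} (hκ : ContDiffOn ℝ ∞ κ (Iio S)) (hκ0 : ∀ s < S, 0 < κ s)
    (hb : ContDiffOn ℝ ∞ b (Iio S)) (hq : ContDiffOn ℝ ∞ q (Iio S)) (hφ : ContDiffOn ℝ ∞ φ J)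
    (hW : ContDiffOn ℝ ∞ W (dom S)) (hW0 : ∀ s ≤ 0, ∀ z ∈ J, W (s, z) = 0)
    (h : ∀ p ∈ Iio S ×ˢ Ioo (-1 : ℝ) 1, redOp a n S κ b q φ W p = 0) :
    ∀ p ∈ dom S, W p = 0 := by
  have hu := isFlatCurve_crv hS hW hW0
  have hZ := contDiffOn_dZ hW
  have hZ0 := dZ_eq_zero hS hW hW0
  have hZZ := contDiffOn_dZ hZ
  have hZZ0 := dZ_eq_zero hS hZ hZ0
  -- the angular operator applied to `W`, with the weight cancelled so that it is continuous at the poles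
  set A : C(J, ℂ) := mulC (wtc a n 0) (continuous_wtc a n 0)
  set B : C(J, ℂ) := mulC (wt a 1 1) (continuous_wt a 1 1)
  set y : ℝ → C(J, ℂ) := fun s => A * crv (dZ S W) s + B * crv (dZ S (dZ S W)) s with hy
  have hyf : IsFlatCurve S y := ((isFlatCurve_crv hS hZ hZ0).clm (ContinuousLinearMap.mul ℂ _ A)).add
    ((isFlatCurve_crv hS hZZ hZZ0).clm (ContinuousLinearMap.mul ℂ _ B))
  set g : ℝ → C(J, ℂ) := fun s => constC (meanC ha n 0 (crv W s)) - y s with hg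
  have hgf : IsFlatCurve S g := ((hu.clm (meanC ha n 0)).clm constC).sub hyf
  have key := wave_unique_continuous ha n (mkC φ hφ.continuousOn) hS hκ hκ0 hb hq hu hgf
    fun s hs => by
      constructor
      · have h1 := kC_of_hasDerivAt ha n (d := crv W s) (v := crv (dZ S W) s) (y := -y s)
          (fun z hz => hasDerivAt_of_const_add_primC (crv_eq_const_add_primC hW hs) hz)
          fun z hz => by
            have hzJ : z ∈ J := ⟨hz.1.le, hz.2.le⟩
            have h2 := (hasDerivAt_wtC (a := a) n 0 z).mul
              (hasDerivAt_of_const_add_primC (crv_eq_const_add_primC hZ hs) hz)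
            refine h2.congr_deriv ?_
            have e : ex (-y s) z = -((wtc a n 0 z : ℂ) * ex (crv (dZ S W) s) z
                + (wt a 1 1 z : ℂ) * ex (crv (dZ S (dZ S W)) s) z) := by
              rw [← ex_mulC (continuous_wtc a n 0) hzJ, ← ex_mulC (continuous_wt a 1 1) hzJ]; rfl
            rw [e, wt_succ_succ]
            push_cast
            ring
        refine h1.symm.trans (congrArg (kC ha n) ?_)
        simp only [hg]
        abel
      · refine ext_ex_Ioo fun z hz => ?_
        have hzJ : z ∈ J := ⟨hz.1.le, hz.2.le⟩
        have h1 := h (s, z) ⟨hs, hz⟩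
        have h2 : deriv (deriv (crv W)) s = crv (dS S (dS S W)) s := by
          rw [← deriv_crv (contDiffOn_dS hW) hs]
          exact (Filter.eventuallyEq_of_mem (Iio_mem_nhds hs) fun t ht =>
            deriv_crv hW ht).deriv_eq
        rw [redOp] at h1
        simp only at h1
        have e0 : ex ((0 : ℝ → C(J, ℂ)) s) z = 0 := rfl
        simp only [hg, hy, waveRHS, ex_sub, ex_add, ex_smul, potC_apply, ex_mul, ex_mkC _ hzJ,
          ex_constC, h2, deriv_crv hW hs, e0, ex_mulC (continuous_wtc a n 0) hzJ,
          ex_mulC (continuous_wt a 1 1) hzJ, ex_crv hW.continuousOn hs hzJ,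
          ex_crv hZ.continuousOn hs hzJ, ex_crv hZZ.continuousOn hs hzJ,
          ex_crv (contDiffOn_dS hW).continuousOn hs hzJ,
          ex_crv (contDiffOn_dS (contDiffOn_dS hW)).continuousOn hs hzJ, A, B]
        linear_combination h1
  rintro ⟨s, z⟩ ⟨hs, hz⟩
  rw [← ex_crv hW.continuousOn hs hz, key s hs]
  rfl

end Reduced

/-! ### Smooth equivariant functions on the disc -/

section Whitney

/-- Integrals of smooth functions depend smoothly on parameters. -/
theorem contDiffOn_integral {E : Type} [NormedAddCommGroup E] [NormedSpace ℝ E]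
    [FiniteDimensional ℝ E] {F : Type} [NormedAddCommGroup F] [NormedSpace ℝ F] [CompleteSpace F]
    {O : Set (E × ℝ)} (hO : IsOpen O) {s : Set E} (hs : IsOpen s)
    (hsO : ∀ x ∈ s, ∀ t ∈ Icc (0 : ℝ) 1, (x, t) ∈ O) {Φ : E × ℝ → F} (hΦ : ContDiffOn ℝ ∞ Φ O) :
    ContDiffOn ℝ ∞ (fun x => ∫ t in (0 : ℝ)..1, Φ (x, t)) s := by
  have hcont : ∀ {G : Type} [NormedAddCommGroup G] [NormedSpace ℝ G] {Ψ : E × ℝ → G},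
      ContDiffOn ℝ ∞ Ψ O → ∀ x ∈ s, ContinuousOn (fun t => Ψ (x, t)) (uIcc 0 1) :=
    fun hΨ x hx => hΨ.continuousOn.comp (by fun_prop) fun t ht =>
      hsO x hx t (by rwa [uIcc_of_le zero_le_one] at ht)
  have hderiv : ∀ {G : Type} [NormedAddCommGroup G] [NormedSpace ℝ G] [CompleteSpace G]
      {Ψ : E × ℝ → G}, ContDiffOn ℝ ∞ Ψ O → ∀ x ∈ s,
      HasFDerivAt (fun x => ∫ t in (0 : ℝ)..1, Ψ (x, t))
        (∫ t in (0 : ℝ)..1, (fderiv ℝ Ψ (x, t)).comp (ContinuousLinearMap.inl ℝ E ℝ)) x := by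
    intro G _ _ _ Ψ hΨ x hx
    have hΨ' : ContDiffOn ℝ ∞ (fun p => (fderiv ℝ Ψ p).comp (ContinuousLinearMap.inl ℝ E ℝ)) O :=
      (hΨ.fderiv_of_isOpen hO (by simp)).clm_comp contDiffOn_const
    obtain ⟨ε, hε, hball⟩ := Metric.nhds_basis_closedBall.mem_iff.1 (hs.mem_nhds hx)
    obtain ⟨B, hB⟩ := ((isCompact_closedBall x ε).prod (isCompact_Icc (a := (0 : ℝ)) (b := 1)))
      |>.exists_bound_of_continuousOn (hΨ'.continuousOn.mono fun p hp =>
        hsO p.1 (hball hp.1) p.2 hp.2)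
    have hIcc : ∀ t ∈ uIoc (0 : ℝ) 1, t ∈ Icc (0 : ℝ) 1 := fun t ht => by
      rw [uIoc_of_le zero_le_one] at ht; exact ⟨ht.1.le, ht.2⟩
    have hmeas : ∀ {G : Type} [NormedAddCommGroup G] [NormedSpace ℝ G] {Ψ : E × ℝ → G},
        ContDiffOn ℝ ∞ Ψ O → ∀ x ∈ s, MeasureTheory.AEStronglyMeasurable (fun t => Ψ (x, t))
          (MeasureTheory.volume.restrict (uIoc 0 1)) := fun hΨ x hx =>
      ((hcont hΨ x hx).mono uIoc_subset_uIcc).aestronglyMeasurable measurableSet_uIoc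
    refine intervalIntegral.hasFDerivAt_integral_of_dominated_of_fderiv_le
      (F := fun x t => Ψ (x, t)) (bound := fun _ => B)
      (F' := fun x t => (fderiv ℝ Ψ (x, t)).comp (ContinuousLinearMap.inl ℝ E ℝ))
      (Metric.closedBall_mem_nhds x hε) ?_ (hcont hΨ x hx).intervalIntegrable (hmeas hΨ' x hx) ?_
      (continuous_const.intervalIntegrable _ _) ?_
    · filter_upwards [hs.mem_nhds hx] with y hy
      exact hmeas hΨ y hy
    · exact Eventually.of_forall fun t ht y hy => hB (y, t) ⟨hy, hIcc t ht⟩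
    · refine Eventually.of_forall fun t ht y hy => ?_
      have h1 : HasFDerivAt Ψ (fderiv ℝ Ψ (y, t)) (y, t) :=
        ((hΨ.contDiffAt (hO.mem_nhds (hsO y (hball hy) t (hIcc t ht)))).differentiableAt
          (by simp)).hasFDerivAt
      exact h1.comp y (hasFDerivAt_prodMk_left y t)
  rw [contDiffOn_infty]
  intro k
  induction k generalizing F with
  | zero =>
    rw [Nat.cast_zero, contDiffOn_zero]
    exact fun x hx => (hderiv hΦ x hx).continuousAt.continuousWithinAt
  | succ k ih =>
    rw [Nat.cast_succ, contDiffOn_succ_iff_hasFDerivWithinAt_of_uniqueDiffOn hs.uniqueDiffOn]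
    refine ⟨by simp, _, ?_, fun x hx => (hderiv hΦ x hx).hasFDerivWithinAt⟩
    exact ih ((hΦ.fderiv_of_isOpen hO (by simp)).clm_comp contDiffOn_const)

variable {P : Set ℝ}

/-- Parameter dependent functions on an open interval. -/
abbrev strip (P : Set ℝ) : Set (ℝ × ℝ) := Ioo (-1 : ℝ) 1 ×ˢ P

theorem mul_mem_strip {p : ℝ × ℝ} (hp : p ∈ strip P) {t : ℝ} (ht : t ∈ Icc (0 : ℝ) 1) :
    (t * p.1, p.2) ∈ strip P := by
  refine ⟨⟨?_, ?_⟩, hp.2⟩ <;> nlinarith [hp.1.1, hp.1.2, ht.1, ht.2]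

/-- The weighted average along the segment from the axis. -/
theorem contDiffOn_average (hP : IsOpen P) (k : ℕ) {G : ℝ × ℝ → ℂ}
    (hG : ContDiffOn ℝ ∞ G (strip P)) :
    ContDiffOn ℝ ∞ (fun p : ℝ × ℝ => ∫ t in (0 : ℝ)..1, (t : ℂ) ^ k * G (t * p.1, p.2))
      (strip P) := by
  have hmap : ContDiff ℝ ∞ fun q : (ℝ × ℝ) × ℝ => (q.2 * q.1.1, q.1.2) := by fun_prop
  refine contDiffOn_integral (E := ℝ × ℝ) (O := (fun q : (ℝ × ℝ) × ℝ => (q.2 * q.1.1, q.1.2)) ⁻¹' strip P)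
    ((isOpen_Ioo.prod hP).preimage hmap.continuous) (isOpen_Ioo.prod hP)
    (fun p hp t ht => mul_mem_strip hp ht)
    (Φ := fun q : (ℝ × ℝ) × ℝ => (q.2 : ℂ) ^ k * G (q.2 * q.1.1, q.1.2)) ?_
  refine ContDiffOn.mul ?_ (hG.comp hmap.contDiffOn fun q hq => hq)
  exact ((Complex.ofRealCLM.contDiff.comp contDiff_snd).pow k).contDiffOn

/-- Evenness in the first variable. -/
def EvenOn (P : Set ℝ) (G : ℝ × ℝ → ℂ) : Prop := ∀ p ∈ strip P, G (-p.1, p.2) = G p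

theorem neg_mem_strip {p : ℝ × ℝ} (hp : p ∈ strip P) : (-p.1, p.2) ∈ strip P :=
  ⟨⟨by linarith [hp.1.2], by linarith [hp.1.1]⟩, hp.2⟩

theorem EvenOn.average {G : ℝ × ℝ → ℂ} (hG : EvenOn P G) (k : ℕ) :
    EvenOn P (fun p : ℝ × ℝ => ∫ t in (0 : ℝ)..1, (t : ℂ) ^ k * G (t * p.1, p.2)) := fun p hp => by
  refine intervalIntegral.integral_congr fun t ht => ?_
  rw [uIcc_of_le zero_le_one] at ht
  have := hG _ (mul_mem_strip hp ht)
  simp only at this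
  simp only [mul_neg, this]

theorem hasFDerivAt_strip (hP : IsOpen P) {G : ℝ × ℝ → ℂ} (hG : ContDiffOn ℝ ∞ G (strip P))
    {p : ℝ × ℝ} (hp : p ∈ strip P) : HasFDerivAt G (fderiv ℝ G p) p :=
  ((hG.contDiffAt ((isOpen_Ioo.prod hP).mem_nhds hp)).differentiableAt (by simp)).hasFDerivAt

theorem contDiffOn_fderiv_strip (hP : IsOpen P) {G : ℝ × ℝ → ℂ}
    (hG : ContDiffOn ℝ ∞ G (strip P)) (v : ℝ × ℝ) :
    ContDiffOn ℝ ∞ (fun p => fderiv ℝ G p v) (strip P) :=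
  (hG.fderiv_of_isOpen (isOpen_Ioo.prod hP) (by simp)).clm_apply contDiffOn_const

theorem fderiv_neg_of_symm (hP : IsOpen P) {G : ℝ × ℝ → ℂ} (hG : ContDiffOn ℝ ∞ G (strip P))
    {c : ℂ} (h : ∀ p ∈ strip P, G (-p.1, p.2) = c * G p) {p : ℝ × ℝ} (hp : p ∈ strip P)
    (v : ℝ × ℝ) : fderiv ℝ G (-p.1, p.2) (-v.1, v.2) = c * fderiv ℝ G p v := by
  have hL : HasFDerivAt (fun p : ℝ × ℝ => (-p.1, p.2))
      ((-ContinuousLinearMap.fst ℝ ℝ ℝ).prod (ContinuousLinearMap.snd ℝ ℝ ℝ)) p :=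
    ((-ContinuousLinearMap.fst ℝ ℝ ℝ).prod (ContinuousLinearMap.snd ℝ ℝ ℝ)).hasFDerivAt
  have h1 := (hasFDerivAt_strip hP hG (neg_mem_strip hp)).comp p hL
  have h2 := (hasFDerivAt_strip hP hG hp).const_mul c
  have h3 := h1.unique (h2.congr_of_eventuallyEq
    (eventually_of_mem ((isOpen_Ioo.prod hP).mem_nhds hp) h))
  simpa using DFunLike.congr_fun h3 v

theorem EvenOn.fderiv_snd (hP : IsOpen P) {G : ℝ × ℝ → ℂ} (hG : ContDiffOn ℝ ∞ G (strip P))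
    (he : EvenOn P G) : EvenOn P fun p => fderiv ℝ G p (0, 1) := fun p hp => by
  simpa using fderiv_neg_of_symm hP hG (c := 1)
      (fun p hp => by rw [one_mul]; exact he p hp) hp (0, 1)

/-- Division of the radial derivative of an even function by the radius. -/
theorem exists_even_div (hP : IsOpen P) {G : ℝ × ℝ → ℂ} (hG : ContDiffOn ℝ ∞ G (strip P))
    (he : EvenOn P G) : ∃ H : ℝ × ℝ → ℂ, ContDiffOn ℝ ∞ H (strip P) ∧ EvenOn P H ∧
      ∀ p ∈ strip P, fderiv ℝ G p (1, 0) = p.1 * H p := by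
  set G1 : ℝ × ℝ → ℂ := fun p => fderiv ℝ G p (1, 0) with hG1
  have hG1s : ContDiffOn ℝ ∞ G1 (strip P) := contDiffOn_fderiv_strip hP hG _
  have hodd : ∀ p ∈ strip P, G1 (-p.1, p.2) = -1 * G1 p := fun p hp => by
    have h1 := fderiv_neg_of_symm hP hG (c := 1)
      (fun p hp => by rw [one_mul]; exact he p hp) hp (1, 0)
    have h2 : ((-1, 0) : ℝ × ℝ) = -(1, 0) := by simp
    simp only [h2, map_neg, one_mul] at h1
    simp only [hG1]
    rw [← h1]; ring
  set G2 : ℝ × ℝ → ℂ := fun p => fderiv ℝ G1 p (1, 0) with hG2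
  have hG2s : ContDiffOn ℝ ∞ G2 (strip P) := contDiffOn_fderiv_strip hP hG1s _
  have heven : EvenOn P G2 := fun p hp => by
    have h1 := fderiv_neg_of_symm hP hG1s hodd hp (1, 0)
    have h2 : ((-1, 0) : ℝ × ℝ) = -(1, 0) := by simp
    simp only [h2, map_neg] at h1
    simp only [hG2]
    linear_combination -h1
  refine ⟨_, contDiffOn_average hP 0 hG2s, heven.average 0, fun p hp => ?_⟩
  have hline : ∀ t ∈ uIcc (0 : ℝ) 1, HasDerivAt (fun t : ℝ => G1 (t * p.1, p.2))
      (p.1 * G2 (t * p.1, p.2)) t := fun t ht => by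
    rw [uIcc_of_le zero_le_one] at ht
    have h1 : HasDerivAt (fun t : ℝ => (t * p.1, p.2)) ((p.1, 0) : ℝ × ℝ) t := by
      simpa using ((hasDerivAt_id t).mul_const p.1).prodMk (hasDerivAt_const t p.2)
    refine ((hasFDerivAt_strip hP hG1s (mul_mem_strip hp ht)).comp_hasDerivAt t h1).congr_deriv ?_
    have h2 : ((p.1, 0) : ℝ × ℝ) = p.1 • (1, 0) := by simp
    rw [h2, map_smul, Complex.real_smul]
  have hint : IntervalIntegrable (fun t : ℝ => (p.1 : ℂ) * G2 (t * p.1, p.2))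
      MeasureTheory.volume 0 1 := by
    refine ContinuousOn.intervalIntegrable (continuousOn_const.mul ?_)
    refine hG2s.continuousOn.comp (by fun_prop) fun t ht => mul_mem_strip hp ?_
    rwa [uIcc_of_le zero_le_one] at ht
  have h0 : G1 (0, p.2) = 0 := by
    have := hodd (0, p.2) ⟨⟨by norm_num, by norm_num⟩, hp.2⟩
    simp only [neg_zero] at this
    linear_combination this / 2
  have := intervalIntegral.integral_eq_sub_of_hasDerivAt hline hint
  rw [intervalIntegral.integral_const_mul] at this
  simp only [one_mul, zero_mul, h0, sub_zero] at this
  simp only [pow_zero, one_mul]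
  exact this.symm

/-- A smooth even function is a smooth function of the square. -/
theorem contDiffOn_comp_sqrt (hP : IsOpen P) {G : ℝ × ℝ → ℂ}
    (hG : ContDiffOn ℝ ∞ G (strip P)) (he : EvenOn P G) :
    ContDiffOn ℝ ∞ (fun q : ℝ × ℝ => G (√q.1, q.2)) (Ico (0 : ℝ) 1 ×ˢ P) := by
  have hmap : ∀ q ∈ Ico (0 : ℝ) 1 ×ˢ P, (√q.1, q.2) ∈ strip P := fun q hq =>
    ⟨⟨by linarith [Real.sqrt_nonneg q.1], by rw [Real.sqrt_lt' one_pos]; simpa using hq.1.2⟩, hq.2⟩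
  have hcont : ∀ {G : ℝ × ℝ → ℂ}, ContDiffOn ℝ ∞ G (strip P) →
      ContinuousOn (fun q : ℝ × ℝ => G (√q.1, q.2)) (Ico (0 : ℝ) 1 ×ˢ P) := fun hG =>
    hG.continuousOn.comp (by fun_prop) hmap
  have huniq : UniqueDiffOn ℝ (Ico (0 : ℝ) 1 ×ˢ P) :=
    (uniqueDiffOn_Ico 0 1).prod hP.uniqueDiffOn
  rw [contDiffOn_infty]
  intro k
  induction k generalizing G with
  | zero => rw [Nat.cast_zero, contDiffOn_zero]; exact hcont hG
  | succ k ih =>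
    -- `∂_x G = x H` with `H` even, so the derivative in `x²` is `H / 2`, again of the same kind
    obtain ⟨H, hH, heH, hdiv⟩ := exists_even_div hP hG he
    have hGr := contDiffOn_fderiv_strip hP hG (0, 1)
    rw [Nat.cast_succ, contDiffOn_succ_iff_hasFDerivWithinAt_of_uniqueDiffOn huniq]
    set L : ℝ × ℝ → (ℝ × ℝ →L[ℝ] ℂ) := fun q =>
      (ContinuousLinearMap.fst ℝ ℝ ℝ).smulRight (H (√q.1, q.2) / 2)
        + (ContinuousLinearMap.snd ℝ ℝ ℝ).smulRight (fderiv ℝ G (√q.1, q.2) (0, 1)) with hL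
    refine ⟨by simp, L, ?_, fun q hq => ?_⟩
    · exact (contDiffOn_const.smulRight ((ih hH heH).div_const 2)).add
        (contDiffOn_const.smulRight (ih hGr (he.fderiv_snd hP hG)))
    have hLc : ContinuousOn L (Ico (0 : ℝ) 1 ×ˢ P) := by
      have h1 := ((hcont hH).div_const 2)
      have h2 := hcont hGr
      exact (((contDiffOn_const (n := 0)).smulRight (contDiffOn_zero.2 h1)).add
        ((contDiffOn_const (n := 0)).smulRight (contDiffOn_zero.2 h2))).continuousOn
    -- away from the axis the derivative is given by the chain rule
    have hint : ∀ q : ℝ × ℝ, q.1 ∈ Ioo (0 : ℝ) 1 → q.2 ∈ P →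
        HasFDerivAt (fun q : ℝ × ℝ => G (√q.1, q.2)) (L q) q := fun q h1 h2 => by
      have hq0 : √q.1 ≠ 0 := (Real.sqrt_pos.2 h1.1).ne'
      have hm : (√q.1, q.2) ∈ strip P := hmap q ⟨⟨h1.1.le, h1.2⟩, h2⟩
      have hs : HasFDerivAt (fun q : ℝ × ℝ => (√q.1, q.2))
          (((1 / (2 * √q.1)) • ContinuousLinearMap.fst ℝ ℝ ℝ).prod
            (ContinuousLinearMap.snd ℝ ℝ ℝ)) q :=
        ((Real.hasDerivAt_sqrt h1.1.ne').comp_hasFDerivAt q hasFDerivAt_fst).prodMk hasFDerivAt_snd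
      refine ((hasFDerivAt_strip hP hG hm).comp q hs).congr_fderiv ?_
      refine ContinuousLinearMap.ext fun v => ?_
      have e : (((1 / (2 * √q.1)) * v.1, v.2) : ℝ × ℝ)
          = ((1 / (2 * √q.1)) * v.1) • (1, 0) + v.2 • (0, 1) := by simp
      have e2 := hdiv _ hm
      simp only at e2
      have hqc : ((√q.1 : ℝ) : ℂ) ≠ 0 := by exact_mod_cast hq0
      simp only [hL, ContinuousLinearMap.comp_apply, ContinuousLinearMap.prod_apply,
        smul_apply, ContinuousLinearMap.coe_fst', ContinuousLinearMap.coe_snd',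
        add_apply, ContinuousLinearMap.smulRight_apply, smul_eq_mul, e,
        map_add, map_smul, e2, Complex.real_smul]
      push_cast
      field_simp
    rcases eq_or_lt_of_le hq.1.1 with h0 | h0
    · -- at the boundary, the derivative is the limit of the derivatives inside
      obtain ⟨ε, hε, hball⟩ := Metric.nhds_basis_closedBall.mem_iff.1 (hP.mem_nhds hq.2)
      set s : Set (ℝ × ℝ) := Ioo (0 : ℝ) (1 / 2) ×ˢ Metric.ball q.2 ε
      have hcl : closure s ⊆ Ico (0 : ℝ) 1 ×ˢ P := by
        rw [closure_prod_eq, closure_Ioo (by norm_num)]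
        refine prod_mono (fun x hx => ⟨hx.1, by linarith [hx.2]⟩)
          ((closure_minimal Metric.ball_subset_closedBall Metric.isClosed_closedBall).trans hball)
      have hsub : s ⊆ Ico (0 : ℝ) 1 ×ˢ P := subset_closure.trans hcl
      have hin : ∀ y ∈ s, HasFDerivAt (fun q : ℝ × ℝ => G (√q.1, q.2)) (L y) y := fun y hy =>
        hint y ⟨hy.1.1, by linarith [hy.1.2]⟩ (hsub hy).2
      have h1 : HasFDerivWithinAt (fun q : ℝ × ℝ => G (√q.1, q.2)) (L q) (closure s) q := by
        refine hasFDerivWithinAt_closure_of_tendsto_fderiv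
          (fun y hy => (hin y hy).differentiableAt.differentiableWithinAt)
          ((convex_Ioo _ _).prod (convex_ball _ _)) (isOpen_Ioo.prod Metric.isOpen_ball)
          (fun y hy => ((hcont hG) y (hcl hy)).mono hsub) ?_
        refine ((hLc q hq).mono hsub : Tendsto L _ _).congr' ?_
        filter_upwards [self_mem_nhdsWithin] with y hy
        exact (hin y hy).fderiv.symm
      refine h1.mono_of_mem_nhdsWithin ?_
      rw [closure_prod_eq, closure_Ioo (by norm_num)]
      refine mem_nhdsWithin.2 ⟨Iio (1 / 2) ×ˢ Metric.ball q.2 ε,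
        isOpen_Iio.prod Metric.isOpen_ball, ⟨?_, Metric.mem_ball_self hε⟩, ?_⟩
      · rw [← h0]; exact mem_Iio.2 (by norm_num)
      · rintro y ⟨hy1, hy2⟩
        exact ⟨⟨hy2.1.1, (mem_Iio.1 hy1.1).le⟩, subset_closure hy1.2⟩
    · exact (hint q ⟨h0, hq.1.2⟩ hq.2).hasFDerivWithinAt

/-- Parameter dependent functions on the unit disc. -/
abbrev disc (P : Set ℝ) : Set (ℂ × ℝ) := Metric.ball (0 : ℂ) 1 ×ˢ P

theorem axis_mem_disc {p : ℝ × ℝ} (hp : p ∈ strip P) : ((p.1 : ℂ), p.2) ∈ disc P := by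
  refine ⟨?_, hp.2⟩
  rw [mem_ball_zero_iff, Complex.norm_real, Real.norm_eq_abs]
  exact abs_lt.2 hp.1

/-- On the axis an equivariant function of weight `n` is `xⁿ` times a smooth even function. -/
theorem exists_even_of_equivariant (hP : IsOpen P) (n : ℕ) {U : ℂ × ℝ → ℂ}
    (hU : ContDiffOn ℝ ∞ U (disc P))
    (hm : ∀ c : ℂ, ‖c‖ = 1 → ∀ p ∈ disc P, U (c * p.1, p.2) = c ^ n * U p) :
    ∃ G : ℝ × ℝ → ℂ, ContDiffOn ℝ ∞ G (strip P) ∧ EvenOn P G ∧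
      ∀ p ∈ strip P, U ((p.1 : ℂ), p.2) = (p.1 : ℂ) ^ n * G p := by
  have hopen : IsOpen (disc P) := Metric.isOpen_ball.prod hP
  have haxis : ContDiff ℝ ∞ fun p : ℝ × ℝ => ((p.1 : ℂ), p.2) :=
    (Complex.ofRealCLM.contDiff.comp contDiff_fst).prodMk contDiff_snd
  induction n generalizing U with
  | zero =>
    refine ⟨fun p => U ((p.1 : ℂ), p.2), hU.comp haxis.contDiffOn fun p hp => axis_mem_disc hp,
      fun p hp => ?_, fun p _ => by simp⟩
    simpa using hm (-1) (by simp) _ (axis_mem_disc hp)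
  | succ n ih =>
    have hd : ∀ p ∈ disc P, HasFDerivAt U (fderiv ℝ U p) p := fun p hp =>
      ((hU.contDiffAt (hopen.mem_nhds hp)).differentiableAt (by simp)).hasFDerivAt
    -- the derivative `∂_x - i ∂_y` lowers the weight by one
    set V : ℂ × ℝ → ℂ := fun p => fderiv ℝ U p (1, 0) - Complex.I * fderiv ℝ U p (Complex.I, 0)
      with hV
    have hVs : ContDiffOn ℝ ∞ V (disc P) := by
      have h1 := hU.fderiv_of_isOpen hopen (m := ∞) (by simp)
      exact (h1.clm_apply contDiffOn_const).sub
        (contDiffOn_const.mul (h1.clm_apply contDiffOn_const))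
    have hrot : ∀ c : ℂ, ‖c‖ = 1 → ∀ p ∈ disc P, (c * p.1, p.2) ∈ disc P := fun c hc p hp => by
      refine ⟨?_, hp.2⟩
      have := hp.1
      rw [mem_ball_zero_iff] at this ⊢
      rwa [norm_mul, hc, one_mul]
    have hVm : ∀ c : ℂ, ‖c‖ = 1 → ∀ p ∈ disc P, V (c * p.1, p.2) = c ^ n * V p := by
      intro c hc p hp
      have hc0 : c ≠ 0 := by rintro rfl; simp at hc
      have hL : HasFDerivAt (fun p : ℂ × ℝ => (c * p.1, p.2))
          ((c • ContinuousLinearMap.fst ℝ ℂ ℝ).prod (ContinuousLinearMap.snd ℝ ℂ ℝ)) p :=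
        ((c • ContinuousLinearMap.fst ℝ ℂ ℝ).prod (ContinuousLinearMap.snd ℝ ℂ ℝ)).hasFDerivAt
      have h3 := ((hd _ (hrot c hc p hp)).comp p hL).unique
        (((hd p hp).const_mul (c ^ (n + 1))).congr_of_eventuallyEq
          (eventually_of_mem (hopen.mem_nhds hp) (hm c hc)))
      have e1 := DFunLike.congr_fun h3 (1, 0)
      have e2 := DFunLike.congr_fun h3 (Complex.I, 0)
      simp only [ContinuousLinearMap.comp_apply, ContinuousLinearMap.prod_apply,
        smul_apply, ContinuousLinearMap.coe_fst', ContinuousLinearMap.coe_snd',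
        smul_eq_mul, mul_one] at e1 e2
      have d1 : ((c, 0) : ℂ × ℝ) = c.re • (1, 0) + c.im • (Complex.I, 0) := by
        simp only [Prod.smul_mk, Prod.mk_add_mk, Complex.real_smul, mul_one, smul_zero, add_zero,
          Complex.re_add_im]
      have d2 : ((c * Complex.I, 0) : ℂ × ℝ) = (-c.im) • (1, 0) + c.re • (Complex.I, 0) := by
        simp only [Prod.smul_mk, Prod.mk_add_mk, Complex.real_smul, mul_one, smul_zero, add_zero]
        congr 1
        conv_lhs => rw [← Complex.re_add_im c]
        push_cast
        linear_combination (c.im : ℂ) * Complex.I_mul_I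
      rw [d1, map_add, map_smul, map_smul, Complex.real_smul, Complex.real_smul] at e1
      rw [d2, map_add, map_smul, map_smul, Complex.real_smul, Complex.real_smul] at e2
      refine mul_left_cancel₀ hc0 ?_
      simp only [hV]
      conv_lhs => rw [← Complex.re_add_im c]
      set X := fderiv ℝ U (((c.re : ℂ) + c.im * Complex.I) * p.1, p.2) (1, 0) with hX
      set Y := fderiv ℝ U (((c.re : ℂ) + c.im * Complex.I) * p.1, p.2) (Complex.I, 0) with hY
      simp only [Complex.re_add_im] at hX hY
      rw [← hX, ← hY] at e1 e2
      push_cast at e2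
      linear_combination e1 - Complex.I * e2 - (c.im : ℂ) * Y * Complex.I_mul_I
    obtain ⟨G, hG, he, hGV⟩ := ih hVs hVm
    refine ⟨_, contDiffOn_average hP (2 * n + 1) hG, he.average (2 * n + 1), fun p hp => ?_⟩
    -- the angular derivative on the axis
    have hang : ∀ q ∈ strip P, (q.1 : ℂ) * fderiv ℝ U ((q.1 : ℂ), q.2) (Complex.I, 0)
        = (n + 1) * Complex.I * U ((q.1 : ℂ), q.2) := fun q hq => by
      have hexp : HasDerivAt (fun φ : ℝ => Complex.exp (φ * Complex.I)) Complex.I 0 := by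
        have h1 : HasDerivAt (fun φ : ℝ => (φ : ℂ) * Complex.I) Complex.I 0 := by
          simpa using (Complex.ofRealCLM.hasDerivAt (x := 0)).mul_const Complex.I
        simpa using h1.cexp
      have h1 : HasDerivAt (fun φ : ℝ => (Complex.exp (φ * Complex.I) * q.1, q.2))
          ((Complex.I * q.1, 0) : ℂ × ℝ) 0 :=
        (hexp.mul_const (q.1 : ℂ)).prodMk (hasDerivAt_const 0 q.2)
      have h2 : HasDerivAt (fun φ : ℝ => Complex.exp (φ * Complex.I) ^ (n + 1)
          * U ((q.1 : ℂ), q.2)) ((n + 1) * Complex.I * U ((q.1 : ℂ), q.2)) 0 := by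
        have := (hexp.pow (n + 1)).mul_const (U ((q.1 : ℂ), q.2))
        simpa using this
      have h0 : (Complex.exp ((0 : ℝ) * Complex.I) * (q.1 : ℂ), q.2) = ((q.1 : ℂ), q.2) := by simp
      have h3 := (show HasFDerivAt U (fderiv ℝ U ((q.1 : ℂ), q.2))
        (Complex.exp ((0 : ℝ) * Complex.I) * (q.1 : ℂ), q.2) by
          rw [h0]; exact hd _ (axis_mem_disc hq)).comp_hasDerivAt (0 : ℝ) h1
      have h4 := h3.unique (h2.congr_of_eventuallyEq (Eventually.of_forall fun φ =>
        hm _ (Complex.norm_exp_ofReal_mul_I φ) _ (axis_mem_disc hq)))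
      rw [← h4, show ((Complex.I * q.1, 0) : ℂ × ℝ) = q.1 • (Complex.I, 0) by
        simp [mul_comm], map_smul, Complex.real_smul]
    -- `U` is recovered from `V` by integrating `t ^ (n + 1) U (t x)`, whose derivative is explicit
    have hline : ∀ t ∈ uIcc (0 : ℝ) 1,
        HasDerivAt (fun t : ℝ => (t : ℂ) ^ (n + 1) * U ((t * p.1 : ℝ), p.2))
        ((p.1 : ℂ) ^ (n + 1) * ((t : ℂ) ^ (2 * n + 1) * G (t * p.1, p.2))) t := fun t ht => by
      rw [uIcc_of_le zero_le_one] at ht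
      have hq := mul_mem_strip hp ht
      have h1 : HasDerivAt (fun t : ℝ => (((t * p.1 : ℝ) : ℂ), p.2)) ((p.1, 0) : ℂ × ℝ) t := by
        simpa using (((hasDerivAt_id t).mul_const p.1).ofReal_comp).prodMk (hasDerivAt_const t p.2)
      have h2 := (hd _ (axis_mem_disc hq)).comp_hasDerivAt t h1
      have h3 : HasDerivAt (fun t : ℝ => (t : ℂ) ^ (n + 1)) ((n + 1) * (t : ℂ) ^ n) t := by
        have := (Complex.ofRealCLM.hasDerivAt (x := t)).pow (n + 1)
        exact this.congr_deriv (by simp)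
      refine (h3.mul h2).congr_deriv ?_
      have e1 := hang _ hq
      have e2 := hGV _ hq
      simp only [hV] at e1 e2
      rw [show ((p.1, 0) : ℂ × ℝ) = p.1 • (1, 0) by simp, map_smul, Complex.real_smul]
      set A := fderiv ℝ U (((t * p.1 : ℝ) : ℂ), p.2) (1, 0)
      set B := fderiv ℝ U (((t * p.1 : ℝ) : ℂ), p.2) (Complex.I, 0)
      set u := U (((t * p.1 : ℝ) : ℂ), p.2)
      push_cast at e1 e2
      rw [mul_pow] at e2
      simp only [Function.comp]
      linear_combination (t : ℂ) ^ (n + 1) * p.1 * e2 + Complex.I * (t : ℂ) ^ n * e1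
        + (n + 1) * (t : ℂ) ^ n * u * Complex.I_mul_I
    have hint : IntervalIntegrable (fun t : ℝ => (p.1 : ℂ) ^ (n + 1)
        * ((t : ℂ) ^ (2 * n + 1) * G (t * p.1, p.2))) MeasureTheory.volume 0 1 := by
      refine ContinuousOn.intervalIntegrable (continuousOn_const.mul
        (ContinuousOn.mul (by fun_prop) ?_))
      refine hG.continuousOn.comp (by fun_prop) fun t ht => mul_mem_strip hp ?_
      rwa [uIcc_of_le zero_le_one] at ht
    have := intervalIntegral.integral_eq_sub_of_hasDerivAt hline hint
    rw [intervalIntegral.integral_const_mul] at this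
    rw [this]
    simp

/-- A smooth equivariant function of weight `n` on the disc is `ζⁿ` times a smooth function
of `|ζ|²`. -/
theorem exists_of_equivariant (hP : IsOpen P) (n : ℕ) {U : ℂ × ℝ → ℂ}
    (hU : ContDiffOn ℝ ∞ U (disc P))
    (hm : ∀ c : ℂ, ‖c‖ = 1 → ∀ p ∈ disc P, U (c * p.1, p.2) = c ^ n * U p) :
    ∃ W : ℝ × ℝ → ℂ, ContDiffOn ℝ ∞ W (Ico (0 : ℝ) 1 ×ˢ P) ∧
      ∀ p ∈ disc P, U p = p.1 ^ n * W (‖p.1‖ ^ 2, p.2) := by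
  obtain ⟨G, hG, he, h⟩ := exists_even_of_equivariant hP n hU hm
  refine ⟨_, contDiffOn_comp_sqrt hP hG he, fun p hp => ?_⟩
  have hlt : ‖p.1‖ < 1 := mem_ball_zero_iff.1 hp.1
  have hst : (‖p.1‖, p.2) ∈ strip P := ⟨⟨by linarith [norm_nonneg p.1], hlt⟩, hp.2⟩
  have key : ∃ c : ℂ, ‖c‖ = 1 ∧ c * (‖p.1‖ : ℂ) = p.1 := by
    by_cases h0 : p.1 = 0
    · exact ⟨1, by simp, by simp [h0]⟩
    · have hn : (‖p.1‖ : ℂ) ≠ 0 := by simpa using h0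
      refine ⟨p.1 / ‖p.1‖, ?_, div_mul_cancel₀ _ hn⟩
      rw [norm_div, Complex.norm_real, norm_norm, div_self (by simpa using h0)]
  obtain ⟨c, hc, hcp⟩ := key
  have e1 := hm c hc _ (axis_mem_disc hst)
  have e2 := h _ hst
  simp only [hcp] at e1
  simp only at e2
  rw [Real.sqrt_sq (norm_nonneg _), ← Prod.mk.eta (p := p)]
  rw [e1, e2, ← mul_assoc, ← mul_pow, hcp]

end Whitney

/-! ### The slice and its radial coordinate -/

section Slice

variable {M a δ rp : ℝ}

/-- The quotient `Δ_r / (r - r₊)` at `r = r₊ - s`. -/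
def kap (M a rp s : ℝ) : ℝ :=
  (rp - s) ^ 3 + (rp - s) ^ 2 * rp + (rp - s) * rp ^ 2 + rp ^ 3 + (1 + a ^ 2) * (rp - s + rp)
    - 2 * M

theorem DeltaR_eq_kap (h : DeltaR M a rp = 0) (s : ℝ) :
    DeltaR M a (rp - s) = -(s * kap M a rp s) := by
  have : DeltaR M a (rp - s) - DeltaR M a rp = -(s * kap M a rp s) := by
    simp only [DeltaR, kap]; ring
  rw [← this, h, sub_zero]

theorem contDiff_kap : ContDiff ℝ ∞ (kap M a rp) := by unfold kap; fun_prop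

theorem hasDerivAt_DeltaR (r : ℝ) :
    HasDerivAt (DeltaR M a) (4 * r ^ 3 + 2 * (1 + a ^ 2) * r - 2 * M) r := by
  have h : DeltaR M a = fun r => r ^ 4 + (1 + a ^ 2) * r ^ 2 + (-(2 * M)) * r + a ^ 2 := by
    funext r; simp only [DeltaR]; ring
  rw [h]
  refine ((((hasDerivAt_pow 4 r).add ((hasDerivAt_pow 2 r).const_mul _)).add
    ((hasDerivAt_id r).const_mul _)).add_const _).congr_deriv ?_
  push_cast; ring

theorem kap_anti (hrp : 0 < rp) {s t : ℝ} (hst : s ≤ t) (ht : t ≤ rp) :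
    kap M a rp t ≤ kap M a rp s := by
  have h0 : 0 ≤ rp - t := by linarith
  have h1 : rp - t ≤ rp - s := by linarith
  have h3 := pow_le_pow_left₀ h0 h1 3
  have h2 := mul_le_mul_of_nonneg_right (pow_le_pow_left₀ h0 h1 2) hrp.le
  have h4 := mul_le_mul_of_nonneg_right h1 (sq_nonneg rp)
  have h5 : (1 + a ^ 2) * (rp - t + rp) ≤ (1 + a ^ 2) * (rp - s + rp) :=
    mul_le_mul_of_nonneg_left (by linarith) (by positivity)
  unfold kap
  linarith

/-- The radial range is a half line on which `Δ_r` has a single, simple zero. -/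
theorem exists_radii_eq (hrp : IsGreatest {r : ℝ | 0 < r ∧ DeltaR M a r = 0} rp)
    (hrp' : 0 < deriv (DeltaR M a) rp) (hδ : 0 < δ)
    (hδ' : ∃ r, 0 < r ∧ r < rp ∧ DeltaR M a r < -δ) :
    ∃ S, 0 < S ∧ S < rp ∧ radii M a δ = Ioi (rp - S) ∧ ∀ s < S, 0 < kap M a rp s := by
  obtain ⟨r1, hr1, hr1', hΔ1⟩ := hδ'
  obtain ⟨hrp0, hroot⟩ := hrp.1
  have hcont : Continuous (DeltaR M a) := by unfold DeltaR; fun_prop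
  have hcpt : IsCompact (Icc r1 rp ∩ {r | DeltaR M a r ≤ -δ}) :=
    isCompact_Icc.inter_right (isClosed_le hcont continuous_const)
  obtain ⟨r0, ⟨⟨h1, h2⟩, h3⟩, hmax⟩ := hcpt.exists_isGreatest ⟨r1, ⟨le_rfl, hr1'.le⟩, hΔ1.le⟩
  have h3 : DeltaR M a r0 ≤ -δ := h3
  have h4 : r0 < rp := lt_of_le_of_ne h2 fun h => by rw [h, hroot] at h3; linarith
  have hk0 : 0 < kap M a rp 0 := by
    have h5 : kap M a rp 0 = deriv (DeltaR M a) rp := by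
      rw [(hasDerivAt_DeltaR rp).deriv]; unfold kap; ring
    rwa [h5]
  have hkS : 0 < kap M a rp (rp - r0) := by
    have h5 := DeltaR_eq_kap hroot (rp - r0)
    rw [sub_sub_cancel] at h5
    by_contra! h6
    nlinarith
  have hk : ∀ s < rp - r0, 0 < kap M a rp s := fun s hs =>
    hkS.trans_le (kap_anti hrp0 hs.le (by linarith))
  refine ⟨rp - r0, by linarith, by linarith, ?_, hk⟩
  rw [sub_sub_cancel]
  ext r
  constructor
  · rintro ⟨-, hr⟩
    rw [mem_Ioi]
    by_contra! h5
    linarith [hr r0 h5]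
  · intro hr
    rw [mem_Ioi] at hr
    refine ⟨by linarith, fun r' hr' => ?_⟩
    rcases le_or_gt r' rp with h5 | h5
    · by_contra! h6
      linarith [hmax ⟨⟨by linarith, h5⟩, h6⟩]
    · have h6 := DeltaR_eq_kap hroot (rp - r')
      rw [sub_sub_cancel] at h6
      have := hk (rp - r') (by linarith)
      nlinarith

theorem rad_sq (x : Fin 3 → ℝ) : rad x ^ 2 = x 0 ^ 2 + x 1 ^ 2 + x 2 ^ 2 :=
  Real.sq_sqrt (by positivity)

theorem rad_nonneg (x : Fin 3 → ℝ) : 0 ≤ rad x := Real.sqrt_nonneg _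

theorem continuous_rad : Continuous rad := by unfold rad; fun_prop

theorem rad_eq_of_sq {x : Fin 3 → ℝ} {r : ℝ} (hr : 0 ≤ r)
    (h : x 0 ^ 2 + x 1 ^ 2 + x 2 ^ 2 = r ^ 2) : rad x = r := by
  rw [rad, h, Real.sqrt_sq hr]

theorem contDiffAt_rad {x : Fin 3 → ℝ} (hx : 0 < rad x) : ContDiffAt ℝ ∞ rad x := by
  have h0 : x 0 ^ 2 + x 1 ^ 2 + x 2 ^ 2 ≠ 0 := by rw [← rad_sq]; positivity
  unfold rad
  exact ContDiffAt.sqrt (by fun_prop) h0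

theorem div_rad_mem_J {x : Fin 3 → ℝ} (hx : 0 < rad x) : x 2 / rad x ∈ J := by
  have h := rad_sq x
  have h2 := abs_le_of_sq_le_sq' (by nlinarith [sq_nonneg (x 0), sq_nonneg (x 1)] :
    x 2 ^ 2 ≤ rad x ^ 2) hx.le
  exact ⟨by rw [le_div_iff₀ hx]; linarith, by rw [div_le_iff₀ hx]; linarith⟩

/-- Rotation about the axis. -/
def rot (φ : ℝ) (x : Fin 3 → ℝ) : Fin 3 → ℝ :=
  ![Real.cos φ * x 0 - Real.sin φ * x 1, Real.sin φ * x 0 + Real.cos φ * x 1, x 2]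

theorem rad_rot (φ : ℝ) (x : Fin 3 → ℝ) : rad (rot φ x) = rad x := by
  refine rad_eq_of_sq (rad_nonneg x) ?_
  rw [rad_sq]
  simp only [rot, Matrix.cons_val_zero, Matrix.cons_val_one, Matrix.cons_val]
  linear_combination (x 0 ^ 2 + x 1 ^ 2) * Real.sin_sq_add_cos_sq φ

theorem hasDerivAt_rot (x : Fin 3 → ℝ) (φ : ℝ) :
    HasDerivAt (fun φ => rot φ x) ![-(rot φ x) 1, rot φ x 0, 0] φ := by
  rw [hasDerivAt_pi]
  have hc := Real.hasDerivAt_cos φ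
  have hs := Real.hasDerivAt_sin φ
  intro i
  fin_cases i
  · refine ((hc.mul_const (x 0)).sub (hs.mul_const (x 1))).congr_deriv ?_
    simp [rot]; ring
  · refine ((hs.mul_const (x 0)).add (hc.mul_const (x 1))).congr_deriv ?_
    simp [rot]; ring
  · exact hasDerivAt_const φ (x 2)

/-- Functions on the region `r > r₀` of azimuthal mode `m` are multiplied by a character under
rotations. -/
theorem apply_rot_of_hasMode {r0 : ℝ} {m : ℤ} {u : (Fin 3 → ℝ) → ℂ}
    (hu : ContDiffOn ℝ ∞ u {x | r0 < rad x}) (hm : HasMode m {x | r0 < rad x} u) {x : Fin 3 → ℝ}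
    (hx : r0 < rad x) (φ : ℝ) : u (rot φ x) = Complex.exp (m * φ * Complex.I) * u x := by
  have hopen : IsOpen {x | r0 < rad x} := isOpen_lt continuous_const continuous_rad
  have hrx : ∀ φ, rot φ x ∈ {x | r0 < rad x} := fun φ => by
    change r0 < rad (rot φ x)
    rw [rad_rot]; exact hx
  set g : ℝ → ℂ := fun φ => Complex.exp (-(m * φ * Complex.I)) * u (rot φ x) with hg
  have hgd : ∀ φ, HasDerivAt g 0 φ := fun φ => by
    have h1 : HasDerivAt (fun φ : ℝ => Complex.exp (-(m * φ * Complex.I)))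
        (Complex.exp (-(m * φ * Complex.I)) * -(m * Complex.I)) φ := by
      have h2 : HasDerivAt (fun φ : ℝ => -((m : ℂ) * φ * Complex.I)) (-(m * Complex.I)) φ := by
        have := (((Complex.ofRealCLM.hasDerivAt (x := φ)).const_mul (m : ℂ)).mul_const
          Complex.I).neg
        exact this.congr_deriv (by simp)
      exact h2.cexp
    have h2 : HasFDerivAt u (fderiv ℝ u (rot φ x)) (rot φ x) :=
      ((hu.contDiffAt (hopen.mem_nhds (hrx φ))).differentiableAt (by simp)).hasFDerivAt
    refine (h1.mul (h2.comp_hasDerivAt φ (hasDerivAt_rot x φ))).congr_deriv ?_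
    have h3 := hm _ (hrx φ)
    simp only [Function.comp]
    linear_combination Complex.exp (-(m * φ * Complex.I)) * Complex.I * h3
      + Complex.exp (-(m * φ * Complex.I)) *
        fderiv ℝ u (rot φ x) ![-(rot φ x) 1, rot φ x 0, 0] * Complex.I_mul_I
  have hconst := is_const_of_deriv_eq_zero (fun φ => (hgd φ).differentiableAt)
    (fun φ => (hgd φ).deriv) φ 0
  have h0 : rot 0 x = x := by
    ext i; fin_cases i <;> simp [rot]
  simp only [hg, h0, Complex.ofReal_zero, mul_zero, zero_mul, neg_zero, Complex.exp_zero,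
    one_mul] at hconst
  rw [← hconst, ← mul_assoc, ← Complex.exp_add]
  simp

end Slice

/-! ### Reduction of functions of fixed azimuthal mode to two variables -/

section Reduction

variable {rp S : ℝ}

/-- The upper hemispheres, parametrised by the disc. -/
def chart (rp : ℝ) (p : ℂ × ℝ) : Fin 3 → ℝ :=
  ![(rp - p.2) * p.1.re, (rp - p.2) * p.1.im, (rp - p.2) * √(1 - (p.1.re ^ 2 + p.1.im ^ 2))]

theorem norm_sq_eq (z : ℂ) : ‖z‖ ^ 2 = z.re ^ 2 + z.im ^ 2 := by
  rw [Complex.sq_norm, Complex.normSq_apply]; ring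

theorem one_sub_pos_of_mem_disc {p : ℂ × ℝ} (hp : p ∈ disc (Iio S)) :
    0 < 1 - (p.1.re ^ 2 + p.1.im ^ 2) := by
  have h1 : ‖p.1‖ < 1 := mem_ball_zero_iff.1 hp.1
  rw [← norm_sq_eq]
  nlinarith [norm_nonneg p.1]

theorem rad_chart (hS : S < rp) {p : ℂ × ℝ} (hp : p ∈ disc (Iio S)) :
    rad (chart rp p) = rp - p.2 := by
  have h2 : p.2 < S := hp.2
  refine rad_eq_of_sq (by linarith) ?_
  simp only [chart, Matrix.cons_val_zero, Matrix.cons_val_one, Matrix.cons_val]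
  rw [mul_pow _ (√_), Real.sq_sqrt (one_sub_pos_of_mem_disc hp).le]
  ring

theorem contDiffOn_chart : ContDiffOn ℝ ∞ (chart rp) (disc (Iio S)) := by
  have hre : ContDiff ℝ ∞ fun p : ℂ × ℝ => p.1.re := Complex.reCLM.contDiff.comp contDiff_fst
  have him : ContDiff ℝ ∞ fun p : ℂ × ℝ => p.1.im := Complex.imCLM.contDiff.comp contDiff_fst
  have hr : ContDiff ℝ ∞ fun p : ℂ × ℝ => rp - p.2 := contDiff_const.sub contDiff_snd
  rw [contDiffOn_pi]
  intro i
  fin_cases i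
  · exact (hr.mul hre).contDiffOn
  · exact (hr.mul him).contDiffOn
  · exact hr.contDiffOn.mul (ContDiffOn.sqrt
      (contDiff_const.sub ((hre.pow 2).add (him.pow 2))).contDiffOn
      fun p hp => (one_sub_pos_of_mem_disc hp).ne')

/-- The complex coordinate `(x₁ + i σ x₂) / r`. -/
def zet (σ : ℝ) (x : Fin 3 → ℝ) : ℂ := ((x 0 : ℂ) + Complex.I * (σ * x 1)) / rad x

/-- Near the north pole the profile is smooth as a function of `sin² θ`: the chart by `ζ` turns the
mode condition into equivariance under rotations of the disc. -/
theorem exists_hemisphere_reduction (hS : S < rp) (n : ℕ) {u : (Fin 3 → ℝ) → ℂ}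
    (hu : ContDiffOn ℝ ∞ u {x | rp - S < rad x})
    (hm : ∀ x, rp - S < rad x → ∀ φ : ℝ, u (rot φ x) = Complex.exp (n * φ * Complex.I) * u x) :
    ∃ W : ℝ × ℝ → ℂ, ContDiffOn ℝ ∞ W (Ico (0 : ℝ) 1 ×ˢ Iio S) ∧
      ∀ x, rp - S < rad x → 0 < x 2 →
        u x = zet 1 x ^ n * W (1 - (x 2 / rad x) ^ 2, rp - rad x) := by
  have hmem : ∀ p ∈ disc (Iio S), rp - S < rad (chart rp p) := fun p hp => by
    rw [rad_chart hS hp]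
    have h2 : p.2 < S := hp.2
    linarith
  obtain ⟨W, hW, h⟩ := exists_of_equivariant (P := Iio S) isOpen_Iio n
    (U := fun p => u (chart rp p)) (hu.comp contDiffOn_chart hmem) fun c hc p hp => by
      obtain ⟨φ, rfl⟩ := (Complex.norm_eq_one_iff c).1 hc
      have h1 : chart rp (Complex.exp (φ * Complex.I) * p.1, p.2) = rot φ (chart rp p) := by
        have hn : (Complex.exp (φ * Complex.I) * p.1).re ^ 2
            + (Complex.exp (φ * Complex.I) * p.1).im ^ 2 = p.1.re ^ 2 + p.1.im ^ 2 := by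
          rw [← norm_sq_eq, ← norm_sq_eq, norm_mul, hc, one_mul]
        ext i
        fin_cases i
        · simp only [chart, rot, Complex.mul_re, Complex.exp_ofReal_mul_I_re,
            Complex.exp_ofReal_mul_I_im, Matrix.cons_val_zero, Matrix.cons_val_one, Fin.zero_eta]
          ring
        · simp only [chart, rot, Complex.mul_im, Complex.exp_ofReal_mul_I_re,
            Complex.exp_ofReal_mul_I_im, Matrix.cons_val_zero, Matrix.cons_val_one, Fin.mk_one]
          ring
        · simp only [chart, rot, hn, Matrix.cons_val, Fin.reduceFinMk]
      rw [h1, hm _ (hmem p hp), ← Complex.exp_nat_mul, mul_assoc]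
  refine ⟨W, hW, fun x hx hx2 => ?_⟩
  have hr : 0 < rad x := by linarith
  have hrc : (rad x : ℂ) ≠ 0 := by exact_mod_cast hr.ne'
  have hre : (zet 1 x).re = x 0 / rad x := by
    rw [zet, Complex.div_ofReal_re]; simp
  have him : (zet 1 x).im = x 1 / rad x := by
    rw [zet, Complex.div_ofReal_im]; simp
  have hsq := rad_sq x
  have hn : (zet 1 x).re ^ 2 + (zet 1 x).im ^ 2 = 1 - (x 2 / rad x) ^ 2 := by
    rw [hre, him]; field_simp; linarith
  have hp : (zet 1 x, rp - rad x) ∈ disc (Iio S) := by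
    refine ⟨?_, by rw [mem_Iio]; linarith⟩
    rw [mem_ball_zero_iff]
    have h1 : ‖zet 1 x‖ ^ 2 < 1 := by
      rw [norm_sq_eq, hn]
      have : 0 < x 2 / rad x := div_pos hx2 hr
      nlinarith
    nlinarith [norm_nonneg (zet 1 x)]
  have hx' : chart rp (zet 1 x, rp - rad x) = x := by
    ext i
    fin_cases i
    · simp only [chart, hre, Matrix.cons_val_zero, Fin.zero_eta, sub_sub_cancel]
      field_simp
    · simp only [chart, him, Matrix.cons_val_one, Matrix.cons_val_zero, Fin.mk_one, sub_sub_cancel]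
      field_simp
    · simp only [chart, hn, Matrix.cons_val, Fin.reduceFinMk, sub_sub_cancel]
      rw [Real.sqrt_sq (div_pos hx2 hr).le]
      field_simp
  have := h _ hp
  simp only [hx', norm_sq_eq, hn] at this
  exact this

/-- The coefficient of `zet ^ n` in a function of mode `n`, as a function of `s = r₊ - r` and
`z = cos θ`. -/
theorem exists_reduction_nat (hS : S < rp) (n : ℕ) {u : (Fin 3 → ℝ) → ℂ}
    (hu : ContDiffOn ℝ ∞ u {x | rp - S < rad x})
    (hm : ∀ x, rp - S < rad x → ∀ φ : ℝ, u (rot φ x) = Complex.exp (n * φ * Complex.I) * u x) :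
    ∃ w : ℝ × ℝ → ℂ, ContDiffOn ℝ ∞ w (dom S) ∧
      ∀ x, rp - S < rad x → u x = zet 1 x ^ n * w (rp - rad x, x 2 / rad x) := by
  obtain ⟨W₁, hW₁, h₁⟩ := exists_hemisphere_reduction hS n hu hm
  -- reflection in the equatorial plane
  set refl : (Fin 3 → ℝ) → Fin 3 → ℝ := fun x => ![x 0, x 1, -x 2] with hrefl
  have hrad : ∀ x, rad (refl x) = rad x := fun x => by simp [rad, hrefl]
  have hreflrot : ∀ φ x, refl (rot φ x) = rot φ (refl x) := fun φ x => by
    ext i; fin_cases i <;> simp [hrefl, rot]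
  have hreflrefl : ∀ x, refl (refl x) = x := fun x => by
    ext i; fin_cases i <;> simp [hrefl]
  have hreflsmooth : ContDiff ℝ ∞ refl := by
    rw [contDiff_pi]
    intro i
    fin_cases i
    · exact contDiff_apply ℝ ℝ 0
    · exact contDiff_apply ℝ ℝ 1
    · exact (contDiff_apply ℝ ℝ 2).neg
  obtain ⟨W₂, hW₂, h₂⟩ := exists_hemisphere_reduction hS n (u := u ∘ refl)
    (hu.comp hreflsmooth.contDiffOn fun x hx => by
      change _ < rad (refl x); rw [hrad]; exact hx)
    fun x hx φ => by
      simp only [Function.comp]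
      rw [hreflrot, hm _ (by rw [hrad]; exact hx)]
  have h₂' : ∀ x, rp - S < rad x → x 2 < 0 →
      u x = zet 1 x ^ n * W₂ (1 - (x 2 / rad x) ^ 2, rp - rad x) := fun x hx hx2 => by
    have h3 : (refl x) 2 = -x 2 := rfl
    have h4 : zet 1 (refl x) = zet 1 x := by rw [zet, zet, hrad]; rfl
    have := h₂ (refl x) (by rw [hrad]; exact hx) (by rw [h3]; linarith)
    simp only [Function.comp, hreflrefl, hrad, h3, h4, neg_div, neg_sq] at this
    exact this
  -- the formula on the prime meridian
  set pt : ℝ × ℝ → Fin 3 → ℝ := fun p => ![(rp - p.1) * √(1 - p.2 ^ 2), 0, (rp - p.1) * p.2]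
    with hpt
  set w₀ : ℝ × ℝ → ℂ := fun p => u (pt p) / ((√(1 - p.2 ^ 2) : ℝ) : ℂ) ^ n with hw₀
  have hradpt : ∀ p : ℝ × ℝ, p.1 < S → p.2 ∈ Ioo (-1 : ℝ) 1 → rad (pt p) = rp - p.1 := fun p h1 h2 =>
    rad_eq_of_sq (by linarith) (by
      simp only [hpt, Matrix.cons_val_zero, Matrix.cons_val_one, Matrix.cons_val]
      rw [mul_pow, Real.sq_sqrt (one_sub_sq_pos h2).le]; ring)
  have hzpt : ∀ p : ℝ × ℝ, p.1 < S → p.2 ∈ Ioo (-1 : ℝ) 1 →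
      zet 1 (pt p) = ((√(1 - p.2 ^ 2) : ℝ) : ℂ) := fun p h1 h2 => by
    have hne : ((rp - p.1 : ℝ) : ℂ) ≠ 0 := by
      have : 0 < rp - p.1 := by linarith
      exact_mod_cast this.ne'
    rw [zet, hradpt p h1 h2]
    simp only [hpt, Matrix.cons_val_zero, Matrix.cons_val_one]
    rw [Complex.ofReal_mul]
    simp only [Complex.ofReal_zero, mul_zero, add_zero]
    exact mul_div_cancel_left₀ _ hne
  have hsq0 : ∀ p : ℝ × ℝ, p.2 ∈ Ioo (-1 : ℝ) 1 → ((√(1 - p.2 ^ 2) : ℝ) : ℂ) ^ n ≠ 0 := fun p h2 => by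
    have : √(1 - p.2 ^ 2) ≠ 0 := (Real.sqrt_pos.2 (one_sub_sq_pos h2)).ne'
    exact pow_ne_zero _ (by exact_mod_cast this)
  have hpt2 : ∀ p : ℝ × ℝ, p.1 < S → (pt p) 2 / (rp - p.1) = p.2 := fun p h1 => by
    have : rp - p.1 ≠ 0 := by linarith
    simp only [hpt, Matrix.cons_val]
    field_simp
  have hw₁ : ∀ p : ℝ × ℝ, p.1 < S → p.2 ∈ Ioo (-1 : ℝ) 1 → 0 < p.2 →
      w₀ p = W₁ (1 - p.2 ^ 2, p.1) := fun p h1 h2 h3 => by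
    have := h₁ (pt p) (by rw [hradpt p h1 h2]; linarith) (by
      simp only [hpt, Matrix.cons_val]; exact mul_pos (by linarith) h3)
    rw [hradpt p h1 h2, hzpt p h1 h2, hpt2 p h1, sub_sub_cancel] at this
    simp only [hw₀]
    rw [this, mul_div_cancel_left₀ _ (hsq0 p h2)]
  have hw₂ : ∀ p : ℝ × ℝ, p.1 < S → p.2 ∈ Ioo (-1 : ℝ) 1 → p.2 < 0 →
      w₀ p = W₂ (1 - p.2 ^ 2, p.1) := fun p h1 h2 h3 => by
    have := h₂' (pt p) (by rw [hradpt p h1 h2]; linarith) (by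
      simp only [hpt, Matrix.cons_val]; exact mul_neg_of_pos_of_neg (by linarith) h3)
    rw [hradpt p h1 h2, hzpt p h1 h2, hpt2 p h1, sub_sub_cancel] at this
    simp only [hw₀]
    rw [this, mul_div_cancel_left₀ _ (hsq0 p h2)]
  have hw₀s : ContDiffOn ℝ ∞ w₀ (Iio S ×ˢ Ioo (-1 : ℝ) 1) := by
    have hsq : ContDiffOn ℝ ∞ (fun p : ℝ × ℝ => √(1 - p.2 ^ 2)) (Iio S ×ˢ Ioo (-1 : ℝ) 1) :=
      ContDiffOn.sqrt (by fun_prop) fun p hp => (one_sub_sq_pos hp.2).ne'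
    have hr : ContDiff ℝ ∞ fun p : ℝ × ℝ => rp - p.1 := contDiff_const.sub contDiff_fst
    have hpts : ContDiffOn ℝ ∞ pt (Iio S ×ˢ Ioo (-1 : ℝ) 1) := by
      rw [contDiffOn_pi]
      intro i
      fin_cases i
      · exact hr.contDiffOn.mul hsq
      · exact contDiffOn_const
      · exact (hr.mul contDiff_snd).contDiffOn
    simp only [hw₀, div_eq_mul_inv]
    refine (hu.comp hpts fun p hp => ?_).mul
      (((Complex.ofRealCLM.contDiff.comp_contDiffOn hsq).pow n).inv fun p hp => hsq0 p hp.2)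
    have h1 : p.1 < S := hp.1
    change _ < rad (pt p)
    rw [hradpt p h1 hp.2]
    linarith
  set w : ℝ × ℝ → ℂ := fun p => if 0 < p.2 then W₁ (1 - p.2 ^ 2, p.1) else
    if p.2 < 0 then W₂ (1 - p.2 ^ 2, p.1) else w₀ p with hw
  have hww₀ : ∀ p : ℝ × ℝ, p.1 < S → p.2 ∈ Ioo (-1 : ℝ) 1 → w p = w₀ p := fun p h1 h2 => by
    simp only [hw]
    split_ifs with h3 h4
    · exact (hw₁ p h1 h2 h3).symm
    · exact (hw₂ p h1 h2 h4).symm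
    · rfl
  have hmap : ContDiff ℝ ∞ fun p : ℝ × ℝ => (1 - p.2 ^ 2, p.1) := by fun_prop
  refine ⟨w, fun p hp => ?_, fun x hx => ?_⟩
  · rcases lt_trichotomy p.2 0 with h0 | h0 | h0
    · have h1 : ContDiffWithinAt ℝ ∞ (fun p : ℝ × ℝ => W₂ (1 - p.2 ^ 2, p.1))
          (dom S ∩ {p | p.2 < 0}) p :=
        (hW₂.comp hmap.contDiffOn fun q hq => ⟨⟨one_sub_sq_nonneg hq.1.2, by
          have : q.2 < 0 := hq.2
          nlinarith⟩, hq.1.1⟩) p ⟨hp, h0⟩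
      have h2 : {p : ℝ × ℝ | p.2 < 0} ∈ 𝓝 p := (isOpen_lt continuous_snd continuous_const).mem_nhds h0
      refine (contDiffWithinAt_inter h2).1 (h1.congr_of_mem (fun q hq => ?_) ⟨hp, h0⟩)
      have : q.2 < 0 := hq.2
      simp only [hw, if_neg (not_lt.2 this.le), if_pos this]
    · have h2 : Iio S ×ˢ Ioo (-1 : ℝ) 1 ∈ 𝓝 p := (isOpen_Iio.prod isOpen_Ioo).mem_nhds
        ⟨hp.1, by rw [h0]; exact ⟨by norm_num, by norm_num⟩⟩
      refine ((hw₀s.contDiffAt h2).congr_of_eventuallyEq ?_).contDiffWithinAt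
      filter_upwards [h2] with q hq
      exact hww₀ q hq.1 hq.2
    · have h1 : ContDiffWithinAt ℝ ∞ (fun p : ℝ × ℝ => W₁ (1 - p.2 ^ 2, p.1))
          (dom S ∩ {p | 0 < p.2}) p :=
        (hW₁.comp hmap.contDiffOn fun q hq => ⟨⟨one_sub_sq_nonneg hq.1.2, by
          have : 0 < q.2 := hq.2
          nlinarith⟩, hq.1.1⟩) p ⟨hp, h0⟩
      have h2 : {p : ℝ × ℝ | 0 < p.2} ∈ 𝓝 p := (isOpen_lt continuous_const continuous_snd).mem_nhds h0
      refine (contDiffWithinAt_inter h2).1 (h1.congr_of_mem (fun q hq => ?_) ⟨hp, h0⟩)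
      have : 0 < q.2 := hq.2
      simp only [hw, if_pos this]
  · have hr : 0 < rad x := by linarith
    rcases lt_trichotomy (x 2) 0 with h0 | h0 | h0
    · have h3 : x 2 / rad x < 0 := div_neg_of_neg_of_pos h0 hr
      rw [h₂' x hx h0]
      simp only [hw, if_neg (not_lt.2 h3.le), if_pos h3]
    · have hp : ((rp - rad x, x 2 / rad x) : ℝ × ℝ).2 ∈ Ioo (-1 : ℝ) 1 := by
        simp only [h0, zero_div]; exact ⟨by norm_num, by norm_num⟩
      have hlt : ((rp - rad x, x 2 / rad x) : ℝ × ℝ).1 < S := by simp only; linarith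
      have hpteq : pt (rp - rad x, 0) = ![rad x, 0, 0] := by simp [hpt]
      have hn : ‖zet 1 x‖ = 1 := by
        have hsq := rad_sq x
        have h1 : ‖zet 1 x‖ ^ 2 = 1 := by
          rw [norm_sq_eq, zet, Complex.div_ofReal_re, Complex.div_ofReal_im]
          simp only [Complex.add_re, Complex.ofReal_re, Complex.mul_re, Complex.I_re, Complex.add_im,
            Complex.ofReal_im, Complex.mul_im, Complex.I_im]
          field_simp
          rw [hsq, h0]; simp
        nlinarith [norm_nonneg (zet 1 x)]
      obtain ⟨φ, hφ⟩ := (Complex.norm_eq_one_iff _).1 hn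
      have hrotx : rot φ ![rad x, 0, 0] = x := by
        have hre : Real.cos φ = x 0 / rad x := by
          rw [← Complex.exp_ofReal_mul_I_re, hφ, zet, Complex.div_ofReal_re]; simp
        have him : Real.sin φ = x 1 / rad x := by
          rw [← Complex.exp_ofReal_mul_I_im, hφ, zet, Complex.div_ofReal_im]; simp
        ext i
        fin_cases i
        · simp [rot, hre]; field_simp
        · simp [rot, him]; field_simp
        · simp [rot, h0]
      have hrad0 : rad ![rad x, 0, 0] = rad x := rad_eq_of_sq hr.le (by simp)
      have h5 := hm ![rad x, 0, 0] (by rw [hrad0]; exact hx) φ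
      rw [hrotx] at h5
      rw [hww₀ _ hlt hp, h5, ← hφ, ← Complex.exp_nat_mul, mul_assoc]
      simp [hw₀, h0, hpteq]
    · have h3 : 0 < x 2 / rad x := div_pos h0 hr
      rw [h₁ x hx h0]
      simp only [hw, if_pos h3]

/-- The orientation of the complex coordinate that makes a function of mode `m` a multiple of a
nonnegative power. -/
def sgn (m : ℤ) : ℝ := if 0 ≤ m then 1 else -1

theorem sgn_mul_natAbs (m : ℤ) : sgn m * (m.natAbs : ℝ) = m := by
  unfold sgn
  split_ifs with h
  · rw [one_mul, Nat.cast_natAbs, abs_of_nonneg h]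
  · rw [Nat.cast_natAbs, abs_of_neg (not_le.1 h)]; push_cast; ring

theorem sgn_sq (m : ℤ) : sgn m ^ 2 = 1 := by unfold sgn; split_ifs <;> norm_num

/-- A smooth function of mode `m` is `ζ ^ |m|` times a smooth function of `r` and `cos θ`.  Negative
modes are reduced to positive ones by the reflection `x₂ ↦ -x₂`. -/
theorem exists_reduction (hS : S < rp) {m : ℤ} {u : (Fin 3 → ℝ) → ℂ}
    (hu : ContDiffOn ℝ ∞ u {x | rp - S < rad x}) (hm : HasMode m {x | rp - S < rad x} u) :
    ∃ w : ℝ × ℝ → ℂ, ContDiffOn ℝ ∞ w (dom S) ∧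
      ∀ x, rp - S < rad x → u x = zet (sgn m) x ^ m.natAbs * w (rp - rad x, x 2 / rad x) := by
  have hrot := fun x (hx : rp - S < rad x) φ => apply_rot_of_hasMode hu hm hx φ
  rcases le_or_gt 0 m with h0 | h0
  · have hs : sgn m = 1 := if_pos h0
    rw [hs]
    refine exists_reduction_nat hS m.natAbs hu fun x hx φ => ?_
    rw [hrot x hx φ, ← Int.cast_natCast, Int.natAbs_of_nonneg h0]
  · have hs : sgn m = -1 := if_neg (not_le.2 h0)
    set refl : (Fin 3 → ℝ) → Fin 3 → ℝ := fun x => ![x 0, -x 1, x 2] with hrefl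
    have hrad : ∀ x, rad (refl x) = rad x := fun x => by simp [rad, hrefl]
    have hreflrot : ∀ φ x, refl (rot φ x) = rot (-φ) (refl x) := fun φ x => by
      ext i; fin_cases i <;> simp [hrefl, rot]; ring
    have hreflrefl : ∀ x, refl (refl x) = x := fun x => by
      ext i; fin_cases i <;> simp [hrefl]
    have hreflsmooth : ContDiff ℝ ∞ refl := by
      rw [contDiff_pi]
      intro i
      fin_cases i
      · exact contDiff_apply ℝ ℝ 0
      · exact (contDiff_apply ℝ ℝ 1).neg
      · exact contDiff_apply ℝ ℝ 2
    obtain ⟨w, hw, h⟩ := exists_reduction_nat hS m.natAbs (u := u ∘ refl)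
      (hu.comp hreflsmooth.contDiffOn fun x hx => by
        change _ < rad (refl x); rw [hrad]; exact hx)
      fun x hx φ => by
        simp only [Function.comp]
        rw [hreflrot, hrot _ (by rw [hrad]; exact hx)]
        have : (m : ℂ) = -(m.natAbs : ℂ) := by
          rw [← Int.cast_natCast, Int.ofNat_natAbs_of_nonpos h0.le]; push_cast; ring
        rw [this]
        congr 2
        push_cast
        ring
    refine ⟨w, hw, fun x hx => ?_⟩
    have h1 := h (refl x) (by rw [hrad]; exact hx)
    simp only [Function.comp, hreflrefl, hrad] at h1
    have h2 : zet (sgn m) x = zet 1 (refl x) := by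
      rw [zet, zet, hrad, hs]
      simp [hrefl]
    rw [h1, h2]
    rfl

end Reduction

/-! ### Derivatives of functions of fixed frequency and mode -/

section ModeCalculus

variable {lam : ℂ} {σ rp : ℝ} {n : ℕ}

/-- The spacetime function `e^{-iλt} ζⁿ A(s, z)` with `s = r₊ - r` and `z = cos θ`. -/
def modeFun (lam : ℂ) (σ rp : ℝ) (n : ℕ) (A : ℝ × ℝ → ℂ) (q : Fin 4 → ℝ) : ℂ :=
  Complex.exp (-Complex.I * lam * (q 0 : ℂ)) *
    (zet σ (space q) ^ n * A (rp - rad (space q), space q 2 / rad (space q)))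

/-- The coordinate map to the `(s, z)` plane. -/
def szMap (rp : ℝ) (x : Fin 3 → ℝ) : ℝ × ℝ := (rp - rad x, x 2 / rad x)

/-- The spatial inner product of a position with a tangent vector. -/
def sdot (q v : Fin 4 → ℝ) : ℝ := q 1 * v 1 + q 2 * v 2 + q 3 * v 3

theorem hasFDerivAt_coord (q : Fin 4 → ℝ) (j : Fin 4) :
    HasFDerivAt (fun q : Fin 4 → ℝ => q j) (ContinuousLinearMap.proj (R := ℝ) j) q :=
  (ContinuousLinearMap.proj (R := ℝ) (φ := fun _ : Fin 4 => ℝ) j).hasFDerivAt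

theorem exists_hasFDerivAt_rad {q : Fin 4 → ℝ} (hq : 0 < rad (space q)) :
    ∃ L : (Fin 4 → ℝ) →L[ℝ] ℝ, HasFDerivAt (fun q => rad (space q)) L q ∧
      ∀ v, L v = sdot q v / rad (space q) := by
  have h0 : q 1 ^ 2 + q 2 ^ 2 + q 3 ^ 2 ≠ 0 := by
    have := rad_sq (space q)
    change _ = q 1 ^ 2 + q 2 ^ 2 + q 3 ^ 2 at this
    rw [← this]; positivity
  have h1 := ((((hasFDerivAt_coord q 1).pow 2).add ((hasFDerivAt_coord q 2).pow 2)).add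
    ((hasFDerivAt_coord q 3).pow 2)).sqrt h0
  refine ⟨_, h1, fun v => ?_⟩
  have e : rad (space q) = √(q 1 ^ 2 + q 2 ^ 2 + q 3 ^ 2) := rfl
  rw [e]
  have hr : √(q 1 ^ 2 + q 2 ^ 2 + q 3 ^ 2) ≠ 0 := by rw [← e]; exact hq.ne'
  simp [sdot]
  field_simp

/-- The derivative of a function of fixed frequency and mode, off the axis. -/
theorem fderiv_modeFun {A : ℝ × ℝ → ℂ} {q : Fin 4 → ℝ} (hq : 0 < rad (space q))
    (hζ : (q 1 : ℂ) + Complex.I * (σ * q 2) ≠ 0)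
    (hA : DifferentiableAt ℝ A (szMap rp (space q))) :
    DifferentiableAt ℝ (modeFun lam σ rp n A) q ∧ ∀ v,
      fderiv ℝ (modeFun lam σ rp n A) q v
        = (-Complex.I * lam * v 0 + n * ((v 1 + Complex.I * (σ * v 2))
            / ((q 1 : ℂ) + Complex.I * (σ * q 2)) - sdot q v / (rad (space q) : ℂ) ^ 2))
            * modeFun lam σ rp n A q
          - sdot q v / rad (space q)
            * modeFun lam σ rp n (fun p => fderiv ℝ A p (1, 0)) q
          + (v 3 / rad (space q) - q 3 * sdot q v / (rad (space q) : ℂ) ^ 3)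
            * modeFun lam σ rp n (fun p => fderiv ℝ A p (0, 1)) q := by
  obtain ⟨Lr, hLr, hLrv⟩ := exists_hasFDerivAt_rad hq
  have hrc : (rad (space q) : ℂ) ≠ 0 := by exact_mod_cast hq.ne'
  -- the phase
  have hE : HasFDerivAt (fun q : Fin 4 → ℝ => Complex.exp (-Complex.I * lam * (q 0 : ℂ)))
      (Complex.exp (-Complex.I * lam * (q 0 : ℂ)) • ((-Complex.I * lam) •
        (Complex.ofRealCLM.comp (ContinuousLinearMap.proj (R := ℝ) (φ := fun _ : Fin 4 => ℝ) 0)))) q :=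
    ((Complex.ofRealCLM.hasFDerivAt.comp q (hasFDerivAt_coord q 0)).const_mul
      (-Complex.I * lam)).cexp
  -- the angular factor
  have hrC : HasFDerivAt (fun q : Fin 4 → ℝ => (rad (space q) : ℂ)) (Complex.ofRealCLM.comp Lr) q :=
    Complex.ofRealCLM.hasFDerivAt.comp q hLr
  have hnum : HasFDerivAt (fun q : Fin 4 → ℝ => (q 1 : ℂ) + Complex.I * (σ * q 2))
      (Complex.ofRealCLM.comp (ContinuousLinearMap.proj (R := ℝ) (φ := fun _ : Fin 4 => ℝ) 1)
        + Complex.I • ((σ : ℂ) • Complex.ofRealCLM.comp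
          (ContinuousLinearMap.proj (R := ℝ) (φ := fun _ : Fin 4 => ℝ) 2))) q :=
    (Complex.ofRealCLM.hasFDerivAt.comp q (hasFDerivAt_coord q 1)).add
      (((Complex.ofRealCLM.hasFDerivAt.comp q (hasFDerivAt_coord q 2)).const_mul
        (σ : ℂ)).const_mul Complex.I)
  have hinv : HasFDerivAt (fun q : Fin 4 → ℝ => ((rad (space q) : ℂ))⁻¹)
      ((-((rad (space q) : ℂ) ^ 2)⁻¹) • Complex.ofRealCLM.comp Lr) q := by
    have h1 : HasDerivAt (fun x : ℂ => x⁻¹) (-((rad (space q) : ℂ) ^ 2)⁻¹) (rad (space q) : ℂ) :=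
      hasDerivAt_inv hrc
    exact h1.comp_hasFDerivAt q hrC
  have hZ : HasFDerivAt (fun q : Fin 4 → ℝ => zet σ (space q)) _ q := hnum.mul hinv
  have hZn := hZ.pow n
  -- the profile
  have hs : HasFDerivAt (fun q : Fin 4 → ℝ => rp - rad (space q)) (-Lr) q := hLr.const_sub rp
  have hz : HasFDerivAt (fun q : Fin 4 → ℝ => q 3 * (rad (space q))⁻¹) _ q :=
    (hasFDerivAt_coord q 3).mul ((hasDerivAt_inv hq.ne').comp_hasFDerivAt q hLr)
  have hsz : HasFDerivAt (fun q : Fin 4 → ℝ => szMap rp (space q)) _ q := hs.prodMk hz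
  have hAq := hA.hasFDerivAt.comp q hsz
  have hM : HasFDerivAt (modeFun lam σ rp n A) _ q := hE.mul (hZn.mul hAq)
  refine ⟨hM.differentiableAt, fun v => ?_⟩
  rw [hM.fderiv]
  have hZ0 : zet σ (space q) ≠ 0 := div_ne_zero hζ hrc
  have hpow : (n : ℂ) * zet σ (space q) ^ (n - 1) = n * (zet σ (space q) ^ n / zet σ (space q)) := by
    rcases Nat.eq_zero_or_pos n with h | h
    · simp [h]
    · obtain ⟨k, rfl⟩ := Nat.exists_eq_succ_of_ne_zero h.ne'
      rw [Nat.succ_sub_one, pow_succ, mul_div_cancel_right₀ _ hZ0]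
  obtain ⟨A1, hA1⟩ : ∃ c, fderiv ℝ A (szMap rp (space q)) (1, 0) = c := ⟨_, rfl⟩
  obtain ⟨A2, hA2⟩ : ∃ c, fderiv ℝ A (szMap rp (space q)) (0, 1) = c := ⟨_, rfl⟩
  have hpair : ∀ x y : ℝ, fderiv ℝ A (szMap rp (space q)) (x, y) = x * A1 + y * A2 :=
    fun x y => by
      have : ((x, y) : ℝ × ℝ) = x • (1, 0) + y • (0, 1) := by simp
      rw [this, map_add, map_smul, map_smul, Complex.real_smul, Complex.real_smul, hA1, hA2]
  have hzet : zet σ (space q) = ((q 1 : ℂ) + Complex.I * (σ * q 2)) / rad (space q) := rfl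
  have hmod : ∀ B, modeFun lam σ rp n B q = Complex.exp (-Complex.I * lam * (q 0 : ℂ)) *
      (zet σ (space q) ^ n * B (szMap rp (space q))) := fun _ => rfl
  rw [hmod, hmod, hmod, hA1, hA2]
  simp only [add_apply, smul_apply, ContinuousLinearMap.comp_apply, ContinuousLinearMap.prod_apply,
    ContinuousLinearMap.proj_apply, Complex.ofRealCLM_apply, smul_eq_mul, neg_apply, hLrv, hpair,
    nsmul_eq_mul, hpow]
  change _ = (-Complex.I * lam * v 0 + n * ((v 1 + Complex.I * (σ * v 2))
      / ((q 1 : ℂ) + Complex.I * (σ * q 2)) - sdot q v / (rad (space q) : ℂ) ^ 2)) *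
    (_ * (_ * A (rp - rad (space q), space q 2 / rad (space q)))) - _ + _
  generalize zet σ (space q) ^ n = Zn
  rw [hzet]
  generalize (q 1 : ℂ) + Complex.I * (σ * q 2) = N at hζ ⊢
  generalize (v 1 : ℂ) + Complex.I * (σ * v 2) = N'
  generalize Complex.exp _ = E0
  generalize A _ = A0
  push_cast
  field_simp
  ring

end ModeCalculus

/-! ### The determinant of the dual metric -/

section Determinant

variable {M a : ℝ} {fp : ℝ → ℝ} {x : Fin 3 → ℝ}

theorem cosSq_add_sinSq (hx : 0 < rad x) : cosSq x + sinSq x = 1 := by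
  have h := rad_sq x
  rw [cosSq, sinSq]; field_simp; linarith

theorem cosSq_eq : cosSq x = (x 2 / rad x) ^ 2 := by rw [cosSq, div_pow]

theorem DeltaTheta_pos (ha : |a| < 1) (hx : 0 < rad x) : 0 < DeltaTheta a x := by
  have h1 := cosSq_add_sinSq hx
  have h2 : 0 ≤ sinSq x := by unfold sinSq; positivity
  have h3 : a ^ 2 < 1 := (sq_lt_one_iff_abs_lt_one a).2 ha
  have h4 : 0 ≤ cosSq x := by unfold cosSq; positivity
  unfold DeltaTheta
  nlinarith

theorem rhoSq_pos (hx : 0 < rad x) : 0 < rhoSq a x := by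
  unfold rhoSq cosSq; positivity

/-- Off the axis the dual metric is the form
`-ϱ⁻² (Δ_r V² + 2 (1 - α) V W + k Y² + (Δ_θ / ρ²) Θ²)` in a frame `V, W, Y, Θ`, with
`ρ² = x₁² + x₂²` and `Θ = ρ ∂_θ`. -/
theorem dualMetric_eq_frame (ha : |a| < 1) (hx : 0 < rad x) (hρ : x 0 ^ 2 + x 1 ^ 2 ≠ 0) :
    dualMetric M a fp x = -(rhoSq a x)⁻¹ •
      ((Matrix.of ![vecR x + fp (rad x) • vecT, (rad x ^ 2 + a ^ 2) • vecT + a • vecPhi x,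
          (a * sinSq x) • vecT + vecPhi x,
          ![0, x 0 * x 2, x 1 * x 2, -(x 0 ^ 2 + x 1 ^ 2)]]).transpose *
        !![DeltaR M a (rad x), 1 - a ^ 2, 0, 0; 1 - a ^ 2, 0, 0, 0;
          0, 0, (1 - a ^ 2) ^ 2 / (DeltaTheta a x * sinSq x), 0;
          0, 0, 0, DeltaTheta a x / (x 0 ^ 2 + x 1 ^ 2)] *
        Matrix.of ![vecR x + fp (rad x) • vecT, (rad x ^ 2 + a ^ 2) • vecT + a • vecPhi x,
          (a * sinSq x) • vecT + vecPhi x,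
          ![0, x 0 * x 2, x 1 * x 2, -(x 0 ^ 2 + x 1 ^ 2)]]) := by
  have hΔ := (DeltaTheta_pos ha hx).ne'
  have hcs := cosSq_add_sinSq hx
  have hs : sinSq x ≠ 0 := by unfold sinSq; positivity
  have hr := hx.ne'
  have hsq := rad_sq x
  rw [dualMetric]
  congr 1
  set V := vecR x + fp (rad x) • vecT with hV
  set W := (rad x ^ 2 + a ^ 2) • vecT + a • vecPhi x with hW
  set Y := (a * sinSq x) • vecT + vecPhi x with hY
  set Θ : Fin 4 → ℝ := ![0, x 0 * x 2, x 1 * x 2, -(x 0 ^ 2 + x 1 ^ 2)] with hΘ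
  have hround : roundDual x = (x 0 ^ 2 + x 1 ^ 2)⁻¹ • Matrix.vecMulVec Θ Θ
      + (sinSq x)⁻¹ • Matrix.vecMulVec (vecPhi x) (vecPhi x) := by
    have e : (sinSq x)⁻¹ = rad x ^ 2 / (x 0 ^ 2 + x 1 ^ 2) := by rw [sinSq, inv_div]
    rw [roundDual, e]
    ext i j
    fin_cases i <;> fin_cases j <;>
      simp [vecR, vecPhi, vecT, hΘ] <;> field_simp <;> (try rw [hsq]) <;> ring
  have hΔs : DeltaTheta a x * (sinSq x)⁻¹ - a ^ 2 * (1 - a ^ 2 + DeltaTheta a x) / DeltaTheta a x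
      = (1 - a ^ 2) ^ 2 / (DeltaTheta a x * sinSq x) := by
    have hD : DeltaTheta a x = 1 - a ^ 2 + a ^ 2 * sinSq x := by
      rw [DeltaTheta]; linear_combination -a ^ 2 * hcs
    field_simp
    rw [hD]; ring
  have hb : ((1 - a ^ 2) ^ 2 * a / DeltaTheta a x) • symm2 vecT (vecPhi x)
      + ((1 - a ^ 2) ^ 2 * a ^ 2 * sinSq x / DeltaTheta a x) • Matrix.vecMulVec vecT vecT
      + ((1 - a ^ 2) ^ 2 / (DeltaTheta a x * sinSq x)) •
        Matrix.vecMulVec (vecPhi x) (vecPhi x)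
      = ((1 - a ^ 2) ^ 2 / (DeltaTheta a x * sinSq x)) • Matrix.vecMulVec Y Y := by
    ext i j
    simp only [hY, symm2, Matrix.add_apply, Matrix.smul_apply, Matrix.vecMulVec_apply,
      Pi.add_apply, Pi.smul_apply, smul_eq_mul]
    field_simp
    ring
  have hprod : (Matrix.of ![V, W, Y, Θ]).transpose *
      !![DeltaR M a (rad x), 1 - a ^ 2, 0, 0; 1 - a ^ 2, 0, 0, 0;
          0, 0, (1 - a ^ 2) ^ 2 / (DeltaTheta a x * sinSq x), 0;
          0, 0, 0, DeltaTheta a x / (x 0 ^ 2 + x 1 ^ 2)] * Matrix.of ![V, W, Y, Θ]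
      = DeltaR M a (rad x) • Matrix.vecMulVec V V + (1 - a ^ 2) • symm2 V W
        + ((1 - a ^ 2) ^ 2 / (DeltaTheta a x * sinSq x)) • Matrix.vecMulVec Y Y
        + (DeltaTheta a x / (x 0 ^ 2 + x 1 ^ 2)) • Matrix.vecMulVec Θ Θ := by
    ext i j
    simp only [Matrix.mul_apply, Fin.sum_univ_four, Matrix.transpose_apply, Matrix.of_apply,
      Matrix.cons_val', Matrix.cons_val_zero, Matrix.cons_val_one, Matrix.cons_val,
      Matrix.add_apply, Matrix.smul_apply, symm2, Matrix.vecMulVec_apply, smul_eq_mul]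
    ring
  rw [hprod, ← hb, ← hΔs, hround]
  module

/-- The frame of `dualMetric_eq_frame` has determinant `±ϱ² r ρ²`, which makes
`|g|^{-1/2} = (1 - α)² r² / ϱ²` off the axis; on the axis this is a direct computation. -/
theorem det_dualMetric (ha : |a| < 1) (hx : 0 < rad x) :
    (dualMetric M a fp x).det = -((1 - a ^ 2) ^ 2 * rad x ^ 2 / rhoSq a x) ^ 2 := by
  have hϱ := (rhoSq_pos (a := a) hx).ne'
  have hr := hx.ne'
  have hsq := rad_sq x
  have hΔ := (DeltaTheta_pos ha hx).ne'
  have hcs := cosSq_add_sinSq hx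
  rcases eq_or_ne (x 0 ^ 2 + x 1 ^ 2) 0 with hρ | hρ
  · have h0 : x 0 = 0 := by nlinarith [sq_nonneg (x 0), sq_nonneg (x 1)]
    have h1 : x 1 = 0 := by nlinarith [sq_nonneg (x 0), sq_nonneg (x 1)]
    have hs0 : sinSq x = 0 := by rw [sinSq, hρ, zero_div]
    have hΔ1 : DeltaTheta a x = 1 - a ^ 2 := by rw [DeltaTheta]; rw [hs0, add_zero] at hcs; rw [hcs, mul_one]
    have h2 : x 2 ^ 2 = rad x ^ 2 := by rw [hsq, h0, h1]; ring
    have hϱ2 : rhoSq a x = rad x ^ 2 + a ^ 2 := by rw [rhoSq]; rw [hs0, add_zero] at hcs; rw [hcs, mul_one]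
    set ε := x 2 / rad x with hε
    have hε2 : ε ^ 2 = 1 := by rw [hε, div_pow, h2, div_self (pow_ne_zero 2 hr)]
    have hB : dualMetric M a fp x = -(rhoSq a x)⁻¹ •
        !![DeltaR M a (rad x) * fp (rad x) ^ 2 + 2 * ((1 - a ^ 2) * fp (rad x) * (rad x ^ 2 + a ^ 2)),
          0, 0, ε * (DeltaR M a (rad x) * fp (rad x) + (1 - a ^ 2) * (rad x ^ 2 + a ^ 2));
          0, (1 - a ^ 2) * rad x ^ 2, 0, 0; 0, 0, (1 - a ^ 2) * rad x ^ 2, 0;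
          ε * (DeltaR M a (rad x) * fp (rad x) + (1 - a ^ 2) * (rad x ^ 2 + a ^ 2)),
          0, 0, DeltaR M a (rad x)] := by
      rw [dualMetric]
      congr 1
      ext i j
      fin_cases i <;> fin_cases j <;>
        simp [vecR, vecPhi, vecT, symm2, roundDual, h0, h1, hs0, hΔ1, ← hε] <;>
        first | ring1 | linear_combination (DeltaR M a (rad x) - (1 - a ^ 2) * rad x ^ 2) * hε2
    rw [hB, Matrix.det_smul]
    simp [Matrix.det_succ_row_zero, Fin.sum_univ_succ, Fin.succAbove]
    field_simp
    rw [hε2, hϱ2]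
    ring
  · have hs : sinSq x ≠ 0 := by unfold sinSq; positivity
    rw [dualMetric_eq_frame ha hx hρ, Matrix.det_smul, Matrix.det_mul, Matrix.det_mul,
      Matrix.det_transpose]
    have hdet : (Matrix.of ![vecR x + fp (rad x) • vecT,
        (rad x ^ 2 + a ^ 2) • vecT + a • vecPhi x, (a * sinSq x) • vecT + vecPhi x,
          ![0, x 0 * x 2, x 1 * x 2, -(x 0 ^ 2 + x 1 ^ 2)]]).det ^ 2
        = (rhoSq a x * rad x * (x 0 ^ 2 + x 1 ^ 2)) ^ 2 := by
      have hϱ2 : rhoSq a x = rad x ^ 2 + a ^ 2 - a ^ 2 * sinSq x := by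
        rw [rhoSq]; linear_combination a ^ 2 * hcs
      rw [hϱ2]
      generalize sinSq x = s2
      have e : (Matrix.of ![vecR x + fp (rad x) • vecT,
        (rad x ^ 2 + a ^ 2) • vecT + a • vecPhi x, (a * s2) • vecT + vecPhi x,
          ![0, x 0 * x 2, x 1 * x 2, -(x 0 ^ 2 + x 1 ^ 2)]]).det * rad x
          = ((rad x ^ 2 + a ^ 2 - a ^ 2 * s2) * (x 0 ^ 2 + x 1 ^ 2))
            * (x 0 ^ 2 + x 1 ^ 2 + x 2 ^ 2) := by
        simp [Matrix.det_succ_row_zero, Fin.sum_univ_succ, vecR, vecPhi, vecT, Fin.succAbove]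
        field_simp
        ring
      rw [← hsq, eq_comm, ← div_eq_iff hr] at e
      rw [← e]
      field_simp
    have hQ : (!![DeltaR M a (rad x), 1 - a ^ 2, 0, 0; 1 - a ^ 2, 0, 0, 0;
          0, 0, (1 - a ^ 2) ^ 2 / (DeltaTheta a x * sinSq x), 0;
          0, 0, 0, DeltaTheta a x / (x 0 ^ 2 + x 1 ^ 2)]).det
          = -((1 - a ^ 2) ^ 4 / (sinSq x * (x 0 ^ 2 + x 1 ^ 2))) := by
      simp [Matrix.det_succ_row_zero, Fin.sum_univ_succ, Fin.succAbove]
      field_simp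
      ring
    have e2 : sinSq x * rad x ^ 2 = x 0 ^ 2 + x 1 ^ 2 := by rw [sinSq]; field_simp
    rw [hQ, mul_right_comm, ← sq, hdet, ← e2]
    simp only [Fintype.card_fin]
    field_simp

end Determinant

/-! ### The flux of a function of fixed frequency and mode -/

section Flux

variable {M a : ℝ} {fp : ℝ → ℝ} {x : Fin 3 → ℝ} {lam : ℂ} {σ rp : ℝ} {n : ℕ} {m : ℤ}

theorem sum_mul_apply_single (L : (Fin 4 → ℝ) →L[ℝ] ℂ) (V : Fin 4 → ℝ) :
    ∑ j, (V j : ℂ) * L (Pi.single j 1) = L V := by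
  have h := LinearMap.pi_apply_eq_sum_univ (L : (Fin 4 → ℝ) →ₗ[ℝ] ℂ) V
  rw [ContinuousLinearMap.coe_coe] at h
  rw [h]
  refine Finset.sum_congr rfl fun j _ => ?_
  rw [Complex.real_smul]
  congr 2
  ext k
  simp [Pi.single_apply, eq_comm]

/-- The contraction of the dual metric with a covector. -/
theorem sum_dualMetric (L : (Fin 4 → ℝ) →L[ℝ] ℂ) (i : Fin 4) :
    ∑ j, (dualMetric M a fp x i j : ℂ) * L (Pi.single j 1)
      = -(rhoSq a x : ℂ)⁻¹ *
        (DeltaR M a (rad x) * ((vecR x i + fp (rad x) * vecT i : ℝ) : ℂ)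
            * (L (vecR x) + fp (rad x) * L vecT)
          + (1 - a ^ 2) * (((vecR x i + fp (rad x) * vecT i : ℝ) : ℂ)
              * ((rad x ^ 2 + a ^ 2) * L vecT + a * L (vecPhi x))
            + (((rad x ^ 2 + a ^ 2) * vecT i + a * vecPhi x i : ℝ) : ℂ)
              * (L (vecR x) + fp (rad x) * L vecT))
          + DeltaTheta a x * (rad x ^ 2 * (L (Pi.single i 1) - vecT i * L vecT
              - vecR x i * L (vecR x)))
          - (a ^ 2 * (1 - a ^ 2 + DeltaTheta a x) / DeltaTheta a x)
            * (vecPhi x i * L (vecPhi x))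
          + ((1 - a ^ 2) ^ 2 * a / DeltaTheta a x) *
            (vecT i * L (vecPhi x) + vecPhi x i * L vecT)
          + ((1 - a ^ 2) ^ 2 * a ^ 2 * sinSq x / DeltaTheta a x) * (vecT i * L vecT)) := by
  have hadd : ∀ B C : Matrix (Fin 4) (Fin 4) ℝ, ∑ j, ((B + C) i j : ℂ) * L (Pi.single j 1)
      = ∑ j, (B i j : ℂ) * L (Pi.single j 1) + ∑ j, (C i j : ℂ) * L (Pi.single j 1) := by
    intro B C
    rw [← Finset.sum_add_distrib]
    exact Finset.sum_congr rfl fun j _ => by rw [Matrix.add_apply]; push_cast; ring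
  have hsub : ∀ B C : Matrix (Fin 4) (Fin 4) ℝ, ∑ j, ((B - C) i j : ℂ) * L (Pi.single j 1)
      = ∑ j, (B i j : ℂ) * L (Pi.single j 1) - ∑ j, (C i j : ℂ) * L (Pi.single j 1) := by
    intro B C
    rw [← Finset.sum_sub_distrib]
    exact Finset.sum_congr rfl fun j _ => by rw [Matrix.sub_apply]; push_cast; ring
  have hsmul : ∀ (c : ℝ) (B : Matrix (Fin 4) (Fin 4) ℝ),
      ∑ j, ((c • B) i j : ℂ) * L (Pi.single j 1) = c * ∑ j, (B i j : ℂ) * L (Pi.single j 1) := by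
    intro c B
    rw [Finset.mul_sum]
    exact Finset.sum_congr rfl fun j _ => by
      rw [Matrix.smul_apply, smul_eq_mul]; push_cast; ring
  have hvec : ∀ V W : Fin 4 → ℝ,
      ∑ j, ((Matrix.vecMulVec V W i j : ℝ) : ℂ) * L (Pi.single j 1) = V i * L W := by
    intro V W
    rw [← sum_mul_apply_single L W, Finset.mul_sum]
    exact Finset.sum_congr rfl fun j _ => by rw [Matrix.vecMulVec_apply]; push_cast; ring
  have hone : ∑ j, ((1 : Matrix (Fin 4) (Fin 4) ℝ) i j : ℂ) * L (Pi.single j 1)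
      = L (Pi.single i 1) := by
    rw [Finset.sum_eq_single i]
    · simp
    · intro j _ hj
      rw [Matrix.one_apply_ne' hj]; simp
    · simp
  simp only [dualMetric, symm2, roundDual, hadd, hsub, hsmul, hvec, hone, map_add, map_smul,
    Pi.add_apply, Pi.smul_apply, smul_eq_mul, Complex.real_smul]
  push_cast
  ring

/-- The `∂_r + f ∂_t` derivative of the profile `w`. -/
def radialDeriv (fp : ℝ → ℝ) (lam : ℂ) (rp : ℝ) (w : ℝ × ℝ → ℂ) (p : ℝ × ℝ) : ℂ :=
  -fderiv ℝ w p (1, 0) - Complex.I * lam * (fp (rp - p.1) * w p)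

/-- The symbol of `(r² + a²) ∂_t + a ∂_φ` at frequency `λ` and mode `m`. -/
def rotSymbol (a : ℝ) (lam : ℂ) (m : ℤ) (r : ℝ) : ℂ :=
  -Complex.I * lam * (r ^ 2 + a ^ 2) + Complex.I * a * m

/-- The factor `Δ_θ` as a function of `z = cos θ`. -/
def angFactor (a z : ℝ) : ℝ := 1 - a ^ 2 * z ^ 2

/-- The profile of the `∂_t` component of the flux. -/
def fluxT (M a : ℝ) (fp : ℝ → ℝ) (lam : ℂ) (rp : ℝ) (m : ℤ) (w : ℝ × ℝ → ℂ) (p : ℝ × ℝ) : ℂ :=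
  (fp (rp - p.1) * DeltaR M a (rp - p.1) * radialDeriv fp lam rp w p
    + (1 - a ^ 2) * fp (rp - p.1) * rotSymbol a lam m (rp - p.1) * w p
    + (1 - a ^ 2) * ((rp - p.1 : ℝ) ^ 2 + a ^ 2) * radialDeriv fp lam rp w p
    + ((1 - a ^ 2) ^ 2 * a / angFactor a p.2) * (Complex.I * m * w p)
    + ((1 - a ^ 2) ^ 2 * a ^ 2 * (1 - p.2 ^ 2) / angFactor a p.2) * (-Complex.I * lam * w p))
  / (rp - p.1 : ℝ) ^ 2

/-- The profile of the `∂_φ` component of the flux. -/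
def fluxPhi (a : ℝ) (fp : ℝ → ℝ) (lam : ℂ) (rp : ℝ) (m : ℤ) (w : ℝ × ℝ → ℂ) (p : ℝ × ℝ) : ℂ :=
  ((1 - a ^ 2) * a * radialDeriv fp lam rp w p
    - (a ^ 2 * (1 - a ^ 2 + angFactor a p.2) / angFactor a p.2) * (Complex.I * m * w p)
    + ((1 - a ^ 2) ^ 2 * a / angFactor a p.2) * (-Complex.I * lam * w p))
  / (rp - p.1 : ℝ) ^ 2

/-- The profile of the `∂_r` component of the flux. -/
def fluxR (M a : ℝ) (fp : ℝ → ℝ) (lam : ℂ) (rp : ℝ) (m : ℤ) (n : ℕ) (w : ℝ × ℝ → ℂ)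
    (p : ℝ × ℝ) : ℂ :=
  (DeltaR M a (rp - p.1) * radialDeriv fp lam rp w p
      + (1 - a ^ 2) * rotSymbol a lam m (rp - p.1) * w p) / (rp - p.1 : ℝ) ^ 2
    - n * (angFactor a p.2 * w p) / (rp - p.1 : ℝ)
    - p.2 * (angFactor a p.2 * fderiv ℝ w p (0, 1)) / (rp - p.1 : ℝ)

/-- The profile of the component of the flux along the complex direction `(1, iσ, 0)`. -/
def fluxN (a : ℝ) (w : ℝ × ℝ → ℂ) (p : ℝ × ℝ) : ℂ := angFactor a p.2 * w p

/-- The profile of the component of the flux along the axis. -/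
def fluxZ (a rp : ℝ) (w : ℝ × ℝ → ℂ) (p : ℝ × ℝ) : ℂ :=
  angFactor a p.2 * fderiv ℝ w p (0, 1) / (rp - p.1 : ℝ)

/-- The flux of `e^{-iλt} ζⁿ w`, up to the factor `-(1 - α)⁻²`. -/
def waveFlux (M a : ℝ) (fp : ℝ → ℝ) (lam : ℂ) (σ rp : ℝ) (m : ℤ) (n : ℕ) (w : ℝ × ℝ → ℂ) (i : Fin 4)
    (q : Fin 4 → ℝ) : ℂ :=
  vecT i * modeFun lam σ rp n (fluxT M a fp lam rp m w) q
    + vecR (space q) i * modeFun lam σ rp n (fluxR M a fp lam rp m n w) q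
    + vecPhi (space q) i * modeFun lam σ rp n (fluxPhi a fp lam rp m w) q
    + (n * (![0, 1, Complex.I * σ, 0] : Fin 4 → ℂ) i / ((q 1 : ℂ) + Complex.I * (σ * q 2)))
      * modeFun lam σ rp n (fluxN a w) q
    + (![0, 0, 0, 1] : Fin 4 → ℂ) i * modeFun lam σ rp n (fluxZ a rp w) q

theorem sqrt_abs_det_dualMetric (ha : |a| < 1) (hx : 0 < rad x) :
    √|(dualMetric M a fp x).det| = (1 - a ^ 2) ^ 2 * rad x ^ 2 / rhoSq a x := by
  have h := rhoSq_pos (a := a) hx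
  rw [det_dualMetric ha hx, abs_neg, abs_of_nonneg (sq_nonneg _), Real.sqrt_sq (by positivity)]

theorem num_ne_zero {q : Fin 4 → ℝ} (hq1 : q 1 ≠ 0) : (q 1 : ℂ) + Complex.I * (σ * q 2) ≠ 0 := fun h => by
  have := congrArg Complex.re h
  simp at this
  exact hq1 this

/-- The vector fields `∂_t`, `∂_r`, `∂_φ` act on mode functions through their profiles. -/
theorem fderiv_modeFun_frame (hσ : σ ^ 2 = 1) (hm : σ * n = m) {w : ℝ × ℝ → ℂ}
    {q : Fin 4 → ℝ} (hq : 0 < rad (space q)) (hζ : (q 1 : ℂ) + Complex.I * (σ * q 2) ≠ 0)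
    (hw : DifferentiableAt ℝ w (szMap rp (space q))) :
    fderiv ℝ (modeFun lam σ rp n w) q vecT = -Complex.I * lam * modeFun lam σ rp n w q ∧
    fderiv ℝ (modeFun lam σ rp n w) q (vecR (space q))
      = -modeFun lam σ rp n (fun p => fderiv ℝ w p (1, 0)) q ∧
    fderiv ℝ (modeFun lam σ rp n w) q (vecPhi (space q))
      = Complex.I * m * modeFun lam σ rp n w q := by
  have hfd := (fderiv_modeFun (lam := lam) (n := n) hq hζ hw).2
  have hrc : (rad (space q) : ℂ) ≠ 0 := by exact_mod_cast hq.ne'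
  have hsq : (q 1 : ℂ) ^ 2 + (q 2) ^ 2 + (q 3) ^ 2 = (rad (space q) : ℂ) ^ 2 := by
    exact_mod_cast (rad_sq (space q)).symm
  have hσc : (σ : ℂ) ^ 2 = 1 := by exact_mod_cast hσ
  have hmc : (m : ℂ) = σ * n := by exact_mod_cast hm.symm
  refine ⟨?_, ?_, ?_⟩
  · rw [hfd]; simp [vecT, sdot]
  · have hv0 : vecR (space q) 0 = 0 := rfl
    have hv1 : vecR (space q) 1 = q 1 / rad (space q) := rfl
    have hv2 : vecR (space q) 2 = q 2 / rad (space q) := rfl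
    have hv3 : vecR (space q) 3 = q 3 / rad (space q) := rfl
    have hsd : (sdot q (vecR (space q)) : ℂ) = rad (space q) := by
      rw [sdot, hv1, hv2, hv3]
      push_cast
      field_simp
      linear_combination hsq
    rw [hfd, hsd, hv0, hv1, hv2, hv3]
    push_cast
    have : ((q 1 : ℂ) / rad (space q) + Complex.I * (σ * (q 2 / rad (space q))))
        / ((q 1 : ℂ) + Complex.I * (σ * q 2)) = 1 / rad (space q) := by
      rw [div_eq_div_iff hζ hrc]
      field_simp
    rw [this]
    field_simp
    ring
  · have hv0 : vecPhi (space q) 0 = 0 := rfl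
    have hv1 : vecPhi (space q) 1 = -q 2 := rfl
    have hv2 : vecPhi (space q) 2 = q 1 := rfl
    have hv3 : vecPhi (space q) 3 = 0 := rfl
    have hsd : sdot q (vecPhi (space q)) = 0 := by
      rw [sdot, hv1, hv2, hv3]; ring
    rw [hfd, hsd, hv0, hv1, hv2, hv3]
    have : (((-q 2 : ℝ) : ℂ) + Complex.I * (σ * q 1)) / ((q 1 : ℂ) + Complex.I * (σ * q 2))
        = Complex.I * σ := by
      rw [div_eq_iff hζ]
      push_cast
      linear_combination (-(q 2 : ℂ) * σ ^ 2) * Complex.I_sq + (q 2 : ℂ) * hσc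
    rw [this, hmc]
    push_cast
    ring

/-- The density times the metric gradient of a mode function is, up to a constant, an explicit vector
field whose components are again mode functions. -/
theorem waveFlux_modeFun (ha : |a| < 1) (hσ : σ ^ 2 = 1) (hm : σ * n = m) {w : ℝ × ℝ → ℂ}
    {q : Fin 4 → ℝ} (hq : 0 < rad (space q)) (hq1 : q 1 ≠ 0)
    (hw : DifferentiableAt ℝ w (szMap rp (space q))) (i : Fin 4) :
    ((√|(dualMetric M a fp (space q)).det|)⁻¹ : ℂ) *
        ∑ j, (dualMetric M a fp (space q) i j : ℂ) * pd j (modeFun lam σ rp n w) q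
      = -((1 - a ^ 2 : ℂ) ^ 2)⁻¹ * waveFlux M a fp lam σ rp m n w i q := by
  have hζ := num_ne_zero (σ := σ) hq1
  have hfd := (fderiv_modeFun (lam := lam) (n := n) hq hζ hw).2
  have ha2 : a ^ 2 < 1 := (sq_lt_one_iff_abs_lt_one a).2 ha
  have hαc : (1 - a ^ 2 : ℂ) ≠ 0 := by
    have : (1 - a ^ 2 : ℝ) ≠ 0 := by linarith
    exact_mod_cast this
  have hrc : (rad (space q) : ℂ) ≠ 0 := by exact_mod_cast hq.ne'
  have hϱc : (rhoSq a (space q) : ℂ) ≠ 0 := by exact_mod_cast (rhoSq_pos (a := a) hq).ne'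
  have hΔ : DeltaTheta a (space q) = angFactor a (q 3 / rad (space q)) := by
    rw [DeltaTheta, cosSq_eq]; rfl
  have hΔc : (angFactor a (q 3 / rad (space q)) : ℂ) ≠ 0 := by
    rw [← hΔ]; exact_mod_cast (DeltaTheta_pos ha hq).ne'
  have hs : sinSq (space q) = 1 - (q 3 / rad (space q)) ^ 2 := by
    have := cosSq_add_sinSq hq
    rw [cosSq_eq] at this
    linarith! only [this]
  obtain ⟨hT, hR, hΦ⟩ := fderiv_modeFun_frame (lam := lam) hσ hm hq hζ hw
  -- the coordinate derivative minus its parts along `∂_t` and `∂_r`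
  have hei : fderiv ℝ (modeFun lam σ rp n w) q (Pi.single i 1)
        - vecT i * (-Complex.I * lam * modeFun lam σ rp n w q)
        - vecR (space q) i * (-modeFun lam σ rp n (fun p => fderiv ℝ w p (1, 0)) q)
      = n * ((![0, 1, Complex.I * σ, 0] : Fin 4 → ℂ) i / ((q 1 : ℂ) + Complex.I * (σ * q 2))
          - vecR (space q) i / rad (space q)) * modeFun lam σ rp n w q
        + ((![0, 0, 0, 1] : Fin 4 → ℂ) i / rad (space q)
          - q 3 * vecR (space q) i / (rad (space q) : ℂ) ^ 2)
          * modeFun lam σ rp n (fun p => fderiv ℝ w p (0, 1)) q := by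
    rw [hfd]
    fin_cases i
    · simp [vecT, vecR, sdot]
    · simp [vecT, vecR, sdot, space, Fin.tail]
      field_simp
      ring
    · simp [vecT, vecR, sdot, space, Fin.tail]
      field_simp
      ring
    · simp [vecT, vecR, sdot, space, Fin.tail]
      field_simp
      ring
  simp only [pd]
  rw [sum_dualMetric, sqrt_abs_det_dualMetric ha hq, hT, hR, hΦ, hei, hΔ, hs, waveFlux]
  have hmod : ∀ B, modeFun lam σ rp n B q = Complex.exp (-Complex.I * lam * (q 0 : ℂ)) *
      (zet σ (space q) ^ n * B (szMap rp (space q))) := fun _ => rfl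
  simp only [hmod, fluxT, fluxPhi, fluxR, fluxN, fluxZ, radialDeriv, rotSymbol]
  have hp1 : rp - (szMap rp (space q)).1 = rad (space q) := by simp [szMap]
  have hp2 : (szMap rp (space q)).2 = q 3 / rad (space q) := rfl
  rw [hp1, hp2]
  generalize fderiv ℝ w (szMap rp (space q)) (1, 0) = w1
  generalize fderiv ℝ w (szMap rp (space q)) (0, 1) = w2
  generalize w (szMap rp (space q)) = w0
  generalize zet σ (space q) ^ n = Zn
  generalize Complex.exp _ = E0
  generalize (![0, 1, Complex.I * σ, 0] : Fin 4 → ℂ) i = ε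
  generalize (![0, 0, 0, 1] : Fin 4 → ℂ) i = ε'
  generalize vecR (space q) i = Ri
  generalize vecPhi (space q) i = Pi
  generalize vecT i = Ti
  generalize angFactor a (q 3 / rad (space q)) = h at *
  generalize (q 1 : ℂ) + Complex.I * (σ * q 2) = N at *
  generalize DeltaR M a (rad (space q)) = D
  generalize fp (rad (space q)) = f
  push_cast
  field_simp
  ring

end Flux

/-! ### The divergence of the flux -/

section Divergence

variable {lam : ℂ} {σ rp : ℝ} {n : ℕ} {q : Fin 4 → ℝ}

theorem pd_add {i : Fin 4} {f g : (Fin 4 → ℝ) → ℂ} (hf : DifferentiableAt ℝ f q)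
    (hg : DifferentiableAt ℝ g q) : pd i (fun q => f q + g q) q = pd i f q + pd i g q := by
  have := fderiv_add hf hg
  change fderiv ℝ (f + g) q _ = _
  rw [this]; rfl

theorem sum_pd_mul {X : Fin 4 → (Fin 4 → ℝ) → ℂ} {g : (Fin 4 → ℝ) → ℂ}
    (hX : ∀ i, DifferentiableAt ℝ (X i) q) (hg : DifferentiableAt ℝ g q) :
    ∑ i, pd i (fun q => X i q * g q) q
      = (∑ i, pd i (X i) q) * g q + ∑ i, X i q * pd i g q := by
  rw [Finset.sum_mul, ← Finset.sum_add_distrib]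
  refine Finset.sum_congr rfl fun i _ => ?_
  have := fderiv_mul (hX i) hg
  change fderiv ℝ (X i * g) q _ = _
  rw [this]
  simp only [add_apply, smul_apply, smul_eq_mul, pd]
  ring

theorem hasFDerivAt_ofReal_coord (j : Fin 4) :
    HasFDerivAt (fun q : Fin 4 → ℝ => (q j : ℂ))
      (Complex.ofRealCLM.comp (ContinuousLinearMap.proj (R := ℝ) (φ := fun _ : Fin 4 => ℝ) j)) q :=
  Complex.ofRealCLM.hasFDerivAt.comp q (hasFDerivAt_coord q j)

theorem sum_pd_radial (hq : 0 < rad (space q)) :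
    (∀ i, DifferentiableAt ℝ (fun q => (vecR (space q) i : ℂ)) q) ∧
      ∑ i, pd i (fun q => (vecR (space q) i : ℂ)) q = 2 / rad (space q) := by
  obtain ⟨Lr, hLr, hLrv⟩ := exists_hasFDerivAt_rad hq
  have hrc : (rad (space q) : ℂ) ≠ 0 := by exact_mod_cast hq.ne'
  have hc : ∀ j : Fin 4, HasFDerivAt (fun q : Fin 4 → ℝ => ((q j * (rad (space q))⁻¹ : ℝ) : ℂ))
      (Complex.ofRealCLM.comp (q j • -(rad (space q) ^ 2)⁻¹ • Lr +
        (rad (space q))⁻¹ • ContinuousLinearMap.proj j)) q := fun j =>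
    Complex.ofRealCLM.hasFDerivAt.comp q
      ((hasFDerivAt_coord q j).mul ((hasDerivAt_inv hq.ne').comp_hasFDerivAt q hLr))
  have h0 : HasFDerivAt (fun q => (vecR (space q) 0 : ℂ)) (0 : (Fin 4 → ℝ) →L[ℝ] ℂ) q :=
    hasFDerivAt_const (((0 : ℝ) : ℂ)) q
  have h1 : HasFDerivAt (fun q => (vecR (space q) 1 : ℂ)) _ q := hc 1
  have h2 : HasFDerivAt (fun q => (vecR (space q) 2 : ℂ)) _ q := hc 2
  have h3 : HasFDerivAt (fun q => (vecR (space q) 3 : ℂ)) _ q := hc 3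
  have hsq : (q 1 : ℂ) ^ 2 + (q 2) ^ 2 + (q 3) ^ 2 = (rad (space q) : ℂ) ^ 2 := by
    exact_mod_cast (rad_sq (space q)).symm
  refine ⟨fun i => ?_, ?_⟩
  · fin_cases i
    exacts [h0.differentiableAt, h1.differentiableAt, h2.differentiableAt, h3.differentiableAt]
  · simp only [Fin.sum_univ_four, pd, h0.fderiv, h1.fderiv, h2.fderiv, h3.fderiv]
    simp only [ContinuousLinearMap.comp_apply, add_apply, smul_apply, hLrv, sdot, zero_apply,
      ContinuousLinearMap.proj_apply, Complex.ofRealCLM_apply, smul_eq_mul]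
    simp
    field_simp
    linear_combination -hsq

theorem sum_pd_rotational :
    (∀ i, DifferentiableAt ℝ (fun q => (vecPhi (space q) i : ℂ)) q) ∧
      ∑ i, pd i (fun q => (vecPhi (space q) i : ℂ)) q = 0 := by
  have h0 : HasFDerivAt (fun q => (vecPhi (space q) 0 : ℂ)) (0 : (Fin 4 → ℝ) →L[ℝ] ℂ) q :=
    hasFDerivAt_const (((0 : ℝ) : ℂ)) q
  have h1 : HasFDerivAt (fun q => (vecPhi (space q) 1 : ℂ)) _ q :=
    Complex.ofRealCLM.hasFDerivAt.comp q (hasFDerivAt_coord q 2).neg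
  have h2 : HasFDerivAt (fun q => (vecPhi (space q) 2 : ℂ)) _ q := hasFDerivAt_ofReal_coord 1
  have h3 : HasFDerivAt (fun q => (vecPhi (space q) 3 : ℂ)) (0 : (Fin 4 → ℝ) →L[ℝ] ℂ) q :=
    hasFDerivAt_const (((0 : ℝ) : ℂ)) q
  refine ⟨fun i => ?_, ?_⟩
  · fin_cases i
    exacts [h0.differentiableAt, h1.differentiableAt, h2.differentiableAt, h3.differentiableAt]
  · simp only [Fin.sum_univ_four, pd, h0.fderiv, h1.fderiv, h2.fderiv, h3.fderiv]
    simp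

/-- The complex direction `(1, iσ, 0)` is isotropic, so that its multiple by `(x₁ + iσx₂)⁻¹` has
no divergence. -/
theorem sum_pd_isotropic (hσ : σ ^ 2 = 1) (hq1 : q 1 ≠ 0) (c : ℂ) :
    (∀ i, DifferentiableAt ℝ (fun q : Fin 4 → ℝ => c * (![0, 1, Complex.I * σ, 0] : Fin 4 → ℂ) i
        / ((q 1 : ℂ) + Complex.I * (σ * q 2))) q) ∧
      ∑ i, pd i (fun q : Fin 4 → ℝ => c * (![0, 1, Complex.I * σ, 0] : Fin 4 → ℂ) i
        / ((q 1 : ℂ) + Complex.I * (σ * q 2))) q = 0 := by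
  have hζ := num_ne_zero (σ := σ) hq1
  have hnum : HasFDerivAt (fun q : Fin 4 → ℝ => (q 1 : ℂ) + Complex.I * (σ * q 2))
      (Complex.ofRealCLM.comp (ContinuousLinearMap.proj (R := ℝ) (φ := fun _ : Fin 4 => ℝ) 1)
        + Complex.I • ((σ : ℂ) • Complex.ofRealCLM.comp
          (ContinuousLinearMap.proj (R := ℝ) (φ := fun _ : Fin 4 => ℝ) 2))) q :=
    (hasFDerivAt_ofReal_coord 1).add (((hasFDerivAt_ofReal_coord 2).const_mul
        (σ : ℂ)).const_mul Complex.I)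
  have hinv := (hasDerivAt_inv hζ).comp_hasFDerivAt q hnum
  have h : ∀ i, HasFDerivAt (fun q : Fin 4 → ℝ => c * (![0, 1, Complex.I * σ, 0] : Fin 4 → ℂ) i
        / ((q 1 : ℂ) + Complex.I * (σ * q 2))) _ q := fun i =>
    hinv.const_mul (c * (![0, 1, Complex.I * σ, 0] : Fin 4 → ℂ) i)
  have hσc : (σ : ℂ) ^ 2 = 1 := by exact_mod_cast hσ
  refine ⟨fun i => (h i).differentiableAt, ?_⟩
  simp only [Fin.sum_univ_four, pd, (h _).fderiv]
  simp
  linear_combination (((q 1 : ℂ) + Complex.I * (σ * q 2)) ^ 2)⁻¹ * c * (hσc - σ ^ 2 * Complex.I_sq)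

variable {M a : ℝ} {fp : ℝ → ℝ} {m : ℤ} {w : ℝ × ℝ → ℂ}

/-- The divergence of the flux, in terms of the profiles of its components. -/
theorem sum_pd_waveFlux (hσ : σ ^ 2 = 1) (hm : σ * n = m) (hq : 0 < rad (space q))
    (hq1 : q 1 ≠ 0) (hT : DifferentiableAt ℝ (fluxT M a fp lam rp m w) (szMap rp (space q)))
    (hR : DifferentiableAt ℝ (fluxR M a fp lam rp m n w) (szMap rp (space q)))
    (hP : DifferentiableAt ℝ (fluxPhi a fp lam rp m w) (szMap rp (space q)))
    (hN : DifferentiableAt ℝ (fluxN a w) (szMap rp (space q)))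
    (hZ : DifferentiableAt ℝ (fluxZ a rp w) (szMap rp (space q))) :
    (∀ i, DifferentiableAt ℝ (waveFlux M a fp lam σ rp m n w i) q) ∧
    ∑ i, pd i (waveFlux M a fp lam σ rp m n w i) q
      = modeFun lam σ rp n (fun p =>
        -Complex.I * lam * fluxT M a fp lam rp m w p
        + (2 / (rp - p.1 : ℝ) * fluxR M a fp lam rp m n w p
          - fderiv ℝ (fluxR M a fp lam rp m n w) p (1, 0))
        + Complex.I * m * fluxPhi a fp lam rp m w p
        - n * (n / (rp - p.1 : ℝ) ^ 2 * fluxN a w p + fderiv ℝ (fluxN a w) p (1, 0) / (rp - p.1 : ℝ)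
          + p.2 / (rp - p.1 : ℝ) ^ 2 * fderiv ℝ (fluxN a w) p (0, 1))
        - n * p.2 / (rp - p.1 : ℝ) * fluxZ a rp w p - p.2 * fderiv ℝ (fluxZ a rp w) p (1, 0)
        + (1 - p.2 ^ 2) / (rp - p.1 : ℝ) * fderiv ℝ (fluxZ a rp w) p (0, 1)) q := by
  have hζ := num_ne_zero (σ := σ) hq1
  have hrc : (rad (space q) : ℂ) ≠ 0 := by exact_mod_cast hq.ne'
  have hσc : (σ : ℂ) ^ 2 = 1 := by exact_mod_cast hσ
  have hd := fun A (hA : DifferentiableAt ℝ A (szMap rp (space q))) =>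
    fderiv_modeFun (lam := lam) (n := n) hq hζ hA
  have hf := fun A (hA : DifferentiableAt ℝ A (szMap rp (space q))) =>
    fderiv_modeFun_frame (lam := lam) hσ hm hq hζ hA
  obtain ⟨hXR, hdivR⟩ := sum_pd_radial hq
  obtain ⟨hXP, hdivP⟩ := sum_pd_rotational (q := q)
  obtain ⟨hXN, hdivN⟩ := sum_pd_isotropic hσ hq1 (n : ℂ)
  have hXT : ∀ i, DifferentiableAt ℝ (fun _ : Fin 4 → ℝ => (vecT i : ℂ)) q := fun i =>
    differentiableAt_const _
  have hXZ : ∀ i, DifferentiableAt ℝ (fun _ : Fin 4 → ℝ => (![0, 0, 0, 1] : Fin 4 → ℂ) i) q :=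
    fun i => differentiableAt_const _
  have hconst : ∀ i (c : ℂ), pd i (fun _ => c) q = 0 := fun i c => by simp [pd]
  have d1 := fun i => (hXT i).mul (hd _ hT).1
  have d2 := fun i => (hXR i).mul (hd _ hR).1
  have d3 := fun i => (hXP i).mul (hd _ hP).1
  have d4 := fun i => (hXN i).mul (hd _ hN).1
  have d5 := fun i => (hXZ i).mul (hd _ hZ).1
  refine ⟨fun i => ((((d1 i).add (d2 i)).add (d3 i)).add (d4 i)).add (d5 i), ?_⟩
  have hsplit : ∀ i, pd i (waveFlux M a fp lam σ rp m n w i) q = _ := fun i =>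
    (pd_add ((((d1 i).add (d2 i)).add (d3 i)).add (d4 i)) (d5 i)).trans
      (congrArg (· + _) ((pd_add (((d1 i).add (d2 i)).add (d3 i)) (d4 i)).trans
        (congrArg (· + _) ((pd_add ((d1 i).add (d2 i)) (d3 i)).trans
          (congrArg (· + _) (pd_add (d1 i) (d2 i)))))))
  simp only [hsplit, Finset.sum_add_distrib]
  have s1 := sum_pd_mul hXT (hd _ hT).1
  have s2 := sum_pd_mul hXR (hd _ hR).1
  have s3 := sum_pd_mul hXP (hd _ hP).1
  have s4 := sum_pd_mul hXN (hd _ hN).1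
  have s5 := sum_pd_mul hXZ (hd _ hZ).1
  rw [hdivR] at s2
  rw [hdivP] at s3
  rw [hdivN] at s4
  simp only [hconst, Finset.sum_const_zero, zero_mul, zero_add] at s1 s3 s4 s5
  simp only [pd] at s1 s2 s3 s4 s5 ⊢
  rw [sum_mul_apply_single, (hf _ hT).1] at s1
  rw [sum_mul_apply_single, (hf _ hR).2.1] at s2
  rw [sum_mul_apply_single, (hf _ hP).2.2] at s3
  refine (congrArg₂ (· + ·) (congrArg₂ (· + ·) (congrArg₂ (· + ·) (congrArg₂ (· + ·) s1 s2) s3)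
    s4) s5).trans ?_
  simp only [Fin.sum_univ_four, (hd _ hN).2, (hd _ hZ).2, Pi.single_apply, sdot]
  simp
  have hmod : ∀ B, modeFun lam σ rp n B q = Complex.exp (-Complex.I * lam * (q 0 : ℂ)) *
      (zet σ (space q) ^ n * B (szMap rp (space q))) := fun _ => rfl
  have hp1 : rp - (szMap rp (space q)).1 = rad (space q) := by simp [szMap]
  have hp1' : (rp : ℂ) - (szMap rp (space q)).1 = rad (space q) := by rw [← hp1]; push_cast; rfl
  have hp2 : (szMap rp (space q)).2 = q 3 / rad (space q) := rfl
  simp only [hmod, hp1', hp2]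
  have hblock : ∀ F G H : ℂ,
      n / ((q 1 : ℂ) + Complex.I * (σ * q 2)) *
          (n * (((q 1 : ℂ) + Complex.I * (σ * q 2))⁻¹ - q 1 / (rad (space q) : ℂ) ^ 2) * F
            - q 1 / rad (space q) * G + -(q 3 * q 1 / (rad (space q) : ℂ) ^ 3 * H))
        + n * (Complex.I * σ) / ((q 1 : ℂ) + Complex.I * (σ * q 2)) *
          (n * (Complex.I * σ / ((q 1 : ℂ) + Complex.I * (σ * q 2)) - q 2 / (rad (space q) : ℂ) ^ 2)
              * F - q 2 / rad (space q) * G + -(q 3 * q 2 / (rad (space q) : ℂ) ^ 3 * H))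
      = -(n * (n / (rad (space q) : ℂ) ^ 2 * F + G / rad (space q)
          + q 3 / (rad (space q) : ℂ) ^ 3 * H)) := fun F G H => by
    have hI : 1 + (Complex.I * (σ : ℂ)) ^ 2 = 0 := by
      linear_combination (σ : ℂ) ^ 2 * Complex.I_sq - hσc
    obtain ⟨N, hN⟩ : ∃ N, (q 1 : ℂ) + Complex.I * (σ * q 2) = N := ⟨_, rfl⟩
    rw [hN] at hζ ⊢
    have hq1 : (q 1 : ℂ) = N - Complex.I * (σ * q 2) := by rw [← hN]; ring
    have hNN : N⁻¹ * N = 1 := inv_mul_cancel₀ hζ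
    rw [hq1]
    linear_combination (n : ℂ) ^ 2 * N⁻¹ ^ 2 * F * hI
      - (n * (n / (rad (space q) : ℂ) ^ 2 * F + G / rad (space q)
          + q 3 / (rad (space q) : ℂ) ^ 3 * H)) * hNN
  rw [hblock]
  push_cast
  generalize zet σ (space q) ^ n = Zn
  generalize Complex.exp _ = E0
  field_simp
  ring

end Divergence

/-! ### The reduced operator -/

section ReducedOperator

variable {M a ν rp S : ℝ} {fp : ℝ → ℝ} {lam : ℂ} {m : ℤ} {n : ℕ} {w : ℝ × ℝ → ℂ}

/-- The coefficient of `∂_s` in the reduced operator. -/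
def coefB (M a : ℝ) (fp : ℝ → ℝ) (lam : ℂ) (rp : ℝ) (m : ℤ) (s : ℝ) : ℂ :=
  (4 * (rp - s : ℝ) ^ 3 + 2 * (1 + a ^ 2) * (rp - s : ℝ) - 2 * M)
    - 2 * Complex.I * lam * ((fp (rp - s) * DeltaR M a (rp - s) : ℝ) : ℂ)
    + 2 * (1 - a ^ 2) * rotSymbol a lam m (rp - s)

/-- The radial potential in the reduced operator. -/
def coefQ (M a ν : ℝ) (fp : ℝ → ℝ) (lam : ℂ) (rp : ℝ) (m : ℤ) (s : ℝ) : ℂ :=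
  -(Complex.I * lam * ((deriv (fun s => fp (rp - s) * DeltaR M a (rp - s)) s : ℝ) : ℂ)
      - lam ^ 2 * ((fp (rp - s) ^ 2 * DeltaR M a (rp - s) : ℝ) : ℂ)
      - 2 * Complex.I * lam * (1 - a ^ 2) * rotSymbol a lam m (rp - s) * fp (rp - s)
      - 2 * Complex.I * lam * (1 - a ^ 2) * (rp - s : ℝ))
    + (ν ^ 2 - 9 / 4) * (rp - s : ℝ) ^ 2

/-- The angular potential in the reduced operator. -/
def coefPhi (a ν : ℝ) (lam : ℂ) (m : ℤ) (n : ℕ) (z : ℝ) : ℂ :=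
  -(2 * n * a ^ 2 * z ^ 2 - n * (n + 1) * angFactor a z
      + a ^ 2 * (1 - a ^ 2 + angFactor a z) / angFactor a z * m ^ 2
      + 2 * ((1 - a ^ 2) ^ 2 * a / angFactor a z) * lam * m
      - (1 - a ^ 2) ^ 2 * a ^ 2 * (1 - z ^ 2) / angFactor a z * lam ^ 2)
    + (ν ^ 2 - 9 / 4) * (a ^ 2 * z ^ 2)

theorem isOpen_interior_dom : IsOpen (Iio S ×ˢ Ioo (-1 : ℝ) 1) := isOpen_Iio.prod isOpen_Ioo

theorem dom_mem_nhds {p : ℝ × ℝ} (hp : p ∈ Iio S ×ˢ Ioo (-1 : ℝ) 1) : dom S ∈ 𝓝 p :=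
  mem_of_superset (isOpen_interior_dom.mem_nhds hp)
    (prod_mono_right Ioo_subset_Icc_self)

theorem dS_eq_fderiv {p : ℝ × ℝ} (hp : p ∈ Iio S ×ˢ Ioo (-1 : ℝ) 1) :
    dS S w p = fderiv ℝ w p (1, 0) := by
  rw [dS, fderivWithin_of_mem_nhds (dom_mem_nhds hp)]

theorem dZ_eq_fderiv {p : ℝ × ℝ} (hp : p ∈ Iio S ×ˢ Ioo (-1 : ℝ) 1) :
    dZ S w p = fderiv ℝ w p (0, 1) := by
  rw [dZ, fderivWithin_of_mem_nhds (dom_mem_nhds hp)]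

theorem fderiv_fst_eq {A : ℝ × ℝ → ℂ} {s z : ℝ} {d : ℂ} (hA : DifferentiableAt ℝ A (s, z))
    (h : HasDerivAt (fun t => A (t, z)) d s) : fderiv ℝ A (s, z) (1, 0) = d := by
  have h1 : HasDerivAt (fun t : ℝ => (t, z)) ((1, 0) : ℝ × ℝ) s :=
    (hasDerivAt_id s).prodMk (hasDerivAt_const s z)
  exact (hA.hasFDerivAt.comp_hasDerivAt s h1).unique h

theorem fderiv_snd_eq {A : ℝ × ℝ → ℂ} {s z : ℝ} {d : ℂ} (hA : DifferentiableAt ℝ A (s, z))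
    (h : HasDerivAt (fun y => A (s, y)) d z) : fderiv ℝ A (s, z) (0, 1) = d := by
  have h1 : HasDerivAt (fun y : ℝ => (s, y)) ((0, 1) : ℝ × ℝ) z :=
    (hasDerivAt_const z s).prodMk (hasDerivAt_id z)
  exact (hA.hasFDerivAt.comp_hasDerivAt z h1).unique h

theorem angFactor_ne_zero (ha : |a| < 1) {z : ℝ} (hz : z ∈ Ioo (-1 : ℝ) 1) :
    (angFactor a z : ℂ) ≠ 0 := by
  have h1 : a ^ 2 < 1 := (sq_lt_one_iff_abs_lt_one a).2 ha
  have h2 := one_sub_sq_pos hz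
  have : angFactor a z ≠ 0 := by
    unfold angFactor
    nlinarith [sq_nonneg a, sq_nonneg z]
  exact_mod_cast this

theorem differentiableAt_fluxes (ha : |a| < 1) (hS : S < rp)
    (hfp : ContDiffOn ℝ ∞ fp (Ioi (rp - S))) (hw : ContDiffOn ℝ ∞ w (dom S)) {p : ℝ × ℝ}
    (hp : p ∈ Iio S ×ˢ Ioo (-1 : ℝ) 1) :
    DifferentiableAt ℝ w p ∧
    DifferentiableAt ℝ (fluxT M a fp lam rp m w) p ∧
    DifferentiableAt ℝ (fluxR M a fp lam rp m n w) p ∧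
    DifferentiableAt ℝ (fluxPhi a fp lam rp m w) p ∧
    DifferentiableAt ℝ (fluxN a w) p ∧ DifferentiableAt ℝ (fluxZ a rp w) p := by
  have hps : p.1 < S := hp.1
  have hwp : ContDiffAt ℝ ∞ w p := hw.contDiffAt (dom_mem_nhds hp)
  have h0 : DifferentiableAt ℝ w p := hwp.differentiableAt (by simp)
  have hv : ∀ v, DifferentiableAt ℝ (fun p => fderiv ℝ w p v) p := fun v =>
    ((hwp.fderiv_right (m := ∞) (by simp)).clm_apply contDiffAt_const).differentiableAt (by simp)
  have h1 := hv (1, 0)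
  have h2 := hv (0, 1)
  have hr : ((rp - p.1 : ℝ) : ℂ) ≠ 0 := by
    have : rp - p.1 ≠ 0 := by linarith
    exact_mod_cast this
  have hh := angFactor_ne_zero ha hp.2
  have hof : ∀ g : ℝ × ℝ → ℝ, DifferentiableAt ℝ g p → DifferentiableAt ℝ (fun p => (g p : ℂ)) p :=
    fun g hg => Complex.ofRealCLM.differentiableAt.comp p hg
  have hfpp : DifferentiableAt ℝ (fun p : ℝ × ℝ => (fp (rp - p.1) : ℂ)) p :=
    hof _ (((hfp.contDiffAt (Ioi_mem_nhds (by linarith : rp - S < rp - p.1))).differentiableAt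
      (by simp)).comp p (by fun_prop))
  have hD : DifferentiableAt ℝ (fun p : ℝ × ℝ => (DeltaR M a (rp - p.1) : ℂ)) p :=
    hof _ (by unfold DeltaR; fun_prop)
  have hrp : DifferentiableAt ℝ (fun p : ℝ × ℝ => ((rp - p.1 : ℝ) : ℂ)) p := hof _ (by fun_prop)
  have hz : DifferentiableAt ℝ (fun p : ℝ × ℝ => (p.2 : ℂ)) p := hof _ (by fun_prop)
  have hang : DifferentiableAt ℝ (fun p : ℝ × ℝ => (angFactor a p.2 : ℂ)) p :=
    hof _ (by unfold angFactor; fun_prop)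
  have hrd : DifferentiableAt ℝ (radialDeriv fp lam rp w) p := by
    unfold radialDeriv; fun_prop
  have hY : DifferentiableAt ℝ (fun p : ℝ × ℝ => rotSymbol a lam m (rp - p.1)) p := by
    unfold rotSymbol
    fun_prop
  have hri : DifferentiableAt ℝ (fun p : ℝ × ℝ => ((rp - p.1 : ℝ) : ℂ)⁻¹) p :=
    ((hasDerivAt_inv hr).comp_hasFDerivAt p hrp.hasFDerivAt).differentiableAt
  have hhi : DifferentiableAt ℝ (fun p : ℝ × ℝ => (angFactor a p.2 : ℂ)⁻¹) p :=
    ((hasDerivAt_inv hh).comp_hasFDerivAt p hang.hasFDerivAt).differentiableAt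
  refine ⟨h0, ?_, ?_, ?_, ?_, ?_⟩
  · unfold fluxT; simp only [div_eq_mul_inv, ← inv_pow]; fun_prop
  · unfold fluxR; simp only [div_eq_mul_inv, ← inv_pow]; fun_prop
  · unfold fluxPhi; simp only [div_eq_mul_inv, ← inv_pow]; fun_prop
  · unfold fluxN; fun_prop
  · unfold fluxZ; simp only [div_eq_mul_inv]; fun_prop

end ReducedOperator

section DivergenceProfile

variable {M a ν rp S : ℝ} {fp : ℝ → ℝ} {lam : ℂ} {m : ℤ} {n : ℕ} {w : ℝ × ℝ → ℂ}

/-- The profile of the divergence of the flux is the reduced operator. -/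
theorem divergence_profile (ha : |a| < 1) (hS : S < rp) (hroot : DeltaR M a rp = 0)
    (hfp : ContDiffOn ℝ ∞ fp (Ioi (rp - S))) (hw : ContDiffOn ℝ ∞ w (dom S)) {p : ℝ × ℝ}
    (hp : p ∈ Iio S ×ˢ Ioo (-1 : ℝ) 1) :
    -((rp - p.1 : ℝ) : ℂ) ^ 2 *
      (-Complex.I * lam * fluxT M a fp lam rp m w p
        + (2 / (rp - p.1 : ℝ) * fluxR M a fp lam rp m n w p
          - fderiv ℝ (fluxR M a fp lam rp m n w) p (1, 0))
        + Complex.I * m * fluxPhi a fp lam rp m w p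
        - n * (n / (rp - p.1 : ℝ) ^ 2 * fluxN a w p + fderiv ℝ (fluxN a w) p (1, 0) / (rp - p.1 : ℝ)
          + p.2 / (rp - p.1 : ℝ) ^ 2 * fderiv ℝ (fluxN a w) p (0, 1))
        - n * p.2 / (rp - p.1 : ℝ) * fluxZ a rp w p - p.2 * fderiv ℝ (fluxZ a rp w) p (1, 0)
        + (1 - p.2 ^ 2) / (rp - p.1 : ℝ) * fderiv ℝ (fluxZ a rp w) p (0, 1))
      + ((rp - p.1 : ℝ) ^ 2 + a ^ 2 * p.2 ^ 2) * ((ν ^ 2 - 9 / 4) * w p)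
    = redOp a n S (kap M a rp) (coefB M a fp lam rp m) (coefQ M a ν fp lam rp m)
        (coefPhi a ν lam m n) w p := by
  obtain ⟨-, -, dR, -, dN, dZ'⟩ :=
    differentiableAt_fluxes (M := M) (lam := lam) (m := m) (n := n) ha hS hfp hw hp
  obtain ⟨s, z⟩ := p
  have hs : s < S := hp.1
  have hz : z ∈ Ioo (-1 : ℝ) 1 := hp.2
  have hzJ : z ∈ J := ⟨hz.1.le, hz.2.le⟩
  have hr : ((rp - s : ℝ) : ℂ) ≠ 0 := by
    have : rp - s ≠ 0 := by linarith
    exact_mod_cast this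
  -- derivatives of the profile
  have hSnhds : ∀ᶠ t in 𝓝 s, t < S := Iio_mem_nhds hs
  have hznhds : ∀ᶠ y in 𝓝 z, y ∈ Ioo (-1 : ℝ) 1 := Ioo_mem_nhds hz.1 hz.2
  have hw1 := hasDerivAt_dS hw hs hzJ
  have hw2 := hasDerivAt_dZ hw hs hz
  have hw11 : HasDerivAt (fun t => fderiv ℝ w (t, z) (1, 0)) (dS S (dS S w) (s, z)) s :=
    (hasDerivAt_dS (contDiffOn_dS hw) hs hzJ).congr_of_eventuallyEq
      (hSnhds.mono fun t ht => (dS_eq_fderiv (p := (t, z)) ⟨ht, hz⟩).symm)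
  have hw21 : HasDerivAt (fun t => fderiv ℝ w (t, z) (0, 1)) (dS S (dZ S w) (s, z)) s :=
    (hasDerivAt_dS (contDiffOn_dZ hw) hs hzJ).congr_of_eventuallyEq
      (hSnhds.mono fun t ht => (dZ_eq_fderiv (p := (t, z)) ⟨ht, hz⟩).symm)
  have hw22 : HasDerivAt (fun y => fderiv ℝ w (s, y) (0, 1)) (dZ S (dZ S w) (s, z)) z :=
    (hasDerivAt_dZ (contDiffOn_dZ hw) hs hz).congr_of_eventuallyEq
      (hznhds.mono fun y hy => (dZ_eq_fderiv (p := (s, y)) ⟨hs, hy⟩).symm)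
  -- derivatives of the coefficients
  have hof : ∀ {g : ℝ → ℝ} {d t : ℝ}, HasDerivAt g d t → HasDerivAt (fun t => (g t : ℂ)) (d : ℂ) t :=
    fun h => h.ofReal_comp
  have hrs : HasDerivAt (fun t : ℝ => rp - t) (-1) s := (hasDerivAt_id s).const_sub rp
  have hrsc : HasDerivAt (fun t : ℝ => ((rp - t : ℝ) : ℂ)) (-1) s := by
    have := hof hrs; push_cast at this; exact_mod_cast this
  have hinv : HasDerivAt (fun t : ℝ => ((rp - t : ℝ) : ℂ)⁻¹) (((rp - s : ℝ) : ℂ)⁻¹ ^ 2) s :=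
    (hrsc.inv hr).congr_deriv (by field_simp)
  have hDr : HasDerivAt (fun t : ℝ => DeltaR M a (rp - t))
      (-(4 * (rp - s) ^ 3 + 2 * (1 + a ^ 2) * (rp - s) - 2 * M)) s :=
    ((hasDerivAt_DeltaR (M := M) (a := a) (rp - s)).comp s hrs).congr_deriv (by ring)
  have hFDr : HasDerivAt (fun t : ℝ => fp (rp - t) * DeltaR M a (rp - t))
      (deriv (fun t => fp (rp - t) * DeltaR M a (rp - t)) s) s := by
    have h1 : DifferentiableAt ℝ fp (rp - s) :=
      (hfp.contDiffAt (Ioi_mem_nhds (by linarith : rp - S < rp - s))).differentiableAt (by simp)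
    exact ((h1.comp s hrs.differentiableAt).mul hDr.differentiableAt).hasDerivAt
  have hD := hof hDr
  have hFD := hof hFDr
  have hY : HasDerivAt (fun t : ℝ => rotSymbol a lam m (rp - t))
      (2 * Complex.I * lam * (rp - s : ℝ)) s := by
    refine ((((hrsc.pow 2).add_const ((a : ℂ) ^ 2)).const_mul (-Complex.I * lam)).add_const
      (Complex.I * a * m)).congr_deriv ?_
    push_cast; ring
  have hang : HasDerivAt (fun y : ℝ => (angFactor a y : ℂ)) (-2 * a ^ 2 * z) z := by
    have h1 : HasDerivAt (angFactor a) (-2 * a ^ 2 * z) z :=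
      (((hasDerivAt_pow 2 z).const_mul (a ^ 2)).const_sub 1).congr_deriv (by push_cast; ring)
    have := hof h1; push_cast at this; exact this
  -- derivatives of the components of the flux
  obtain ⟨eD, hDs⟩ : ∃ c : ℂ, ((deriv (fun t => fp (rp - t) * DeltaR M a (rp - t)) s : ℝ) : ℂ) = c :=
    ⟨_, rfl⟩
  rw [hDs] at hFD
  have hR0 := (((((hD.mul hw11).neg.sub ((hFD.mul hw1).const_mul (Complex.I * lam))).add
      ((hY.mul hw1).const_mul (1 - (a : ℂ) ^ 2))).mul (hinv.pow 2)).sub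
      ((hw1.const_mul ((n : ℂ) * angFactor a z)).mul hinv)).sub
      ((hw21.const_mul ((z : ℂ) * angFactor a z)).mul hinv)
  have hR := hR0.congr_of_eventuallyEq (f₁ := fun t => fluxR M a fp lam rp m n w (t, z))
    (Eventually.of_forall fun t => by
      simp only [fluxR, radialDeriv, Pi.sub_apply, Pi.mul_apply, Pi.add_apply, Pi.neg_apply,
        Pi.pow_apply, Complex.ofReal_mul]
      ring)
  have hN1 : HasDerivAt (fun t => fluxN a w (t, z)) _ s := hw1.const_mul (angFactor a z : ℂ)
  have hN2 : HasDerivAt (fun y => fluxN a w (s, y)) _ z := hang.mul hw2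
  have hZ1 : HasDerivAt (fun t => fluxZ a rp w (t, z)) _ s :=
    (hw21.const_mul (angFactor a z : ℂ)).mul hinv
  have hZ2 : HasDerivAt (fun y => fluxZ a rp w (s, y)) _ z :=
    (hang.mul hw22).mul_const ((rp - s : ℝ) : ℂ)⁻¹
  rw [fderiv_fst_eq dR hR, fderiv_fst_eq dN hN1, fderiv_snd_eq dN hN2, fderiv_fst_eq dZ' hZ1,
    fderiv_snd_eq dZ' hZ2]
  have hκ : (s : ℂ) * kap M a rp s = -DeltaR M a (rp - s) := by
    rw [DeltaR_eq_kap hroot]; push_cast; ring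
  simp only [redOp, coefB, coefQ, coefPhi, fluxT, fluxR, fluxPhi, fluxN, fluxZ, radialDeriv,
    wt, wtc, ← dS_eq_fderiv hp, ← dZ_eq_fderiv hp, Pi.sub_apply, Pi.mul_apply, Pi.add_apply, Pi.neg_apply,
      Pi.pow_apply, hDs]
  rw [show (((s * kap M a rp s : ℝ)) : ℂ) = -DeltaR M a (rp - s) by rw [← hκ]; push_cast; rfl]
  generalize dS S (dS S w) (s, z) = w11 at *
  generalize dS S (dZ S w) (s, z) = w21 at *
  generalize dZ S (dZ S w) (s, z) = w22 at *
  generalize dS S w (s, z) = w1 at *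
  generalize dZ S w (s, z) = w2 at *
  generalize w (s, z) = w0 at *
  simp only [rotSymbol]
  clear hw1 hw2 hw11 hw21 hw22 hrs hrsc hinv hDr hFDr hD hFD hY hang hR hR0 hN1 hN2 hZ1 hZ2 hκ
  generalize DeltaR M a (rp - s) = D
  generalize fp (rp - s) = f
  generalize (rp - s : ℝ) = r at *
  have hh' : (angFactor a z : ℂ) = 1 - a ^ 2 * z ^ 2 := by rw [angFactor]; push_cast; ring
  -- the potential contains the inverse of the angular factor, which is left as a variable `k`
  simp only [div_eq_mul_inv _ (angFactor a z : ℂ)]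
  obtain ⟨k, hk⟩ : ∃ k, (angFactor a z : ℂ)⁻¹ = k := ⟨_, rfl⟩
  rw [hk, hh']
  push_cast
  field_simp
  ring_nf
  simp only [Complex.I_sq]
  ring

end DivergenceProfile

/-! ### The stationary operator on functions of fixed mode -/

section StationaryOperator

variable {M a ν rp S σ : ℝ} {fp : ℝ → ℝ} {lam : ℂ} {m : ℤ} {n : ℕ} {w : ℝ × ℝ → ℂ}
  {u : (Fin 3 → ℝ) → ℂ}

theorem szMap_mem {x : Fin 3 → ℝ} (hS : S < rp) (hx : rp - S < rad x) (hx0 : x 0 ≠ 0) :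
    szMap rp x ∈ Iio S ×ˢ Ioo (-1 : ℝ) 1 := by
  have hr : 0 < rad x := by linarith
  have hsq := rad_sq x
  have h1 : 0 < x 0 ^ 2 := by positivity
  have h2 := abs_lt_of_sq_lt_sq' (by nlinarith [sq_nonneg (x 1)] : x 2 ^ 2 < rad x ^ 2) hr.le
  refine ⟨?_, ?_, ?_⟩
  · change rp - rad x < S; linarith
  · change -1 < x 2 / rad x
    rw [lt_div_iff₀ hr]; linarith
  · change x 2 / rad x < 1
    rw [div_lt_iff₀ hr]; linarith

theorem contDiff_space : ContDiff ℝ ∞ space := by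
  rw [contDiff_pi]
  intro i
  exact contDiff_apply ℝ ℝ i.succ

theorem continuous_space : Continuous space := contDiff_space.continuous

/-- Off the axis, the stationary operator acts on the profile of a function of fixed mode by the
reduced operator. -/
theorem statOp_eq_redOp_of_ne (ha : |a| < 1) (hS : S < rp) (hroot : DeltaR M a rp = 0)
    (hfp : ContDiffOn ℝ ∞ fp (Ioi (rp - S))) (hσ : σ ^ 2 = 1) (hm : σ * n = m)
    (hw : ContDiffOn ℝ ∞ w (dom S)) (hu : ∀ x, rp - S < rad x → u x = zet σ x ^ n * w (szMap rp x))
    {x : Fin 3 → ℝ} (hx : rp - S < rad x) (hx0 : x 0 ≠ 0) :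
    statOp M a ν fp lam u x = zet σ x ^ n *
      redOp a n S (kap M a rp) (coefB M a fp lam rp m) (coefQ M a ν fp lam rp m)
        (coefPhi a ν lam m n) w (szMap rp x) := by
  -- the computation takes place where `x₁ ≠ 0`, so that `ζ ≠ 0` and the poles are avoided
  set q₀ : Fin 4 → ℝ := Fin.cons 0 x with hq₀
  have hsp : space q₀ = x := Fin.tail_cons _ _
  have hr : 0 < rad x := by linarith
  set O : Set (Fin 4 → ℝ) := {q | rp - S < rad (space q) ∧ q 1 ≠ 0} with hO
  have hOo : IsOpen O := (isOpen_lt continuous_const (continuous_rad.comp continuous_space)).inter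
    (isOpen_ne_fun (continuous_apply 1) continuous_const)
  have hqO : q₀ ∈ O := ⟨by rw [hsp]; exact hx, hx0⟩
  have hmem : ∀ q ∈ O, szMap rp (space q) ∈ Iio S ×ˢ Ioo (-1 : ℝ) 1 := fun q hq =>
    szMap_mem hS hq.1 hq.2
  have hψ : ∀ q ∈ O, (fun p : Fin 4 → ℝ => Complex.exp (-Complex.I * lam * (p 0 : ℂ)) * u (space p))
      =ᶠ[𝓝 q] modeFun lam σ rp n w := fun q hq => by
    filter_upwards [hOo.mem_nhds hq] with p hp
    rw [hu _ hp.1]; rfl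
  have hflux : ∀ i, (fun q => ((√|(dualMetric M a fp (space q)).det|)⁻¹ : ℂ) *
      ∑ j, (dualMetric M a fp (space q) i j : ℂ) *
        pd j (fun p => Complex.exp (-Complex.I * lam * (p 0 : ℂ)) * u (space p)) q)
      =ᶠ[𝓝 q₀] fun q => -((1 - a ^ 2 : ℂ) ^ 2)⁻¹ * waveFlux M a fp lam σ rp m n w i q := fun i => by
    filter_upwards [hOo.mem_nhds hqO] with q hq
    have hr : 0 < rad (space q) := by linarith [hq.1]
    rw [← waveFlux_modeFun ha hσ hm hr hq.2
      (differentiableAt_fluxes (M := M) (lam := lam) (m := m) (n := n) ha hS hfp hw (hmem q hq)).1 i]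
    simp only [pd, (hψ q hq).fderiv_eq]
  obtain ⟨-, dT, dR, dP, dN, dZ'⟩ :=
    differentiableAt_fluxes (M := M) (lam := lam) (m := m) (n := n) ha hS hfp hw (hmem q₀ hqO)
  have hr0 : 0 < rad (space q₀) := by rw [hsp]; exact hr
  obtain ⟨hdiff, hdiv⟩ := sum_pd_waveFlux hσ hm hr0 hqO.2 dT dR dP dN dZ'
  have hpd : ∀ i, pd i (fun q => ((√|(dualMetric M a fp (space q)).det|)⁻¹ : ℂ) *
      ∑ j, (dualMetric M a fp (space q) i j : ℂ) *
        pd j (fun p => Complex.exp (-Complex.I * lam * (p 0 : ℂ)) * u (space p)) q) q₀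
      = -((1 - a ^ 2 : ℂ) ^ 2)⁻¹ * pd i (waveFlux M a fp lam σ rp m n w i) q₀ := fun i => by
    rw [pd, (hflux i).fderiv_eq, fderiv_const_mul (hdiff i), pd]; rfl
  have hmode : ∀ A, modeFun lam σ rp n A q₀ = zet σ x ^ n * A (szMap rp x) := fun A => by
    have h0 : q₀ 0 = 0 := rfl
    rw [modeFun, hsp, h0]
    simp [szMap]
  have hred := divergence_profile (M := M) (ν := ν) (lam := lam) (m := m) (n := n) ha hS hroot hfp hw
    (hmem q₀ hqO)
  rw [hsp] at hred
  have hstat : statOp M a ν fp lam u x = (rhoSq a x : ℂ) *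
      ((√|(dualMetric M a fp (space q₀)).det| : ℂ) *
        (∑ i, -((1 - a ^ 2 : ℂ) ^ 2)⁻¹ * pd i (waveFlux M a fp lam σ rp m n w i) q₀)
      + ((ν : ℂ) ^ 2 - 9 / 4) * u x) := by
    rw [← Finset.sum_congr rfl fun i _ => hpd i]; rfl
  rw [hstat, hsp, sqrt_abs_det_dualMetric ha hr, ← Finset.mul_sum, hdiv, hmode, hu x hx, ← hred]
  have hp1 : rp - (szMap rp x).1 = rad x := by simp [szMap]
  have hp2 : (szMap rp x).2 = x 2 / rad x := rfl
  have hϱ : (rhoSq a x : ℂ) = (rad x : ℂ) ^ 2 + a ^ 2 * ((szMap rp x).2 : ℂ) ^ 2 := by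
    rw [rhoSq, cosSq_eq, hp2]; push_cast; ring
  have hϱ0 : (rhoSq a x : ℂ) ≠ 0 := by exact_mod_cast (rhoSq_pos (a := a) hr).ne'
  have hα : (1 - a ^ 2 : ℂ) ≠ 0 := by
    have h1 : a ^ 2 < 1 := (sq_lt_one_iff_abs_lt_one a).2 ha
    have : (1 - a ^ 2 : ℝ) ≠ 0 := by linarith
    exact_mod_cast this
  simp only [hp1]
  rw [← hϱ]
  generalize -Complex.I * lam * fluxT M a fp lam rp m w (szMap rp x) + _ + _ - _ - _ - _ + _ = Q
  push_cast
  field_simp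

theorem contDiffAt_cosSq {x : Fin 3 → ℝ} (hr : 0 < rad x) : ContDiffAt ℝ ∞ cosSq x := by
  have hri : ContDiffAt ℝ ∞ (fun x => (rad x)⁻¹) x := (contDiffAt_rad hr).inv hr.ne'
  have hx2 : ContDiffAt ℝ ∞ (fun x : Fin 3 → ℝ => x 2) x := (contDiff_apply ℝ ℝ 2).contDiffAt
  change ContDiffAt ℝ ∞ (fun x => x 2 ^ 2 / rad x ^ 2) x
  simp only [div_eq_mul_inv, ← inv_pow]
  exact (hx2.pow 2).mul (hri.pow 2)

theorem contDiffAt_rhoSq {x : Fin 3 → ℝ} (hr : 0 < rad x) : ContDiffAt ℝ ∞ (rhoSq a) x :=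
  ((contDiffAt_rad hr).pow 2).add (contDiffAt_const.mul (contDiffAt_cosSq hr))

theorem contDiffAt_dualMetric (ha : |a| < 1) (hS : S < rp)
    (hfp : ContDiffOn ℝ ∞ fp (Ioi (rp - S))) {x : Fin 3 → ℝ} (hx : rp - S < rad x) (i j : Fin 4) :
    ContDiffAt ℝ ∞ (fun x => dualMetric M a fp x i j) x := by
  have hr : 0 < rad x := by linarith
  have hrad := contDiffAt_rad hr
  have hx0 : ∀ k : Fin 3, ContDiffAt ℝ ∞ (fun x : Fin 3 → ℝ => x k) x := fun k =>
    (contDiff_apply ℝ ℝ k).contDiffAt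
  have hri : ContDiffAt ℝ ∞ (fun x => (rad x)⁻¹) x := hrad.inv hr.ne'
  have hcos := contDiffAt_cosSq hr
  have hsin : ContDiffAt ℝ ∞ sinSq x := by
    change ContDiffAt ℝ ∞ (fun x => (x 0 ^ 2 + x 1 ^ 2) / rad x ^ 2) x
    simp only [div_eq_mul_inv, ← inv_pow]
    fun_prop
  have hϱ : ContDiffAt ℝ ∞ (fun x => (rhoSq a x)⁻¹) x :=
    (contDiffAt_rhoSq hr).inv (rhoSq_pos (a := a) hr).ne'
  have hΔ : ContDiffAt ℝ ∞ (DeltaTheta a) x := contDiffAt_const.sub (contDiffAt_const.mul hcos)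
  have hΔi : ContDiffAt ℝ ∞ (fun x => (DeltaTheta a x)⁻¹) x := hΔ.inv (DeltaTheta_pos ha hr).ne'
  have hD : ContDiffAt ℝ ∞ (fun x => DeltaR M a (rad x)) x := by unfold DeltaR; fun_prop
  have hf : ContDiffAt ℝ ∞ (fun x => fp (rad x)) x := (hfp.contDiffAt (Ioi_mem_nhds hx)).comp x hrad
  have hR : ∀ k, ContDiffAt ℝ ∞ (fun x => vecR x k) x := fun k => by
    fin_cases k
    · exact contDiffAt_const
    all_goals exact (hx0 _).mul hri
  have hP : ∀ k, ContDiffAt ℝ ∞ (fun x => vecPhi x k) x := fun k => by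
    fin_cases k
    exacts [contDiffAt_const, (hx0 1).neg, hx0 0, contDiffAt_const]
  simp only [dualMetric, symm2, roundDual, Matrix.add_apply, Matrix.sub_apply, Matrix.smul_apply,
    Matrix.vecMulVec_apply, Pi.add_apply, Pi.smul_apply, smul_eq_mul, div_eq_mul_inv]
  have hV : ∀ k, ContDiffAt ℝ ∞ (fun x => vecR x k + fp (rad x) * vecT k) x := fun k =>
    (hR k).add (hf.mul contDiffAt_const)
  have hW : ∀ k, ContDiffAt ℝ ∞ (fun x => (rad x ^ 2 + a ^ 2) * vecT k + a * vecPhi x k) x :=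
    fun k => (((hrad.pow 2).add contDiffAt_const).mul contDiffAt_const).add
      (contDiffAt_const.mul (hP k))
  exact hϱ.neg.mul ((((((hD.mul ((hV i).mul (hV j))).add (contDiffAt_const.mul
    (((hV i).mul (hW j)).add ((hW i).mul (hV j))))).add (hΔ.mul ((hrad.pow 2).mul
      (contDiffAt_const.sub ((hR i).mul (hR j)))))).sub
    (((contDiffAt_const.mul (contDiffAt_const.add hΔ)).mul hΔi).mul ((hP i).mul (hP j)))).add
    ((contDiffAt_const.mul hΔi).mul ((contDiffAt_const.mul (hP j)).add
      ((hP i).mul contDiffAt_const)))).add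
    (((contDiffAt_const.mul hsin).mul hΔi).mul contDiffAt_const))

theorem continuousOn_statOp (ha : |a| < 1) (hS : S < rp)
    (hfp : ContDiffOn ℝ ∞ fp (Ioi (rp - S))) (hu : ContDiffOn ℝ ∞ u {x | rp - S < rad x}) :
    ContinuousOn (statOp M a ν fp lam u) {x | rp - S < rad x} := by
  intro x hx
  have hx : rp - S < rad x := hx
  have hr : 0 < rad x := by linarith
  set q₀ : Fin 4 → ℝ := Fin.cons 0 x with hq₀
  have hsp : space q₀ = x := Fin.tail_cons _ _
  have hopen : IsOpen {x | rp - S < rad x} := isOpen_lt continuous_const continuous_rad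
  have hof : ∀ {g : (Fin 4 → ℝ) → ℝ}, ContDiffAt ℝ ∞ g q₀ → ContDiffAt ℝ ∞ (fun q => (g q : ℂ)) q₀ :=
    fun h => Complex.ofRealCLM.contDiff.contDiffAt.comp q₀ h
  have hψ : ContDiffAt ℝ ∞ (fun p : Fin 4 → ℝ =>
      Complex.exp (-Complex.I * lam * (p 0 : ℂ)) * u (space p)) q₀ := by
    refine ContDiffAt.mul (ContDiffAt.cexp (contDiffAt_const.mul
      (hof (contDiff_apply ℝ ℝ 0).contDiffAt))) (ContDiffAt.comp q₀ ?_ contDiff_space.contDiffAt)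
    rw [hsp]; exact hu.contDiffAt (hopen.mem_nhds hx)
  have hpd : ∀ {g : (Fin 4 → ℝ) → ℂ} (i), ContDiffAt ℝ ∞ g q₀ → ContDiffAt ℝ ∞ (pd i g) q₀ :=
    fun i hg => (hg.fderiv_right (m := ∞) (by simp)).clm_apply contDiffAt_const
  have hdet : (fun q => ((√|(dualMetric M a fp (space q)).det|)⁻¹ : ℂ)) =ᶠ[𝓝 q₀]
      fun q => ((rhoSq a (space q) / ((1 - a ^ 2) ^ 2 * rad (space q) ^ 2) : ℝ) : ℂ) := by
    have : {q : Fin 4 → ℝ | 0 < rad (space q)} ∈ 𝓝 q₀ :=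
      (isOpen_lt continuous_const (continuous_rad.comp continuous_space)).mem_nhds
        (by change 0 < rad (space q₀); rw [hsp]; exact hr)
    filter_upwards [this] with q hq
    rw [sqrt_abs_det_dualMetric ha hq, ← Complex.ofReal_inv, inv_div]
  have hcomp : ∀ {g : (Fin 3 → ℝ) → ℝ}, ContDiffAt ℝ ∞ g x →
      ContDiffAt ℝ ∞ (fun q => (g (space q) : ℂ)) q₀ := fun {g} hg =>
    hof (ContDiffAt.comp (g := g) q₀ (by rw [hsp]; exact hg) contDiff_space.contDiffAt)
  have hcoef : ContDiffAt ℝ ∞ (fun q => ((√|(dualMetric M a fp (space q)).det|)⁻¹ : ℂ)) q₀ := by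
    have ha2 : 1 - a ^ 2 ≠ 0 := by linarith [(sq_lt_one_iff_abs_lt_one a).2 ha]
    refine ContDiffAt.congr_of_eventuallyEq (hcomp
      (g := fun x => rhoSq a x / ((1 - a ^ 2) ^ 2 * rad x ^ 2)) ?_) hdet
    exact (contDiffAt_rhoSq hr).div (contDiffAt_const.mul ((contDiffAt_rad hr).pow 2))
      (by positivity)
  have hbox : ∀ i, ContinuousAt (pd i (fun q => ((√|(dualMetric M a fp (space q)).det|)⁻¹ : ℂ) *
      ∑ j, (dualMetric M a fp (space q) i j : ℂ) *
        pd j (fun p => Complex.exp (-Complex.I * lam * (p 0 : ℂ)) * u (space p)) q)) q₀ := fun i => by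
    have h1 : ∀ j ∈ Finset.univ, ContDiffAt ℝ ∞ (fun q => (dualMetric M a fp (space q) i j : ℂ) *
        pd j (fun p => Complex.exp (-Complex.I * lam * (p 0 : ℂ)) * u (space p)) q) q₀ := fun j _ =>
      (hcomp (g := fun x => dualMetric M a fp x i j)
        (contDiffAt_dualMetric ha hS hfp hx i j)).mul (hpd j hψ)
    exact (hpd i (hcoef.mul (ContDiffAt.sum h1))).continuousAt
  have hcons : ContinuousAt (fun y : Fin 3 → ℝ => (Fin.cons 0 y : Fin 4 → ℝ)) x := by
    fun_prop
  have hdet' : ContinuousAt (fun y => (√|(dualMetric M a fp y).det| : ℂ)) x := by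
    have h1 : ContinuousAt (fun y => (dualMetric M a fp y)) x :=
      continuousAt_pi.2 fun i => continuousAt_pi.2 fun j =>
        (contDiffAt_dualMetric ha hS hfp hx i j).continuousAt
    have h2 : Continuous fun A : Matrix (Fin 4) (Fin 4) ℝ => (√|A.det| : ℂ) :=
      Complex.continuous_ofReal.comp (Real.continuous_sqrt.comp
        (continuous_abs.comp (Continuous.matrix_det continuous_id)))
    exact h2.continuousAt.comp h1
  have hϱ : ContinuousAt (fun y => (rhoSq a y : ℂ)) x :=
    Complex.continuous_ofReal.continuousAt.comp (contDiffAt_rhoSq hr).continuousAt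
  have hux : ContinuousAt u x := hu.continuousOn.continuousAt (hopen.mem_nhds hx)
  have hsum : ContinuousAt (fun y : Fin 3 → ℝ => ∑ i, pd i (fun q =>
      ((√|(dualMetric M a fp (space q)).det|)⁻¹ : ℂ) *
      ∑ j, (dualMetric M a fp (space q) i j : ℂ) *
        pd j (fun p => Complex.exp (-Complex.I * lam * (p 0 : ℂ)) * u (space p)) q)
        (Fin.cons 0 y)) x :=
    tendsto_finsetSum _ fun i _ => (hbox i).comp (f := fun y : Fin 3 → ℝ => (Fin.cons 0 y : Fin 4 → ℝ)) hcons
  exact (hϱ.mul ((hdet'.mul hsum).add (continuousAt_const.mul hux))).continuousWithinAt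

/-- The stationary operator acts on the profile of a smooth function of fixed mode by the reduced
operator; on the axis, where the computation is singular, this follows by continuity. -/
theorem statOp_eq_redOp (ha : |a| < 1) (hS : S < rp) (hroot : DeltaR M a rp = 0)
    (hfp : ContDiffOn ℝ ∞ fp (Ioi (rp - S))) (hσ : σ ^ 2 = 1) (hm : σ * n = m)
    (hw : ContDiffOn ℝ ∞ w (dom S)) (hu : ∀ x, rp - S < rad x → u x = zet σ x ^ n * w (szMap rp x))
    {f : (Fin 3 → ℝ) → ℂ} (huS : ContDiffOn ℝ ∞ u {x | rp - S < rad x})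
    (hf : ContinuousOn f {x | rp - S < rad x})
    (h : ∀ x, rp - S < rad x → x 0 ≠ 0 → zet σ x ^ n *
      redOp a n S (kap M a rp) (coefB M a fp lam rp m) (coefQ M a ν fp lam rp m)
        (coefPhi a ν lam m n) w (szMap rp x) = f x) :
    ∀ x, rp - S < rad x → statOp M a ν fp lam u x = f x := by
  have hopen : IsOpen {x | rp - S < rad x} := isOpen_lt continuous_const continuous_rad
  have hdense : Dense {x : Fin 3 → ℝ | x 0 ≠ 0} :=
    (dense_compl_singleton (0 : ℝ)).preimage (isOpenMap_eval 0)
  have h1 : EqOn (statOp M a ν fp lam u) f {x | rp - S < rad x ∧ x 0 ≠ 0} := fun x hx => by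
    rw [statOp_eq_redOp_of_ne ha hS hroot hfp hσ hm hw hu hx.1 hx.2, h x hx.1 hx.2]
  exact h1.of_subset_closure (continuousOn_statOp ha hS hfp huS) hf
    (fun x hx => hx.1) (hdense.open_subset_closure_inter hopen)

end StationaryOperator

/-! ### Supports, lifts and coefficients -/

section Lift

variable {M a ν δ rp S σ : ℝ} {fp : ℝ → ℝ} {lam : ℂ} {m : ℤ} {n : ℕ} {w : ℝ × ℝ → ℂ}
  {u : (Fin 3 → ℝ) → ℂ}

theorem suppOn_subset_iff (hsl : slice M a δ = {x | rp - S < rad x}) (hS : 0 < S) :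
    suppOn (slice M a δ) u ⊆ slice M a δ \ exterior rp ↔ ∀ x, rp < rad x → u x = 0 := by
  constructor
  · intro h x hx
    by_contra hne
    have hxs : x ∈ slice M a δ := by rw [hsl]; change rp - S < rad x; linarith
    exact (h ⟨hxs, subset_closure ⟨hxs, hne⟩⟩).2 hx
  · rintro h x ⟨hxs, hxc⟩
    refine ⟨hxs, fun hx => ?_⟩
    have hopen : IsOpen {x | rp < rad x} := isOpen_lt continuous_const continuous_rad
    obtain ⟨y, hy, -, hy'⟩ := mem_closure_iff.1 hxc _ hopen hx
    exact hy' (h y hy)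

/-- Every interior point of the `(s, z)` domain comes from a point off the axis. -/
theorem exists_szMap_eq (σ : ℝ) (hS : S < rp) {p : ℝ × ℝ} (hp : p ∈ Iio S ×ˢ Ioo (-1 : ℝ) 1) :
    ∃ x, rad x = rp - p.1 ∧ szMap rp x = p ∧ x 0 ≠ 0 ∧ zet σ x ≠ 0 := by
  have h1 : p.1 < S := hp.1
  have hr : 0 < rp - p.1 := by linarith
  have hq := one_sub_sq_pos hp.2
  have hrad : rad ![(rp - p.1) * √(1 - p.2 ^ 2), 0, (rp - p.1) * p.2] = rp - p.1 := by
    refine rad_eq_of_sq hr.le ?_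
    simp only [Matrix.cons_val_zero, Matrix.cons_val_one, Matrix.cons_val]
    rw [mul_pow, Real.sq_sqrt hq.le]; ring
  have hx0 : (rp - p.1) * √(1 - p.2 ^ 2) ≠ 0 := mul_ne_zero hr.ne' (Real.sqrt_pos.2 hq).ne'
  refine ⟨_, hrad, ?_, hx0, ?_⟩
  · rw [szMap, hrad]
    ext
    · simp
    · simp only [Matrix.cons_val]
      field_simp
  · rw [zet, hrad]
    have hxc : (((rp - p.1) * √(1 - p.2 ^ 2) : ℝ) : ℂ) ≠ 0 := by exact_mod_cast hx0
    have hrc : ((rp - p.1 : ℝ) : ℂ) ≠ 0 := by exact_mod_cast hr.ne'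
    simp only [Matrix.cons_val_zero, Matrix.cons_val_one, Complex.ofReal_zero, mul_zero, add_zero]
    exact div_ne_zero hxc hrc

/-- The profile of a function that vanishes in the exterior vanishes for `s ≤ 0`. -/
theorem profile_eq_zero (hS0 : 0 < S) (hS : S < rp) (hw : ContDiffOn ℝ ∞ w (dom S))
    (hu : ∀ x, rp - S < rad x → u x = zet σ x ^ n * w (szMap rp x))
    (h0 : ∀ x, rp < rad x → u x = 0) : ∀ s ≤ 0, ∀ z ∈ J, w (s, z) = 0 := by
  have h1 : EqOn w 0 (Iio 0 ×ˢ Ioo (-1 : ℝ) 1) := fun p hp => by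
    have hp1 : p.1 < 0 := hp.1
    obtain ⟨x, hx, hsz, -, hζ⟩ := exists_szMap_eq σ hS (p := p) ⟨hp1.trans hS0, hp.2⟩
    have h2 := hu x (by rw [hx]; linarith)
    rw [h0 x (by rw [hx]; linarith), hsz] at h2
    exact (mul_eq_zero.1 h2.symm).resolve_left (pow_ne_zero n hζ)
  have hsub : Iic (0 : ℝ) ×ˢ J ⊆ dom S := prod_mono_left fun s (hs : s ≤ 0) => hs.trans_lt hS0
  have h2 := h1.of_subset_closure (hw.continuousOn.mono hsub) continuousOn_const
    (prod_mono Iio_subset_Iic_self Ioo_subset_Icc_self)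
    (by rw [closure_prod_eq, closure_Iio, closure_Ioo (by norm_num)])
  exact fun s hs z hz => h2 ⟨hs, hz⟩

theorem contDiffOn_lift (hS : S < rp) (hw : ContDiffOn ℝ ∞ w (dom S)) :
    ContDiffOn ℝ ∞ (fun x => zet σ x ^ n * w (szMap rp x)) {x | rp - S < rad x} := by
  have hpos : ∀ x : Fin 3 → ℝ, rp - S < rad x → 0 < rad x := fun x hx => by linarith
  have hx : ∀ k : Fin 3, ContDiff ℝ ∞ (fun x : Fin 3 → ℝ => x k) := fun k => contDiff_apply ℝ ℝ k
  have hof : ∀ {g : (Fin 3 → ℝ) → ℝ}, ContDiffOn ℝ ∞ g {x | rp - S < rad x} →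
      ContDiffOn ℝ ∞ (fun x => (g x : ℂ)) {x | rp - S < rad x} := fun h =>
    Complex.ofRealCLM.contDiff.comp_contDiffOn h
  have hrad : ContDiffOn ℝ ∞ rad {x | rp - S < rad x} := fun x hx =>
    (contDiffAt_rad (hpos x hx)).contDiffWithinAt
  have hrne : ∀ x ∈ {x | rp - S < rad x}, rad x ≠ 0 := fun x hx => (hpos x hx).ne'
  have hζ : ContDiffOn ℝ ∞ (zet σ) {x | rp - S < rad x} := by
    have h1 : ContDiffOn ℝ ∞ (fun x : Fin 3 → ℝ => ((x 0 : ℂ) + Complex.I * (σ * x 1)) *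
        (((rad x)⁻¹ : ℝ) : ℂ)) {x | rp - S < rad x} :=
      ((hof (hx 0).contDiffOn).add (contDiffOn_const.mul (contDiffOn_const.mul
        (hof (hx 1).contDiffOn)))).mul (hof (hrad.inv hrne))
    refine h1.congr fun x _ => ?_
    rw [zet, div_eq_mul_inv, Complex.ofReal_inv]
  refine (hζ.pow n).mul (hw.comp ((contDiffOn_const.sub hrad).prodMk
    ((hx 2).contDiffOn.div hrad hrne)) fun x hx => ⟨?_, div_rad_mem_J (hpos x hx)⟩)
  have hx : rp - S < rad x := hx
  change rp - rad x < S
  linarith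

theorem hasMode_lift (hS : S < rp) (hσ : σ ^ 2 = 1) (hm : σ * n = m)
    (hw : ContDiffOn ℝ ∞ w (dom S)) :
    HasMode m {x | rp - S < rad x} (fun x => zet σ x ^ n * w (szMap rp x)) := by
  intro x hx
  have hopen : IsOpen {x | rp - S < rad x} := isOpen_lt continuous_const continuous_rad
  have hrot0 : rot 0 x = x := by
    ext i; fin_cases i <;> simp [rot]
  have hd : HasFDerivAt (fun x => zet σ x ^ n * w (szMap rp x)) _ x :=
    (((contDiffOn_lift hS hw).contDiffAt (hopen.mem_nhds hx)).differentiableAt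
      (by simp)).hasFDerivAt
  have hd' : HasFDerivAt (fun x => zet σ x ^ n * w (szMap rp x))
      (fderiv ℝ (fun x => zet σ x ^ n * w (szMap rp x)) x) (rot 0 x) := by rw [hrot0]; exact hd
  have h1 := hd'.comp_hasDerivAt (0 : ℝ) (hasDerivAt_rot x 0)
  have hσc : (σ : ℂ) ^ 2 = 1 := by exact_mod_cast hσ
  have hmc : (m : ℂ) = σ * n := by exact_mod_cast hm.symm
  have hζ : ∀ φ : ℝ, zet σ (rot φ x)
      = ((Real.cos φ : ℂ) + Complex.I * (σ * (Real.sin φ : ℂ))) * zet σ x := fun φ => by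
    have h0 : rot φ x 0 = Real.cos φ * x 0 - Real.sin φ * x 1 := rfl
    have h1 : rot φ x 1 = Real.sin φ * x 0 + Real.cos φ * x 1 := rfl
    rw [zet, zet, rad_rot, h0, h1]
    push_cast
    linear_combination (-(Complex.sin φ * x 1 / rad x) * σ ^ 2) * Complex.I_sq
      + (Complex.sin φ * x 1 / rad x) * hσc
  have hsz : ∀ φ, szMap rp (rot φ x) = szMap rp x := fun φ => by rw [szMap, rad_rot]; rfl
  have h2 : HasDerivAt (fun φ => zet σ (rot φ x) ^ n * w (szMap rp (rot φ x)))
      (Complex.I * m * (zet σ x ^ n * w (szMap rp x))) 0 := by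
    have hc : HasDerivAt (fun φ : ℝ => (Real.cos φ : ℂ) + Complex.I * (σ * (Real.sin φ : ℂ)))
        (Complex.I * σ) 0 :=
      ((Real.hasDerivAt_cos 0).ofReal_comp.add
        (((Real.hasDerivAt_sin 0).ofReal_comp.const_mul (σ : ℂ)).const_mul
          Complex.I)).congr_deriv (by simp)
    have h3 := ((hc.pow n).mul_const (zet σ x ^ n)).mul_const (w (szMap rp x))
    refine (h3.congr_deriv ?_).congr_of_eventuallyEq (Eventually.of_forall fun φ => ?_)
    · rw [hmc]; simp; ring
    · simp only [hζ, hsz, mul_pow, Pi.pow_apply]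
  have h4 := h1.unique h2
  rw [hrot0] at h4
  have hx01 : (![-x 1, x 0, 0] : Fin 3 → ℝ) = ![-(rot 0 x) 1, rot 0 x 0, 0] := by rw [hrot0]
  change -Complex.I * fderiv ℝ (fun x => zet σ x ^ n * w (szMap rp x)) x ![-x 1, x 0, 0] - _ = 0
  rw [h4]
  linear_combination (-(m : ℂ) * (zet σ x ^ n * w (szMap rp x))) * Complex.I_sq

/-- The radial coefficients of the reduced operator are smooth across the horizon. -/
theorem contDiffOn_coefs (hfp : ContDiffOn ℝ ∞ fp (Ioi (rp - S))) :
    ContDiffOn ℝ ∞ (coefB M a fp lam rp m) (Iio S) ∧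
      ContDiffOn ℝ ∞ (coefQ M a ν fp lam rp m) (Iio S) := by
  have hof : ∀ {g : ℝ → ℝ}, ContDiffOn ℝ ∞ g (Iio S) → ContDiffOn ℝ ∞ (fun s => (g s : ℂ)) (Iio S) :=
    fun h => Complex.ofRealCLM.contDiff.comp_contDiffOn h
  have hr : ContDiffOn ℝ ∞ (fun s : ℝ => rp - s) (Iio S) := by fun_prop
  have hf : ContDiffOn ℝ ∞ (fun s => fp (rp - s)) (Iio S) := hfp.comp hr fun s hs => by
    have : s < S := hs
    rw [mem_Ioi]; linarith
  have hD : ContDiffOn ℝ ∞ (fun s => DeltaR M a (rp - s)) (Iio S) := by unfold DeltaR; fun_prop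
  have hfD := hf.mul hD
  have hdfD : ContDiffOn ℝ ∞ (deriv fun s => fp (rp - s) * DeltaR M a (rp - s)) (Iio S) :=
    hfD.deriv_of_isOpen isOpen_Iio (by simp)
  have hrc := hof hr
  have hfc := hof hf
  have hY : ContDiffOn ℝ ∞ (fun s => rotSymbol a lam m (rp - s)) (Iio S) := by
    unfold rotSymbol
    exact (contDiffOn_const.mul ((hrc.pow 2).add contDiffOn_const)).add contDiffOn_const
  constructor
  · exact ((((contDiffOn_const.mul (hrc.pow 3)).add (contDiffOn_const.mul hrc)).sub
      contDiffOn_const).sub (contDiffOn_const.mul (hof hfD))).add (contDiffOn_const.mul hY)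
  · exact ((((contDiffOn_const.mul (hof hdfD)).sub (contDiffOn_const.mul
      (hof ((hf.pow 2).mul hD)))).sub ((contDiffOn_const.mul hY).mul hfc)).sub
        (contDiffOn_const.mul hrc)).neg.add (contDiffOn_const.mul (hrc.pow 2))

theorem contDiffOn_coefPhi (ha : |a| < 1) : ContDiffOn ℝ ∞ (coefPhi a ν lam m n) J := by
  have hz : ContDiffOn ℝ ∞ (fun z : ℝ => (z : ℂ)) J := Complex.ofRealCLM.contDiff.contDiffOn
  have hh : ContDiffOn ℝ ∞ (fun z : ℝ => (angFactor a z : ℂ)) J :=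
    Complex.ofRealCLM.contDiff.comp_contDiffOn
      (contDiff_const.sub (contDiff_const.mul (contDiff_id.pow 2))).contDiffOn
  have hh0 : ∀ z ∈ J, (angFactor a z : ℂ) ≠ 0 := fun z hz => by
    have := (hfac_pos ha hz).ne'
    exact_mod_cast this
  have hhi := hh.inv hh0
  unfold coefPhi
  simp only [div_eq_mul_inv]
  exact (((((contDiffOn_const.mul (hz.pow 2)).sub (contDiffOn_const.mul hh)).add
    (((contDiffOn_const.mul (contDiffOn_const.add hh)).mul hhi).mul contDiffOn_const)).add
    (((contDiffOn_const.mul (contDiffOn_const.mul hhi)).mul contDiffOn_const).mul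
      contDiffOn_const)).sub
    (((contDiffOn_const.mul (contDiffOn_const.sub (hz.pow 2))).mul hhi).mul
      contDiffOn_const)).neg.add (contDiffOn_const.mul (contDiffOn_const.mul (hz.pow 2)))

theorem dS_sub {F G : ℝ × ℝ → ℂ} (hF : ContDiffOn ℝ ∞ F (dom S)) (hG : ContDiffOn ℝ ∞ G (dom S)) :
    EqOn (dS S fun p => F p - G p) (fun p => dS S F p - dS S G p) (dom S) := fun p hp => by
  simp only [dS]
  rw [fderivWithin_fun_sub (uniqueDiffOn_dom p hp) (hF.differentiableOn (by simp) p hp)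
    (hG.differentiableOn (by simp) p hp)]
  rfl

theorem dZ_sub {F G : ℝ × ℝ → ℂ} (hF : ContDiffOn ℝ ∞ F (dom S)) (hG : ContDiffOn ℝ ∞ G (dom S)) :
    EqOn (dZ S fun p => F p - G p) (fun p => dZ S F p - dZ S G p) (dom S) := fun p hp => by
  simp only [dZ]
  rw [fderivWithin_fun_sub (uniqueDiffOn_dom p hp) (hF.differentiableOn (by simp) p hp)
    (hG.differentiableOn (by simp) p hp)]
  rfl

theorem redOp_sub {κ : ℝ → ℝ} {b q φ : ℝ → ℂ} {F G : ℝ × ℝ → ℂ} (hF : ContDiffOn ℝ ∞ F (dom S))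
    (hG : ContDiffOn ℝ ∞ G (dom S)) {p : ℝ × ℝ} (hp : p ∈ dom S) :
    redOp a n S κ b q φ (fun p => F p - G p) p
      = redOp a n S κ b q φ F p - redOp a n S κ b q φ G p := by
  have h1 := dS_congr (dS_sub hF hG) hp
  have h2 := dZ_congr (dZ_sub hF hG) hp
  rw [dS_sub (contDiffOn_dS hF) (contDiffOn_dS hG) hp] at h1
  rw [dZ_sub (contDiffOn_dZ hF) (contDiffOn_dZ hG) hp] at h2
  simp only [redOp]
  rw [h1, h2, dS_sub hF hG hp, dZ_sub hF hG hp]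
  ring

end Lift

end KerrAdS

end

theorem mainTheorem4
    (M a ν δ rp : ℝ) (fp : ℝ → ℝ) (hM : 0 < M) (ha : |a| < 1) (hν : 0 < ν)
    (hrp : IsGreatest {r : ℝ | 0 < r ∧ KerrAdS.DeltaR M a r = 0} rp)
    (hrp' : 0 < deriv (KerrAdS.DeltaR M a) rp)
    (hδ : 0 < δ) (hδ' : ∃ r, 0 < r ∧ r < rp ∧ KerrAdS.DeltaR M a r < -δ)
    (hfp : ContDiffOn ℝ ∞ fp (KerrAdS.radii M a δ))
    (hdt : ∀ x ∈ KerrAdS.slice M a δ, 0 < KerrAdS.dualMetric M a fp x 0 0)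
    (lam : ℂ) (m : ℤ) (f : (Fin 3 → ℝ) → ℂ)
    (hf : ContDiffOn ℝ ∞ f (KerrAdS.slice M a δ))
    (hfm : KerrAdS.HasMode m (KerrAdS.slice M a δ) f)
    (hfs : KerrAdS.suppOn (KerrAdS.slice M a δ) f ⊆
      KerrAdS.slice M a δ \ KerrAdS.exterior rp) :
    ∃ u : (Fin 3 → ℝ) → ℂ,
      (ContDiffOn ℝ ∞ u (KerrAdS.slice M a δ) ∧
        KerrAdS.HasMode m (KerrAdS.slice M a δ) u ∧
        KerrAdS.suppOn (KerrAdS.slice M a δ) u ⊆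
          KerrAdS.slice M a δ \ KerrAdS.exterior rp ∧
        ∀ x ∈ KerrAdS.slice M a δ, KerrAdS.statOp M a ν fp lam u x = f x) ∧
      ∀ v : (Fin 3 → ℝ) → ℂ,
        ContDiffOn ℝ ∞ v (KerrAdS.slice M a δ) →
        KerrAdS.HasMode m (KerrAdS.slice M a δ) v →
        KerrAdS.suppOn (KerrAdS.slice M a δ) v ⊆
          KerrAdS.slice M a δ \ KerrAdS.exterior rp →
        (∀ x ∈ KerrAdS.slice M a δ, KerrAdS.statOp M a ν fp lam v x = f x) →
        Set.EqOn v u (KerrAdS.slice M a δ) := by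
  obtain ⟨hrp0, hroot⟩ := hrp.1
  obtain ⟨S, hS0, hS, hrad, hκ0⟩ := KerrAdS.exists_radii_eq hrp hrp' hδ hδ'
  have hsl : KerrAdS.slice M a δ = {x | rp - S < KerrAdS.rad x} := by
    rw [KerrAdS.slice, hrad]; rfl
  have hsupp := fun v => KerrAdS.suppOn_subset_iff (u := v) hsl hS0
  rw [hrad] at hfp
  have hf0 := (hsupp f).1 hfs
  simp only [hsupp]
  rw [hsl] at hf hfm ⊢
  have hσ := KerrAdS.sgn_sq m
  have hm := KerrAdS.sgn_mul_natAbs m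
  have hκ := (KerrAdS.contDiff_kap (M := M) (a := a) (rp := rp)).contDiffOn (s := Iio S)
  obtain ⟨hb, hq⟩ := KerrAdS.contDiffOn_coefs (M := M) (a := a) (ν := ν) (lam := lam) (m := m) hfp
  have hφ := KerrAdS.contDiffOn_coefPhi (ν := ν) (lam := lam) (m := m) (n := m.natAbs) ha
  obtain ⟨F, hF, hfF⟩ := KerrAdS.exists_reduction hS hf hfm
  have hF0 := KerrAdS.profile_eq_zero hS0 hS hF hfF hf0
  obtain ⟨W, hW, hW0, hWF⟩ := KerrAdS.exists_reduced_solution ha m.natAbs hS0 hκ hκ0 hb hq hφ hF hF0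
  have hWs := KerrAdS.contDiffOn_lift (σ := KerrAdS.sgn m) (n := m.natAbs) hS hW
  refine ⟨fun x => KerrAdS.zet (KerrAdS.sgn m) x ^ m.natAbs * W (KerrAdS.szMap rp x),
    ⟨hWs, KerrAdS.hasMode_lift hS hσ hm hW, fun x hx => ?_, ?_⟩, ?_⟩
  · have h1 : W (KerrAdS.szMap rp x) = 0 := hW0 _ (by linarith) _
      (KerrAdS.div_rad_mem_J (hrp0.trans hx))
    simp only [h1, mul_zero]
  -- the equation extends from the region off the axis by continuity
  · exact KerrAdS.statOp_eq_redOp ha hS hroot hfp hσ hm hW (fun _ _ => rfl) hWs hf.continuousOn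
      fun x hx hx0 => by rw [hWF _ (KerrAdS.szMap_mem hS hx hx0), hfF x hx]; rfl
  · intro v hv hvm hv0 hvf
    obtain ⟨w, hw, hvw⟩ := KerrAdS.exists_reduction hS hv hvm
    have hw0 := KerrAdS.profile_eq_zero hS0 hS hw hvw hv0
    -- the profiles of two solutions differ by a solution of the homogeneous reduced equation
    have hd := KerrAdS.eq_zero_of_reduced ha m.natAbs hS0 hκ hκ0 hb hq hφ (hw.sub hW)
      (fun s hs z hz => by rw [hw0 s hs z hz, hW0 s hs z hz, sub_zero])
      fun p hp => by
        obtain ⟨x, hx, hsz, hx0, hζ⟩ := KerrAdS.exists_szMap_eq (KerrAdS.sgn m) hS hp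
        have hp1 : p.1 < S := hp.1
        have hxS : rp - S < KerrAdS.rad x := by rw [hx]; linarith
        have h1 := KerrAdS.statOp_eq_redOp_of_ne (ν := ν) (lam := lam) ha hS hroot hfp hσ hm hw hvw
          hxS hx0
        rw [hvf x hxS, hfF x hxS] at h1
        have h2 := mul_left_cancel₀ (pow_ne_zero _ hζ) h1
        change F (KerrAdS.szMap rp x) = _ at h2
        rw [hsz] at h2
        have h3 := KerrAdS.redOp_sub (a := a) (n := m.natAbs) (κ := KerrAdS.kap M a rp)
          (b := KerrAdS.coefB M a fp lam rp m) (q := KerrAdS.coefQ M a ν fp lam rp m)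
          (φ := KerrAdS.coefPhi a ν lam m m.natAbs) hw hW
          (p := p) ⟨hp.1, hp.2.1.le, hp.2.2.le⟩
        rw [hWF p hp, ← h2, sub_self] at h3
        exact h3
    intro x hx
    have hx : rp - S < KerrAdS.rad x := hx
    have h1 := hd (KerrAdS.szMap rp x)
      ⟨by change rp - KerrAdS.rad x < S; linarith, KerrAdS.div_rad_mem_J (by linarith)⟩
    rw [sub_eq_zero] at h1
    change v x = _ * W (KerrAdS.szMap rp x)
    rw [hvw x hx, ← h1]
    rfl
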